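/- **Convergence of the loop vertex expansion (LVE) of the connected Schwinger functions.** *Setting.* Fix a mass $m>0$. Let $\mathcal P=\{p\in\mathbb Z^3: p_1+p_2+p_3=0\}$ and $C_0(p)=(p^2+m^2)^{-1}$. Let $\tau_i(q)$, $i=1,2,3$, $q\in\mathbb Z$, be independent standard real Gaussian variables, with joint law $\nu$; put $\Gamma(p)=\sum_{i=1}^3\tau_i(p_i)$. For $\lambda\in\mathbb C$ write $\phi=\arg\lambda$, let $\sqrt{2\lambda}$ and $\ln$ be principal branches, and let $$R(p)=\frac{C_0(p)}{1-i\sqrt{2\lambda}\,C_0(p)\Gamma(p)},\qquad W=\sum_{p\in\mathcal P}\ln\bigl(1-i\sqrt{2\lambda}\,C_0(p)\Gamma(p)\bigr),$$ the sum being taken, unconditionally, in $L^2(\nu)$. For sources $J,\bar J:\mathcal P\to\mathbb C$ of finite support, treated as independent complex variables, let $$\mathcal Z[J,\bar J]=\int d\nu\;\exp\Bigl(-W-\sum_{p}\bar J(p)R(p)J(p)\Bigr),$$ and for $N\ge1$ and $p_1,\dots,p_N,\bar p_1,\dots,\bar p_N\in\mathcal P$ let $$S_{2N}(p,\bar p)=\prod_{i=1}^N\frac{\partial}{\partial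 J(\bar p_i)}\frac{\partial}{\partial\bar J(p_i)}\ln\mathcal Z[J,\bar J]\Big|_{J=\bar J=0}.$$ *Trees.* A ciliated tree $(T,c)$ of order $n$ with $N$ cilia is a tree $T$ on the vertex set $\{1,\dots,n\}$ together with an injection $c:\{1,\dots,N\}\to\{1,\dots,n\}$; the vertices in the image of $c$ are called ciliated, the other ones loop vertices, and $d_a$ is the degree of the vertex $a$ in $T$. For $w\in[0,1]^{E(T)}$ let $X^T(w)$ be the $n\times n$ matrix with $X_{aa}=1$ and, for $a\ne b$, $X_{ab}$ the infimum of $w_l$ over the edges $l$ of the path of $T$ from $a$ to $b$. Let $\nu_{X^T(w)}$ be the centred Gaussian law of $n$ replicas $\tau^{(a)}$ of the fields with covariance $\mathbb E\,\tau_i^{(a)}(q)\tau_j^{(b)}(q')=X_{ab}\delta_{ij}\delta_{qq'}$, and let $R_a$ be the resolvent formed with $\tau^{(a)}$. For external momenta $p_1,\dots,p_N\in\mathcal P$ the amplitude is $$A_{T,c}(p)=(-1)^N\frac{(-2\lambda)^{n-1}}{n!}\int_{[0,1]^{E(T)}}\!\!dw\int d\nu_{X^T(w)}\sum_{k}\ \prod_{a\text{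 loop}}(d_a-1)!\,R_a(k_a)^{d_a}\prod_{a\text{ ciliated}}d_a!\,R_a(k_a)^{d_a+1}\prod_{\{a,b\}\in E(T)}\Bigl(\sum_{i=1}^3\delta_{k_{a,i},k_{b,i}}\Bigr),$$ where the sum runs over all $k\in\mathcal P^n$ with $k_{c(i)}=p_i$ for $i=1,\dots,N$. *Claim.* There is a constant $\kappa>0$, depending only on $m$ (in particular neither on $N$ nor on the external momenta), such that the following holds for every $\lambda$ in the interior of the cardioid $|\lambda|<\kappa^{-1}\cos^2(\phi/2)$. 1. As a function of the real variable $\Gamma(p)$ the resolvent satisfies, for all $p\in\mathcal P$ and $d\ge0$, $$\bigl|\partial_\Gamma^{\,d}R(p)\bigr|\le d!\,|2\lambda|^{d/2}\,C_0(p)^{d+1}\,\cos(\phi/2)^{-(d+1)} .$$ 2. The sum $W$ exists, the integrand of $\mathcal Z[J,\bar J]$ is $\nu$-integrable for all $J,\bar J$, and $\mathcal Z[0,0]\notin(-\infty,0]$. 3. (Free energy.) The tree expansion $\ln\mathcal Z[0,0]-\int d\nu\,(-W)=\sum_{n\ge2}\sum_T A_T$ (no cilia) converges absolutely. 4. (Schwinger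 functions.) For all $N\ge1$ and all $p_1,\dots,p_N,\bar p_1,\dots,\bar p_N\in\mathcal P$, $\ln\mathcal Z$ is, near $0$, an analytic function of the parameters $x,y\in\mathbb C^N$ of the sources $J=\sum_i x_i\delta_{\bar p_i}$, $\bar J=\sum_i y_i\delta_{p_i}$, and $$S_{2N}(p,\bar p)=\Bigl(\sum_{\pi\in\mathfrak S_N}\prod_{i=1}^N\delta_{p_i,\bar p_{\pi(i)}}\Bigr)\sum_{n\ge1}\ \sum_{(T,c)\text{ of order }n}A_{T,c}(p),$$ where the sum over all ciliated trees with $N$ cilia converges absolutely. In 3 and 4 absolute convergence means that all the sums over momenta and all the integrals that define the amplitudes converge absolutely, and that the sum over trees still converges when every integrand is replaced by the sum over $k$ of the absolute values of its terms. -/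

import Mathlib

open MeasureTheory ProbabilityTheory Filter Topology
open scoped BigOperators ENNReal Nat unitInterval

noncomputable section

namespace TGFT

/-- The momentum lattice `𝒫 = {p ∈ ℤ³ | p₁ + p₂ + p₃ = 0}`; the condition is the closure
constraint. -/
abbrev Momentum : Type := {p : Fin 3 → ℤ // ∑ i, p i = 0}

/-- The propagator `C₀(p) = 1 / (p² + m²)`. -/
def propagator (m : ℝ) (p : Momentum) : ℝ := (∑ i, ((p.1 i : ℤ) : ℝ) ^ 2 + m ^ 2)⁻¹

/-- The three intermediate vector fields: `τ (i, q)` is the value `τ_i(q)`. -/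
abbrev Field : Type := Fin 3 × ℤ → ℝ

/-- `Γ(p) = τ₁(p₁) + τ₂(p₂) + τ₃(p₃)`. -/
def Gam (p : Momentum) (τ : Field) : ℝ := ∑ i, τ (i, p.1 i)

/-- The normalized Gaussian measure with `∫ τ_i(q) τ_j(q') dν = δ_{ij} δ_{qq'}`. -/
def fieldMeasure : Measure Field := Measure.infinitePi fun _ : Fin 3 × ℤ => gaussianReal 0 1

/-- `z = i √(2λ)`, with the principal square root. -/
def zeta (lam : ℂ) : ℂ := Complex.I * (2 * lam) ^ (1 / 2 : ℂ)

/-- The factor `1 - i √(2λ) C₀(p) s`, where `s` stands for the real number `Γ(p)`. -/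
def denom (m : ℝ) (lam : ℂ) (p : Momentum) (s : ℝ) : ℂ :=
  1 - zeta lam * (propagator m p : ℂ) * (s : ℂ)

/-- The resolvent `R(p) = C₀(p) / (1 - i √(2λ) C₀(p) s)` as a function of `s = Γ(p)`. -/
def resolvent (m : ℝ) (lam : ℂ) (p : Momentum) (s : ℝ) : ℂ :=
  (propagator m p : ℂ) / denom m lam p s

/-- `W` is the random variable `∑_{p ∈ 𝒫} ln (1 - i √(2λ) C₀(p) Γ(p))`. The series has no
absolutely convergent version for fixed `τ`; it is summed (unconditionally) in `L²(ν)`. -/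
def IsTraceLog (m : ℝ) (lam : ℂ) (W : Field → ℂ) : Prop :=
  MemLp W 2 fieldMeasure ∧
    Tendsto (fun A : Finset Momentum =>
        eLpNorm (fun τ => (∑ p ∈ A, Complex.log (denom m lam p (Gam p τ))) - W τ) 2 fieldMeasure)
      atTop (𝓝 0)

/-- Pairs `(J, J̄)` of sources with finitely many nonzero modes; `J` and `J̄` are independent
complex variables. -/
abbrev Source : Type := (Momentum →₀ ℂ) × (Momentum →₀ ℂ)

/-- The source term `∑_p J̄(p) R(p) J(p)`. -/
def sourceTerm (m : ℝ) (lam : ℂ) (S : Source) (τ : Field) : ℂ :=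
  S.1.sum fun p j => S.2 p * resolvent m lam p (Gam p τ) * j

/-- The integrand of the partition function. -/
def weight (m : ℝ) (lam : ℂ) (W : Field → ℂ) (S : Source) (τ : Field) : ℂ :=
  Complex.exp (-W τ - sourceTerm m lam S τ)

/-- The partition function `Z[J, J̄]`. -/
def partitionFn (m : ℝ) (lam : ℂ) (W : Field → ℂ) (S : Source) : ℂ :=
  ∫ τ, weight m lam W S τ ∂fieldMeasure

/-- The partial derivative `∂ / ∂J(p)` of a functional of the sources. -/
def derivJ (p : Momentum) (G : Source → ℂ) : Source → ℂ :=
  fun S => deriv (fun t : ℂ => G (S.1 + Finsupp.single p t, S.2)) 0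

/-- The partial derivative `∂ / ∂J̄(p)` of a functional of the sources. -/
def derivJbar (p : Momentum) (G : Source → ℂ) : Source → ℂ :=
  fun S => deriv (fun t : ℂ => G (S.1, S.2 + Finsupp.single p t)) 0

/-- The connected `2N`-point function
`∏_i ∂/∂J(p̄_i) ∂/∂J̄(p_i) ln Z[J, J̄]` at `J = J̄ = 0`. -/
def schwinger (m : ℝ) (lam : ℂ) (W : Field → ℂ) {N : ℕ} (p pbar : Fin N → Momentum) : ℂ :=
  (List.finRange N).foldr (fun i G => derivJ (pbar i) (derivJbar (p i) G))
    (fun S => Complex.log (partitionFn m lam W S)) 0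

/-- The sources `J = ∑_i a_i δ_{p̄_i}`, `J̄ = ∑_i b_i δ_{p_i}`. -/
def modeSource {N : ℕ} (p pbar : Fin N → Momentum) (ab : (Fin N → ℂ) × (Fin N → ℂ)) : Source :=
  (∑ i, Finsupp.single (pbar i) (ab.1 i), ∑ i, Finsupp.single (p i) (ab.2 i))

/-- Labelled trees on `n` vertices (`n` arbitrary), `N` distinct vertices of which carry a
cilium; the cilia are numbered from `0` to `N - 1`. -/
abbrev CiliatedTree (N : ℕ) : Type :=
  Σ n : ℕ, {T : SimpleGraph (Fin n) // T.IsTree} × (Fin N ↪ Fin n)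

variable {N : ℕ}

namespace CiliatedTree

/-- The number of vertices. -/
abbrev order (x : CiliatedTree N) : ℕ := x.1

/-- The underlying tree. -/
abbrev tree (x : CiliatedTree N) : SimpleGraph (Fin x.order) := x.2.1.1

/-- The vertex carrying a given cilium. -/
abbrev cilium (x : CiliatedTree N) : Fin N ↪ Fin x.order := x.2.2

/-- The unique path between two vertices of the tree. -/
def path (x : CiliatedTree N) (a b : Fin x.order) : x.tree.Walk a b :=
  (x.2.1.2.existsUnique_path a b).choose

/-- The weakening parameters: one number `w_l ∈ [0, 1]` for each edge `l`. -/
abbrev Weights (x : CiliatedTree N) : Type := x.tree.edgeSet → I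

open scoped Classical in
/-- The product of the Lebesgue measures of `[0, 1]` over the edges. -/
def weightsMeasure (x : CiliatedTree N) : Measure x.Weights :=
  Measure.pi fun _ => (volume : Measure I)

open scoped Classical in
/-- The interpolation matrix `X(w)`: the entry `X_{ab}` is the infimum of `w_l` over the edges
`l` of the path from `a` to `b`, and `X_{aa} = 1` (infimum over the empty set in `[0, 1]`). -/
def interpolation (x : CiliatedTree N) (w : x.Weights) :
    Matrix (Fin x.order) (Fin x.order) ℝ :=
  Matrix.of fun a b =>
    (Finset.inf (Finset.univ.filter
      fun l : x.tree.edgeSet => (l : Sym2 (Fin x.order)) ∈ (x.path a b).edges) w : I)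

/-- Replicated fields: one copy of the intermediate fields for each vertex of the tree. -/
abbrev Replicas (x : CiliatedTree N) : Type := Fin 3 × ℤ → EuclideanSpace ℝ (Fin x.order)

/-- The centred Gaussian measure `ν_{X(w)}` of the replicated fields, with covariance
`X(w)_{ab} δ_{ij} δ_{qq'}`. -/
def replicaMeasure (x : CiliatedTree N) (w : x.Weights) : Measure x.Replicas :=
  Measure.infinitePi fun _ : Fin 3 × ℤ => multivariateGaussian 0 (x.interpolation w)

/-- The fields of the replica attached to the vertex `a`. -/
def replica (x : CiliatedTree N) (τ : x.Replicas) (a : Fin x.order) : Field := fun iq => τ iq a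

/-- Assignments of a momentum to every vertex; the vertex carrying the `i`-th cilium has the
external momentum `p i`. -/
abbrev Momenta (x : CiliatedTree N) (p : Fin N → Momentum) : Type :=
  {k : Fin x.order → Momentum // ∀ i, k (x.cilium i) = p i}

open scoped Classical in
/-- The factor of a vertex: `(d - 1)! R^d` for a loop vertex with `d` lines (up to powers of
`i √(2λ)`, the `d`-th derivative of `-ln (1 - i √(2λ) C₀ Γ)` in `Γ`) and `d! R^(d + 1)` for a
ciliated vertex with `d` lines (the `d`-th derivative of the resolvent). -/
def vertexFactor (m : ℝ) (lam : ℂ) (x : CiliatedTree N) (k : Fin x.order → Momentum)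
    (τ : x.Replicas) (a : Fin x.order) : ℂ :=
  if a ∈ Set.range x.cilium then
    ((x.tree.degree a)! : ℂ) *
      resolvent m lam (k a) (Gam (k a) (x.replica τ a)) ^ (x.tree.degree a + 1)
  else
    ((x.tree.degree a - 1)! : ℂ) *
      resolvent m lam (k a) (Gam (k a) (x.replica τ a)) ^ (x.tree.degree a)

open scoped Classical in
/-- The product over the lines `l` of `∑_i δ_{p_{s(l) i} p_{t(l) i}}`. -/
def lineFactor (x : CiliatedTree N) (k : Fin x.order → Momentum) : ℂ :=
  ∏ ab ∈ (Finset.univ : Finset (Fin x.order × Fin x.order)).filter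
      (fun ab => ab.1 < ab.2 ∧ x.tree.Adj ab.1 ab.2),
    ∑ i : Fin 3, if (k ab.1).1 i = (k ab.2).1 i then 1 else 0

/-- The contribution of a momentum assignment, before integration. -/
def integrand (m : ℝ) (lam : ℂ) (p : Fin N → Momentum) (x : CiliatedTree N) (τ : x.Replicas)
    (k : x.Momenta p) : ℂ :=
  (∏ a, vertexFactor m lam x k.1 τ a) * lineFactor x k.1

/-- The amplitude of a ciliated tree in the loop vertex expansion. -/
def amplitude (m : ℝ) (lam : ℂ) (p : Fin N → Momentum) (x : CiliatedTree N) : ℂ :=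
  (-1) ^ N * ((-2 * lam) ^ (x.order - 1) / (x.order ! : ℂ)) *
    ∫ w, ∫ τ, ∑' k : x.Momenta p, integrand m lam p x τ k ∂(x.replicaMeasure w) ∂x.weightsMeasure

/-- The amplitude with absolute values inside all sums and integrals. -/
def absAmplitude (m : ℝ) (lam : ℂ) (p : Fin N → Momentum) (x : CiliatedTree N) : ℝ :=
  ((2 * ‖lam‖) ^ (x.order - 1) / (x.order ! : ℝ)) *
    ∫ w, ∫ τ, ∑' k : x.Momenta p, ‖integrand m lam p x τ k‖
      ∂(x.replicaMeasure w) ∂x.weightsMeasure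

/-- Every sum and every integral in the amplitude of `x` converges absolutely. -/
def WellDefined (m : ℝ) (lam : ℂ) (p : Fin N → Momentum) (x : CiliatedTree N) : Prop :=
  (∀ τ : x.Replicas, Summable fun k : x.Momenta p => ‖integrand m lam p x τ k‖) ∧
  (∀ w, Integrable (fun τ => ∑' k : x.Momenta p, integrand m lam p x τ k) (x.replicaMeasure w)) ∧
  (∀ w, Integrable (fun τ => ∑' k : x.Momenta p, ‖integrand m lam p x τ k‖)
    (x.replicaMeasure w)) ∧
  Integrable (fun w => ∫ τ, ∑' k : x.Momenta p, integrand m lam p x τ k ∂(x.replicaMeasure w))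
    x.weightsMeasure ∧
  Integrable (fun w => ∫ τ, ∑' k : x.Momenta p, ‖integrand m lam p x τ k‖ ∂(x.replicaMeasure w))
    x.weightsMeasure

end CiliatedTree

/-- Absolute convergence of the loop vertex expansion restricted to a set of trees: absolute
values are taken inside the integrals and the sums over momenta. -/
def LVEConvergesAbsolutely (m : ℝ) (lam : ℂ) (p : Fin N → Momentum)
    (A : Set (CiliatedTree N)) : Prop :=
  (∀ x ∈ A, x.WellDefined m lam p) ∧
    Summable fun x : A => CiliatedTree.absAmplitude m lam p x.1

/-- The sum over the pairings of incoming and outgoing external momenta,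
`∑_π ∏_i δ_{p_i, p̄_{π(i)}}`. -/
def pairing (p pbar : Fin N → Momentum) : ℂ :=
  ∑ π : Equiv.Perm (Fin N), ∏ i, if p i = pbar (π i) then 1 else 0

/-- The interior `|λ| < cos²(φ/2) / κ`, `φ = arg λ ∈ (-π, π]`, of a cardioid. -/
def cardioid (κ : ℝ) : Set ℂ := {lam | ‖lam‖ < Real.cos (lam.arg / 2) ^ 2 / κ}

end TGFT

end

set_option linter.unusedSectionVars false
set_option linter.style.haveILetI false

noncomputable section

namespace LVE

/-! ### Product measures -/

section Product

variable {ι X 𝕜 : Type*} [Fintype ι] [DecidableEq ι] [MeasurableSpace X] [RCLike 𝕜]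

/-- Replacing one coordinate of a product measure. -/
lemma map_update_prod_pi (ν : ι → Measure X) [∀ i, SigmaFinite (ν i)] (l : ι) (μ : Measure X)
    [SigmaFinite μ] [IsProbabilityMeasure (ν l)] :
    (μ.prod (Measure.pi ν)).map (fun p => Function.update p.2 l p.1) =
      Measure.pi (Function.update ν l μ) := by
  have : ∀ i, SigmaFinite (Function.update ν l μ i) := by
    intro i
    by_cases h : i = l
    · subst h; simpa
    · simpa [Function.update_of_ne h] using inferInstanceAs (SigmaFinite (ν i))
  symm
  refine Measure.pi_eq fun s hs => ?_
  have hm : Measurable fun p : X × (ι → X) => Function.update p.2 l p.1 := by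
    refine measurable_pi_iff.2 fun i => ?_
    by_cases h : i = l
    · subst h; simpa using measurable_fst
    · simp only [Function.update_of_ne h]; fun_prop
  rw [Measure.map_apply hm (MeasurableSet.univ_pi hs)]
  have hpre : (fun p : X × (ι → X) => Function.update p.2 l p.1) ⁻¹' (Set.univ.pi s) =
      s l ×ˢ Set.univ.pi (Function.update s l Set.univ) := by
    ext ⟨u, w⟩
    simp only [Set.mem_preimage, Set.mem_pi, Set.mem_univ, true_imp_iff, Set.mem_prod]
    constructor
    · intro h
      refine ⟨by simpa using h l, fun i => ?_⟩
      by_cases hi : i = l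
      · subst hi; simp
      · simpa [Function.update_of_ne hi] using h i
    · rintro ⟨h1, h2⟩ i
      by_cases hi : i = l
      · subst hi; simpa
      · simpa [Function.update_of_ne hi] using h2 i
  rw [hpre, Measure.prod_prod, Measure.pi_pi, ← Finset.mul_prod_erase _ _ (Finset.mem_univ l),
    ← Finset.mul_prod_erase _ _ (Finset.mem_univ l)]
  simp only [Function.update_self, measure_univ, one_mul]
  congr 1
  refine Finset.prod_congr rfl fun i hi => ?_
  have := Finset.ne_of_mem_erase hi
  simp [Function.update_of_ne this]

/-- Functions of disjoint sets of coordinates are independent. -/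
lemma integral_mul_of_dependsOn (μ : ι → Measure X) [∀ i, IsProbabilityMeasure (μ i)]
    (S : Set ι) {f g : (ι → X) → 𝕜} (hf : DependsOn f S) (hg : DependsOn g Sᶜ) :
    ∫ x, f x * g x ∂Measure.pi μ = (∫ x, f x ∂Measure.pi μ) * ∫ x, g x ∂Measure.pi μ := by
  classical
  have hX : ∀ i : ι, Nonempty X := fun i => nonempty_of_isProbabilityMeasure (μ i)
  have e := measurePreserving_piEquivPiSubtypeProd μ (fun i => i ∈ S)
  set eqv := MeasurableEquiv.piEquivPiSubtypeProd (fun _ : ι => X) (fun i => i ∈ S)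
  let F : ({i // i ∈ S} → X) → 𝕜 := fun a =>
    f fun i => if h : i ∈ S then a ⟨i, h⟩ else (hX i).some
  let G : ({i // i ∉ S} → X) → 𝕜 := fun a =>
    g fun i => if h : i ∉ S then a ⟨i, h⟩ else (hX i).some
  have hF : ∀ x, f x = F (eqv x).1 := fun x => hf fun i hi => by
    simp only [dif_pos hi]; rfl
  have hG : ∀ x, g x = G (eqv x).2 := fun x => hg fun i hi => by
    have hi' : i ∉ S := hi
    simp only [hi', not_false_eq_true, dif_pos]; rfl
  have key : ∀ H : ({i // i ∈ S} → X) × ({i // i ∉ S} → X) → 𝕜,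
      ∫ x, H (eqv x) ∂Measure.pi μ = ∫ y, H y ∂((Measure.pi fun i : {i // i ∈ S} => μ i).prod
        (Measure.pi fun i : {i // i ∉ S} => μ i)) := fun H =>
    e.integral_comp eqv.measurableEmbedding H
  simp_rw [hF, hG]
  rw [key (fun y => F y.1 * G y.2), key (fun y => F y.1), key (fun y => G y.2),
    integral_prod_mul]
  congr 1
  · rw [integral_fun_fst]; simp
  · rw [integral_fun_snd]; simp

end Product

/-! ### The forest formula -/

section Forest

variable {V : Type*} [Fintype V] [DecidableEq V]

/-- The end points of `e` are connected by the edges in `B`. -/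
def Linked (B : Set (Sym2 V)) (e : Sym2 V) : Prop :=
  e ∈ Sym2.fromRel (r := (SimpleGraph.fromEdgeSet B).Reachable) ⟨fun _ _ h => h.symm⟩

@[simp] lemma linked_mk {B : Set (Sym2 V)} {a b : V} :
    Linked B s(a, b) ↔ (SimpleGraph.fromEdgeSet B).Reachable a b := Iff.rfl

/-- The edges of `F` of weight at least `t`. -/
def level (F : Finset (Sym2 V)) (w : Sym2 V → ℝ) (t : ℝ) : Set (Sym2 V) := {e | e ∈ F ∧ t ≤ w e}

open scoped Classical in
/-- The indicator function of the set of pairs that are connected at level `t`. -/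
def linkInd (F : Finset (Sym2 V)) (w : Sym2 V → ℝ) (l : Sym2 V) (t : ℝ) : ℝ :=
  if Linked (level F w t) l then 1 else 0

/-- The interaction of the pairs in `P` weakened by the edges of `F`. -/
def energy (P : Finset (Sym2 V)) (C : Sym2 V → ℝ) (s : ℝ) (F : Finset (Sym2 V))
    (w : Sym2 V → ℝ) : ℝ :=
  ∑ l ∈ P, C l * ∫ t in s..1, linkInd F w l t

/-- The box in which the weights vary: `(s, 1]` for the edges in `F`, `(0, 1]` for the others. -/
def weightBox (s : ℝ) (F : Finset (Sym2 V)) : Set (Sym2 V → ℝ) :=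
  Set.univ.pi fun e => Set.Ioc (if e ∈ F then s else 0) 1

/-- Lebesgue measure on the box of weights. -/
def edgeMeasure (s : ℝ) (F : Finset (Sym2 V)) : Measure (Sym2 V → ℝ) :=
  volume.restrict (weightBox s F)

/-- The contribution of the edge set `F` to the forest formula. -/
def forestTerm (P : Finset (Sym2 V)) (C : Sym2 V → ℝ) (s : ℝ) (F : Finset (Sym2 V)) : ℝ :=
  (∏ l ∈ F, C l) * ∫ w, Real.exp (energy P C s F w) ∂edgeMeasure s F

lemma edgeMeasure_eq_pi (s : ℝ) (F : Finset (Sym2 V)) :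
    edgeMeasure s F =
      Measure.pi fun e => (volume : Measure ℝ).restrict (Set.Ioc (if e ∈ F then s else 0) 1) := by
  rw [edgeMeasure, weightBox, volume_pi, Measure.restrict_pi_pi]

instance (s : ℝ) (F : Finset (Sym2 V)) : IsFiniteMeasure (edgeMeasure s F) := by
  rw [edgeMeasure_eq_pi]; infer_instance

lemma measurableSet_weightBox (s : ℝ) (F : Finset (Sym2 V)) : MeasurableSet (weightBox s F) :=
  MeasurableSet.univ_pi fun _ => measurableSet_Ioc

lemma measurable_linkInd (F : Finset (Sym2 V)) (l : Sym2 V) :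
    Measurable fun q : (Sym2 V → ℝ) × ℝ => linkInd F q.1 l q.2 := by
  classical
  have h1 : Measurable fun q : (Sym2 V → ℝ) × ℝ => fun e : Sym2 V => (e ∈ F ∧ q.2 ≤ q.1 e) := by
    refine measurable_pi_iff.2 fun e => ?_
    by_cases he : e ∈ F
    · simp only [he, true_and]
      exact measurableSet_setOfPred.1 (measurableSet_le measurable_snd (by fun_prop))
    · simp only [he, false_and]; exact measurable_const
  have h2 : Measurable fun B : Sym2 V → Prop =>
      if Linked (Set.ofPred B) l then (1 : ℝ) else 0 := measurable_of_finite _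
  exact h2.comp h1

lemma linkInd_nonneg (F : Finset (Sym2 V)) (w : Sym2 V → ℝ) (l : Sym2 V) (t : ℝ) :
    0 ≤ linkInd F w l t := by unfold linkInd; split_ifs <;> norm_num

lemma linkInd_le_one (F : Finset (Sym2 V)) (w : Sym2 V → ℝ) (l : Sym2 V) (t : ℝ) :
    linkInd F w l t ≤ 1 := by unfold linkInd; split_ifs <;> norm_num

lemma intervalIntegrable_linkInd (F : Finset (Sym2 V)) (w : Sym2 V → ℝ) (l : Sym2 V) (a b : ℝ) :
    IntervalIntegrable (linkInd F w l) volume a b := by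
  have hm : Measurable (linkInd F w l) :=
    (measurable_linkInd F l).comp (measurable_const.prodMk measurable_id)
  refine (intervalIntegrable_const (c := (1 : ℝ))).mono_fun hm.aestronglyMeasurable
    (ae_of_all _ fun t => ?_)
  simpa [abs_of_nonneg (linkInd_nonneg F w l t)] using linkInd_le_one F w l t

lemma measurable_energy (P : Finset (Sym2 V)) (C : Sym2 V → ℝ) (s : ℝ) (F : Finset (Sym2 V)) :
    Measurable (energy P C s F) := by
  unfold energy
  refine Finset.measurable_sum _ fun l _ => Measurable.const_mul ?_ _
  simp only [intervalIntegral]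
  refine Measurable.sub ?_ ?_ <;>
  exact ((measurable_linkInd F l).stronglyMeasurable.integral_prod_right).measurable

lemma abs_integral_linkInd_le (F : Finset (Sym2 V)) (w : Sym2 V → ℝ) (l : Sym2 V) (s : ℝ) :
    |∫ t in s..1, linkInd F w l t| ≤ |1 - s| := by
  have := intervalIntegral.norm_integral_le_of_norm_le_const (a := s) (b := 1) (C := 1)
    (f := linkInd F w l) fun t _ => by
      rw [Real.norm_of_nonneg (linkInd_nonneg F w l t)]; exact linkInd_le_one F w l t
  simpa using this

lemma energy_le (P : Finset (Sym2 V)) (C : Sym2 V → ℝ) (s : ℝ) (F : Finset (Sym2 V))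
    (w : Sym2 V → ℝ) : energy P C s F w ≤ ∑ l ∈ P, |C l| * |1 - s| := by
  refine Finset.sum_le_sum fun l _ => (le_abs_self _).trans ?_
  rw [abs_mul]
  exact mul_le_mul_of_nonneg_left (abs_integral_linkInd_le F w l s) (abs_nonneg _)

lemma ae_injective_edgeMeasure (s : ℝ) (F : Finset (Sym2 V)) :
    ∀ᵐ w ∂edgeMeasure s F, Function.Injective w := by
  refine ae_restrict_of_ae ?_
  have : ∀ e e' : Sym2 V, e ≠ e' → ∀ᵐ w : Sym2 V → ℝ, w e ≠ w e' := by
    intro e e' h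
    let p : (Sym2 V → ℝ) →ₗ[ℝ] ℝ := (LinearMap.proj e : (Sym2 V → ℝ) →ₗ[ℝ] ℝ) - LinearMap.proj e'
    have hp : LinearMap.ker p ≠ ⊤ := by
      intro h1
      have h2 : p (Pi.single e 1) = 0 := by
        have : Pi.single e (1 : ℝ) ∈ LinearMap.ker p := h1 ▸ Submodule.mem_top
        exact this
      simp [p, h.symm] at h2
    have h0 := Measure.addHaar_submodule (volume : Measure (Sym2 V → ℝ)) _ hp
    rw [ae_iff]
    refine measure_mono_null (fun w hw => ?_) h0
    simp only [ne_eq, not_not, Set.mem_ofPred_eq] at hw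
    simp [p, hw]
  have h : ∀ᵐ w : Sym2 V → ℝ, ∀ e e' : Sym2 V, e ≠ e' → w e ≠ w e' := by
    simp only [ae_all_iff]
    exact this
  filter_upwards [h] with w hw e e' he
  by_contra hne
  exact hw e e' hne he

/-- Disintegration of the weights according to the edge of smallest weight. -/
lemma integral_edgeMeasure_eq_sum (s : ℝ) (hs : s ≤ 1) (F : Finset (Sym2 V)) (hF : F.Nonempty)
    (h : (Sym2 V → ℝ) → ℝ) (hm : Measurable h) (c : ℝ) (hc : ∀ w, |h w| ≤ c) :
    ∫ w, h w ∂edgeMeasure s F =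
      ∑ l ∈ F, ∫ u in s..1, ∫ w, h (Function.update w l u) ∂edgeMeasure u (F.erase l) := by
  classical
  set A : Sym2 V → Set (Sym2 V → ℝ) := fun l => {w | ∀ e ∈ F.erase l, w l < w e} with hA
  have hAm : ∀ l, MeasurableSet (A l) := fun l => by
    have : A l = ⋂ e ∈ F.erase l, {w | w l < w e} := by ext; simp [hA]
    rw [this]
    exact Finset.measurableSet_biInter _ fun e _ => measurableSet_lt (by fun_prop) (by fun_prop)
  have hint : ∀ l, Integrable ((A l).indicator h) (edgeMeasure s F) := fun l =>
    (Integrable.of_bound hm.aestronglyMeasurable c (ae_of_all _ hc)).indicator (hAm l)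
  have h1 : ∫ w, h w ∂edgeMeasure s F = ∑ l ∈ F, ∫ w, (A l).indicator h w ∂edgeMeasure s F := by
    rw [← integral_finsetSum _ fun l _ => hint l]
    refine integral_congr_ae ?_
    filter_upwards [ae_injective_edgeMeasure s F] with w hw
    obtain ⟨l, hl, hmin⟩ := F.exists_min_image w hF
    rw [Finset.sum_eq_single_of_mem l hl]
    · rw [Set.indicator_of_mem]
      intro e he
      exact lt_of_le_of_ne (hmin e (Finset.mem_of_mem_erase he))
        fun h => (Finset.ne_of_mem_erase he) (hw h.symm)
    · intro l' hl' hne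
      rw [Set.indicator_of_notMem]
      intro hmem
      exact absurd (hmem l (Finset.mem_erase.2 ⟨hne.symm, hl⟩)) (not_lt.2 (hmin l' hl'))
  rw [h1]
  refine Finset.sum_congr rfl fun l hl => ?_
  have hupd : edgeMeasure s F =
      (((volume : Measure ℝ).restrict (Set.Ioc s 1)).prod (edgeMeasure s (F.erase l))).map
        fun p => Function.update p.2 l p.1 := by
    haveI : IsProbabilityMeasure ((fun e => (volume : Measure ℝ).restrict
        (Set.Ioc (if e ∈ F.erase l then s else 0) 1)) l) := ⟨by simp⟩
    rw [edgeMeasure_eq_pi, edgeMeasure_eq_pi, map_update_prod_pi]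
    congr 1
    funext e
    by_cases he : e = l
    · subst he; simp [hl]
    · simp [he]
  have hum : Measurable fun p : ℝ × (Sym2 V → ℝ) => Function.update p.2 l p.1 := by
    refine measurable_pi_iff.2 fun i => ?_
    by_cases h : i = l
    · subst h; simpa using measurable_fst
    · simp only [Function.update_of_ne h]; fun_prop
  have hmi : Measurable ((A l).indicator h) := hm.indicator (hAm l)
  rw [hupd, integral_map hum.aemeasurable hmi.aestronglyMeasurable, integral_prod,
    intervalIntegral.integral_of_le hs]
  · refine setIntegral_congr_fun measurableSet_Ioc fun u hu => ?_
    have hbox : edgeMeasure u (F.erase l) = (edgeMeasure s (F.erase l)).restrict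
        {w | ∀ e ∈ F.erase l, u < w e} := by
      have hms : MeasurableSet {w : Sym2 V → ℝ | ∀ e ∈ F.erase l, u < w e} := by
        have : {w : Sym2 V → ℝ | ∀ e ∈ F.erase l, u < w e} = ⋂ e ∈ F.erase l, {w | u < w e} := by
          ext; simp
        rw [this]
        exact Finset.measurableSet_biInter _ fun e _ => measurableSet_lt (by fun_prop) (by fun_prop)
      rw [edgeMeasure, edgeMeasure, Measure.restrict_restrict hms]
      congr 1
      ext w
      simp only [weightBox, Set.mem_pi, Set.mem_univ, true_imp_iff, Set.mem_inter_iff,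
        Set.mem_ofPred_eq, Set.mem_Ioc]
      constructor
      · intro hw
        refine ⟨fun e he => by simpa [he] using (hw e).1, fun e => ⟨?_, (hw e).2⟩⟩
        have := (hw e).1
        split_ifs at this ⊢
        · exact hu.1.trans this
        · exact this
      · rintro ⟨hw1, hw2⟩ e
        refine ⟨?_, (hw2 e).2⟩
        have := (hw2 e).1
        split_ifs at this ⊢ with he
        · exact hw1 e he
        · exact this
    have hms : MeasurableSet {w : Sym2 V → ℝ | ∀ e ∈ F.erase l, u < w e} := by
        have : {w : Sym2 V → ℝ | ∀ e ∈ F.erase l, u < w e} = ⋂ e ∈ F.erase l, {w | u < w e} := by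
          ext; simp
        rw [this]
        exact Finset.measurableSet_biInter _ fun e _ => measurableSet_lt (by fun_prop) (by fun_prop)
    simp only
    rw [hbox, ← integral_indicator hms]
    refine integral_congr_ae (ae_of_all _ fun w => ?_)
    have hiff : Function.update w l u ∈ A l ↔ w ∈ {w : Sym2 V → ℝ | ∀ e ∈ F.erase l, u < w e} := by
      simp only [hA, Set.mem_ofPred_eq, Function.update_self]
      refine forall₂_congr fun e he => ?_
      rw [Function.update_of_ne (Finset.ne_of_mem_erase he)]
    by_cases hw : w ∈ {w : Sym2 V → ℝ | ∀ e ∈ F.erase l, u < w e}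
    · simp only [Set.indicator_of_mem hw, Set.indicator_of_mem (hiff.2 hw)]
    · simp only [Set.indicator_of_notMem hw, Set.indicator_of_notMem (fun h => hw (hiff.1 h))]
  · refine Integrable.of_bound (hmi.comp hum).aestronglyMeasurable c (ae_of_all _ fun p => ?_)
    refine (norm_indicator_le_norm_self _ _).trans (hc _)

open scoped Classical in
/-- The total interaction of the pairs in `P` that are connected by the edges in `F`. -/
def linkSum (P : Finset (Sym2 V)) (C : Sym2 V → ℝ) (F : Finset (Sym2 V)) : ℝ :=
  ∑ l ∈ P, if Linked (F : Set (Sym2 V)) l then C l else 0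

lemma energy_update (P : Finset (Sym2 V)) (C : Sym2 V → ℝ) {s u : ℝ} (hu : u ∈ Set.Ioc s 1)
    (F : Finset (Sym2 V)) {l : Sym2 V} (hl : l ∈ F) (w : Sym2 V → ℝ)
    (hw : ∀ e ∈ F.erase l, u < w e) :
    energy P C s F (Function.update w l u) =
      (u - s) * linkSum P C F + energy P C u (F.erase l) w := by
  classical
  rw [energy, energy, linkSum, Finset.mul_sum, ← Finset.sum_add_distrib]
  refine Finset.sum_congr rfl fun x _ => ?_
  rw [← intervalIntegral.integral_add_adjacent_intervals
    (intervalIntegrable_linkInd F (Function.update w l u) x s u)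
    (intervalIntegrable_linkInd F (Function.update w l u) x u 1)]
  have h1 : ∫ t in s..u, linkInd F (Function.update w l u) x t =
      ∫ _ in s..u, if Linked (F : Set (Sym2 V)) x then (1 : ℝ) else 0 := by
    rw [intervalIntegral.integral_of_le hu.1.le, intervalIntegral.integral_of_le hu.1.le]
    refine setIntegral_congr_fun measurableSet_Ioc fun t ht => ?_
    have : level F (Function.update w l u) t = (F : Set (Sym2 V)) := by
      ext e
      simp only [level, Set.mem_ofPred_eq, SetLike.mem_coe, and_iff_left_iff_imp]
      intro he
      by_cases hel : e = l
      · subst hel; simpa using ht.2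
      · rw [Function.update_of_ne hel]
        exact ht.2.trans (hw e (Finset.mem_erase.2 ⟨hel, he⟩)).le
    simp only [linkInd, this]
  have h2 : ∫ t in u..1, linkInd F (Function.update w l u) x t =
      ∫ t in u..1, linkInd (F.erase l) w x t := by
    rw [intervalIntegral.integral_of_le hu.2, intervalIntegral.integral_of_le hu.2]
    refine setIntegral_congr_fun measurableSet_Ioc fun t ht => ?_
    have : level F (Function.update w l u) t = level (F.erase l) w t := by
      ext e
      simp only [level, Set.mem_ofPred_eq, Finset.mem_erase]
      by_cases hel : e = l
      · subst hel; simp [ht.1]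
      · simp [hel]
    simp only [linkInd, this]
  rw [h1, h2, intervalIntegral.integral_const, smul_eq_mul]
  split_ifs <;> ring

lemma forestTerm_eq_sum (P : Finset (Sym2 V)) (C : Sym2 V → ℝ) {s : ℝ} (hs : s ≤ 1)
    (F : Finset (Sym2 V)) (hF : F.Nonempty) :
    forestTerm P C s F = ∑ l ∈ F, C l *
      ∫ u in s..1, Real.exp ((u - s) * linkSum P C F) * forestTerm P C u (F.erase l) := by
  rw [forestTerm, integral_edgeMeasure_eq_sum s hs F hF (fun w => Real.exp (energy P C s F w))
    (Real.measurable_exp.comp (measurable_energy P C s F))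
    (Real.exp (∑ l ∈ P, |C l| * |1 - s|)) fun w => by
      rw [abs_of_pos (Real.exp_pos _)]; exact Real.exp_le_exp.2 (energy_le P C s F w),
    Finset.mul_sum]
  refine Finset.sum_congr rfl fun l hl => ?_
  rw [← Finset.mul_prod_erase F C hl, mul_assoc, ← intervalIntegral.integral_const_mul]
  congr 1
  rw [intervalIntegral.integral_of_le hs, intervalIntegral.integral_of_le hs]
  refine setIntegral_congr_fun measurableSet_Ioc fun u hu => ?_
  simp only [forestTerm]
  rw [mul_left_comm, ← integral_const_mul (Real.exp _)]
  congr 1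
  refine setIntegral_congr_fun (measurableSet_weightBox _ _) fun w hw => ?_
  rw [← Real.exp_add, energy_update P C hu F hl w]
  intro e he
  simpa [he] using (Set.mem_univ_pi.1 hw e).1

lemma forestTerm_empty (P : Finset (Sym2 V)) (hP : ∀ l ∈ P, ¬ l.IsDiag) (C : Sym2 V → ℝ) (s : ℝ) :
    forestTerm P C s ∅ = 1 := by
  have h : ∀ w, energy P C s ∅ w = 0 := fun w => by
    refine Finset.sum_eq_zero fun l hl => ?_
    have : ∀ t, linkInd ∅ w l t = 0 := fun t => by
      rw [linkInd, if_neg]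
      induction l with | _ a b => ?_
      have hab : a ≠ b := fun h => hP _ hl (by simp [h])
      have : level (∅ : Finset (Sym2 V)) w t = ∅ := by ext; simp [level]
      simp [this, hab]
    simp [this]
  simp [forestTerm, h, edgeMeasure_eq_pi, Measure.real, Measure.pi_univ]

/-- The differential equation satisfied by the contribution of a forest. -/
lemma hasDerivWithinAt_forestTerm (P : Finset (Sym2 V)) (hP : ∀ l ∈ P, ¬ l.IsDiag)
    (C : Sym2 V → ℝ) (F : Finset (Sym2 V)) :
    ∀ s ∈ Set.Icc (0 : ℝ) 1, HasDerivWithinAt (fun s => forestTerm P C s F)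
      (-(linkSum P C F * forestTerm P C s F + ∑ l ∈ F, C l * forestTerm P C s (F.erase l)))
      (Set.Icc 0 1) s := by
  induction hn : F.card using Nat.strong_induction_on generalizing F with
  | _ n ih =>
  intro s hs
  rcases F.eq_empty_or_nonempty with rfl | hF
  · have h0 : linkSum P C ∅ = 0 := by
      refine Finset.sum_eq_zero fun l hl => if_neg ?_
      induction l with | _ a b => ?_
      have hab : a ≠ b := fun h => hP _ hl (by simp [h])
      simp [hab]
    simp only [forestTerm_empty P hP C, h0]
    simpa using hasDerivWithinAt_const s (Set.Icc (0 : ℝ) 1) (1 : ℝ)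
  set a := linkSum P C F with ha
  have hcont : ∀ l ∈ F, ContinuousOn (fun u => forestTerm P C u (F.erase l)) (Set.Icc 0 1) :=
    fun l hl u hu => (ih _ (by rw [← hn]; exact Finset.card_erase_lt_of_mem hl) _ rfl u
      hu).continuousWithinAt
  have hI : ∀ l ∈ F, HasDerivWithinAt
      (fun s => ∫ u in s..1, Real.exp (u * a) * forestTerm P C u (F.erase l))
      (-(Real.exp (s * a) * forestTerm P C s (F.erase l))) (Set.Icc 0 1) s := by
    intro l hl
    have hc : ContinuousOn (fun u => Real.exp (u * a) * forestTerm P C u (F.erase l))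
      (Set.Icc 0 1) := (by fun_prop : Continuous fun u : ℝ => Real.exp (u * a)).continuousOn.mul
        (hcont l hl)
    haveI : Fact (s ∈ Set.Icc (0 : ℝ) 1) := ⟨hs⟩
    refine intervalIntegral.integral_hasDerivWithinAt_left (s := Set.Icc (0 : ℝ) 1)
      (t := Set.Icc (0 : ℝ) 1) ?_ ?_ (hc s hs)
    · refine ContinuousOn.intervalIntegrable ?_
      rw [Set.uIcc_of_le hs.2]
      exact hc.mono (Set.Icc_subset_Icc_left hs.1)
    · exact hc.stronglyMeasurableAtFilter_nhdsWithin measurableSet_Icc s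
  have hform : ∀ s ∈ Set.Icc (0 : ℝ) 1, forestTerm P C s F = Real.exp (-(s * a)) *
      ∑ l ∈ F, C l * ∫ u in s..1, Real.exp (u * a) * forestTerm P C u (F.erase l) := by
    intro s hs
    rw [forestTerm_eq_sum P C hs.2 F hF, Finset.mul_sum]
    refine Finset.sum_congr rfl fun l _ => ?_
    rw [mul_left_comm]
    congr 1
    rw [← intervalIntegral.integral_const_mul]
    congr 1
    funext u
    rw [← mul_assoc, ← Real.exp_add]
    congr 2
    ring
  have hE : HasDerivWithinAt (fun s : ℝ => Real.exp (-(s * a))) (-a * Real.exp (-(s * a)))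
      (Set.Icc 0 1) s := by
    have h1 : HasDerivAt (fun s : ℝ => -(s * a)) (-a) s := by
      simpa using ((hasDerivAt_id' s).mul_const a).fun_neg
    simpa [mul_comm] using (h1.exp).hasDerivWithinAt
  have hD := hE.mul (HasDerivWithinAt.fun_sum fun l hl => (hI l hl).const_mul (C l))
  refine (hD.congr_deriv ?_).congr (fun s hs => hform s hs) (hform s hs)
  rw [hform s hs, mul_assoc, neg_mul, ← sub_eq_zero]
  simp only [mul_neg, Finset.sum_neg_distrib, Finset.mul_sum]
  have : ∀ l ∈ F, Real.exp (-(s * a)) * (C l * (Real.exp (s * a) * forestTerm P C s (F.erase l)))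
      = C l * forestTerm P C s (F.erase l) := fun l _ => by
    rw [mul_left_comm, ← mul_assoc (Real.exp (-(s * a))), ← Real.exp_add]
    simp
  rw [Finset.sum_congr rfl this]
  ring

open scoped Classical in
/-- The forests with edges in `P`. -/
def forests (P : Finset (Sym2 V)) : Finset (Finset (Sym2 V)) :=
  P.powerset.filter fun F => (SimpleGraph.fromEdgeSet (F : Set (Sym2 V))).IsAcyclic

lemma mem_forests {P F : Finset (Sym2 V)} : F ∈ forests P ↔
    F ⊆ P ∧ (SimpleGraph.fromEdgeSet (F : Set (Sym2 V))).IsAcyclic := by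
  simp [forests]

lemma fromEdgeSet_insert_mk (F : Finset (Sym2 V)) (a b : V) :
    SimpleGraph.fromEdgeSet ((insert s(a, b) F : Finset (Sym2 V)) : Set (Sym2 V)) =
      SimpleGraph.fromEdgeSet (F : Set (Sym2 V)) ⊔ SimpleGraph.edge a b := by
  rw [Finset.coe_insert, SimpleGraph.edge, ← SimpleGraph.fromEdgeSet_union, Set.insert_eq,
    Set.union_comm]

lemma insert_mem_forests_iff {P F : Finset (Sym2 V)} (hP : ∀ l ∈ P, ¬ l.IsDiag) {l : Sym2 V}
    (hl : l ∈ P) (hlF : l ∉ F) :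
    insert l F ∈ forests P ↔ F ∈ forests P ∧ ¬ Linked (F : Set (Sym2 V)) l := by
  induction l with | _ a b => ?_
  have hab : a ≠ b := fun h => hP _ hl (by simp [h])
  rw [mem_forests, mem_forests, fromEdgeSet_insert_mk, SimpleGraph.isAcyclic_sup_fromEdgeSet_iff,
    linked_mk, Finset.insert_subset_iff]
  have h2 : ¬ (SimpleGraph.fromEdgeSet (F : Set (Sym2 V))).Adj a b := by simp [hlF]
  simp only [hl, true_and, hab, h2, or_self]
  tauto

/-- The forest formula of Brydges and Kennedy. -/
theorem sum_forestTerm (P : Finset (Sym2 V)) (hP : ∀ l ∈ P, ¬ l.IsDiag) (C : Sym2 V → ℝ) :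
    ∑ F ∈ forests P, forestTerm P C 0 F = Real.exp (∑ l ∈ P, C l) := by
  classical
  set c := ∑ l ∈ P, C l with hc
  have hcomb : ∀ K : Finset (Sym2 V) → ℝ,
      ∑ F ∈ forests P, (linkSum P C F * K F + ∑ l ∈ F, C l * K (F.erase l)) =
        c * ∑ F ∈ forests P, K F := by
    intro K
    have h1 : ∑ F ∈ forests P, ∑ l ∈ F, C l * K (F.erase l) =
        ∑ F ∈ forests P, ∑ l ∈ P.filter (fun l => ¬ Linked (F : Set (Sym2 V)) l), C l * K F := by
      rw [Finset.sum_sigma', Finset.sum_sigma']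
      have hnl : ∀ (F : Finset (Sym2 V)) (l : Sym2 V), l ∈ P → ¬ Linked (F : Set (Sym2 V)) l →
          l ∉ F := by
        intro F l hl hn hlF
        induction l with | _ a b => ?_
        have hab : a ≠ b := fun h => hP _ hl (by simp [h])
        exact hn (SimpleGraph.Adj.reachable (by simp [hab, hlF]))
      refine Finset.sum_bij' (fun x _ => ⟨x.1.erase x.2, x.2⟩) (fun x _ => ⟨insert x.2 x.1, x.2⟩)
        ?_ ?_ ?_ ?_ ?_
      · rintro ⟨F, l⟩ h
        simp only [Finset.mem_sigma, Finset.mem_filter] at h ⊢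
        have hl : l ∈ P := (mem_forests.1 h.1).1 h.2
        have := (insert_mem_forests_iff hP hl (Finset.notMem_erase l F)).1
          (by rw [Finset.insert_erase h.2]; exact h.1)
        exact ⟨this.1, hl, this.2⟩
      · rintro ⟨F, l⟩ h
        simp only [Finset.mem_sigma, Finset.mem_filter] at h ⊢
        exact ⟨(insert_mem_forests_iff hP h.2.1 (hnl F l h.2.1 h.2.2)).2 ⟨h.1, h.2.2⟩,
          Finset.mem_insert_self _ _⟩
      · rintro ⟨F, l⟩ h
        simp only [Finset.mem_sigma] at h
        simp [Finset.insert_erase h.2]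
      · rintro ⟨F, l⟩ h
        simp only [Finset.mem_sigma, Finset.mem_filter] at h
        simp [Finset.erase_insert (hnl F l h.2.1 h.2.2)]
      · rintro ⟨F, l⟩ h
        rfl
    rw [Finset.sum_add_distrib, h1, ← Finset.sum_add_distrib, Finset.mul_sum]
    refine Finset.sum_congr rfl fun F _ => ?_
    rw [← Finset.sum_mul, ← add_mul, linkSum, Finset.sum_filter, ← Finset.sum_add_distrib]
    congr 1
    refine Finset.sum_congr rfl fun l _ => ?_
    split_ifs <;> simp
  set y : ℝ → ℝ := fun s => Real.exp (s * c) * ∑ F ∈ forests P, forestTerm P C s F with hy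
  have hder : ∀ s ∈ Set.Icc (0 : ℝ) 1, HasDerivWithinAt y 0 (Set.Icc 0 1) s := by
    intro s hs
    have h1 := HasDerivWithinAt.fun_sum (u := forests P)
      fun F _ => hasDerivWithinAt_forestTerm P hP C F s hs
    have h2 : HasDerivWithinAt (fun s : ℝ => Real.exp (s * c)) (c * Real.exp (s * c))
        (Set.Icc 0 1) s := by
      have h3 : HasDerivAt (fun s : ℝ => s * c) c s := by
        simpa using (hasDerivAt_id' s).mul_const c
      simpa [mul_comm] using h3.exp.hasDerivWithinAt
    refine (h2.mul h1).congr_deriv ?_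
    rw [Finset.sum_neg_distrib, hcomb]
    ring
  have hconst := constant_of_derivWithin_zero (f := y) (a := 0) (b := 1)
    (fun s hs => (hder s hs).differentiableWithinAt)
    (fun s hs => (hder s (Set.Ico_subset_Icc_self hs)).derivWithin
      (uniqueDiffOn_Icc one_pos s (Set.Ico_subset_Icc_self hs))) 1 (by simp)
  have h0 : y 0 = ∑ F ∈ forests P, forestTerm P C 0 F := by simp [hy]
  have h1 : y 1 = Real.exp c := by
    simp only [hy, one_mul]
    have hemp : ∅ ∈ forests P := mem_forests.2 ⟨Finset.empty_subset _, by simp⟩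
    rw [Finset.sum_eq_single_of_mem _ hemp, forestTerm_empty P hP, mul_one]
    intro F hF hne
    rw [forestTerm_eq_sum P C le_rfl F (Finset.nonempty_iff_ne_empty.2 hne)]
    simp
  rw [← h0, ← hconst, h1]

end Forest

/-! ### Decomposition of forests into trees -/

section Trees

variable {V : Type*} [Fintype V] [DecidableEq V]

/-- The pairs of distinct elements of `A`. -/
def pairs (A : Finset V) : Finset (Sym2 V) := A.sym2.filter fun l => ¬ l.IsDiag

lemma mk_mem_pairs {A : Finset V} {a b : V} : s(a, b) ∈ pairs A ↔ a ∈ A ∧ b ∈ A ∧ a ≠ b := by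
  simp [pairs, and_assoc]

lemma not_isDiag_of_mem_pairs {A : Finset V} : ∀ l ∈ pairs A, ¬ l.IsDiag := fun _ hl =>
  (Finset.mem_filter.1 hl).2

lemma pairs_mono {A B : Finset V} (h : A ⊆ B) : pairs A ⊆ pairs B := fun l hl => by
  induction l with | _ a b => ?_
  rw [mk_mem_pairs] at hl ⊢
  exact ⟨h hl.1, h hl.2.1, hl.2.2⟩

lemma disjoint_pairs {A B : Finset V} (h : Disjoint A B) : Disjoint (pairs A) (pairs B) := by
  rw [Finset.disjoint_left]
  intro l h1 h2
  induction l with | _ a b => ?_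
  rw [mk_mem_pairs] at h1 h2
  exact Finset.disjoint_left.1 h h1.1 h2.1

open scoped Classical in
/-- The edge sets of the trees with vertex set `B`. -/
def trees (B : Finset V) : Finset (Finset (Sym2 V)) :=
  (forests (pairs B)).filter fun F =>
    ∀ a ∈ B, ∀ b ∈ B, (SimpleGraph.fromEdgeSet (F : Set (Sym2 V))).Reachable a b

lemma mem_trees {B : Finset V} {F : Finset (Sym2 V)} : F ∈ trees B ↔ F ∈ forests (pairs B) ∧
    ∀ a ∈ B, ∀ b ∈ B, (SimpleGraph.fromEdgeSet (F : Set (Sym2 V))).Reachable a b := by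
  simp [trees]

/-- The sum over the trees with vertex set `B`. -/
def treeSum (B : Finset V) (C : Sym2 V → ℝ) : ℝ := ∑ F ∈ trees B, forestTerm (pairs B) C 0 F

lemma reachable_union {B B' : Finset V} (hB : Disjoint B B') {S S' : Set (Sym2 V)}
    (hS : S ⊆ pairs B) (hS' : S' ⊆ pairs B') {a b : V} (ha : a ∈ B)
    (h : (SimpleGraph.fromEdgeSet (S ∪ S')).Reachable a b) :
    b ∈ B ∧ (SimpleGraph.fromEdgeSet S).Reachable a b := by
  obtain ⟨p⟩ := h
  induction p with
  | nil => exact ⟨ha, SimpleGraph.Reachable.refl _⟩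
  | @cons u v w huv p ih =>
    have h1 : s(u, v) ∈ S := by
      rcases (SimpleGraph.fromEdgeSet_adj _).1 huv with ⟨h1 | h1, _⟩
      · exact h1
      · exact absurd (mk_mem_pairs.1 (hS' h1)).1 (Finset.disjoint_left.1 hB ha)
    have hv : v ∈ B := (mk_mem_pairs.1 (hS h1)).2.1
    refine ⟨(ih hv).1, SimpleGraph.Reachable.trans (SimpleGraph.Adj.reachable ?_) (ih hv).2⟩
    exact (SimpleGraph.fromEdgeSet_adj _).2 ⟨h1, huv.ne⟩

lemma reachable_union_iff {B B' : Finset V} (hB : Disjoint B B') {S S' : Set (Sym2 V)}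
    (hS : S ⊆ pairs B) (hS' : S' ⊆ pairs B') {a b : V} (ha : a ∈ B) :
    (SimpleGraph.fromEdgeSet (S ∪ S')).Reachable a b ↔
      (SimpleGraph.fromEdgeSet S).Reachable a b :=
  ⟨fun h => (reachable_union hB hS hS' ha h).2,
    fun h => h.mono (SimpleGraph.fromEdgeSet_mono Set.subset_union_left)⟩

lemma union_mem_forests {A B B' : Finset V} (hB : Disjoint B B') (hA : B ⊆ A) (hA' : B' ⊆ A)
    {F F' : Finset (Sym2 V)} (hF : F ∈ forests (pairs B)) (hF' : F' ∈ forests (pairs B')) :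
    F ∪ F' ∈ forests (pairs A) := by
  induction F' using Finset.induction_on with
  | empty =>
    rw [mem_forests] at hF ⊢
    simpa using ⟨hF.1.trans (pairs_mono hA), hF.2⟩
  | insert l F' hl ih =>
    have hlB : l ∈ pairs B' := (mem_forests.1 hF').1 (Finset.mem_insert_self _ _)
    have h1 := (insert_mem_forests_iff not_isDiag_of_mem_pairs hlB hl).1 hF'
    have hlF : l ∉ F ∪ F' := by
      simp only [Finset.mem_union, not_or]
      exact ⟨fun h => Finset.disjoint_left.1 (disjoint_pairs hB) ((mem_forests.1 hF).1 h) hlB, hl⟩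
    rw [Finset.union_insert, insert_mem_forests_iff not_isDiag_of_mem_pairs
      (pairs_mono hA' hlB) hlF]
    refine ⟨ih h1.1, fun h => h1.2 ?_⟩
    induction l with | _ a b => ?_
    rw [linked_mk] at h ⊢
    rw [Finset.coe_union, Set.union_comm] at h
    exact (reachable_union hB.symm (Finset.coe_subset.2 (mem_forests.1 h1.1).1)
      (Finset.coe_subset.2 (mem_forests.1 hF).1) (mk_mem_pairs.1 hlB).1 h).2

lemma subset_mem_forests {P P' F F' : Finset (Sym2 V)} (hF : F ∈ forests P) (h : F' ⊆ F)
    (h' : F' ⊆ P') : F' ∈ forests P' :=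
  mem_forests.2 ⟨h', (mem_forests.1 hF).2.anti (SimpleGraph.fromEdgeSet_mono (by simpa using h))⟩

lemma linkInd_congr {F F' : Finset (Sym2 V)} {w w' : Sym2 V → ℝ} {l l' : Sym2 V} {t t' : ℝ}
    (h : Linked (level F w t) l ↔ Linked (level F' w' t') l') :
    linkInd F w l t = linkInd F' w' l' t' := by
  by_cases h' : Linked (level F' w' t') l'
  · rw [linkInd, linkInd, if_pos h', if_pos (h.2 h')]
  · rw [linkInd, linkInd, if_neg h', if_neg fun h1 => h' (h.1 h1)]

lemma level_union (F F' : Finset (Sym2 V)) (w : Sym2 V → ℝ) (t : ℝ) :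
    level (F ∪ F') w t = level F w t ∪ level F' w t := by
  ext e; simp [level, or_and_right]

lemma level_subset (F : Finset (Sym2 V)) (w : Sym2 V → ℝ) (t : ℝ) : level F w t ⊆ F :=
  fun _ h => h.1

lemma energy_union {A B B' : Finset V} (hB : Disjoint B B') (hA : B ∪ B' = A)
    {F F' : Finset (Sym2 V)} (hF : F ⊆ pairs B) (hF' : F' ⊆ pairs B') (C : Sym2 V → ℝ) (s : ℝ)
    (w : Sym2 V → ℝ) :
    energy (pairs A) C s (F ∪ F') w = energy (pairs B) C s F w + energy (pairs B') C s F' w := by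
  classical
  have hL : ∀ t, (level F w t ⊆ pairs B) := fun t =>
    (level_subset F w t).trans (Finset.coe_subset.2 hF)
  have hL' : ∀ t, (level F' w t ⊆ pairs B') := fun t =>
    (level_subset F' w t).trans (Finset.coe_subset.2 hF')
  have hsub : pairs B ∪ pairs B' ⊆ pairs A := Finset.union_subset
    (pairs_mono (hA ▸ Finset.subset_union_left)) (pairs_mono (hA ▸ Finset.subset_union_right))
  rw [energy, ← Finset.sum_subset hsub, Finset.sum_union (disjoint_pairs hB), energy, energy]
  · congr 1
    · refine Finset.sum_congr rfl fun l hl => ?_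
      have : linkInd (F ∪ F') w l = linkInd F w l := by
        funext t
        induction l with | _ a b => ?_
        refine linkInd_congr ?_
        rw [linked_mk, linked_mk, level_union, reachable_union_iff hB (hL t) (hL' t) (mk_mem_pairs.1 hl).1]
      rw [this]
    · refine Finset.sum_congr rfl fun l hl => ?_
      have : linkInd (F ∪ F') w l = linkInd F' w l := by
        funext t
        induction l with | _ a b => ?_
        refine linkInd_congr ?_
        rw [linked_mk, linked_mk, level_union, Set.union_comm, reachable_union_iff hB.symm (hL' t) (hL t) (mk_mem_pairs.1 hl).1]
      rw [this]
  · intro l hl hn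
    have : linkInd (F ∪ F') w l = 0 := by
      funext t
      induction l with | _ a b => ?_
      simp only [linkInd, linked_mk, level_union, Pi.zero_apply]
      rw [if_neg]
      intro h
      rw [mk_mem_pairs, ← hA] at hl
      rw [Finset.mem_union, mk_mem_pairs, mk_mem_pairs] at hn
      rcases Finset.mem_union.1 hl.1 with ha | ha
      · exact hn (Or.inl ⟨ha, (reachable_union hB (hL t) (hL' t) ha h).1, hl.2.2⟩)
      · rw [Set.union_comm] at h
        exact hn (Or.inr ⟨ha, (reachable_union hB.symm (hL' t) (hL t) ha h).1, hl.2.2⟩)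
    simp [this]

lemma edgeMeasure_zero (F : Finset (Sym2 V)) :
    edgeMeasure 0 F = Measure.pi fun _ => (volume : Measure ℝ).restrict (Set.Ioc 0 1) := by
  simp [edgeMeasure_eq_pi]

instance : IsProbabilityMeasure ((volume : Measure ℝ).restrict (Set.Ioc (0 : ℝ) 1)) := ⟨by simp⟩

lemma dependsOn_energy (P : Finset (Sym2 V)) (C : Sym2 V → ℝ) (s : ℝ) (F : Finset (Sym2 V)) :
    DependsOn (energy P C s F) (F : Set (Sym2 V)) := by
  intro w w' h
  have : level F w = level F w' := by
    funext t
    ext e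
    simp only [level, Set.mem_ofPred_eq, and_congr_right_iff]
    intro he
    rw [h e he]
  have h2 : ∀ l, linkInd F w l = linkInd F w' l := fun l => funext fun t =>
    linkInd_congr (by rw [this])
  simp only [energy, h2]

lemma forestTerm_union {A B B' : Finset V} (hB : Disjoint B B') (hA : B ∪ B' = A)
    {F F' : Finset (Sym2 V)} (hF : F ⊆ pairs B) (hF' : F' ⊆ pairs B') (C : Sym2 V → ℝ) :
    forestTerm (pairs A) C 0 (F ∪ F') =
      forestTerm (pairs B) C 0 F * forestTerm (pairs B') C 0 F' := by
  have hd : Disjoint F F' := Finset.disjoint_of_subset_left hF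
    (Finset.disjoint_of_subset_right hF' (disjoint_pairs hB))
  simp only [forestTerm, edgeMeasure_zero]
  rw [Finset.prod_union hd, mul_mul_mul_comm]
  congr 1
  rw [← integral_mul_of_dependsOn (𝕜 := ℝ) (fun _ => (volume : Measure ℝ).restrict (Set.Ioc 0 1))
    (F : Set (Sym2 V))]
  · simp only [energy_union hB hA hF hF', Real.exp_add]
  · intro w w' h
    simp only [dependsOn_energy _ C 0 F h]
  · intro w w' h
    simp only [dependsOn_energy _ C 0 F' fun e he => h e fun he' =>
      Finset.disjoint_left.1 hd he' he]

/-- The expansion of the Boltzmann factor in the connected component of a vertex. -/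
theorem exp_sum_pairs (A : Finset V) {r : V} (hr : r ∈ A) (C : Sym2 V → ℝ) :
    Real.exp (∑ l ∈ pairs A, C l) = ∑ B ∈ A.powerset.filter (r ∈ ·),
      treeSum B C * Real.exp (∑ l ∈ pairs (A \ B), C l) := by
  classical
  have h0 : ∀ B ∈ A.powerset.filter (r ∈ ·),
      treeSum B C * Real.exp (∑ l ∈ pairs (A \ B), C l) =
      ∑ x ∈ trees B ×ˢ forests (pairs (A \ B)), forestTerm (pairs A) C 0 (x.1 ∪ x.2) := by
    intro B hB
    rw [← sum_forestTerm _ not_isDiag_of_mem_pairs, treeSum, Finset.sum_mul_sum,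
      ← Finset.sum_product']
    refine Finset.sum_congr rfl fun x hx => ?_
    rw [Finset.mem_product] at hx
    simp only [Finset.mem_filter, Finset.mem_powerset] at hB
    exact (forestTerm_union Finset.disjoint_sdiff (Finset.union_sdiff_of_subset hB.1)
      (mem_forests.1 (mem_trees.1 hx.1).1).1 (mem_forests.1 hx.2).1 C).symm
  rw [← sum_forestTerm _ not_isDiag_of_mem_pairs, Finset.sum_congr rfl h0, Finset.sum_sigma']
  let comp : Finset (Sym2 V) → Finset V := fun F =>
    A.filter fun a => (SimpleGraph.fromEdgeSet (F : Set (Sym2 V))).Reachable r a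
  have hsplit : ∀ F ∈ forests (pairs A),
      (F ∩ pairs (comp F)) ∪ (F ∩ pairs (A \ comp F)) = F := by
    intro F hF
    rw [← Finset.inter_union_distrib_left, Finset.inter_eq_left]
    intro l hl
    have hlA := (mem_forests.1 hF).1 hl
    induction l with | _ a b => ?_
    rw [mk_mem_pairs] at hlA
    have hab : (SimpleGraph.fromEdgeSet (F : Set (Sym2 V))).Adj a b := by simp [hl, hlA.2.2]
    have hiff : (SimpleGraph.fromEdgeSet (F : Set (Sym2 V))).Reachable r a ↔
        (SimpleGraph.fromEdgeSet (F : Set (Sym2 V))).Reachable r b :=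
      ⟨fun h => h.trans hab.reachable, fun h => h.trans hab.symm.reachable⟩
    simp only [Finset.mem_union, mk_mem_pairs, comp, Finset.mem_filter, Finset.mem_sdiff, hlA,
      true_and, hiff, ne_eq, not_false_eq_true, and_true, and_self]
    tauto
  have hreach : ∀ F ∈ forests (pairs A), ∀ a ∈ comp F,
      (SimpleGraph.fromEdgeSet ((F ∩ pairs (comp F) : Finset (Sym2 V)) : Set (Sym2 V))).Reachable
        r a := by
    intro F hF a ha
    have hrc : r ∈ comp F := Finset.mem_filter.2 ⟨hr, SimpleGraph.Reachable.refl _⟩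
    refine (reachable_union (B := comp F) (B' := A \ comp F) Finset.disjoint_sdiff
      (S' := ((F ∩ pairs (A \ comp F) : Finset (Sym2 V)) : Set (Sym2 V)))
      (Finset.coe_subset.2 Finset.inter_subset_right)
      (Finset.coe_subset.2 Finset.inter_subset_right) hrc ?_).2
    rw [← Finset.coe_union, hsplit F hF]
    exact (Finset.mem_filter.1 ha).2
  have hcomp : ∀ B ∈ A.powerset.filter (r ∈ ·), ∀ F ∈ trees B,
      ∀ F' ∈ forests (pairs (A \ B)), comp (F ∪ F') = B := by
    intro B hB F hF F' hF'
    simp only [Finset.mem_filter, Finset.mem_powerset] at hB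
    ext a
    simp only [comp, Finset.mem_filter, Finset.coe_union]
    rw [reachable_union_iff Finset.disjoint_sdiff
      (Finset.coe_subset.2 (mem_forests.1 (mem_trees.1 hF).1).1)
      (Finset.coe_subset.2 (mem_forests.1 hF').1) hB.2]
    refine ⟨fun h => ?_, fun h => ⟨hB.1 h, (mem_trees.1 hF).2 r hB.2 a h⟩⟩
    have := reachable_union (S' := ∅) (Finset.disjoint_empty_right B)
      (Finset.coe_subset.2 (mem_forests.1 (mem_trees.1 hF).1).1) (by simp) hB.2
      (by simpa using h.2)
    exact this.1
  refine Finset.sum_bij'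
    (fun F _ => ⟨comp F, (F ∩ pairs (comp F), F ∩ pairs (A \ comp F))⟩)
    (fun x _ => x.2.1 ∪ x.2.2) ?_ ?_ ?_ ?_ ?_
  · intro F hF
    simp only [Finset.mem_sigma, Finset.mem_filter, Finset.mem_powerset, Finset.mem_product]
    refine ⟨⟨Finset.filter_subset _ _, Finset.mem_filter.2 ⟨hr, SimpleGraph.Reachable.refl _⟩⟩,
      mem_trees.2 ⟨subset_mem_forests hF Finset.inter_subset_left Finset.inter_subset_right,
        fun a ha b hb => (hreach F hF a ha).symm.trans (hreach F hF b hb)⟩,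
      subset_mem_forests hF Finset.inter_subset_left Finset.inter_subset_right⟩
  · rintro ⟨B, F, F'⟩ h
    simp only [Finset.mem_sigma, Finset.mem_product] at h
    have hB : B ⊆ A := by have := h.1; simp at this; exact this.1
    exact union_mem_forests Finset.disjoint_sdiff hB Finset.sdiff_subset (mem_trees.1 h.2.1).1 h.2.2
  · intro F hF
    exact hsplit F hF
  · rintro ⟨B, F, F'⟩ h
    simp only [Finset.mem_sigma, Finset.mem_product] at h
    have hc := hcomp B h.1 F h.2.1 F' h.2.2
    have hd := disjoint_pairs (Finset.disjoint_sdiff (s := B) (t := A))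
    have hF := (mem_forests.1 (mem_trees.1 h.2.1).1).1
    have hF' := (mem_forests.1 h.2.2).1
    have e1 : (F ∪ F') ∩ pairs B = F := by
      rw [Finset.union_inter_distrib_right, Finset.inter_eq_left.2 hF,
        Finset.disjoint_iff_inter_eq_empty.1 (Finset.disjoint_of_subset_left hF' hd.symm),
        Finset.union_empty]
    have e2 : (F ∪ F') ∩ pairs (A \ B) = F' := by
      rw [Finset.union_inter_distrib_right, Finset.inter_eq_left.2 hF',
        Finset.disjoint_iff_inter_eq_empty.1 (Finset.disjoint_of_subset_left hF hd),
        Finset.empty_union]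
    simp only [hc, e1, e2]
  · intro F hF
    simp only [hsplit F hF]

end Trees

/-! ### The weakened covariance -/

section Weakening

variable {V : Type*} [Fintype V] [DecidableEq V]

lemma pairs_insert {A : Finset V} {r : V} (hr : r ∉ A) :
    pairs (insert r A) = A.image (fun b => s(r, b)) ∪ pairs A := by
  ext l
  induction l with | _ a b => ?_
  simp only [mk_mem_pairs, Finset.mem_union, Finset.mem_image, Finset.mem_insert, Sym2.eq_iff]
  constructor
  · rintro ⟨rfl | ha, rfl | hb, hab⟩
    · exact absurd rfl hab
    · exact Or.inl ⟨b, hb, Or.inl ⟨rfl, rfl⟩⟩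
    · exact Or.inl ⟨a, ha, Or.inr ⟨rfl, rfl⟩⟩
    · exact Or.inr ⟨ha, hb, hab⟩
  · rintro (⟨x, hx, ⟨rfl, rfl⟩ | ⟨rfl, rfl⟩⟩ | ⟨ha, hb, hab⟩)
    · exact ⟨Or.inl rfl, Or.inr hx, fun h => hr (h ▸ hx)⟩
    · exact ⟨Or.inr hx, Or.inl rfl, fun h => hr (h ▸ hx)⟩
    · exact ⟨Or.inr ha, Or.inr hb, hab⟩

lemma sum_sum_mk {R : Type*} [CommRing R] (A : Finset V) (f : Sym2 V → R) :
    ∑ a ∈ A, ∑ b ∈ A, f s(a, b) = ∑ a ∈ A, f s(a, a) + 2 * ∑ l ∈ pairs A, f l := by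
  induction A using Finset.induction_on with
  | empty => simp [pairs]
  | insert r A hr ih =>
    have hd : Disjoint (A.image fun b => s(r, b)) (pairs A) := by
      rw [Finset.disjoint_left]
      intro l hl hl'
      obtain ⟨b, _, rfl⟩ := Finset.mem_image.1 hl
      exact hr (mk_mem_pairs.1 hl').1
    rw [pairs_insert hr, Finset.sum_union hd, Finset.sum_image fun x _ y _ h => Sym2.congr_right.1 h,
      Finset.sum_insert hr, Finset.sum_insert hr, Finset.sum_insert hr]
    simp only [Finset.sum_insert hr, Finset.sum_add_distrib]
    rw [ih]
    have : ∑ a ∈ A, f s(a, r) = ∑ a ∈ A, f s(r, a) :=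
      Finset.sum_congr rfl fun a _ => by rw [Sym2.eq_swap]
    rw [this]
    ring

/-- The weakened covariance defined by the weights `w` of the edges of `F`. -/
def linkMat (F : Finset (Sym2 V)) (w : Sym2 V → ℝ) (a b : V) : ℝ :=
  ∫ t in (0 : ℝ)..1, linkInd F w s(a, b) t

lemma linkInd_diag (F : Finset (Sym2 V)) (w : Sym2 V → ℝ) (a : V) (t : ℝ) :
    linkInd F w s(a, a) t = 1 := by
  rw [linkInd, if_pos]
  rw [linked_mk]

lemma linkMat_self (F : Finset (Sym2 V)) (w : Sym2 V → ℝ) (a : V) : linkMat F w a a = 1 := by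
  simp [linkMat, linkInd_diag]

lemma linkMat_comm (F : Finset (Sym2 V)) (w : Sym2 V → ℝ) (a b : V) :
    linkMat F w a b = linkMat F w b a := by
  rw [linkMat, linkMat, Sym2.eq_swap]

/-- A symmetric kernel as a function of unordered pairs, with the opposite sign. -/
def coupling {M : V → V → ℝ} (hM : ∀ a b, M a b = M b a) : Sym2 V → ℝ :=
  Sym2.lift ⟨fun a b => -M a b, fun a b => by simp only [hM a b]⟩

@[simp] lemma coupling_mk {M : V → V → ℝ} (hM : ∀ a b, M a b = M b a) (a b : V) :
    coupling hM s(a, b) = -M a b := rfl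

lemma energy_eq (A : Finset V) {M : V → V → ℝ} (hM : ∀ a b, M a b = M b a)
    (F : Finset (Sym2 V)) (w : Sym2 V → ℝ) :
    -(∑ a ∈ A, M a a) / 2 + energy (pairs A) (coupling hM) 0 F w =
      -(∑ a ∈ A, ∑ b ∈ A, linkMat F w a b * M a b) / 2 := by
  have h := sum_sum_mk A fun l => coupling hM l * ∫ t in (0 : ℝ)..1, linkInd F w l t
  have h1 : ∀ a b, coupling hM s(a, b) * ∫ t in (0 : ℝ)..1, linkInd F w s(a, b) t =
      -(linkMat F w a b * M a b) := fun a b => by rw [coupling_mk, linkMat]; ring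
  simp only [h1, linkMat_self, Finset.sum_neg_distrib] at h
  rw [energy]
  simp only [one_mul] at h
  linarith

lemma sum_linked_nonneg (A : Finset V) {M : V → V → ℝ}
    (hM : ∀ S : Finset V, 0 ≤ ∑ a ∈ S, ∑ b ∈ S, M a b) (F : Finset (Sym2 V)) (w : Sym2 V → ℝ)
    (t : ℝ) : 0 ≤ ∑ a ∈ A, ∑ b ∈ A, linkInd F w s(a, b) t * M a b := by
  classical
  set G := SimpleGraph.fromEdgeSet (level F w t)
  have h1 : ∀ a b, linkInd F w s(a, b) t * M a b =
      if G.connectedComponentMk b = G.connectedComponentMk a then M a b else 0 := by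
    intro a b
    simp only [linkInd, linked_mk, SimpleGraph.ConnectedComponent.eq]
    by_cases h : G.Reachable a b
    · rw [if_pos h, if_pos h.symm, one_mul]
    · rw [if_neg h, if_neg fun h' => h h'.symm, zero_mul]
  simp only [h1]
  rw [← Finset.sum_fiberwise_of_maps_to
    (t := A.image G.connectedComponentMk) fun a ha => Finset.mem_image_of_mem _ ha]
  refine Finset.sum_nonneg fun q _ => ?_
  refine (hM (A.filter fun a => G.connectedComponentMk a = q)).trans_eq ?_
  refine Finset.sum_congr rfl fun a ha => ?_
  rw [(Finset.mem_filter.1 ha).2, Finset.sum_filter]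

lemma sum_linkMat_nonneg (A : Finset V) {M : V → V → ℝ}
    (hM : ∀ S : Finset V, 0 ≤ ∑ a ∈ S, ∑ b ∈ S, M a b) (F : Finset (Sym2 V))
    (w : Sym2 V → ℝ) : 0 ≤ ∑ a ∈ A, ∑ b ∈ A, linkMat F w a b * M a b := by
  have h : ∑ a ∈ A, ∑ b ∈ A, linkMat F w a b * M a b =
      ∫ t in (0 : ℝ)..1, ∑ a ∈ A, ∑ b ∈ A, linkInd F w s(a, b) t * M a b := by
    have hi := fun a b => (intervalIntegrable_linkInd F w s(a, b) 0 1).mul_const (M a b)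
    rw [intervalIntegral.integral_finsetSum fun a _ => by
      simpa only [Finset.sum_fn] using IntervalIntegrable.sum A fun b _ => hi a b]
    refine Finset.sum_congr rfl fun a _ => ?_
    rw [intervalIntegral.integral_finsetSum fun b _ => hi a b]
    refine Finset.sum_congr rfl fun b _ => ?_
    rw [intervalIntegral.integral_mul_const, linkMat]
  rw [h]
  exact intervalIntegral.integral_nonneg zero_le_one fun t _ => sum_linked_nonneg A hM F w t

/-- Products over the edges of functions of the end points. -/
lemma prod_edges {R : Type*} [CommMonoid R] (F : Finset (Sym2 V)) (hF : ∀ l ∈ F, ¬ l.IsDiag)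
    (x : V → R) :
    ∏ l ∈ F, Sym2.lift ⟨fun a b => x a * x b, fun _ _ => mul_comm _ _⟩ l =
      ∏ a, x a ^ (F.filter (a ∈ ·)).card := by
  have h : ∀ l ∈ F, Sym2.lift ⟨fun a b => x a * x b, fun _ _ => mul_comm _ _⟩ l =
      ∏ a, if a ∈ l then x a else 1 := by
    intro l hl
    have hd := hF l hl
    induction l with | _ a b => ?_
    have hab : a ≠ b := by simpa using hd
    rw [← Finset.prod_filter]
    have : Finset.univ.filter (· ∈ s(a, b)) = {a, b} := by ext; simp
    rw [this, Finset.prod_pair hab]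
    rfl
  rw [Finset.prod_congr rfl h, Finset.prod_comm]
  refine Finset.prod_congr rfl fun a _ => ?_
  rw [← Finset.prod_filter, Finset.prod_const]

end Weakening

/-! ### The Mayer expansion of a gas with pair interactions -/

/-- A gas of particles: `law` is a probability measure on the space of the marks of the
particles, `act` their activity, and `ker` a pair interaction of positive type. -/
structure MarkGas (Ξ : Type*) [MeasurableSpace Ξ] where
  law : Measure Ξ
  isProb : IsProbabilityMeasure law
  act : Ξ → ℂ
  measurable_act : Measurable act
  ker : Ξ → Ξ → ℝ
  measurable_ker : Measurable (Function.uncurry ker)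
  ker_comm : ∀ x y, ker x y = ker y x
  ker_nonneg : ∀ {ι : Type} (S : Finset ι) (x : ι → Ξ), 0 ≤ ∑ a ∈ S, ∑ b ∈ S, ker (x a) (x b)
  bound : Ξ → ℝ
  ker_le : ∀ x y, |ker x y| ≤ bound x * bound y
  integrable : ∀ d : ℕ, Integrable (fun x => ‖act x‖ * bound x ^ d) law

namespace MarkGas

attribute [instance] MarkGas.isProb

variable {Ξ : Type*} [MeasurableSpace Ξ] (g : MarkGas Ξ)
variable {V : Type} [Fintype V] [DecidableEq V]

/-- The interaction of the particles at the points of a configuration. -/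
def inter (x : V → Ξ) : Sym2 V → ℝ := coupling fun a b => g.ker_comm (x a) (x b)

/-- The Boltzmann factor of the self-interactions. -/
def selfWeight (A : Finset V) (x : V → Ξ) : ℝ := Real.exp (-(∑ a ∈ A, g.ker (x a) (x a)) / 2)

/-- The partition function of the particles in `A`. -/
def moment (A : Finset V) : ℂ :=
  ∫ x : V → Ξ, (∏ a ∈ A, g.act (x a)) *
    (Real.exp (-(∑ a ∈ A, ∑ b ∈ A, g.ker (x a) (x b)) / 2) : ℝ) ∂Measure.pi fun _ => g.law

/-- The tree integrand of the particles in `A`. -/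
def treeIntegrand (A : Finset V) (x : V → Ξ) : ℂ :=
  (∏ a ∈ A, g.act (x a)) * (g.selfWeight A x * treeSum A (g.inter x) : ℝ)

/-- The sum over trees of the particles in `A`. -/
def treeMoment (A : Finset V) : ℂ := ∫ x : V → Ξ, g.treeIntegrand A x ∂Measure.pi fun _ => g.law

lemma selfWeight_mul_exp_energy (A : Finset V) (x : V → Ξ) (F : Finset (Sym2 V))
    (w : Sym2 V → ℝ) :
    g.selfWeight A x * Real.exp (energy (pairs A) (g.inter x) 0 F w) =
      Real.exp (-(∑ a ∈ A, ∑ b ∈ A, linkMat F w a b * g.ker (x a) (x b)) / 2) := by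
  rw [selfWeight, ← Real.exp_add]
  exact congrArg Real.exp (energy_eq A (fun a b => g.ker_comm (x a) (x b)) F w)

lemma selfWeight_mul_exp_energy_le (A : Finset V) (x : V → Ξ) (F : Finset (Sym2 V))
    (w : Sym2 V → ℝ) :
    g.selfWeight A x * Real.exp (energy (pairs A) (g.inter x) 0 F w) ≤ 1 := by
  rw [selfWeight_mul_exp_energy, Real.exp_le_one_iff]
  have := sum_linkMat_nonneg A (M := fun a b => g.ker (x a) (x b))
    (fun S => g.ker_nonneg S x) F w
  linarith

lemma exp_ker_eq (A : Finset V) (x : V → Ξ) :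
    Real.exp (-(∑ a ∈ A, ∑ b ∈ A, g.ker (x a) (x b)) / 2) =
      g.selfWeight A x * Real.exp (∑ l ∈ pairs A, g.inter x l) := by
  rw [selfWeight, ← Real.exp_add]
  congr 1
  have h := sum_sum_mk A (g.inter x)
  simp only [inter, coupling_mk, Finset.sum_neg_distrib] at h ⊢
  linarith

lemma selfWeight_pos (A : Finset V) (x : V → Ξ) : 0 < g.selfWeight A x := Real.exp_pos _

lemma abs_prod_inter_le (F : Finset (Sym2 V)) (hF : ∀ l ∈ F, ¬ l.IsDiag) (x : V → Ξ) :
    |∏ l ∈ F, g.inter x l| ≤ ∏ a, g.bound (x a) ^ (F.filter (a ∈ ·)).card := by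
  rw [← prod_edges F hF fun a => g.bound (x a), Finset.abs_prod]
  refine Finset.prod_le_prod (fun _ _ => abs_nonneg _) fun l _ => ?_
  induction l with | _ a b => ?_
  simpa [inter] using g.ker_le (x a) (x b)

lemma abs_selfWeight_mul_forestTerm_le (A : Finset V) (x : V → Ξ) (F : Finset (Sym2 V))
    (hF : ∀ l ∈ F, ¬ l.IsDiag) :
    |g.selfWeight A x * forestTerm (pairs A) (g.inter x) 0 F| ≤
      ∏ a, g.bound (x a) ^ (F.filter (a ∈ ·)).card := by
  rw [forestTerm, mul_left_comm, abs_mul, ← integral_const_mul]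
  refine (mul_le_of_le_one_right (abs_nonneg _) ?_).trans (g.abs_prod_inter_le F hF x)
  have h := norm_integral_le_of_norm_le_const (μ := edgeMeasure 0 F) (C := 1)
    (f := fun w => g.selfWeight A x * Real.exp (energy (pairs A) (g.inter x) 0 F w))
    (ae_of_all _ fun w => by
      rw [Real.norm_of_nonneg (mul_pos (g.selfWeight_pos A x) (Real.exp_pos _)).le]
      exact g.selfWeight_mul_exp_energy_le A x F w)
  have hp : IsProbabilityMeasure (edgeMeasure 0 F) := by
    rw [edgeMeasure_zero]; infer_instance
  simpa using h

lemma measurable_inter (l : Sym2 V) : Measurable fun x : V → Ξ => g.inter x l := by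
  induction l with | _ a b => ?_
  simp only [inter, coupling_mk]
  have : Measurable fun x : V → Ξ => Function.uncurry g.ker (x a, x b) :=
    g.measurable_ker.comp (by fun_prop)
  exact this.neg

lemma measurable_selfWeight (A : Finset V) : Measurable (g.selfWeight A) := by
  unfold selfWeight
  refine Real.measurable_exp.comp (Measurable.div_const (Measurable.neg ?_) _)
  refine Finset.measurable_fun_sum _ fun a _ => ?_
  exact (g.measurable_ker.comp (by fun_prop) : Measurable fun x : V → Ξ =>
    Function.uncurry g.ker (x a, x a))

lemma measurable_energy_inter (A : Finset V) (F : Finset (Sym2 V)) :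
    Measurable fun q : (V → Ξ) × (Sym2 V → ℝ) => energy (pairs A) (g.inter q.1) 0 F q.2 := by
  unfold energy
  refine Finset.measurable_fun_sum _ fun l _ => ?_
  refine ((g.measurable_inter l).comp measurable_fst).mul ?_
  have h : Measurable fun w => energy {l} 1 0 F w := measurable_energy {l} 1 0 F
  simp only [energy, Finset.sum_singleton, Pi.one_apply, one_mul] at h
  exact h.comp measurable_snd

lemma measurable_forestTerm (A : Finset V) (F : Finset (Sym2 V)) :
    Measurable fun x : V → Ξ => forestTerm (pairs A) (g.inter x) 0 F := by
  unfold forestTerm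
  refine (Finset.measurable_fun_prod _ fun l _ => g.measurable_inter l).mul ?_
  exact ((Real.measurable_exp.comp
    (g.measurable_energy_inter A F)).stronglyMeasurable.integral_prod_right').measurable

lemma integrable_prod_act (A : Finset V) (d : V → ℕ) (hd : ∀ a ∉ A, d a = 0) :
    Integrable (fun x : V → Ξ => (∏ a ∈ A, ‖g.act (x a)‖) * ∏ a, g.bound (x a) ^ d a)
      (Measure.pi fun _ => g.law) := by
  have h : (fun x : V → Ξ => (∏ a ∈ A, ‖g.act (x a)‖) * ∏ a, g.bound (x a) ^ d a) =
      fun x => ∏ a, (if a ∈ A then ‖g.act (x a)‖ * g.bound (x a) ^ d a else 1) := by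
    funext x
    rw [← Finset.prod_filter_mul_prod_filter_not Finset.univ (· ∈ A)
      fun a => g.bound (x a) ^ d a, Finset.prod_ite, ← mul_assoc, Finset.prod_mul_distrib]
    congr 1
    · congr 1
      exact Finset.prod_congr (by ext; simp) fun _ _ => rfl
    · refine Finset.prod_congr rfl fun a ha => ?_
      rw [hd a (Finset.mem_filter.1 ha).2, pow_zero]
  rw [h]
  refine Integrable.fintype_prod (f := fun a y => if a ∈ A then ‖g.act y‖ * g.bound y ^ d a else 1)
    fun a => ?_
  by_cases ha : a ∈ A
  · simpa [ha] using g.integrable (d a)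
  · simp [ha]

lemma card_filter_mem_eq_zero {A : Finset V} {F : Finset (Sym2 V)} (hF : F ⊆ pairs A) :
    ∀ a ∉ A, (F.filter (a ∈ ·)).card = 0 := by
  intro a ha
  rw [Finset.card_eq_zero, Finset.filter_eq_empty_iff]
  intro l hl hal
  have := hF hl
  induction l with | _ b c => ?_
  rw [mk_mem_pairs] at this
  rcases Sym2.mem_iff.1 hal with rfl | rfl
  · exact ha this.1
  · exact ha this.2.1

/-- The tree integrand times the Boltzmann factor of the other particles is integrable. -/
lemma integrable_treeIntegrand_mul {A B : Finset V} (hB : B ⊆ A) :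
    Integrable (fun x : V → Ξ => g.treeIntegrand B x * ((∏ a ∈ A \ B, g.act (x a)) *
      (Real.exp (-(∑ a ∈ A \ B, ∑ b ∈ A \ B, g.ker (x a) (x b)) / 2) : ℝ)))
      (Measure.pi fun _ => g.law) := by
  have hm : Measurable fun x : V → Ξ => g.treeIntegrand B x * ((∏ a ∈ A \ B, g.act (x a)) *
      (Real.exp (-(∑ a ∈ A \ B, ∑ b ∈ A \ B, g.ker (x a) (x b)) / 2) : ℝ)) := by
    have h1 : ∀ S : Finset V, Measurable fun x : V → Ξ => ∏ a ∈ S, g.act (x a) := fun S =>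
      Finset.measurable_fun_prod _ fun a _ => g.measurable_act.comp (measurable_pi_apply a)
    refine ((h1 B).mul (Complex.measurable_ofReal.comp ((g.measurable_selfWeight B).mul ?_))).mul
      ((h1 _).mul (Complex.measurable_ofReal.comp (Real.measurable_exp.comp
        ((Measurable.neg ?_).div_const _))))
    · exact Finset.measurable_fun_sum _ fun F _ => g.measurable_forestTerm B F
    · refine Finset.measurable_fun_sum _ fun a _ => Finset.measurable_fun_sum _ fun b _ => ?_
      exact (g.measurable_ker.comp (by fun_prop) : Measurable fun x : V → Ξ =>
        Function.uncurry g.ker (x a, x b))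
  have hsum := integrable_finsetSum (trees B) fun F hF => g.integrable_prod_act A
    (fun a => (F.filter (a ∈ ·)).card) fun a ha => card_filter_mem_eq_zero
      (mem_forests.1 (mem_trees.1 hF).1).1 a fun h => ha (hB h)
  refine hsum.mono' hm.aestronglyMeasurable (ae_of_all _ fun x => ?_)
  have e1 : Real.exp (-(∑ a ∈ A \ B, ∑ b ∈ A \ B, g.ker (x a) (x b)) / 2) ≤ 1 := by
    rw [Real.exp_le_one_iff]
    have := g.ker_nonneg (A \ B) x
    linarith
  have e2 : |g.selfWeight B x * treeSum B (g.inter x)| ≤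
      ∑ F ∈ trees B, ∏ a, g.bound (x a) ^ (F.filter (a ∈ ·)).card := by
    rw [treeSum, Finset.mul_sum]
    refine (Finset.abs_sum_le_sum_abs _ _).trans (Finset.sum_le_sum fun F hF => ?_)
    exact g.abs_selfWeight_mul_forestTerm_le B x F fun l hl => not_isDiag_of_mem_pairs l
      ((mem_forests.1 (mem_trees.1 hF).1).1 hl)
  have e3 : ∏ a ∈ A, ‖g.act (x a)‖ = (∏ a ∈ B, ‖g.act (x a)‖) * ∏ a ∈ A \ B, ‖g.act (x a)‖ := by
    rw [mul_comm, Finset.prod_sdiff hB]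
  rw [treeIntegrand, norm_mul, norm_mul, norm_mul, norm_prod, norm_prod, Complex.norm_real,
    Complex.norm_real, Real.norm_eq_abs, Real.norm_of_nonneg (Real.exp_pos _).le, e3,
    ← Finset.mul_sum]
  have n1 : 0 ≤ ∏ a ∈ B, ‖g.act (x a)‖ := Finset.prod_nonneg fun _ _ => norm_nonneg _
  have n2 : 0 ≤ ∏ a ∈ A \ B, ‖g.act (x a)‖ := Finset.prod_nonneg fun _ _ => norm_nonneg _
  calc _ ≤ ((∏ a ∈ B, ‖g.act (x a)‖) * ∑ F ∈ trees B,
          ∏ a, g.bound (x a) ^ (F.filter (a ∈ ·)).card) * ((∏ a ∈ A \ B, ‖g.act (x a)‖) * 1) := by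
        refine mul_le_mul (mul_le_mul_of_nonneg_left e2 n1) (mul_le_mul_of_nonneg_left e1 n2)
          (mul_nonneg n2 (Real.exp_pos _).le) (mul_nonneg n1 ((abs_nonneg _).trans e2))
    _ = _ := by ring

/-- Decomposition of the partition function according to the cluster of a particle. -/
theorem moment_eq_sum (A : Finset V) {r : V} (hr : r ∈ A) :
    g.moment A = ∑ B ∈ A.powerset.filter (r ∈ ·), g.treeMoment B * g.moment (A \ B) := by
  have h : ∀ x : V → Ξ, (∏ a ∈ A, g.act (x a)) *
      (Real.exp (-(∑ a ∈ A, ∑ b ∈ A, g.ker (x a) (x b)) / 2) : ℝ) =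
      ∑ B ∈ A.powerset.filter (r ∈ ·), g.treeIntegrand B x * ((∏ a ∈ A \ B, g.act (x a)) *
      (Real.exp (-(∑ a ∈ A \ B, ∑ b ∈ A \ B, g.ker (x a) (x b)) / 2) : ℝ)) := by
    intro x
    rw [exp_ker_eq, exp_sum_pairs A hr, Finset.mul_sum, Complex.ofReal_sum, Finset.mul_sum]
    refine Finset.sum_congr rfl fun B hB => ?_
    have hBA : B ⊆ A := Finset.mem_powerset.1 (Finset.mem_filter.1 hB).1
    have e1 : g.selfWeight A x = g.selfWeight B x * g.selfWeight (A \ B) x := by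
      rw [selfWeight, selfWeight, selfWeight, ← Real.exp_add, ← Finset.sum_sdiff hBA]
      congr 1
      ring
    rw [exp_ker_eq, e1, treeIntegrand, ← Finset.prod_sdiff hBA]
    push_cast
    ring
  rw [moment, integral_congr_ae (ae_of_all _ h), integral_finsetSum]
  · refine Finset.sum_congr rfl fun B hB => ?_
    rw [treeMoment, moment]
    refine integral_mul_of_dependsOn (𝕜 := ℂ) (fun _ => g.law) (B : Set V) ?_ ?_
    · intro x y hxy
      have h1 : g.selfWeight B x = g.selfWeight B y := by
        rw [selfWeight, selfWeight, Finset.sum_congr rfl fun a ha => by rw [hxy a ha]]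
      have h2 : ∀ l ∈ pairs B, g.inter x l = g.inter y l := by
        intro l hl
        induction l with | _ a b => ?_
        rw [mk_mem_pairs] at hl
        simp [inter, hxy a hl.1, hxy b hl.2.1]
      have h3 : treeSum B (g.inter x) = treeSum B (g.inter y) := by
        refine Finset.sum_congr rfl fun F hF => ?_
        rw [forestTerm, forestTerm, Finset.prod_congr (s₂ := F) (g := fun l => g.inter y l) rfl fun l hl => h2 l
          ((mem_forests.1 (mem_trees.1 hF).1).1 hl)]
        have h4 : ∀ w, energy (pairs B) (g.inter x) 0 F w = energy (pairs B) (g.inter y) 0 F w :=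
          fun w => Finset.sum_congr rfl fun l hl => by rw [h2 l hl]
        simp only [h4]
      have h5 : ∏ a ∈ B, g.act (x a) = ∏ a ∈ B, g.act (y a) :=
        Finset.prod_congr rfl fun a ha => by rw [hxy a ha]
      simp only [treeIntegrand, h1, h3, h5]
    · intro x y hxy
      have hxy' : ∀ a ∈ A \ B, x a = y a := fun a ha => hxy a (Finset.mem_sdiff.1 ha).2
      have h5 : ∏ a ∈ A \ B, g.act (x a) = ∏ a ∈ A \ B, g.act (y a) :=
        Finset.prod_congr rfl fun a ha => by rw [hxy' a ha]
      have h6 : ∑ a ∈ A \ B, ∑ b ∈ A \ B, g.ker (x a) (x b) =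
          ∑ a ∈ A \ B, ∑ b ∈ A \ B, g.ker (y a) (y b) :=
        Finset.sum_congr rfl fun a ha => Finset.sum_congr rfl fun b hb => by
          rw [hxy' a ha, hxy' b hb]
      simp only [h5, h6]
  · exact fun B hB => g.integrable_treeIntegrand_mul
      (Finset.mem_powerset.1 (Finset.mem_filter.1 hB).1)

/-- The connected part of order `n`. -/
def cumulant (n : ℕ) : ℂ := g.treeMoment (Finset.univ : Finset (Fin n))

lemma moment_empty : g.moment (∅ : Finset V) = 1 := by simp [moment]

lemma treeMoment_eq_cumulant {z : ℕ → ℂ} (hz : ∀ (n : ℕ) (A : Finset (Fin n)),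
    g.moment A = z A.card) : ∀ (k n : ℕ) (A : Finset (Fin n)), A.card = k → A.Nonempty →
      g.treeMoment A = g.cumulant k := by
  intro k
  induction k using Nat.strong_induction_on with
  | _ k ih =>
  have key : ∀ (n : ℕ) (A : Finset (Fin n)), A.card = k → A.Nonempty → g.treeMoment A =
      z k - ∑ j ∈ Finset.range (k - 1), ((k - 1).choose j : ℂ) *
        (g.cumulant (j + 1) * z (k - (j + 1))) := by
    intro n A hA hne
    obtain ⟨r, hr⟩ := hne
    have hz0 : z 0 = 1 := by rw [← g.moment_empty (V := Fin 0), hz]; simp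
    have h := g.moment_eq_sum A hr
    have hAm : A ∈ A.powerset.filter (r ∈ ·) := by simp [hr]
    rw [← Finset.add_sum_erase _ _ hAm, hz, hA, Finset.sdiff_self, g.moment_empty, mul_one] at h
    rw [h, eq_sub_iff_add_eq, add_right_inj]
    have hk : (A.erase r).card = k - 1 := by rw [Finset.card_erase_of_mem hr, hA]
    have h2 : ∑ B ∈ (A.powerset.filter (r ∈ ·)).erase A, g.treeMoment B * g.moment (A \ B) =
        ∑ B ∈ (A.erase r).powerset.erase (A.erase r),
          g.cumulant (B.card + 1) * z (k - (B.card + 1)) := by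
      refine Finset.sum_bij' (fun B _ => B.erase r) (fun B _ => insert r B) ?_ ?_ ?_ ?_ ?_
      · intro B hB
        simp only [Finset.mem_erase, Finset.mem_filter, Finset.mem_powerset] at hB ⊢
        refine ⟨fun h => hB.1 ?_, Finset.erase_subset_erase _ hB.2.1⟩
        rw [← Finset.insert_erase hB.2.2, h, Finset.insert_erase hr]
      · intro B hB
        simp only [Finset.mem_erase, Finset.mem_filter, Finset.mem_powerset] at hB ⊢
        have hrB : r ∉ B := fun h => (Finset.notMem_erase r A) (hB.2 h)
        refine ⟨fun h => hB.1 ?_, Finset.insert_subset hr (hB.2.trans (Finset.erase_subset _ _)),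
          Finset.mem_insert_self _ _⟩
        rw [← h, Finset.erase_insert hrB]
      · intro B hB
        simp only [Finset.mem_erase, Finset.mem_filter, Finset.mem_powerset] at hB
        exact Finset.insert_erase hB.2.2
      · intro B hB
        simp only [Finset.mem_erase, Finset.mem_powerset] at hB
        exact Finset.erase_insert fun h => (Finset.notMem_erase r A) (hB.2 h)
      · intro B hB
        simp only [Finset.mem_erase, Finset.mem_filter, Finset.mem_powerset] at hB
        have hc : (B.erase r).card + 1 = B.card := Finset.card_erase_add_one hB.2.2
        have hlt : B.card < k := by
          rw [← hA]
          exact Finset.card_lt_card (Finset.ssubset_iff_subset_ne.2 ⟨hB.2.1, hB.1⟩)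
        rw [hc, ih _ hlt n B rfl ⟨r, hB.2.2⟩, hz, Finset.card_sdiff_of_subset hB.2.1, hA]
    rw [h2, ← sub_eq_iff_eq_add'.2 (Finset.add_sum_erase _
      (fun B : Finset (Fin n) => g.cumulant (B.card + 1) * z (k - (B.card + 1)))
      (Finset.mem_powerset_self (A.erase r))).symm,
      Finset.sum_powerset_apply_card fun j => g.cumulant (j + 1) * z (k - (j + 1)), hk,
      Finset.sum_range_succ]
    simp
  intro n A hA hne
  have hk : 0 < k := hA ▸ hne.card_pos
  haveI : Nonempty (Fin k) := ⟨⟨0, hk⟩⟩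
  rw [key n A hA hne, cumulant, key k Finset.univ (by simp) Finset.univ_nonempty]

/-- The recursion between moments and cumulants. -/
theorem moment_succ {z : ℕ → ℂ} (hz : ∀ (n : ℕ) (A : Finset (Fin n)),
    g.moment A = z A.card) (n : ℕ) :
    z (n + 1) = ∑ j ∈ Finset.range (n + 1), (n.choose j : ℂ) *
      (g.cumulant (j + 1) * z (n - j)) := by
  set A : Finset (Fin (n + 1)) := Finset.univ
  have hr : (0 : Fin (n + 1)) ∈ A := Finset.mem_univ _
  have h := g.moment_eq_sum A hr
  rw [hz, Finset.card_univ, Fintype.card_fin] at h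
  rw [h]
  have hk : (A.erase 0).card = n := by rw [Finset.card_erase_of_mem hr]; simp [A]
  have := Finset.sum_powerset_apply_card (fun j => g.cumulant (j + 1) * z (n - j))
    (x := A.erase 0)
  simp only [hk, nsmul_eq_mul] at this
  rw [← this]
  refine Finset.sum_bij' (fun B _ => B.erase 0) (fun B _ => insert 0 B) ?_ ?_ ?_ ?_ ?_
  · intro B hB
    simp only [Finset.mem_filter, Finset.mem_powerset] at hB ⊢
    exact Finset.erase_subset_erase _ hB.1
  · intro B hB
    simp only [Finset.mem_filter, Finset.mem_powerset] at hB ⊢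
    exact ⟨Finset.subset_univ _, Finset.mem_insert_self _ _⟩
  · intro B hB
    exact Finset.insert_erase (Finset.mem_filter.1 hB).2
  · intro B hB
    simp only [Finset.mem_powerset] at hB
    exact Finset.erase_insert fun h => (Finset.notMem_erase 0 A) (hB h)
  · intro B hB
    have hB0 := (Finset.mem_filter.1 hB).2
    have hc : (B.erase 0).card + 1 = B.card := Finset.card_erase_add_one hB0
    rw [g.treeMoment_eq_cumulant hz _ _ B rfl ⟨0, hB0⟩, hc, hz,
      Finset.card_sdiff_of_subset (Finset.subset_univ B)]
    congr 2
    simp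
    omega

end MarkGas

/-! ### The exponential formula -/

section Exponential

lemma summable_mul_pow_of_two_pow {a : ℕ → ℂ} (ha : Summable fun n => ‖a n‖ * 2 ^ n) :
    Summable fun n => ‖a n‖ * (n * (3 / 2 : ℝ) ^ (n - 1)) := by
  have h0 : Tendsto (fun n : ℕ => (n : ℝ) * (3 / 4 : ℝ) ^ n) atTop (𝓝 0) :=
    tendsto_self_mul_const_pow_of_lt_one (by norm_num) (by norm_num)
  refine Summable.of_norm_bounded_eventually_nat ha ?_
  filter_upwards [h0.eventually (gt_mem_nhds (show (0 : ℝ) < 1 / 2 by norm_num)),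
    eventually_ge_atTop 1] with n hn h1
  rw [Real.norm_of_nonneg (by positivity)]
  refine mul_le_mul_of_nonneg_left ?_ (norm_nonneg _)
  obtain ⟨k, rfl⟩ : ∃ k, n = k + 1 := ⟨n - 1, by omega⟩
  have e : (3 / 2 : ℝ) ^ (k + 1) = (3 / 4) ^ (k + 1) * 2 ^ (k + 1) := by
    rw [← mul_pow]; norm_num
  have h2 : (3 / 2 : ℝ) ^ k ≤ (3 / 2 : ℝ) ^ (k + 1) := pow_le_pow_right₀ (by norm_num) (by omega)
  have h3 : (0 : ℝ) < 2 ^ (k + 1) := by positivity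
  calc ((k + 1 : ℕ) : ℝ) * (3 / 2 : ℝ) ^ (k + 1 - 1)
      ≤ ((k + 1 : ℕ) : ℝ) * (3 / 2 : ℝ) ^ (k + 1) :=
        mul_le_mul_of_nonneg_left (by simpa using h2) (Nat.cast_nonneg _)
    _ = ((k + 1 : ℕ) : ℝ) * (3 / 4) ^ (k + 1) * 2 ^ (k + 1) := by rw [e]; ring
    _ ≤ 1 / 2 * 2 ^ (k + 1) := mul_le_mul_of_nonneg_right hn.le h3.le
    _ ≤ 2 ^ (k + 1) := by linarith

lemma summable_of_two_pow {a : ℕ → ℂ} (ha : Summable fun n => ‖a n‖ * 2 ^ n) {x : ℂ}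
    (hx : ‖x‖ < 3 / 2) : Summable fun n => ‖a n * x ^ n‖ := by
  refine ha.of_nonneg_of_le (fun _ => norm_nonneg _) fun n => ?_
  rw [norm_mul, norm_pow]
  exact mul_le_mul_of_nonneg_left (pow_le_pow_left₀ (norm_nonneg _) (by linarith) _)
    (norm_nonneg _)

lemma hasDerivAt_tsum_pow {a : ℕ → ℂ} (ha : Summable fun n => ‖a n‖ * 2 ^ n) {x : ℂ}
    (hx : ‖x‖ < 3 / 2) :
    HasDerivAt (fun y => ∑' n, a n * y ^ n) (∑' n : ℕ, (n + 1 : ℂ) * a (n + 1) * x ^ n) x := by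
  have h := hasDerivAt_tsum_of_isPreconnected (summable_mul_pow_of_two_pow ha)
    (t := Metric.ball (0 : ℂ) (3 / 2)) Metric.isOpen_ball (convex_ball _ _).isPreconnected
    (g := fun n y => a n * y ^ n) (g' := fun n y => a n * (n * y ^ (n - 1)))
    (fun n y _ => (hasDerivAt_pow n y).const_mul (a n))
    (fun n y hy => by
      rw [norm_mul, norm_mul, norm_pow, Complex.norm_natCast]
      have : ‖y‖ ≤ 3 / 2 := (by simpa using hy : ‖y‖ < 3 / 2).le
      gcongr) (y₀ := 0) (Metric.mem_ball_self (by norm_num))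
    (summable_of_two_pow ha (by norm_num)).of_norm (y := x) (by simpa using hx)
  have hs : Summable fun n : ℕ => a n * (n * x ^ (n - 1)) := by
    refine Summable.of_norm_bounded (summable_mul_pow_of_two_pow ha) fun n => ?_
    rw [norm_mul, norm_mul, norm_pow, Complex.norm_natCast]
    gcongr
  refine h.congr_deriv ?_
  rw [hs.tsum_eq_zero_add]
  simp only [Nat.cast_zero, zero_mul, mul_zero, zero_add, Nat.add_sub_cancel]
  refine tsum_congr fun n => ?_
  push_cast
  ring

/-- A power series whose coefficients are moments is the exponential of the power series
of the cumulants. -/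
theorem tsum_eq_exp_of_recursion {z t : ℕ → ℂ} (h0 : z 0 = 1)
    (hrec : ∀ n, z (n + 1) = ∑ j ∈ Finset.range (n + 1), (n.choose j : ℂ) * (t (j + 1) * z (n - j)))
    (hz : Summable fun n => ‖z n / (n ! : ℂ)‖ * 2 ^ n)
    (ht : Summable fun n => ‖t (n + 1) / ((n + 1)! : ℂ)‖ * 2 ^ (n + 1)) :
    ∑' n, z n / n ! = Complex.exp (∑' n, t (n + 1) / (n + 1)!) := by
  set a : ℕ → ℂ := fun n => z n / n ! with ha
  set b : ℕ → ℂ := fun n => if n = 0 then 0 else t n / n ! with hb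
  have hb' : Summable fun n => ‖b n‖ * 2 ^ n := by
    rw [← summable_nat_add_iff 1]
    simpa [hb] using ht
  have e1 : ∑' n, b n = ∑' n, t (n + 1) / (n + 1)! := by
    have hs : Summable b := by
      simpa using (summable_of_two_pow hb' (x := 1) (by norm_num)).of_norm
    rw [hs.tsum_eq_zero_add]
    simp [hb]
  rw [← e1]
  set Z : ℂ → ℂ := fun x => ∑' n, a n * x ^ n
  set B : ℂ → ℂ := fun x => ∑' n, b n * x ^ n
  have hB : ∀ x : ℂ, ‖x‖ < 3 / 2 → HasDerivAt B (∑' n : ℕ, (n + 1 : ℂ) * b (n + 1) * x ^ n) x :=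
    fun x hx => hasDerivAt_tsum_pow hb' hx
  have hZ : ∀ x : ℂ, ‖x‖ < 3 / 2 →
      HasDerivAt Z ((∑' n : ℕ, (n + 1 : ℂ) * b (n + 1) * x ^ n) * Z x) x := by
    intro x hx
    refine (hasDerivAt_tsum_pow hz hx).congr_deriv ?_
    have s1 : Summable fun n : ℕ => ‖(n + 1 : ℂ) * b (n + 1) * x ^ n‖ := by
      have := (summable_nat_add_iff 1).2 (summable_mul_pow_of_two_pow hb')
      refine this.of_nonneg_of_le (fun _ => norm_nonneg _) fun n => ?_
      rw [norm_mul, norm_mul, norm_pow, mul_right_comm, mul_comm]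
      have e : ‖(n + 1 : ℂ)‖ = ((n + 1 : ℕ) : ℝ) := by
        rw [← Complex.norm_natCast]; push_cast; rfl
      rw [e, Nat.add_sub_cancel]
      gcongr
    rw [tsum_mul_tsum_eq_tsum_sum_range_of_summable_norm s1 (summable_of_two_pow hz hx)]
    refine tsum_congr fun n => ?_
    have e2 : (n + 1 : ℂ) * a (n + 1) = z (n + 1) / n ! := by
      simp only [ha, Nat.factorial_succ]
      push_cast
      have : (n ! : ℂ) ≠ 0 := Nat.cast_ne_zero.2 (Nat.factorial_ne_zero n)
      have : (n + 1 : ℂ) ≠ 0 := Nat.cast_add_one_ne_zero n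
      field_simp
    rw [e2, hrec, Finset.sum_div, Finset.sum_mul]
    refine Finset.sum_congr rfl fun j hj => ?_
    have hj' : j ≤ n := Nat.lt_succ_iff.1 (Finset.mem_range.1 hj)
    have e3 : (j + 1 : ℂ) * b (j + 1) = t (j + 1) / j ! := by
      simp only [hb, Nat.factorial_succ, Nat.add_one_ne_zero, if_false]
      push_cast
      have : (j ! : ℂ) ≠ 0 := Nat.cast_ne_zero.2 (Nat.factorial_ne_zero j)
      have : (j + 1 : ℂ) ≠ 0 := Nat.cast_add_one_ne_zero j
      field_simp
    have e4 : x ^ n = x ^ j * x ^ (n - j) := by rw [← pow_add, Nat.add_sub_cancel' hj']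
    have e5 : (n.choose j : ℂ) = (n ! : ℂ) / ((j ! : ℂ) * ((n - j)! : ℂ)) := Nat.cast_choose ℂ hj'
    have : (n ! : ℂ) ≠ 0 := Nat.cast_ne_zero.2 (Nat.factorial_ne_zero n)
    have : (j ! : ℂ) ≠ 0 := Nat.cast_ne_zero.2 (Nat.factorial_ne_zero j)
    have : ((n - j)! : ℂ) ≠ 0 := Nat.cast_ne_zero.2 (Nat.factorial_ne_zero (n - j))
    rw [e3, e4, e5]
    field_simp
  set y : ℝ → ℂ := fun s => Z s * Complex.exp (-B s)
  have hy : ∀ s ∈ Set.Icc (0 : ℝ) 1, HasDerivAt y 0 s := by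
    intro s hs
    have hs' : ‖(s : ℂ)‖ < 3 / 2 := by
      rw [Complex.norm_real, Real.norm_of_nonneg hs.1]; linarith [hs.2]
    refine ((hZ s hs').comp_ofReal.mul (((hB s hs').fun_neg.cexp).comp_ofReal)).congr_deriv ?_
    ring
  have hconst := constant_of_has_deriv_right_zero (f := y) (a := 0) (b := 1)
    (fun s hs => (hy s hs).continuousAt.continuousWithinAt)
    (fun s hs => (hy s (Set.Ico_subset_Icc_self hs)).hasDerivWithinAt) 1 (by simp)
  have hser0 : ∀ c : ℕ → ℂ, ∑' n, c n * (0 : ℂ) ^ n = c 0 := fun c => by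
    rw [tsum_eq_single 0 fun n hn => by simp [hn]]; simp
  have y0 : y 0 = 1 := by
    simp only [y, Z, B, Complex.ofReal_zero, hser0]
    simp [ha, hb, h0]
  have y1 : y 1 = (∑' n, a n) * Complex.exp (-∑' n, b n) := by simp [y, Z, B]
  rw [y0, y1, Complex.exp_neg] at hconst
  have := Complex.exp_ne_zero (∑' n, b n)
  field_simp at hconst
  exact hconst

end Exponential

open TGFT

/-! ### Gaussian characteristic functions -/

section Gaussian

lemma integral_infinitePi_prod {ι X : Type*} [MeasurableSpace X] (μ : ι → Measure X)
    [∀ i, IsProbabilityMeasure (μ i)] (s : Finset ι) (f : ι → X → ℂ) (hf : ∀ i, Measurable (f i)) :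
    ∫ τ, ∏ i ∈ s, f i (τ i) ∂Measure.infinitePi μ = ∏ i ∈ s, ∫ y, f i y ∂μ i := by
  have h1 : ∀ τ : ι → X, ∏ i ∈ s, f i (τ i) = ∏ i : s, f i (s.restrict τ i) := fun τ =>
    (Finset.prod_coe_sort s fun i => f i (τ i)).symm
  simp_rw [h1]
  have h2 := integral_restrict_infinitePi (μ := μ) (s := s)
    (f := fun y : s → X => ∏ i : s, f i (y i)) (Finset.measurable_fun_prod (s := Finset.univ)
      (f := fun (i : s) (y : s → X) => f i (y i)) fun i _ =>
      (hf i).comp (measurable_pi_apply i)).aestronglyMeasurable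
  refine h2.trans ?_
  rw [integral_fintype_prod_eq_prod (fun (i : s) y => f i y), Finset.prod_coe_sort s
      fun i => ∫ y, f i y ∂μ i]

/-- The number of components in which two momenta agree. -/
def overlap (k k' : Momentum) : ℝ := ∑ i : Fin 3, if k.1 i = k'.1 i then 1 else 0

lemma overlap_comm (k k' : Momentum) : overlap k k' = overlap k' k := by
  simp only [overlap, eq_comm]

lemma overlap_nonneg (k k' : Momentum) : 0 ≤ overlap k k' :=
  Finset.sum_nonneg fun _ _ => by split_ifs <;> norm_num

lemma overlap_le (k k' : Momentum) : overlap k k' ≤ 3 := by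
  refine (Finset.sum_le_card_nsmul _ _ 1 fun i _ => ?_).trans (by simp)
  split_ifs <;> norm_num

lemma overlap_self (k : Momentum) : overlap k k = 3 := by simp [overlap]

variable {ι : Type*}

/-- The field indices that occur in the momenta `k a`, `a ∈ S`. -/
def fieldIndices (S : Finset ι) (k : ι → Momentum) : Finset (Fin 3 × ℤ) := by
  classical
  exact Finset.univ ×ˢ S.biUnion fun a => Finset.univ.image fun i => (k a).1 i

lemma mem_fieldIndices {S : Finset ι} {k : ι → Momentum} {a : ι} (ha : a ∈ S) (i : Fin 3) :
    (i, (k a).1 i) ∈ fieldIndices S k := by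
  classical
  simp only [fieldIndices, Finset.mem_product, Finset.mem_univ, true_and, Finset.mem_biUnion,
    Finset.mem_image]
  exact ⟨a, ha, i, rfl⟩

/-- The coefficient of a field component in `x * Γ(k)`. -/
def fieldCoeff (k : Momentum) (x : ℝ) (iq : Fin 3 × ℤ) : ℝ := if k.1 iq.1 = iq.2 then x else 0

lemma sum_fieldIndices {S : Finset ι} {k : ι → Momentum} {a : ι} (ha : a ∈ S) (x : ℝ)
    (f : Fin 3 × ℤ → ℝ) :
    ∑ iq ∈ fieldIndices S k, fieldCoeff (k a) x iq * f iq = x * ∑ i, f (i, (k a).1 i) := by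
  classical
  have hm := fun i => mem_fieldIndices (k := k) ha i
  simp only [fieldIndices, Finset.mem_product, Finset.mem_univ, true_and] at hm
  rw [fieldIndices, Finset.sum_product, Finset.mul_sum]
  refine Finset.sum_congr rfl fun i _ => ?_
  rw [Finset.sum_eq_single_of_mem _ (hm i)]
  · simp [fieldCoeff]
  · intro q _ hq
    simp [fieldCoeff, hq.symm]

lemma sum_fieldIndices_mul {S : Finset ι} {k : ι → Momentum} {a b : ι} (ha : a ∈ S) (x y : ℝ) :
    ∑ iq ∈ fieldIndices S k, fieldCoeff (k a) x iq * fieldCoeff (k b) y iq =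
      x * y * overlap (k a) (k b) := by
  rw [sum_fieldIndices ha x (fieldCoeff (k b) y), mul_assoc, overlap,
    Finset.mul_sum Finset.univ _ y]
  refine congrArg (x * ·) (Finset.sum_congr rfl fun i _ => ?_)
  simp [fieldCoeff, eq_comm]

lemma sum_overlap {S : Finset ι} {k : ι → Momentum} (M : ι → ι → ℝ) (x : ι → ℝ) :
    ∑ a ∈ S, ∑ b ∈ S, M a b * (x a * x b * overlap (k a) (k b)) = ∑ iq ∈ fieldIndices S k,
      ∑ a ∈ S, ∑ b ∈ S, M a b * (fieldCoeff (k a) (x a) iq * fieldCoeff (k b) (x b) iq) := by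
  symm
  rw [Finset.sum_comm (s := fieldIndices S k)]
  refine Finset.sum_congr rfl fun a ha => ?_
  rw [Finset.sum_comm (s := fieldIndices S k)]
  refine Finset.sum_congr rfl fun b _ => ?_
  rw [← Finset.mul_sum, sum_fieldIndices_mul ha]

lemma sum_overlap_one {S : Finset ι} {k : ι → Momentum} (x : ι → ℝ) :
    ∑ a ∈ S, ∑ b ∈ S, x a * x b * overlap (k a) (k b) = ∑ iq ∈ fieldIndices S k,
      (∑ a ∈ S, fieldCoeff (k a) (x a) iq) ^ 2 := by
  have h := sum_overlap (S := S) (k := k) (fun _ _ => 1) x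
  simp only [one_mul] at h
  rw [h]
  refine Finset.sum_congr rfl fun iq _ => ?_
  rw [pow_two, Finset.sum_mul_sum]

lemma sum_overlap_nonneg (S : Finset ι) (k : ι → Momentum) (x : ι → ℝ) :
    0 ≤ ∑ a ∈ S, ∑ b ∈ S, x a * x b * overlap (k a) (k b) := by
  rw [sum_overlap_one]
  exact Finset.sum_nonneg fun _ _ => sq_nonneg _

instance : IsProbabilityMeasure fieldMeasure := by unfold fieldMeasure; infer_instance

/-- The characteristic function of the intermediate fields. -/
lemma integral_exp_fieldMeasure (S : Finset ι) (k : ι → Momentum) (x : ι → ℝ) :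
    ∫ τ, Complex.exp (Complex.I * (∑ a ∈ S, x a * Gam (k a) τ : ℝ)) ∂fieldMeasure =
      (Real.exp (-(∑ a ∈ S, ∑ b ∈ S, x a * x b * overlap (k a) (k b)) / 2) : ℝ) := by
  have h : ∀ τ : Field, Complex.exp (Complex.I * (∑ a ∈ S, x a * Gam (k a) τ : ℝ)) =
      ∏ iq ∈ fieldIndices S k,
        Complex.exp (((inner ℝ (τ iq) (∑ a ∈ S, fieldCoeff (k a) (x a) iq) : ℝ) : ℂ) * Complex.I) := by
    intro τ
    rw [← Complex.exp_sum, ← Finset.sum_mul, mul_comm]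
    congr 2
    rw [← Complex.ofReal_sum]
    congr 1
    simp only [Gam]
    rw [Finset.sum_congr rfl fun a ha => (sum_fieldIndices ha (x a) τ).symm, Finset.sum_comm]
    refine Finset.sum_congr rfl fun iq _ => ?_
    rw [← Finset.sum_mul]
    simp
  simp_rw [h]
  rw [fieldMeasure, integral_infinitePi_prod (fun _ => gaussianReal 0 1) _
    fun iq t => Complex.exp (((inner ℝ t (∑ a ∈ S, fieldCoeff (k a) (x a) iq) : ℝ) : ℂ) * Complex.I)]
  · simp only [← charFun_apply, charFun_gaussianReal]
    rw [← Complex.exp_sum, sum_overlap_one, Complex.ofReal_exp]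
    congr 1
    push_cast
    rw [← Finset.sum_neg_distrib, Finset.sum_div]
    refine Finset.sum_congr rfl fun iq _ => ?_
    simp
    ring
  · intro iq
    fun_prop

/-- The characteristic function of the replicated fields. -/
lemma integral_exp_replicas {n : ℕ} {X : Matrix (Fin n) (Fin n) ℝ} (hX : X.PosSemidef)
    (k : Fin n → Momentum) (x : Fin n → ℝ) :
    ∫ τ, Complex.exp (Complex.I * (∑ a, x a * Gam (k a) (fun iq => τ iq a) : ℝ))
      ∂(Measure.infinitePi fun _ : Fin 3 × ℤ => multivariateGaussian 0 X) =
      (Real.exp (-(∑ a, ∑ b, X a b * (x a * x b * overlap (k a) (k b))) / 2) : ℝ) := by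
  set y : Fin 3 × ℤ → EuclideanSpace ℝ (Fin n) := fun iq =>
    WithLp.toLp 2 fun a => fieldCoeff (k a) (x a) iq with hy
  have h : ∀ τ : Fin 3 × ℤ → EuclideanSpace ℝ (Fin n),
      Complex.exp (Complex.I * (∑ a, x a * Gam (k a) (fun iq => τ iq a) : ℝ)) =
      ∏ iq ∈ fieldIndices Finset.univ k,
        Complex.exp (((inner ℝ (τ iq) (y iq) : ℝ) : ℂ) * Complex.I) := by
    intro τ
    rw [← Complex.exp_sum, ← Finset.sum_mul, mul_comm]
    congr 2
    rw [← Complex.ofReal_sum]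
    congr 1
    simp only [Gam]
    rw [Finset.sum_congr rfl fun a ha => (sum_fieldIndices ha (x a) fun iq => τ iq a).symm,
      Finset.sum_comm]
    refine Finset.sum_congr rfl fun iq _ => ?_
    simp [hy, PiLp.inner_apply]
  simp_rw [h]
  rw [integral_infinitePi_prod (fun _ => multivariateGaussian 0 X) _
    fun iq t => Complex.exp (((inner ℝ t (y iq) : ℝ) : ℂ) * Complex.I)]
  · simp only [← charFun_apply, charFun_multivariateGaussian hX]
    rw [← Complex.exp_sum, sum_overlap X x, Complex.ofReal_exp]
    congr 1
    push_cast
    rw [← Finset.sum_neg_distrib, Finset.sum_div]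
    refine Finset.sum_congr rfl fun iq _ => ?_
    simp only [inner_zero_right, Complex.ofReal_zero, zero_mul, zero_sub, hy, dotProduct,
      Matrix.mulVec, Complex.ofReal_sum, Complex.ofReal_mul, Finset.mul_sum, neg_div]
    congr 2
    refine Finset.sum_congr rfl fun a _ => Finset.sum_congr rfl fun b _ => ?_
    ring
  · intro iq
    fun_prop

/-- Expectations of bounded continuous functions depend continuously on the covariance. -/
lemma continuous_integral_replicas {n : ℕ} {Y : Type*} [TopologicalSpace Y] [FirstCountableTopology Y]
    {E : Type*} [NormedAddCommGroup E] [NormedSpace ℝ E]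
    (X : Y → Matrix (Fin n) (Fin n) ℝ) (hc : Continuous X) (hX : ∀ y, (X y).PosSemidef)
    (f : (Fin 3 × ℤ → EuclideanSpace ℝ (Fin n)) → E) (hf : Continuous f)
    (hfm : StronglyMeasurable f) (c : ℝ) (hb : ∀ τ, ‖f τ‖ ≤ c) :
    Continuous fun y => ∫ τ, f τ ∂(Measure.infinitePi fun _ : Fin 3 × ℤ =>
      multivariateGaussian 0 (X y)) := by
  open scoped Matrix.Norms.L2Operator MatrixOrder in
  have hs : Continuous fun y => CFC.sqrt (X y) := by
    unfold CFC.sqrt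
    exact Continuous.cfcₙ_nnreal_of_mem_nhdsSet (s := Set.univ) _ Filter.univ_mem hc
      (fun y => Matrix.nonneg_iff_posSemidef.2 (hX y)) (by fun_prop)
  let L : Y → EuclideanSpace ℝ (Fin n) → EuclideanSpace ℝ (Fin n) := fun y v =>
    0 + Matrix.toEuclideanCLM (𝕜 := ℝ) (CFC.sqrt (X y)) v
  have hLm : ∀ y, Measurable (L y) := fun y => by fun_prop
  have hL : ∀ v, Continuous fun y => L y v := by
    intro v
    have : ∀ y, L y v = WithLp.toLp 2 ((CFC.sqrt (X y)).mulVec v) := by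
      intro y; simp only [L, zero_add]; rfl
    simp only [this]
    refine (PiLp.continuous_toLp 2 _).comp ?_
    exact hs.matrix_mulVec continuous_const
  have h : ∀ y, ∫ τ, f τ ∂(Measure.infinitePi fun _ : Fin 3 × ℤ => multivariateGaussian 0 (X y)) =
      ∫ τ, f (fun iq => L y (τ iq)) ∂(Measure.infinitePi fun _ : Fin 3 × ℤ =>
        stdGaussian (EuclideanSpace ℝ (Fin n))) := by
    intro y
    have e : (Measure.infinitePi fun _ : Fin 3 × ℤ => multivariateGaussian 0 (X y)) =
        (Measure.infinitePi fun _ : Fin 3 × ℤ => stdGaussian (EuclideanSpace ℝ (Fin n))).map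
          fun τ iq => L y (τ iq) :=
      (Measure.infinitePi_map_pi (fun _ : Fin 3 × ℤ => stdGaussian (EuclideanSpace ℝ (Fin n)))
        fun _ => hLm y).symm
    rw [e, integral_map (by
      exact (measurable_pi_iff.2 fun iq => (hLm y).comp (measurable_pi_apply iq)).aemeasurable)
      hfm.aestronglyMeasurable]
  simp_rw [h]
  refine continuous_of_dominated (bound := fun _ => c) (fun y => ?_)
    (fun y => ae_of_all _ fun τ => hb _) (integrable_const _) (ae_of_all _ fun τ => ?_)
  · exact (hfm.comp_measurable (measurable_pi_iff.2 fun iq =>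
      (hLm y).comp (measurable_pi_apply iq))).aestronglyMeasurable
  · exact hf.comp (continuous_pi fun iq => hL (τ iq))

end Gaussian

/-! ### Vertices as Fourier transforms -/

section TreeTerm

lemma measurable_linkMat {V : Type} [Fintype V] [DecidableEq V] (F : Finset (Sym2 V)) (a b : V) :
    Measurable fun w => linkMat F w a b := by
  have h : Measurable fun w => energy {s(a, b)} 1 0 F w := measurable_energy {s(a, b)} 1 0 F
  simpa only [energy, Finset.sum_singleton, Pi.one_apply, one_mul, linkMat] using h

/-- The number of lines of `F` at `a`. -/
abbrev lineCount {V : Type} [DecidableEq V] (F : Finset (Sym2 V)) (a : V) : ℕ :=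
  (F.filter (a ∈ ·)).card

/-- The overlap of the momenta at the ends of a line. -/
def lineOverlap {V : Type} (k : V → Momentum) : Sym2 V → ℝ :=
  Sym2.lift ⟨fun a b => overlap (k a) (k b), fun _ _ => overlap_comm _ _⟩

@[simp] lemma lineOverlap_mk {V : Type} (k : V → Momentum) (a b : V) :
    lineOverlap k s(a, b) = overlap (k a) (k b) := rfl

lemma lineOverlap_nonneg {V : Type} (k : V → Momentum) (l : Sym2 V) : 0 ≤ lineOverlap k l := by
  induction l with | _ a b => exact overlap_nonneg _ _

lemma posSemidef_of_sum_nonneg {n : ℕ} {X : Matrix (Fin n) (Fin n) ℝ} (hs : ∀ a b, X a b = X b a)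
    (h : ∀ y : Fin n → ℝ, 0 ≤ ∑ a, ∑ b, X a b * (y a * y b)) : X.PosSemidef := by
  refine Matrix.PosSemidef.of_dotProduct_mulVec_nonneg ?_ fun y => ?_
  · ext a b
    simp [hs a b]
  · refine (h y).trans_eq ?_
    simp only [dotProduct, Matrix.mulVec, Finset.mul_sum, Pi.star_apply, star_trivial]
    exact Finset.sum_congr rfl fun a _ => Finset.sum_congr rfl fun b _ => by ring

lemma posSemidef_linkMat {n : ℕ} (F : Finset (Sym2 (Fin n))) (w : Sym2 (Fin n) → ℝ) :
    (Matrix.of fun a b => linkMat F w a b).PosSemidef := by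
  refine posSemidef_of_sum_nonneg (linkMat_comm F w) fun y => ?_
  refine sum_linkMat_nonneg Finset.univ (M := fun a b => y a * y b) (fun S => ?_) F w
  rw [← Finset.sum_mul_sum]
  exact mul_self_nonneg _

lemma measurable_Gam (k : Momentum) : Measurable (Gam k) := by
  unfold Gam
  fun_prop

lemma continuous_Gam (k : Momentum) : Continuous (Gam k) := by
  unfold Gam
  fun_prop

/-- The law of the replicated fields with covariance `X`. -/
abbrev replicaLaw {n : ℕ} (X : Matrix (Fin n) (Fin n) ℝ) :
    Measure (Fin 3 × ℤ → EuclideanSpace ℝ (Fin n)) :=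
  Measure.infinitePi fun _ : Fin 3 × ℤ => multivariateGaussian 0 X

lemma norm_exp_I_mul (x : ℝ) : ‖Complex.exp (Complex.I * (x : ℂ))‖ = 1 := by
  rw [mul_comm]; exact Complex.norm_exp_ofReal_mul_I x

/-- The contribution of a tree to the cumulants, as an expectation over the replicated fields. -/
theorem tree_term {n : ℕ} (F : Finset (Sym2 (Fin n))) (hF : ∀ l ∈ F, ¬ l.IsDiag)
    (k : Fin n → Momentum) (β : Fin n → ℝ) (μ : Measure ℝ) [IsProbabilityMeasure μ]
    (u : Fin n → ℝ → ℂ)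
    (hi : ∀ a (d : ℕ), Integrable (fun α => u a α * (α : ℂ) ^ d) μ) :
    ∫ α : Fin n → ℝ, (∏ a, u a (α a)) * ((∏ l ∈ F, -(Sym2.lift ⟨fun a b => α a * β a * (α b * β b),
      fun _ _ => mul_comm _ _⟩ l * lineOverlap k l)) *
      ∫ w, Real.exp (-(∑ a, ∑ b, linkMat F w a b * (α a * β a * (α b * β b) *
        overlap (k a) (k b))) / 2) ∂edgeMeasure 0 F : ℝ) ∂Measure.pi (fun _ => μ) =
    (∏ l ∈ F, lineOverlap k l : ℝ) * ∫ w, ∫ τ, ∏ a, (∫ α, u a α * (Complex.I * (α * β a : ℝ)) ^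
      lineCount F a * Complex.exp (Complex.I * (α * β a * Gam (k a) (fun iq => τ iq a) : ℝ)) ∂μ)
      ∂replicaLaw (Matrix.of fun a b => linkMat F w a b) ∂edgeMeasure 0 F := by
  have hprob : IsProbabilityMeasure (edgeMeasure 0 F) := by
    rw [edgeMeasure_zero]; infer_instance
  set G : (Fin n → ℝ) → ℂ := fun α => ∏ a, (u a (α a) * (Complex.I * (α a * β a : ℝ)) ^
    lineCount F a) with hG
  have hGi : Integrable G (Measure.pi fun _ => μ) := by
    refine Integrable.fintype_prod (f := fun a y => u a y * (Complex.I * (y * β a : ℝ)) ^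
      lineCount F a) fun a => ?_
    have := (hi a (lineCount F a)).mul_const ((Complex.I * β a) ^ lineCount F a)
    refine this.congr (ae_of_all _ fun y => ?_)
    push_cast
    ring
  have hedge : ∀ α : Fin n → ℝ, ((∏ l ∈ F, -(Sym2.lift ⟨fun a b => α a * β a * (α b * β b),
      fun _ _ => mul_comm _ _⟩ l * lineOverlap k l) : ℝ) : ℂ) =
      (∏ l ∈ F, lineOverlap k l : ℝ) * ∏ a, (Complex.I * (α a * β a : ℝ)) ^ lineCount F a := by
    intro α
    rw [← prod_edges F hF fun a => Complex.I * (α a * β a : ℝ), Complex.ofReal_prod,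
      Complex.ofReal_prod, ← Finset.prod_mul_distrib]
    refine Finset.prod_congr rfl fun l _ => ?_
    induction l with | _ a b => ?_
    simp only [Sym2.lift_mk, lineOverlap_mk]
    push_cast
    linear_combination (-((α a : ℂ) * β a * (α b * β b) * overlap (k a) (k b))) * Complex.I_mul_I
  have hPSD := posSemidef_linkMat F
  set E : (Fin n → ℝ) → (Sym2 (Fin n) → ℝ) → ℝ := fun α w =>
    Real.exp (-(∑ a, ∑ b, linkMat F w a b * (α a * β a * (α b * β b) *
        overlap (k a) (k b))) / 2) with hE
  have hEm : Measurable fun q : (Fin n → ℝ) × (Sym2 (Fin n) → ℝ) => E q.1 q.2 := by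
    refine Real.measurable_exp.comp (Measurable.div_const (Measurable.neg ?_) _)
    refine Finset.measurable_fun_sum _ fun a _ => Finset.measurable_fun_sum _ fun b _ => ?_
    exact ((measurable_linkMat F a b).comp measurable_snd).mul (by fun_prop)
  have hE1 : ∀ α w, ((E α w : ℝ) : ℂ) = ∫ τ, Complex.exp (Complex.I *
      (∑ a, (α a * β a) * Gam (k a) (fun iq => τ iq a) : ℝ))
      ∂replicaLaw (Matrix.of fun a b => linkMat F w a b) := by
    intro α w
    rw [integral_exp_replicas (hPSD w)]
    rfl
  have hEb : ∀ α w, ‖((E α w : ℝ) : ℂ)‖ ≤ 1 := by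
    intro α w
    rw [hE1]
    refine (norm_integral_le_of_norm_le_const (C := 1) (ae_of_all _ fun τ => ?_)).trans (by simp)
    rw [norm_exp_I_mul]
  calc _ = ∫ α : Fin n → ℝ, ∫ w, (∏ l ∈ F, lineOverlap k l : ℝ) * (G α * (E α w : ℝ))
        ∂edgeMeasure 0 F ∂Measure.pi (fun _ => μ) := by
        refine integral_congr_ae (ae_of_all _ fun α => ?_)
        simp only
        rw [integral_const_mul, integral_const_mul, integral_complex_ofReal, Complex.ofReal_mul,
          hedge, hG]
        simp only [Finset.prod_mul_distrib]
        ring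
    _ = ∫ w, ∫ α : Fin n → ℝ, (∏ l ∈ F, lineOverlap k l : ℝ) * (G α * (E α w : ℝ))
        ∂Measure.pi (fun _ => μ) ∂edgeMeasure 0 F := by
        refine integral_integral_swap (f := fun α w => (∏ l ∈ F, lineOverlap k l : ℝ) *
          (G α * (E α w : ℝ))) ?_
        have h1 : Integrable (fun q : (Fin n → ℝ) × (Sym2 (Fin n) → ℝ) => G q.1 * ((E q.1 q.2 : ℝ) : ℂ))
            ((Measure.pi fun _ => μ).prod (edgeMeasure 0 F)) := by
          refine (hGi.comp_fst (edgeMeasure 0 F)).mul_bdd (c := 1) ?_ (ae_of_all _ fun q => hEb _ _)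
          exact (Complex.measurable_ofReal.comp hEm).aestronglyMeasurable
        exact h1.const_mul _
    _ = (∏ l ∈ F, lineOverlap k l : ℝ) * ∫ w, ∫ α : Fin n → ℝ, (G α * (E α w : ℝ))
        ∂Measure.pi (fun _ => μ) ∂edgeMeasure 0 F := by
        rw [← integral_const_mul]
        exact integral_congr_ae (ae_of_all _ fun w => integral_const_mul _ _)
    _ = _ := by
        congr 1
        refine integral_congr_ae (ae_of_all _ fun w => ?_)
        simp only
        set ν := replicaLaw (Matrix.of fun a b => linkMat F w a b)
        have h2 : ∀ α : Fin n → ℝ, G α * ((E α w : ℝ) : ℂ) = ∫ τ, G α * Complex.exp (Complex.I *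
            (∑ a, (α a * β a) * Gam (k a) (fun iq => τ iq a) : ℝ)) ∂ν := fun α => by
          rw [integral_const_mul, hE1]
        simp_rw [h2]
        rw [integral_integral_swap (f := fun (α : Fin n → ℝ)
          (τ : Fin 3 × ℤ → EuclideanSpace ℝ (Fin n)) => G α * Complex.exp (Complex.I *
            (∑ a, (α a * β a) * Gam (k a) (fun iq => τ iq a) : ℝ)))]
        · refine integral_congr_ae (ae_of_all _ fun τ => ?_)
          simp only
          rw [← integral_fintype_prod_eq_prod (𝕜 := ℂ) (μ := fun _ => μ) (fun a (y : ℝ) => u a y *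
            (Complex.I * (y * β a : ℝ)) ^ lineCount F a *
            Complex.exp (Complex.I * (y * β a * Gam (k a) (fun iq => τ iq a) : ℝ)))]
          refine integral_congr_ae (ae_of_all _ fun α => ?_)
          simp only [hG]
          rw [Complex.ofReal_sum, Finset.mul_sum, Complex.exp_sum, ← Finset.prod_mul_distrib]
        · refine (hGi.comp_fst ν).mul_bdd (c := 1) ?_ (ae_of_all _ fun q => ?_)
          · refine (Complex.measurable_exp.comp (Measurable.const_mul ?_ _)).aestronglyMeasurable
            refine Complex.measurable_ofReal.comp (Finset.measurable_fun_sum _ fun a _ => ?_)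
            refine Measurable.mul (by fun_prop) ((measurable_Gam (k a)).comp ?_)
            fun_prop
          · rw [norm_exp_I_mul]

end TreeTerm

/-! ### The gas of vertices -/

section SpeciesGas

/-- The exponential law. -/
def expLaw : Measure ℝ :=
  (volume.restrict (Set.Ioi 0)).withDensity fun α => ENNReal.ofReal (Real.exp (-α))

lemma integral_expLaw {E : Type*} [NormedAddCommGroup E] [NormedSpace ℝ E] (f : ℝ → E) :
    ∫ α, f α ∂expLaw = ∫ α in Set.Ioi 0, Real.exp (-α) • f α := by
  rw [expLaw, integral_withDensity_eq_integral_toReal_smul (by fun_prop)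
    (ae_of_all _ fun _ => ENNReal.ofReal_lt_top)]
  simp only [ENNReal.toReal_ofReal (Real.exp_pos _).le]

lemma integrable_expLaw {E : Type*} [NormedAddCommGroup E] [NormedSpace ℝ E] {f : ℝ → E} :
    Integrable f expLaw ↔ IntegrableOn (fun α => Real.exp (-α) • f α) (Set.Ioi 0) := by
  rw [expLaw, integrable_withDensity_iff_integrable_smul' (by fun_prop)
    (ae_of_all _ fun _ => ENNReal.ofReal_lt_top)]
  simp only [ENNReal.toReal_ofReal (Real.exp_pos _).le, IntegrableOn]

instance : IsProbabilityMeasure expLaw := ⟨by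
  rw [expLaw, withDensity_apply _ MeasurableSet.univ, Measure.restrict_univ,
    ← ofReal_integral_eq_lintegral_ofReal (by simpa [IntegrableOn] using exp_neg_integrableOn_Ioi 0 zero_lt_one)
      (ae_of_all _ fun _ => (Real.exp_pos _).le), integral_exp_neg_Ioi_zero, ENNReal.ofReal_one]⟩

variable {ι : Type} [Fintype ι] [Nonempty ι] [MeasurableSpace ι] [DiscreteMeasurableSpace ι]

/-- The uniform law on a finite set. -/
def uniformLaw (ι : Type) [Fintype ι] [Nonempty ι] [MeasurableSpace ι] : Measure ι :=
  (PMF.uniformOfFintype ι).toMeasure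

instance : IsProbabilityMeasure (uniformLaw ι) := by unfold uniformLaw; infer_instance

lemma uniformLaw_real_singleton (i : ι) :
    (uniformLaw ι).real {i} = ((Fintype.card ι : ℝ))⁻¹ := by
  rw [uniformLaw, measureReal_def, PMF.toMeasure_apply_singleton _ _ (MeasurableSet.of_discrete)]
  simp

/-- The law of a species and a parameter. -/
abbrev markLaw (ι : Type) [Fintype ι] [Nonempty ι] [MeasurableSpace ι] : Measure (ι × ℝ) :=
  (uniformLaw ι).prod expLaw

lemma integral_markLaw {f : ι × ℝ → ℂ} (hf : Integrable f (markLaw ι)) :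
    ∫ ξ, f ξ ∂markLaw ι = ∑ i, (Fintype.card ι : ℂ)⁻¹ * ∫ α, f (i, α) ∂expLaw := by
  rw [integral_prod _ hf, integral_fintype (Integrable.of_finite)]
  refine Finset.sum_congr rfl fun i _ => ?_
  rw [uniformLaw_real_singleton, Complex.real_smul]
  push_cast
  rfl

lemma integrable_markLaw {E : Type*} [NormedAddCommGroup E] {f : ι × ℝ → E}
    (hm : AEStronglyMeasurable f (markLaw ι))
    (hf : ∀ i, Integrable (fun α => f (i, α)) expLaw) : Integrable f (markLaw ι) := by
  rw [integrable_prod_iff hm]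
  exact ⟨ae_of_all _ hf, Integrable.of_finite⟩

lemma integral_pi_markLaw {n : ℕ} {f : (Fin n → ι × ℝ) → ℂ}
    (hf : Integrable f (Measure.pi fun _ => markLaw ι)) :
    ∫ x, f x ∂Measure.pi (fun _ => markLaw ι) = ∑ c : Fin n → ι, ((Fintype.card ι : ℂ)⁻¹) ^ n *
      ∫ α, f (fun a => (c a, α a)) ∂Measure.pi fun _ => expLaw := by
  have h := measurePreserving_arrowProdEquivProdArrow ι ℝ (Fin n) (fun _ => uniformLaw ι)
    fun _ => expLaw
  have h' := h.symm (MeasurableEquiv.arrowProdEquivProdArrow ι ℝ (Fin n))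
  have hi := (h'.integrable_comp_emb (MeasurableEquiv.measurableEmbedding _)).2 hf
  rw [← h'.integral_comp', ← Function.comp_def f, integral_prod _ hi, integral_fintype (Integrable.of_finite)]
  refine Finset.sum_congr rfl fun c _ => ?_
  rw [measureReal_def, Measure.pi_singleton, ENNReal.toReal_prod]
  simp only [← measureReal_def, uniformLaw_real_singleton, Finset.prod_const, Complex.real_smul,
    Finset.card_univ, Fintype.card_fin]
  push_cast
  rfl

/-- Data of the vertices: each species has a momentum, a strength of its coupling to the field and
a finite measure of which the vertex is the Fourier transform. -/
structure VertexData (ι : Type) where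
  mom : ι → Momentum
  str : ι → ℝ
  str_nonneg : ∀ i, 0 ≤ str i
  dens : ι → ℝ → ℂ
  measurable_dens : ∀ i, Measurable (dens i)
  integrable : ∀ i (d : ℕ), IntegrableOn (fun α => dens i α * (α : ℂ) ^ d) (Set.Ioi 0)

namespace VertexData

variable (D : VertexData ι)

/-- The `d`-th derivative of a vertex. -/
def vertex {ι : Type} (D : VertexData ι) (i : ι) (d : ℕ) (s : ℝ) : ℂ :=
  ∫ α in Set.Ioi 0, D.dens i α * (Complex.I * (α * D.str i : ℝ)) ^ d *
    Complex.exp (Complex.I * (α * D.str i * s : ℝ))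

/-- The activity of a mark. -/
def act (ξ : ι × ℝ) : ℂ := Fintype.card ι * (Real.exp ξ.2 * D.dens ξ.1 ξ.2)

lemma act_eq (i : ι) (α : ℝ) : D.act (i, α) = Fintype.card ι * (Real.exp α * D.dens i α) := rfl

lemma measurable_act : Measurable D.act := by
  refine measurable_from_prod_countable_right fun i => ?_
  have := D.measurable_dens i
  simp only [act_eq]
  fun_prop

lemma integrable_act (i : ι) (d : ℕ) :
    Integrable (fun α => D.act (i, α) * (α : ℂ) ^ d) expLaw := by
  rw [integrable_expLaw]
  refine ((D.integrable i d).const_mul (Fintype.card ι : ℂ)).congr (ae_of_all _ fun α => ?_)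
  simp only [act_eq, Complex.real_smul]
  linear_combination (-(Fintype.card ι : ℂ) * D.dens i α * α ^ d) *
    (by rw [← Complex.ofReal_mul, ← Real.exp_add]; simp :
      ((Real.exp (-α) : ℝ) : ℂ) * (Real.exp α : ℝ) = 1)

lemma integral_act (i : ι) (d : ℕ) (s : ℝ) :
    ∫ α, D.act (i, α) * (Complex.I * (α * D.str i : ℝ)) ^ d *
      Complex.exp (Complex.I * (α * D.str i * s : ℝ)) ∂expLaw = Fintype.card ι * D.vertex i d s := by
  rw [integral_expLaw, vertex, ← integral_const_mul]
  refine integral_congr_ae (ae_of_all _ fun α => ?_)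
  simp only [act_eq, Complex.real_smul]
  linear_combination (Fintype.card ι : ℂ) * D.dens i α * (Complex.I * (α * D.str i : ℝ)) ^ d *
      Complex.exp (Complex.I * (α * D.str i * s : ℝ)) *
    (by rw [← Complex.ofReal_mul, ← Real.exp_add]; simp :
      ((Real.exp (-α) : ℝ) : ℂ) * (Real.exp α : ℝ) = 1)

/-- The gas of vertices. -/
def gas : MarkGas (ι × ℝ) where
  law := markLaw ι
  isProb := inferInstance
  act := D.act
  measurable_act := D.measurable_act
  ker ξ ξ' := ξ.2 * D.str ξ.1 * (ξ'.2 * D.str ξ'.1) * overlap (D.mom ξ.1) (D.mom ξ'.1)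
  measurable_ker := by
    have h1 : Measurable fun ξ : ι × ℝ => D.str ξ.1 :=
      (measurable_of_finite D.str).comp measurable_fst
    have h2 : Measurable fun q : (ι × ℝ) × ι × ℝ => overlap (D.mom q.1.1) (D.mom q.2.1) :=
      (measurable_of_finite fun q : ι × ι => overlap (D.mom q.1) (D.mom q.2)).comp
        (by fun_prop : Measurable fun q : (ι × ℝ) × ι × ℝ => (q.1.1, q.2.1))
    refine Measurable.mul (Measurable.mul (Measurable.mul (by fun_prop) (h1.comp measurable_fst))
      (Measurable.mul (by fun_prop) (h1.comp measurable_snd))) h2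
  ker_comm ξ ξ' := by rw [overlap_comm]; ring
  ker_nonneg S x := sum_overlap_nonneg S (fun a => D.mom (x a).1) fun a => (x a).2 * D.str (x a).1
  bound ξ := 2 * (|ξ.2| * D.str ξ.1)
  ker_le ξ ξ' := by
    have h1 := D.str_nonneg ξ.1
    have h2 := D.str_nonneg ξ'.1
    rw [abs_mul, abs_mul, abs_mul, abs_mul, abs_of_nonneg h1, abs_of_nonneg h2,
      abs_of_nonneg (overlap_nonneg _ _)]
    have h3 := overlap_le (D.mom ξ.1) (D.mom ξ'.1)
    have h4 : 0 ≤ |ξ.2| * D.str ξ.1 * (|ξ'.2| * D.str ξ'.1) := by positivity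
    nlinarith
  integrable d := by
    refine integrable_markLaw ?_ fun i => ?_
    · have h1 : Measurable fun ξ : ι × ℝ => D.str ξ.1 :=
        (measurable_of_finite D.str).comp measurable_fst
      have h2 := D.measurable_act
      exact Measurable.aestronglyMeasurable (by fun_prop)
    · refine (((D.integrable_act i d).norm).const_mul ((2 * D.str i) ^ d)).congr
        (ae_of_all _ fun α => ?_)
      simp only [norm_mul, norm_pow, Complex.norm_real, Real.norm_eq_abs]
      ring

lemma integrable_act_law : Integrable D.act (markLaw ι) := by
  refine integrable_markLaw D.measurable_act.aestronglyMeasurable fun i => ?_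
  simpa using D.integrable_act i 0

/-- The sum of the vertices. -/
def total {ι : Type} [Fintype ι] (D : VertexData ι) (τ : Field) : ℂ :=
  ∑ i, D.vertex i 0 (Gam (D.mom i) τ)

lemma measurable_phase : Measurable fun q : (ι × ℝ) × Field =>
    Complex.exp (Complex.I * (q.1.2 * D.str q.1.1 * Gam (D.mom q.1.1) q.2 : ℝ)) := by
  refine Complex.measurable_exp.comp (Measurable.const_mul (Complex.measurable_ofReal.comp ?_) _)
  have h : Measurable fun q : ι × ℝ × Field => q.2.1 * D.str q.1 * Gam (D.mom q.1) q.2.2 := by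
    refine measurable_from_prod_countable_right fun i => ?_
    exact Measurable.mul (measurable_fst.mul_const (D.str i))
      ((measurable_Gam (D.mom i)).comp measurable_snd)
  exact h.comp (by fun_prop : Measurable fun q : (ι × ℝ) × Field => (q.1.1, q.1.2, q.2))

lemma integral_act_phase (τ : Field) : ∫ ξ, D.act ξ *
    Complex.exp (Complex.I * (ξ.2 * D.str ξ.1 * Gam (D.mom ξ.1) τ : ℝ)) ∂markLaw ι = D.total τ := by
  rw [integral_markLaw, total]
  · refine Finset.sum_congr rfl fun i _ => ?_
    have h := D.integral_act i 0 (Gam (D.mom i) τ)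
    simp only [pow_zero, mul_one] at h
    rw [h, ← mul_assoc, inv_mul_cancel₀ (by simp), one_mul]
  · refine D.integrable_act_law.mul_bdd (c := 1) ?_ (ae_of_all _ fun ξ => (norm_exp_I_mul _).le)
    exact (D.measurable_phase.comp (by fun_prop :
      Measurable fun ξ : ι × ℝ => (ξ, τ))).aestronglyMeasurable

lemma moment_gas {n : ℕ} (A : Finset (Fin n)) :
    D.gas.moment A = ∫ τ, D.total τ ^ A.card ∂fieldMeasure := by
  have h1 : ∀ x : Fin n → ι × ℝ, (∏ a ∈ A, D.act (x a)) *
      (Real.exp (-(∑ a ∈ A, ∑ b ∈ A, D.gas.ker (x a) (x b)) / 2) : ℝ) =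
      ∫ τ, ∏ a, (if a ∈ A then D.act (x a) * Complex.exp (Complex.I *
        ((x a).2 * D.str (x a).1 * Gam (D.mom (x a).1) τ : ℝ)) else 1) ∂fieldMeasure := by
    intro x
    have h := integral_exp_fieldMeasure A (fun a => D.mom (x a).1) fun a => (x a).2 * D.str (x a).1
    rw [show D.gas.ker = fun ξ ξ' => ξ.2 * D.str ξ.1 * (ξ'.2 * D.str ξ'.1) *
      overlap (D.mom ξ.1) (D.mom ξ'.1) from rfl, ← h, ← integral_const_mul]
    refine integral_congr_ae (ae_of_all _ fun τ => ?_)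
    simp only
    rw [Finset.prod_ite_mem, Finset.univ_inter, Finset.prod_mul_distrib, ← Complex.exp_sum,
      Complex.ofReal_sum, Finset.mul_sum]
  have h2 : D.gas.moment A = ∫ x : Fin n → ι × ℝ, (∏ a ∈ A, D.act (x a)) *
      (Real.exp (-(∑ a ∈ A, ∑ b ∈ A, D.gas.ker (x a) (x b)) / 2) : ℝ)
      ∂Measure.pi fun _ => markLaw ι := rfl
  rw [h2]
  simp_rw [h1]
  rw [integral_integral_swap (f := fun (x : Fin n → ι × ℝ) (τ : Field) =>
    ∏ a, (if a ∈ A then D.act (x a) * Complex.exp (Complex.I *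
        ((x a).2 * D.str (x a).1 * Gam (D.mom (x a).1) τ : ℝ)) else 1))]
  · refine integral_congr_ae (ae_of_all _ fun τ => ?_)
    simp only
    rw [integral_fintype_prod_eq_prod (𝕜 := ℂ) (μ := fun _ => markLaw ι) fun a (ξ : ι × ℝ) =>
      if a ∈ A then D.act ξ * Complex.exp (Complex.I *
        (ξ.2 * D.str ξ.1 * Gam (D.mom ξ.1) τ : ℝ)) else 1]
    have : ∀ a : Fin n, ∫ ξ, (if a ∈ A then D.act ξ * Complex.exp (Complex.I *
        (ξ.2 * D.str ξ.1 * Gam (D.mom ξ.1) τ : ℝ)) else 1) ∂markLaw ι =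
        if a ∈ A then D.total τ else 1 := by
      intro a
      split_ifs
      · exact D.integral_act_phase τ
      · simp
    simp_rw [this]
    rw [Finset.prod_ite_mem, Finset.univ_inter, Finset.prod_const]
  · have hb : Integrable (fun x : Fin n → ι × ℝ => ∏ a, (if a ∈ A then D.act (x a) else 1))
        (Measure.pi fun _ => markLaw ι) := by
      refine Integrable.fintype_prod (f := fun a ξ => if a ∈ A then D.act ξ else 1) fun a => ?_
      by_cases ha : a ∈ A
      · simpa [ha] using D.integrable_act_law
      · simp [ha]
    refine (hb.comp_fst fieldMeasure).mono ?_ (ae_of_all _ fun q => ?_)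
    · refine Measurable.aestronglyMeasurable (Finset.measurable_fun_prod _ fun a _ => ?_)
      by_cases ha : a ∈ A
      · simp only [ha, if_true]
        exact (D.measurable_act.comp (by fun_prop : Measurable fun q : (Fin n → ι × ℝ) × Field =>
          q.1 a)).mul (D.measurable_phase.comp
            (by fun_prop : Measurable fun q : (Fin n → ι × ℝ) × Field => (q.1 a, q.2)))
      · simp [ha]
    · simp only [Function.uncurry, norm_prod]
      refine Finset.prod_le_prod (fun _ _ => norm_nonneg _) fun a _ => ?_
      split_ifs
      · rw [norm_mul, norm_exp_I_mul, mul_one]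
      · rfl

lemma norm_total_le (τ : Field) : ‖D.total τ‖ ≤ ∫ ξ, ‖D.act ξ‖ ∂markLaw ι := by
  rw [← D.integral_act_phase]
  refine (norm_integral_le_integral_norm _).trans_eq (integral_congr_ae (ae_of_all _ fun ξ => ?_))
  simp only
  rw [norm_mul, norm_exp_I_mul, mul_one]

lemma measurable_total : Measurable D.total := by
  have h : Measurable fun q : Field × ι × ℝ => D.act q.2 *
      Complex.exp (Complex.I * (q.2.2 * D.str q.2.1 * Gam (D.mom q.2.1) q.1 : ℝ)) :=
    (D.measurable_act.comp measurable_snd).mul (D.measurable_phase.comp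
      (by fun_prop : Measurable fun q : Field × ι × ℝ => (q.2, q.1)))
  have := (h.stronglyMeasurable.integral_prod_right' (ν := markLaw ι)).measurable
  simpa only [D.integral_act_phase] using this

lemma integrable_total_pow (n : ℕ) : Integrable (fun τ => D.total τ ^ n) fieldMeasure := by
  refine Integrable.of_bound (D.measurable_total.pow_const n).aestronglyMeasurable
    ((∫ ξ, ‖D.act ξ‖ ∂markLaw ι) ^ n) (ae_of_all _ fun τ => ?_)
  rw [norm_pow]
  exact pow_le_pow_left₀ (norm_nonneg _) (D.norm_total_le τ) n

lemma norm_integral_total_pow_le (n : ℕ) :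
    ‖∫ τ, D.total τ ^ n ∂fieldMeasure‖ ≤ (∫ ξ, ‖D.act ξ‖ ∂markLaw ι) ^ n := by
  refine (norm_integral_le_of_norm_le_const (C := (∫ ξ, ‖D.act ξ‖ ∂markLaw ι) ^ n)
    (ae_of_all _ fun τ => ?_)).trans (by simp)
  rw [norm_pow]
  exact pow_le_pow_left₀ (norm_nonneg _) (D.norm_total_le τ) n

/-- The expectation of the exponential of the sum of the vertices. -/
theorem integral_exp_total (h : Summable fun n : ℕ =>
    ‖D.gas.cumulant (n + 1) / ((n + 1)! : ℂ)‖ * 2 ^ (n + 1)) :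
    ∫ τ, Complex.exp (D.total τ) ∂fieldMeasure =
      Complex.exp (∑' n : ℕ, D.gas.cumulant (n + 1) / ((n + 1)! : ℂ)) := by
  set z : ℕ → ℂ := fun n => ∫ τ, D.total τ ^ n ∂fieldMeasure with hz
  set B := ∫ ξ, ‖D.act ξ‖ ∂markLaw ι with hB
  have hB0 : 0 ≤ B := integral_nonneg fun _ => norm_nonneg _
  have hzm : ∀ (n : ℕ) (A : Finset (Fin n)), D.gas.moment A = z A.card := fun n A => D.moment_gas A
  have hsum : Summable fun n : ℕ => (2 * B) ^ n / (n ! : ℝ) := Real.summable_pow_div_factorial _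
  have hexp : ∫ τ, Complex.exp (D.total τ) ∂fieldMeasure = ∑' n, z n / n ! := by
    have h1 : ∀ τ, Complex.exp (D.total τ) = ∑' n : ℕ, D.total τ ^ n / (n ! : ℂ) := fun τ => by
      rw [Complex.exp_eq_exp_ℂ, NormedSpace.exp_eq_tsum_div]
    simp_rw [h1]
    rw [← integral_tsum_of_summable_integral_norm
      (fun n => (D.integrable_total_pow n).div_const _)]
    · exact tsum_congr fun n => integral_div _ _
    · refine (Real.summable_pow_div_factorial B).of_nonneg_of_le
        (fun n => integral_nonneg fun _ => norm_nonneg _) fun n => ?_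
      refine (le_abs_self _).trans ?_
      refine (norm_integral_le_of_norm_le_const (C := B ^ n / (n ! : ℝ))
        (f := fun τ => ‖D.total τ ^ n / (n ! : ℂ)‖) (ae_of_all fieldMeasure fun τ => ?_)).trans
          (by simp)
      rw [norm_norm, norm_div, norm_pow, Complex.norm_natCast]
      have := D.norm_total_le τ
      gcongr
  rw [hexp]
  refine tsum_eq_exp_of_recursion (by simp [hz]) (D.gas.moment_succ hzm) ?_ h
  refine hsum.of_nonneg_of_le (fun n => by positivity) fun n => ?_
  rw [norm_div, Complex.norm_natCast, div_mul_eq_mul_div, mul_pow, mul_comm]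
  have := D.norm_integral_total_pow_le n
  gcongr

/-- The contribution of a tree and an assignment of species to its vertices. -/
def treeTerm {ι : Type} (D : VertexData ι) {n : ℕ} (F : Finset (Sym2 (Fin n))) (c : Fin n → ι) : ℂ :=
  (∏ l ∈ F, lineOverlap (fun a => D.mom (c a)) l : ℝ) * ∫ w, ∫ τ,
    ∏ a, D.vertex (c a) (lineCount F a) (Gam (D.mom (c a)) (fun iq => τ iq a))
      ∂replicaLaw (Matrix.of fun a b => linkMat F w a b) ∂edgeMeasure 0 F

lemma inter_eq {n : ℕ} (c : Fin n → ι) (α : Fin n → ℝ) (l : Sym2 (Fin n)) :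
    D.gas.inter (fun a => (c a, α a)) l = -(Sym2.lift ⟨fun a b => α a * D.str (c a) *
      (α b * D.str (c b)), fun _ _ => mul_comm _ _⟩ l * lineOverlap (fun a => D.mom (c a)) l) := by
  induction l with | _ a b => rfl

theorem cumulant_eq_sum (n : ℕ) : D.gas.cumulant n =
    ∑ F ∈ trees (Finset.univ : Finset (Fin n)), ∑ c : Fin n → ι, D.treeTerm F c := by
  have h0 : ∀ x : Fin n → ι × ℝ, D.gas.treeIntegrand Finset.univ x =
      ∑ F ∈ trees (Finset.univ : Finset (Fin n)), (∏ a, D.act (x a)) *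
        (D.gas.selfWeight Finset.univ x * forestTerm (pairs Finset.univ) (D.gas.inter x) 0 F : ℝ) := by
    intro x
    rw [MarkGas.treeIntegrand, treeSum, Finset.mul_sum, Complex.ofReal_sum, Finset.mul_sum]
    rfl
  have hi : ∀ F ∈ trees (Finset.univ : Finset (Fin n)), Integrable (fun x : Fin n → ι × ℝ =>
      (∏ a, D.act (x a)) * (D.gas.selfWeight Finset.univ x *
        forestTerm (pairs Finset.univ) (D.gas.inter x) 0 F : ℝ)) (Measure.pi fun _ => markLaw ι) := by
    intro F hF
    have hd : ∀ l ∈ F, ¬ l.IsDiag := fun l hl =>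
      not_isDiag_of_mem_pairs l ((mem_forests.1 (mem_trees.1 hF).1).1 hl)
    have h := D.gas.integrable_prod_act (V := Fin n) Finset.univ
      (fun a => lineCount F a) (by simp)
    refine h.mono ?_ (ae_of_all _ fun x => ?_)
    · refine Measurable.aestronglyMeasurable (Measurable.mul ?_ ?_)
      · exact Finset.measurable_fun_prod _ fun a _ => D.measurable_act.comp (measurable_pi_apply a)
      · exact Complex.measurable_ofReal.comp
          ((D.gas.measurable_selfWeight _).mul (D.gas.measurable_forestTerm _ F))
    · have h1 := D.gas.abs_selfWeight_mul_forestTerm_le Finset.univ x F hd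
      rw [norm_mul, norm_prod, Complex.norm_real]
      refine (mul_le_mul_of_nonneg_left h1 (Finset.prod_nonneg fun _ _ => norm_nonneg _)).trans ?_
      exact le_abs_self _
  rw [MarkGas.cumulant, MarkGas.treeMoment]
  simp_rw [h0]
  refine (integral_finsetSum (μ := Measure.pi fun _ => markLaw ι) _ hi).trans ?_
  refine Finset.sum_congr rfl fun F hF => ?_
  have hd : ∀ l ∈ F, ¬ l.IsDiag := fun l hl =>
    not_isDiag_of_mem_pairs l ((mem_forests.1 (mem_trees.1 hF).1).1 hl)
  refine (integral_pi_markLaw (hi F hF)).trans (Finset.sum_congr rfl fun c _ => ?_)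
  have ht := tree_term F hd (fun a => D.mom (c a)) (fun a => D.str (c a)) expLaw
    (fun a α => D.act (c a, α)) fun a d => D.integrable_act (c a) d
  have hl : ∀ α : Fin n → ℝ, D.gas.selfWeight Finset.univ (fun a => (c a, α a)) *
      forestTerm (pairs Finset.univ) (D.gas.inter fun a => (c a, α a)) 0 F =
      (∏ l ∈ F, -(Sym2.lift ⟨fun a b => α a * D.str (c a) * (α b * D.str (c b)),
        fun _ _ => mul_comm _ _⟩ l * lineOverlap (fun a => D.mom (c a)) l)) *
      ∫ w, Real.exp (-(∑ a, ∑ b, linkMat F w a b * (α a * D.str (c a) * (α b * D.str (c b)) *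
        overlap (D.mom (c a)) (D.mom (c b)))) / 2) ∂edgeMeasure 0 F := by
    intro α
    rw [forestTerm, mul_left_comm, ← integral_const_mul]
    simp only [D.gas.selfWeight_mul_exp_energy, D.inter_eq]
    rfl
  simp_rw [hl]
  rw [ht, treeTerm]
  simp only [D.integral_act, Finset.prod_mul_distrib, Finset.prod_const, Finset.card_univ,
    Fintype.card_fin, integral_const_mul]
  have hc : ((Fintype.card ι : ℂ)⁻¹) ^ n * (Fintype.card ι : ℂ) ^ n = 1 := by
    rw [← mul_pow, inv_mul_cancel₀ (by simp), one_pow]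
  linear_combination (∏ l ∈ F, lineOverlap (fun a => D.mom (c a)) l : ℝ) * (∫ w, ∫ τ,
    ∏ a, D.vertex (c a) (lineCount F a) (Gam (D.mom (c a)) (fun iq => τ iq a))
      ∂replicaLaw (Matrix.of fun a b => linkMat F w a b) ∂edgeMeasure 0 F) * hc

end VertexData

end SpeciesGas

/-! ### The vertices of the expansion -/

section Laplace

lemma integrableOn_pow_mul_exp {ρ : ℂ} (hρ : 0 < ρ.re) (n : ℕ) :
    IntegrableOn (fun α : ℝ => (α : ℂ) ^ n * Complex.exp (-(ρ * α))) (Set.Ioi 0) := by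
  have h := integrableOn_rpow_mul_exp_neg_mul_rpow (s := n) (p := 1) (b := ρ.re)
    (by have : (0 : ℝ) ≤ n := Nat.cast_nonneg n
        linarith) one_pos hρ
  refine Integrable.mono' h (Measurable.aestronglyMeasurable (by fun_prop)) ?_
  filter_upwards [ae_restrict_mem measurableSet_Ioi] with α hα
  rw [norm_mul, norm_pow, Complex.norm_real, Complex.norm_exp, Real.norm_of_nonneg (le_of_lt hα)]
  simp

lemma integral_pow_mul_exp {ρ : ℂ} (hρ : 0 < ρ.re) (n : ℕ) :
    ∫ α : ℝ in Set.Ioi 0, (α : ℂ) ^ n * Complex.exp (-(ρ * α)) = (n ! : ℂ) / ρ ^ (n + 1) := by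
  have hρ0 : ρ ≠ 0 := fun h => by simp [h] at hρ
  have hlim : ∀ n : ℕ, Tendsto (fun α : ℝ => (α : ℂ) ^ n * Complex.exp (-(ρ * α))) atTop (𝓝 0) := by
    intro n
    rw [tendsto_zero_iff_norm_tendsto_zero]
    have h := Real.tendsto_pow_mul_exp_neg_atTop_nhds_zero n
    have h2 := (h.comp (tendsto_id.const_mul_atTop hρ)).const_mul ((ρ.re ^ n)⁻¹)
    rw [mul_zero] at h2
    refine h2.congr' ?_
    filter_upwards [eventually_gt_atTop 0] with α hα
    rw [norm_mul, norm_pow, Complex.norm_real, Complex.norm_exp, Real.norm_of_nonneg hα.le]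
    simp only [Function.comp, id, mul_pow, Complex.neg_re, Complex.mul_re, Complex.ofReal_re,
      Complex.ofReal_im, mul_zero, sub_zero]
    rw [← mul_assoc, inv_mul_cancel_left₀ (pow_ne_zero _ hρ.ne')]
  have hexp : ∀ α : ℝ, HasDerivAt (fun α : ℝ => Complex.exp (-(ρ * α)))
      (Complex.exp (-(ρ * α)) * -(ρ * 1)) α := fun α =>
    (((hasDerivAt_id' α).ofReal_comp.const_mul ρ).fun_neg).cexp
  induction n with
  | zero =>
    have h := integral_Ioi_of_hasDerivAt_of_tendsto (a := (0 : ℝ)) (m := (0 : ℂ))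
      (f := fun α : ℝ => Complex.exp (-(ρ * α))) (f' := fun α => Complex.exp (-(ρ * α)) * -(ρ * 1))
      (by fun_prop) (fun α _ => hexp α)
      (by simpa [IntegrableOn] using (integrableOn_pow_mul_exp hρ 0).mul_const (-(ρ * 1)))
      (by simpa using hlim 0)
    rw [integral_mul_const] at h
    simp only [pow_zero, one_mul, Nat.factorial_zero, zero_add, pow_one, Nat.cast_one]
    rw [eq_div_iff hρ0]
    simp only [Complex.ofReal_zero, mul_zero, neg_zero, Complex.exp_zero] at h
    linear_combination -h
  | succ n ih =>
    have h := integral_Ioi_of_hasDerivAt_of_tendsto (a := (0 : ℝ)) (m := (0 : ℂ))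
      (f := fun α : ℝ => (α : ℂ) ^ (n + 1) * Complex.exp (-(ρ * α)))
      (f' := fun α : ℝ => ((n + 1 : ℕ) * (α : ℂ) ^ n * 1) * Complex.exp (-(ρ * α)) +
        (α : ℂ) ^ (n + 1) * (Complex.exp (-(ρ * α)) * -(ρ * 1)))
      (Continuous.continuousWithinAt (by fun_prop))
      (fun α _ => by
        have := ((hasDerivAt_id' α).ofReal_comp.fun_pow (n + 1)).fun_mul (hexp α)
        simpa using this)
      (by
        have h1 := (integrableOn_pow_mul_exp hρ n).const_mul ((n + 1 : ℕ) : ℂ)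
        have h2 := (integrableOn_pow_mul_exp hρ (n + 1)).mul_const (-(ρ * 1))
        refine (h1.add h2).congr (ae_of_all _ fun α => ?_)
        simp only [Pi.add_apply]
        ring) (hlim (n + 1))
    have h3 : ∫ α : ℝ in Set.Ioi 0, (((n + 1 : ℕ) * (α : ℂ) ^ n * 1) * Complex.exp (-(ρ * α)) +
        (α : ℂ) ^ (n + 1) * (Complex.exp (-(ρ * α)) * -(ρ * 1))) =
        ((n + 1 : ℕ) : ℂ) * (∫ α : ℝ in Set.Ioi 0, (α : ℂ) ^ n * Complex.exp (-(ρ * α))) +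
        (∫ α : ℝ in Set.Ioi 0, (α : ℂ) ^ (n + 1) * Complex.exp (-(ρ * α))) * -(ρ * 1) := by
      rw [← integral_const_mul, ← integral_mul_const, ← integral_add
        ((integrableOn_pow_mul_exp hρ n).const_mul ((n + 1 : ℕ) : ℂ))
        ((integrableOn_pow_mul_exp hρ (n + 1)).mul_const (-(ρ * 1)))]
      refine integral_congr_ae (ae_of_all _ fun α => ?_)
      simp only
      ring
    rw [h3, ih] at h
    rw [eq_div_iff (pow_ne_zero _ hρ0), Nat.factorial_succ]
    push_cast at h ⊢
    field_simp at h
    simp only [ne_eq, Nat.add_eq_zero_iff, one_ne_zero, and_false, not_false_eq_true, zero_pow,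
      zero_mul, sub_zero, mul_zero] at h
    linear_combination -h

lemma integral_pow_mul_exp_real {r : ℝ} (hr : 0 < r) (n : ℕ) :
    ∫ α : ℝ in Set.Ioi 0, α ^ n * Real.exp (-(r * α)) = (n ! : ℝ) / r ^ (n + 1) := by
  have h := integral_pow_mul_exp (ρ := (r : ℂ)) (by simpa using hr) n
  rw [← Complex.ofReal_inj, ← integral_complex_ofReal]
  push_cast
  exact h

lemma integrableOn_pow_mul_exp_real {r : ℝ} (hr : 0 < r) (n : ℕ) :
    IntegrableOn (fun α : ℝ => α ^ n * Real.exp (-(r * α))) (Set.Ioi 0) := by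
  have h := (integrableOn_pow_mul_exp (ρ := (r : ℂ)) (by simpa using hr) n).norm
  refine h.congr ?_
  filter_upwards [ae_restrict_mem measurableSet_Ioi] with α hα
  rw [norm_mul, norm_pow, Complex.norm_real, Complex.norm_exp, Real.norm_of_nonneg (le_of_lt hα)]
  simp

end Laplace

section Resolvent

variable {m : ℝ} {lam : ℂ}

lemma propagator_pos (hm : 0 < m) (p : Momentum) : 0 < propagator m p := by
  unfold propagator
  have : 0 ≤ ∑ i, ((p.1 i : ℤ) : ℝ) ^ 2 := Finset.sum_nonneg fun _ _ => sq_nonneg _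
  positivity

/-- `cos (φ / 2)`, where `φ = arg λ`. -/
def cosHalf (lam : ℂ) : ℝ := Real.cos (lam.arg / 2)

/-- `exp (-i φ / 2)`, where `φ = arg λ`. -/
def rot (lam : ℂ) : ℂ := Complex.exp (-(Complex.I * (lam.arg / 2 : ℝ)))

/-- The modulus `√(2|λ|)` of `i √(2λ)`. -/
def cpl (lam : ℂ) : ℝ := Real.sqrt (2 * ‖lam‖)

lemma cpl_nonneg (lam : ℂ) : 0 ≤ cpl lam := Real.sqrt_nonneg _

lemma cpl_sq (lam : ℂ) : cpl lam ^ 2 = 2 * ‖lam‖ := Real.sq_sqrt (by positivity)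

lemma re_rot (lam : ℂ) : (rot lam).re = cosHalf lam := by
  rw [rot, ← mul_neg, ← Complex.ofReal_neg, mul_comm, Complex.exp_ofReal_mul_I_re, Real.cos_neg,
    cosHalf]

lemma norm_rot (lam : ℂ) : ‖rot lam‖ = 1 := by
  rw [rot, ← mul_neg, ← Complex.ofReal_neg, norm_exp_I_mul]

lemma zeta_mul_rot (lam : ℂ) : zeta lam * rot lam = Complex.I * cpl lam := by
  rw [zeta, mul_assoc]
  congr 1
  rcases eq_or_ne lam 0 with rfl | h
  · simp [cpl]
  have h2 : (2 * lam : ℂ) ≠ 0 := by simp [h]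
  have harg : (2 * lam : ℂ).arg = lam.arg := by
    have := Complex.arg_real_mul lam (r := 2) two_pos
    simpa using this
  have hlog : Complex.log (2 * lam) = (Real.log (2 * ‖lam‖) : ℝ) + lam.arg * Complex.I := by
    rw [Complex.log, harg, norm_mul]
    simp
  rw [Complex.cpow_def_of_ne_zero h2, rot, ← Complex.exp_add, hlog, cpl,
    Real.sqrt_eq_rpow, Real.rpow_def_of_pos (by positivity), Complex.ofReal_exp]
  congr 1
  push_cast
  ring

lemma zeta_sq (lam : ℂ) : zeta lam ^ 2 = -2 * lam := by
  rw [zeta, mul_pow, Complex.I_sq, ← Complex.cpow_nat_mul]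
  simp

lemma norm_zeta (lam : ℂ) : ‖zeta lam‖ = cpl lam := by
  have h := congrArg norm (zeta_mul_rot lam)
  rw [norm_mul, norm_rot, mul_one, norm_mul, Complex.norm_I, one_mul, Complex.norm_real,
    Real.norm_of_nonneg (cpl_nonneg lam)] at h
  exact h

lemma rot_ne_zero (lam : ℂ) : rot lam ≠ 0 := Complex.exp_ne_zero _

/-- The coupling of a vertex to the field. -/
def strength (m : ℝ) (lam : ℂ) (p : Momentum) : ℝ := cpl lam * propagator m p

lemma strength_nonneg (hm : 0 < m) (p : Momentum) : 0 ≤ strength m lam p :=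
  mul_nonneg (cpl_nonneg lam) (propagator_pos hm p).le

lemma rot_mul_denom (p : Momentum) (s : ℝ) :
    rot lam * denom m lam p s = rot lam - Complex.I * (strength m lam p * s : ℝ) := by
  rw [denom, strength]
  push_cast
  linear_combination -(propagator m p : ℂ) * s * zeta_mul_rot lam

lemma re_rot_sub (x : ℝ) : (rot lam - Complex.I * x).re = cosHalf lam := by
  simp [re_rot]

lemma cosHalf_le_norm_denom (p : Momentum) (s : ℝ) : cosHalf lam ≤ ‖denom m lam p s‖ := by
  have h : ‖denom m lam p s‖ = ‖rot lam * denom m lam p s‖ := by rw [norm_mul, norm_rot, one_mul]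
  rw [h, rot_mul_denom, ← re_rot_sub (lam := lam) (strength m lam p * s)]
  exact Complex.re_le_norm _

variable (hr : 0 < cosHalf lam)
include hr

lemma denom_ne_zero (p : Momentum) (s : ℝ) : denom m lam p s ≠ 0 :=
  norm_pos_iff.1 (hr.trans_le (cosHalf_le_norm_denom p s))

lemma denom_mem_slitPlane (p : Momentum) (s : ℝ) : denom m lam p s ∈ Complex.slitPlane := by
  rw [Complex.mem_slitPlane_iff]
  by_contra! h
  have h1 : (rot lam * denom m lam p s).re = cosHalf lam := by rw [rot_mul_denom, re_rot_sub]
  rw [Complex.mul_re, h.2, mul_zero, sub_zero, re_rot] at h1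
  nlinarith

lemma resolvent_eq (p : Momentum) (s : ℝ) : resolvent m lam p s =
    propagator m p * rot lam / (rot lam - Complex.I * (strength m lam p * s : ℝ)) := by
  have h := denom_ne_zero (m := m) hr p s
  have h' := rot_ne_zero lam
  rw [TGFT.resolvent, ← rot_mul_denom]
  field_simp

lemma norm_resolvent_le (hm : 0 < m) (p : Momentum) (s : ℝ) :
    ‖resolvent m lam p s‖ ≤ propagator m p / cosHalf lam := by
  rw [TGFT.resolvent, norm_div, Complex.norm_real, Real.norm_of_nonneg (propagator_pos hm p).le]
  exact div_le_div_of_nonneg_left (propagator_pos hm p).le hr (cosHalf_le_norm_denom p s)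

lemma continuous_resolvent (p : Momentum) : Continuous (resolvent m lam p) := by
  refine Continuous.div continuous_const ?_ (denom_ne_zero hr p)
  unfold denom
  fun_prop

lemma hasDerivAt_denom (p : Momentum) (s : ℝ) :
    HasDerivAt (denom m lam p) (-(zeta lam * propagator m p)) s := by
  have h := ((hasDerivAt_id' s).ofReal_comp.const_mul (zeta lam * (propagator m p : ℂ))).const_sub 1
  exact h.congr_deriv (by simp)

lemma hasDerivAt_resolvent (p : Momentum) (s : ℝ) :
    HasDerivAt (resolvent m lam p) (zeta lam * resolvent m lam p s ^ 2) s := by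
  have h := (hasDerivAt_denom hr p s).inv (denom_ne_zero (m := m) hr p s)
  have h2 := h.const_mul (propagator m p : ℂ)
  refine (h2.congr_of_eventuallyEq (f₁ := resolvent m lam p)
    (Eventually.of_forall fun s => ?_)).congr_deriv ?_
  · simp [TGFT.resolvent, div_eq_mul_inv]
  · have := denom_ne_zero (m := m) hr p s
    rw [TGFT.resolvent]
    field_simp

/-- The derivatives of the resolvent with respect to the field. -/
lemma iteratedDeriv_resolvent (p : Momentum) (d : ℕ) :
    iteratedDeriv d (resolvent m lam p) =
      fun s => (d ! : ℂ) * zeta lam ^ d * resolvent m lam p s ^ (d + 1) := by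
  induction d with
  | zero => funext s; simp
  | succ d ih =>
    funext s
    rw [iteratedDeriv_succ, ih]
    have h := ((hasDerivAt_resolvent (m := m) hr p s).fun_pow (d + 1)).const_mul ((d ! : ℂ) * zeta lam ^ d)
    refine h.deriv.trans ?_
    rw [Nat.factorial_succ]
    push_cast
    ring

lemma norm_iteratedDeriv_resolvent_le (hm : 0 < m) (p : Momentum) (d : ℕ) (s : ℝ) :
    ‖iteratedDeriv d (resolvent m lam p) s‖ ≤ (d ! : ℝ) * cpl lam ^ d *
      propagator m p ^ (d + 1) * (1 / cosHalf lam) ^ (d + 1) := by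
  rw [iteratedDeriv_resolvent hr, norm_mul, norm_mul, norm_pow, norm_pow, Complex.norm_natCast,
    norm_zeta, mul_assoc _ (propagator m p ^ (d + 1)), ← mul_pow, mul_one_div]
  have := norm_resolvent_le hr hm p s
  have := cpl_nonneg lam
  gcongr

end Resolvent

section Vertices

variable {m : ℝ} {lam : ℂ}

/-- The measure of which the `d`-th derivative of a loop vertex is the Fourier transform, with the
contribution of small parameters removed. -/
def loopDens (lam : ℂ) (ε α : ℝ) : ℂ := if ε < α then (α : ℂ)⁻¹ * Complex.exp (-(rot lam * α)) else 0

/-- The measure of which the resolvent is the Fourier transform. -/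
def ciliumDens (m : ℝ) (lam : ℂ) (p : Momentum) (α : ℝ) : ℂ :=
  propagator m p * rot lam * Complex.exp (-(rot lam * α))

lemma measurable_loopDens (lam : ℂ) (ε : ℝ) : Measurable (loopDens lam ε) := by
  unfold loopDens
  refine Measurable.ite measurableSet_Ioi ?_ measurable_const
  fun_prop

lemma measurable_ciliumDens (m : ℝ) (lam : ℂ) (p : Momentum) : Measurable (ciliumDens m lam p) := by
  unfold ciliumDens
  fun_prop

lemma norm_exp_rot (lam : ℂ) (α : ℝ) :
    ‖Complex.exp (-(rot lam * α))‖ = Real.exp (-(cosHalf lam * α)) := by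
  rw [Complex.norm_exp]
  simp [re_rot]

variable (hr : 0 < cosHalf lam)
include hr

lemma integrableOn_ciliumDens (p : Momentum) (d : ℕ) :
    IntegrableOn (fun α => ciliumDens m lam p α * (α : ℂ) ^ d) (Set.Ioi 0) := by
  refine ((integrableOn_pow_mul_exp (ρ := rot lam) (by rwa [re_rot]) d).const_mul
    (propagator m p * rot lam)).congr (ae_of_all _ fun α => ?_)
  simp only [ciliumDens]
  ring

lemma integrableOn_loopDens {ε : ℝ} (hε : 0 < ε) (d : ℕ) :
    IntegrableOn (fun α => loopDens lam ε α * (α : ℂ) ^ d) (Set.Ioi 0) := by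
  refine Integrable.mono' ((integrableOn_pow_mul_exp_real hr d).const_mul ε⁻¹)
    (Measurable.aestronglyMeasurable ?_) ?_
  · have := measurable_loopDens lam ε
    fun_prop
  · filter_upwards [ae_restrict_mem measurableSet_Ioi] with α hα
    have hα0 : 0 < α := hα
    rw [norm_mul, norm_pow, Complex.norm_real, Real.norm_of_nonneg hα0.le, loopDens]
    split_ifs with h
    · rw [norm_mul, norm_exp_rot, norm_inv, Complex.norm_real, Real.norm_of_nonneg hα0.le]
      have : α⁻¹ ≤ ε⁻¹ := inv_anti₀ hε h.le
      have h2 : 0 ≤ Real.exp (-(cosHalf lam * α)) * α ^ d := by positivity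
      nlinarith
    · rw [norm_zero, zero_mul]
      positivity

/-- The derivatives of the resolvent as Fourier transforms. -/
lemma integral_ciliumDens (p : Momentum) (d : ℕ) (s : ℝ) :
    ∫ α in Set.Ioi 0, ciliumDens m lam p α * (Complex.I * (α * strength m lam p : ℝ)) ^ d *
      Complex.exp (Complex.I * (α * strength m lam p * s : ℝ)) =
      (d ! : ℂ) * zeta lam ^ d * resolvent m lam p s ^ (d + 1) := by
  set ρ := rot lam - Complex.I * (strength m lam p * s : ℝ) with hρ
  have hρr : 0 < ρ.re := by rwa [hρ, re_rot_sub]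
  have hρ0 : ρ ≠ 0 := fun h => by simp [h] at hρr
  have h := integral_pow_mul_exp hρr d
  have h1 : ∀ α : ℝ, ciliumDens m lam p α * (Complex.I * (α * strength m lam p : ℝ)) ^ d *
      Complex.exp (Complex.I * (α * strength m lam p * s : ℝ)) =
      (propagator m p * rot lam * (Complex.I * strength m lam p) ^ d) *
        ((α : ℂ) ^ d * Complex.exp (-(ρ * α))) := by
    intro α
    have : Complex.exp (-(ρ * α)) = Complex.exp (-(rot lam * α)) *
        Complex.exp (Complex.I * (α * strength m lam p * s : ℝ)) := by
      rw [← Complex.exp_add, hρ]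
      congr 1
      push_cast
      ring
    rw [this, ciliumDens]
    push_cast
    ring
  simp_rw [h1]
  rw [integral_const_mul, h, resolvent_eq hr]
  have hz : Complex.I * (strength m lam p : ℂ) = zeta lam * (rot lam * propagator m p) := by
    rw [strength]
    push_cast
    linear_combination -(propagator m p : ℂ) * zeta_mul_rot lam
  rw [hz, ← hρ, div_pow, mul_pow, mul_pow, mul_pow]
  field_simp
  ring

/-- The derivatives of a loop vertex as Fourier transforms. -/
lemma integral_loop (p : Momentum) (d : ℕ) (s : ℝ) :
    ∫ α : ℝ in Set.Ioi 0, (α : ℂ)⁻¹ * Complex.exp (-(rot lam * α)) *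
      (Complex.I * (α * strength m lam p : ℝ)) ^ (d + 1) *
      Complex.exp (Complex.I * (α * strength m lam p * s : ℝ)) =
      (d ! : ℂ) * zeta lam ^ (d + 1) * resolvent m lam p s ^ (d + 1) := by
  set ρ := rot lam - Complex.I * (strength m lam p * s : ℝ) with hρ
  have hρr : 0 < ρ.re := by rwa [hρ, re_rot_sub]
  have hρ0 : ρ ≠ 0 := fun h => by simp [h] at hρr
  have h := integral_pow_mul_exp hρr d
  have h1 : ∀ α ∈ Set.Ioi (0 : ℝ), (α : ℂ)⁻¹ * Complex.exp (-(rot lam * α)) *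
      (Complex.I * (α * strength m lam p : ℝ)) ^ (d + 1) *
      Complex.exp (Complex.I * (α * strength m lam p * s : ℝ)) =
      (Complex.I * strength m lam p) ^ (d + 1) *
        ((α : ℂ) ^ d * Complex.exp (-(ρ * α))) := by
    intro α hα
    have hα0 : (α : ℂ) ≠ 0 := by exact_mod_cast (ne_of_gt hα)
    have : Complex.exp (-(ρ * α)) = Complex.exp (-(rot lam * α)) *
        Complex.exp (Complex.I * (α * strength m lam p * s : ℝ)) := by
      rw [← Complex.exp_add, hρ]
      congr 1
      push_cast
      ring
    rw [this]
    push_cast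
    simp only [mul_pow, pow_succ]
    field_simp
  rw [setIntegral_congr_fun measurableSet_Ioi h1, integral_const_mul, h, resolvent_eq hr]
  have hz : Complex.I * (strength m lam p : ℂ) = zeta lam * (rot lam * propagator m p) := by
    rw [strength]
    push_cast
    linear_combination -(propagator m p : ℂ) * zeta_mul_rot lam
  rw [hz, ← hρ, div_pow, mul_pow, mul_pow, mul_pow]
  field_simp

end Vertices

section LoopVertex

variable {m : ℝ} {lam : ℂ}

lemma norm_loopDens_le (lam : ℂ) {ε α : ℝ} (hα : 0 < α) :
    ‖loopDens lam ε α‖ ≤ α⁻¹ * Real.exp (-(cosHalf lam * α)) := by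
  rw [loopDens]
  split_ifs
  · rw [norm_mul, norm_exp_rot, norm_inv, Complex.norm_real, Real.norm_of_nonneg hα.le]
  · rw [norm_zero]
    positivity

lemma norm_exp_I_sub_one_sub_le (y : ℝ) :
    ‖Complex.exp (Complex.I * y) - 1 - Complex.I * y‖ ≤ 2 * y ^ 2 := by
  have hn : ‖Complex.I * (y : ℂ)‖ = |y| := by simp
  rcases le_or_gt |y| 1 with h | h
  · have := Complex.norm_exp_sub_one_sub_id_le (x := Complex.I * y) (by rwa [hn])
    rw [hn, sq_abs] at this
    nlinarith [sq_nonneg y]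
  · have h1 : ‖Complex.exp (Complex.I * y) - 1‖ ≤ |y| := Real.norm_exp_I_mul_ofReal_sub_one_le
    have h2 := norm_sub_le (Complex.exp (Complex.I * y) - 1) (Complex.I * y)
    rw [hn] at h2
    nlinarith [sq_abs y]

/-- A loop vertex, with the contribution of small parameters removed. -/
def loopFun (m : ℝ) (lam : ℂ) (ε : ℝ) (p : Momentum) (s : ℝ) : ℂ :=
  ∫ α in Set.Ioi 0, loopDens lam ε α *
    (Complex.exp (Complex.I * (α * strength m lam p * s : ℝ)) - 1)

/-- The coefficient of the linear part of a loop vertex. -/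
def loopLin (lam : ℂ) (ε : ℝ) : ℂ := ∫ α in Set.Ioi 0, loopDens lam ε α * (Complex.I * (α : ℝ))

/-- The `d`-th derivative of a loop vertex. -/
def loopVertex (m : ℝ) (lam : ℂ) (ε : ℝ) (p : Momentum) (d : ℕ) (s : ℝ) : ℂ :=
  ∫ α in Set.Ioi 0, loopDens lam ε α * (Complex.I * (α * strength m lam p : ℝ)) ^ d *
    Complex.exp (Complex.I * (α * strength m lam p * s : ℝ))

variable (hr : 0 < cosHalf lam)
include hr

lemma integrableOn_loopDens_mul (ε : ℝ) {f : ℝ → ℂ} (hf : Measurable f) {c : ℝ} (n : ℕ)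
    (hb : ∀ α ∈ Set.Ioi (0 : ℝ), ‖f α‖ ≤ c * α ^ (n + 1)) :
    IntegrableOn (fun α => loopDens lam ε α * f α) (Set.Ioi 0) := by
  refine Integrable.mono' ((integrableOn_pow_mul_exp_real hr n).const_mul c)
    ((measurable_loopDens lam ε).mul hf).aestronglyMeasurable ?_
  filter_upwards [ae_restrict_mem measurableSet_Ioi] with α hα
  have hα0 : 0 < α := hα
  rw [norm_mul]
  refine (mul_le_mul (norm_loopDens_le lam hα0) (hb α hα) (norm_nonneg _) (by positivity)).trans_eq ?_
  rw [pow_succ]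
  field_simp

lemma norm_integral_loopDens_mul_le (ε : ℝ) {f : ℝ → ℂ} {c : ℝ} (n : ℕ)
    (hb : ∀ α ∈ Set.Ioi (0 : ℝ), ‖f α‖ ≤ c * α ^ (n + 1)) :
    ‖∫ α in Set.Ioi 0, loopDens lam ε α * f α‖ ≤ c * ((n ! : ℝ) / cosHalf lam ^ (n + 1)) := by
  rw [← integral_pow_mul_exp_real hr, ← integral_const_mul]
  refine norm_integral_le_of_norm_le ((integrableOn_pow_mul_exp_real hr n).const_mul c) ?_
  filter_upwards [ae_restrict_mem measurableSet_Ioi] with α hα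
  have hα0 : 0 < α := hα
  rw [norm_mul]
  refine (mul_le_mul (norm_loopDens_le lam hα0) (hb α hα) (norm_nonneg _) (by positivity)).trans_eq ?_
  rw [pow_succ]
  field_simp

lemma norm_phase_sub_one_le (hm : 0 < m) (p : Momentum) (s : ℝ) {α : ℝ} (hα : 0 < α) :
    ‖Complex.exp (Complex.I * (α * strength m lam p * s : ℝ)) - 1‖ ≤
      (strength m lam p * |s|) * α ^ (0 + 1) := by
  refine Real.norm_exp_I_mul_ofReal_sub_one_le.trans_eq ?_
  rw [Real.norm_eq_abs, abs_mul, abs_mul, abs_of_pos hα, abs_of_nonneg (strength_nonneg hm p)]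
  ring

lemma norm_loopVertex_succ_le (hm : 0 < m) (ε : ℝ) (p : Momentum) (d : ℕ) (s : ℝ) :
    ‖loopVertex m lam ε p (d + 1) s‖ ≤ (d ! : ℝ) * (strength m lam p / cosHalf lam) ^ (d + 1) := by
  simp only [loopVertex, mul_assoc (loopDens lam ε _)]
  refine (norm_integral_loopDens_mul_le hr ε (c := strength m lam p ^ (d + 1)) d
    fun α hα => ?_).trans_eq ?_
  · have hα0 : 0 < α := hα
    have := strength_nonneg (lam := lam) hm p
    rw [norm_mul, norm_pow, norm_exp_I_mul, norm_mul, Complex.norm_I, one_mul, Complex.norm_real,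
      Real.norm_of_nonneg (by positivity), mul_one, mul_pow, mul_comm]
  · rw [div_pow]
    ring

lemma norm_loopLin_le (ε : ℝ) : ‖loopLin lam ε‖ ≤ 1 / cosHalf lam := by
  refine (norm_integral_loopDens_mul_le hr ε (c := 1) 0 fun α hα => ?_).trans_eq (by simp)
  have hα0 : 0 < α := hα
  simp [abs_of_pos hα0]

lemma norm_loopFun_sub_le (hm : 0 < m) (ε : ℝ) (p : Momentum) (s : ℝ) :
    ‖loopFun m lam ε p s - loopLin lam ε * (strength m lam p * s : ℝ)‖ ≤
      2 * (strength m lam p * s) ^ 2 / cosHalf lam ^ 2 := by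
  rw [loopFun, loopLin, ← integral_mul_const, ← integral_sub]
  · have h : ∀ α : ℝ, loopDens lam ε α * (Complex.exp (Complex.I * (α * strength m lam p * s : ℝ)) - 1) -
        loopDens lam ε α * (Complex.I * (α : ℝ)) * (strength m lam p * s : ℝ) = loopDens lam ε α *
        (Complex.exp (Complex.I * (α * strength m lam p * s : ℝ)) - 1 -
          Complex.I * (α * strength m lam p * s : ℝ)) := by
      intro α
      push_cast
      ring
    simp_rw [h]
    refine (norm_integral_loopDens_mul_le hr ε (c := 2 * (strength m lam p * s) ^ 2) 1
      fun α hα => ?_).trans_eq (by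
        rw [Nat.factorial_one, Nat.cast_one]
        ring)
    refine (norm_exp_I_sub_one_sub_le _).trans_eq (by ring)
  · exact integrableOn_loopDens_mul hr ε (by fun_prop) 0 fun α hα =>
      norm_phase_sub_one_le hr hm p s hα
  · refine Integrable.mul_const (integrableOn_loopDens_mul hr ε (c := 1) (by fun_prop) 0
      fun α hα => ?_) _
    have hα0 : 0 < α := hα
    simp [abs_of_pos hα0]

lemma norm_loopFun_sub_zero_le (hm : 0 < m) {ε : ℝ} (hε : 0 ≤ ε) (p : Momentum) (s : ℝ) :
    ‖loopFun m lam ε p s - loopFun m lam 0 p s‖ ≤ ε * (strength m lam p * |s|) := by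
  have hi := fun ε => integrableOn_loopDens_mul hr ε (by fun_prop : Measurable fun α : ℝ =>
    Complex.exp (Complex.I * (α * strength m lam p * s : ℝ)) - 1) 0 fun α hα =>
      norm_phase_sub_one_le hr hm p s hα
  have hs := strength_nonneg (lam := lam) hm p
  rw [loopFun, loopFun, ← integral_sub (hi ε) (hi 0)]
  have h : ∀ α ∈ Set.Ioi (0 : ℝ), ‖loopDens lam ε α *
      (Complex.exp (Complex.I * (α * strength m lam p * s : ℝ)) - 1) - loopDens lam 0 α *
      (Complex.exp (Complex.I * (α * strength m lam p * s : ℝ)) - 1)‖ ≤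
      (Set.Ioc 0 ε).indicator (fun _ => strength m lam p * |s|) α := by
    intro α hα
    have hα0 : 0 < α := hα
    rw [← sub_mul, norm_mul]
    by_cases h : ε < α
    · rw [loopDens, loopDens, if_pos h, if_pos hα0, sub_self, norm_zero, zero_mul]
      exact Set.indicator_nonneg (fun _ _ => by positivity) _
    · rw [Set.indicator_of_mem (Set.mem_Ioc.2 ⟨hα0, not_lt.1 h⟩), loopDens, if_neg h, zero_sub, norm_neg]
      refine (mul_le_mul (norm_loopDens_le lam hα0) (norm_phase_sub_one_le hr hm p s hα0)
        (norm_nonneg _) (by positivity)).trans ?_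
      have h1 : Real.exp (-(cosHalf lam * α)) ≤ 1 := Real.exp_le_one_iff.2 (by
        have := mul_pos hr hα0
        linarith)
      calc _ = Real.exp (-(cosHalf lam * α)) * (strength m lam p * |s|) := by field_simp; ring
        _ ≤ _ := mul_le_of_le_one_left (by positivity) h1
  refine (norm_integral_le_of_norm_le (g := (Set.Ioc 0 ε).indicator
    fun _ => strength m lam p * |s|) ?_ ?_).trans_eq ?_
  · refine IntegrableOn.integrable_indicator ?_ measurableSet_Ioc
    exact integrableOn_const (by
      refine ((Measure.restrict_apply_le _ _).trans_lt ?_).ne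
      simp)
  · filter_upwards [ae_restrict_mem measurableSet_Ioi] with α hα using h α hα
  · rw [integral_indicator measurableSet_Ioc, Measure.restrict_restrict measurableSet_Ioc,
      Set.inter_eq_self_of_subset_left fun x hx => hx.1, setIntegral_const]
    simp [hε]

lemma tendsto_loopVertex (hm : 0 < m) (p : Momentum) (d : ℕ) (s : ℝ) :
    Tendsto (fun ε => loopVertex m lam ε p (d + 1) s) (𝓝 0)
      (𝓝 ((d ! : ℂ) * zeta lam ^ (d + 1) * TGFT.resolvent m lam p s ^ (d + 1))) := by
  rw [← integral_loop hr]
  refine tendsto_integral_filter_of_dominated_convergence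
    (fun α => strength m lam p ^ (d + 1) * (α ^ d * Real.exp (-(cosHalf lam * α))))
    (Eventually.of_forall fun ε => Measurable.aestronglyMeasurable ?_)
    (Eventually.of_forall fun ε => ?_) ((integrableOn_pow_mul_exp_real hr d).const_mul _) ?_
  · have := measurable_loopDens lam ε
    fun_prop
  · filter_upwards [ae_restrict_mem measurableSet_Ioi] with α hα
    have hα0 : 0 < α := hα
    have := strength_nonneg (lam := lam) hm p
    rw [norm_mul, norm_mul, norm_pow, norm_exp_I_mul, norm_mul, Complex.norm_I, one_mul,
      Complex.norm_real, Real.norm_of_nonneg (by positivity), mul_one]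
    refine (mul_le_mul_of_nonneg_right (norm_loopDens_le lam hα0) (by positivity)).trans_eq ?_
    rw [mul_pow, pow_succ α]
    field_simp
  · filter_upwards [ae_restrict_mem measurableSet_Ioi] with α hα
    refine tendsto_const_nhds.congr' ?_
    filter_upwards [eventually_lt_nhds hα] with ε hε
    rw [loopDens, if_pos hε]

lemma hasDerivAt_loopFun_zero (hm : 0 < m) (p : Momentum) (s : ℝ) :
    HasDerivAt (loopFun m lam 0 p) (zeta lam * TGFT.resolvent m lam p s) s := by
  have h := integral_loop (m := m) hr p 0 s
  simp only [zero_add, pow_one, Nat.factorial_zero, Nat.cast_one, one_mul] at h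
  rw [← h]
  have hd : ∀ α ∈ Set.Ioi (0 : ℝ), (α : ℂ)⁻¹ * Complex.exp (-(rot lam * α)) =
      loopDens lam 0 α := fun α hα => by
    rw [loopDens, if_pos (Set.mem_Ioi.1 hα)]
  have h2 := hasDerivAt_integral_of_dominated_loc_of_deriv_le (𝕜 := ℝ) (x₀ := s) (s := Set.univ)
    (μ := volume.restrict (Set.Ioi 0))
    (F := fun s α => loopDens lam 0 α *
      (Complex.exp (Complex.I * (α * strength m lam p * s : ℝ)) - 1))
    (F' := fun s α => loopDens lam 0 α * (Complex.I * (α * strength m lam p : ℝ)) *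
      Complex.exp (Complex.I * (α * strength m lam p * s : ℝ)))
    (bound := fun α => strength m lam p * (α ^ 0 * Real.exp (-(cosHalf lam * α)))) Filter.univ_mem
    (Eventually.of_forall fun s => by
      have := measurable_loopDens lam 0
      exact Measurable.aestronglyMeasurable (by fun_prop))
    (integrableOn_loopDens_mul hr 0 (by fun_prop) 0 fun α hα => norm_phase_sub_one_le hr hm p s hα)
    (by
      have := measurable_loopDens lam 0
      exact Measurable.aestronglyMeasurable (by fun_prop))
    (by
      filter_upwards [ae_restrict_mem measurableSet_Ioi] with α hα s _
      have hα0 : 0 < α := hα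
      have := strength_nonneg (lam := lam) hm p
      rw [norm_mul, norm_mul, norm_exp_I_mul, norm_mul, Complex.norm_I, one_mul,
        Complex.norm_real, Real.norm_of_nonneg (by positivity), mul_one]
      refine (mul_le_mul_of_nonneg_right (norm_loopDens_le lam hα0) (by positivity)).trans_eq ?_
      field_simp)
    ((integrableOn_pow_mul_exp_real hr 0).const_mul _)
    (ae_of_all _ fun α s _ => by
      have h1 : HasDerivAt (fun s : ℝ => Complex.I * ((α * strength m lam p * s : ℝ) : ℂ))
          (Complex.I * ((α * strength m lam p * 1 : ℝ) : ℂ)) s :=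
        (((hasDerivAt_id' s).const_mul (α * strength m lam p)).ofReal_comp).const_mul Complex.I
      refine ((h1.cexp.sub_const 1).const_mul (loopDens lam 0 α)).congr_deriv ?_
      push_cast
      ring)
  refine h2.2.congr_deriv (setIntegral_congr_fun measurableSet_Ioi fun α hα => ?_)
  simp only [hd α hα]

/-- The loop vertex is `-ln (1 - i √(2λ) C₀ Γ)`. -/
theorem loopFun_zero (hm : 0 < m) (p : Momentum) (s : ℝ) :
    loopFun m lam 0 p s = -Complex.log (denom m lam p s) := by
  have h : ∀ s, HasDerivAt (fun s => loopFun m lam 0 p s + Complex.log (denom m lam p s)) 0 s := by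
    intro s
    have h2 := (hasDerivAt_denom (m := m) hr p s).clog_real (denom_mem_slitPlane hr p s)
    refine ((hasDerivAt_loopFun_zero hr hm p s).add h2).congr_deriv ?_
    rw [TGFT.resolvent]
    ring
  have h2 := is_const_of_deriv_eq_zero (fun s => (h s).differentiableAt) (fun s => (h s).deriv) s 0
  have h3 : loopFun m lam 0 p 0 = 0 := by simp [loopFun]
  have h4 : denom m lam p 0 = 1 := by simp [denom]
  simp only [h3, h4, Complex.log_one, add_zero] at h2
  linear_combination h2

lemma loopVertex_zero (hm : 0 < m) {ε : ℝ} (hε : 0 < ε) (p : Momentum) (s : ℝ) :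
    loopVertex m lam ε p 0 s = (∫ α in Set.Ioi 0, loopDens lam ε α) + loopFun m lam ε p s := by
  have h1 : IntegrableOn (loopDens lam ε) (Set.Ioi 0) := by
    simpa using integrableOn_loopDens hr hε 0
  rw [loopFun, ← integral_add h1 (integrableOn_loopDens_mul hr ε (by fun_prop) 0 fun α hα =>
    norm_phase_sub_one_le hr hm p s hα), loopVertex]
  refine integral_congr_ae (ae_of_all _ fun α => ?_)
  simp only
  ring

end LoopVertex

/-! ### Counting trees and summing over momenta -/

section Trees

open scoped Classical in
/-- The finite set of edges of a graph. -/
def treeEdges {n : ℕ} (T : SimpleGraph (Fin n)) : Finset (Sym2 (Fin n)) := T.edgeFinset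

lemma mem_treeEdges {n : ℕ} {T : SimpleGraph (Fin n)} {l : Sym2 (Fin n)} :
    l ∈ treeEdges T ↔ l ∈ T.edgeSet := by
  simp [treeEdges]

lemma not_isDiag_of_mem_treeEdges {n : ℕ} (T : SimpleGraph (Fin n)) :
    ∀ l ∈ treeEdges T, ¬ l.IsDiag := fun _ hl =>
  T.not_isDiag_of_mem_edgeSet (mem_treeEdges.1 hl)

lemma card_treeEdges {n : ℕ} {T : SimpleGraph (Fin n)} (hT : T.IsTree) :
    (treeEdges T).card + 1 = n := by
  classical
  simpa [treeEdges] using hT.card_edgeFinset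

/-- A rooted tree is described by the map from its vertices to their predecessors. -/
lemma exists_parent {n : ℕ} {T : SimpleGraph (Fin n)} (hT : T.IsTree) (r : Fin n) :
    ∃ (par : Fin n → Fin n) (rank : Fin n → ℕ), par r = r ∧ (∀ a, rank a = 0 ↔ a = r) ∧
      (∀ a, a ≠ r → rank (par a) < rank a) ∧
      treeEdges T = (Finset.univ.erase r).image (fun a => s(a, par a)) ∧
      Set.InjOn (fun a => s(a, par a)) (Finset.univ.erase r : Finset (Fin n)) := by
  classical
  have hc := hT.1
  have h : ∀ a, ∃ b, (a = r → b = r) ∧ (a ≠ r → T.Adj a b ∧ T.dist b r < T.dist a r) := by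
    intro a
    rcases eq_or_ne a r with rfl | ha
    · exact ⟨a, fun _ => rfl, fun h => absurd rfl h⟩
    · obtain ⟨p, hp⟩ := hc.exists_walk_length_eq_dist a r
      cases p with
      | nil => exact absurd rfl ha
      | cons hab q =>
        refine ⟨_, fun h => absurd h ha, fun _ => ⟨hab, ?_⟩⟩
        rw [SimpleGraph.Walk.length_cons] at hp
        have := SimpleGraph.dist_le q
        omega
  choose par hpar using h
  have hinj : Set.InjOn (fun a => s(a, par a)) (Finset.univ.erase r : Finset (Fin n)) := by
    intro a ha b hb hab
    simp only [Finset.coe_erase, Finset.coe_univ, Set.mem_sdiff, Set.mem_univ, true_and,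
      Set.mem_singleton_iff] at ha hb
    rcases Sym2.eq_iff.1 hab with h | h
    · exact h.1
    · have h1 := ((hpar a).2 ha).2
      have h2 := ((hpar b).2 hb).2
      rw [h.2] at h1
      rw [← h.1] at h2
      omega
  refine ⟨par, fun a => T.dist a r, (hpar r).1 rfl, fun a => ?_, fun a ha => ((hpar a).2 ha).2,
    ?_, hinj⟩
  · exact hc.dist_eq_zero_iff
  · symm
    refine Finset.eq_of_subset_of_card_le (fun l hl => ?_) ?_
    · obtain ⟨a, ha, rfl⟩ := Finset.mem_image.1 hl
      exact mem_treeEdges.2 ((hpar a).2 (Finset.ne_of_mem_erase ha)).1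
    · rw [Finset.card_image_of_injOn hinj, Finset.card_erase_of_mem (Finset.mem_univ _),
        Finset.card_univ, Fintype.card_fin]
      have := card_treeEdges hT
      omega

/-- The number of preimages. -/
abbrev fiberCard {k n : ℕ} (f : Fin k → Fin n) (a : Fin n) : ℕ :=
  (Finset.univ.filter fun b => f b = a).card

lemma sum_prod_factorial (n k : ℕ) :
    ∑ f : Fin k → Fin n, ∏ a, (fiberCard f a + 1)! = (2 * n).ascFactorial k := by
  induction k with
  | zero => simp [fiberCard]
  | succ k ih =>
    rw [Nat.ascFactorial_succ, ← ih, Finset.mul_sum,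
      ← (Fin.consEquiv fun _ : Fin (k + 1) => Fin n).sum_comp, Fintype.sum_prod_type,
      Finset.sum_comm]
    refine Finset.sum_congr rfl fun f _ => ?_
    have h1 : ∀ v a : Fin n, fiberCard (Fin.consEquiv (fun _ : Fin (k + 1) => Fin n) (v, f)) a =
        fiberCard f a + if v = a then 1 else 0 := by
      intro v a
      simp only [fiberCard, Finset.card_filter, Fin.sum_univ_succ, Fin.consEquiv_apply,
        Fin.cons_zero, Fin.cons_succ]
      rw [add_comm]
    have h2 : ∀ v : Fin n, ∏ a, (fiberCard (Fin.consEquiv (fun _ : Fin (k + 1) => Fin n) (v, f)) a + 1)!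
        = (fiberCard f v + 2) * ∏ a, (fiberCard f a + 1)! := by
      intro v
      rw [← Finset.mul_prod_erase _ _ (Finset.mem_univ v),
        ← Finset.mul_prod_erase Finset.univ (fun a => (fiberCard f a + 1)!) (Finset.mem_univ v),
        ← mul_assoc]
      congr 1
      · rw [h1, if_pos rfl, Nat.factorial_succ]
      · refine Finset.prod_congr rfl fun a ha => ?_
        rw [h1, if_neg (Finset.ne_of_mem_erase ha).symm, add_zero]
    rw [Finset.sum_congr rfl fun v _ => h2 v, ← Finset.sum_mul]
    congr 1
    have h3 : ∑ v, fiberCard f v = k := by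
      have := Finset.card_eq_sum_card_fiberwise (f := f) (s := Finset.univ) (t := Finset.univ)
        (fun _ _ => Finset.mem_coe.2 (Finset.mem_univ _))
      simpa using this.symm
    rw [Finset.sum_add_distrib, h3]
    simp
    ring

lemma lineCount_le_fiberCard {n : ℕ} {r : Fin n} {par : Fin n → Fin n} {F : Finset (Sym2 (Fin n))}
    (hF : F = (Finset.univ.erase r).image (fun a => s(a, par a))) (a : Fin n) :
    lineCount F a ≤ fiberCard par a + 1 := by
  classical
  have h : F.filter (a ∈ ·) ⊆
      (insert a (Finset.univ.filter fun b => par b = a)).image fun b => s(b, par b) := by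
    intro l hl
    rw [Finset.mem_filter, hF] at hl
    obtain ⟨⟨b, _, rfl⟩, hab⟩ := (⟨Finset.mem_image.1 hl.1, hl.2⟩ :
      (∃ b ∈ Finset.univ.erase r, s(b, par b) = l) ∧ a ∈ l)
    refine Finset.mem_image.2 ⟨b, ?_, rfl⟩
    rcases Sym2.mem_iff.1 hab with rfl | h
    · exact Finset.mem_insert_self _ _
    · exact Finset.mem_insert_of_mem (Finset.mem_filter.2 ⟨Finset.mem_univ _, h.symm⟩)
  exact (Finset.card_le_card h).trans (Finset.card_image_le.trans (Finset.card_insert_le _ _))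

/-- The sum over trees of the products of the factorials of the degrees. -/
theorem tsum_trees_le (n : ℕ) (hn : 1 ≤ n) :
    ∑' T : {T : SimpleGraph (Fin n) // T.IsTree}, ((∏ a, (lineCount (treeEdges T.1) a)! : ℕ) : ℝ≥0∞) ≤
      (n ! : ℝ≥0∞) * 8 ^ n := by
  classical
  have h := fun T : {T : SimpleGraph (Fin n) // T.IsTree} => exists_parent T.2 ⟨0, hn⟩
  choose par rank _ _ _ hedge _ using h
  have hinj : Function.Injective par := by
    intro T T' hTT
    have : treeEdges T.1 = treeEdges T'.1 := by rw [hedge, hedge, hTT]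
    apply Subtype.ext
    rw [← SimpleGraph.edgeSet_inj]
    ext l
    rw [← mem_treeEdges, ← mem_treeEdges, this]
  calc _ ≤ ∑' T : {T : SimpleGraph (Fin n) // T.IsTree},
        ((∏ a, (fiberCard (par T) a + 1)! : ℕ) : ℝ≥0∞) := by
        refine ENNReal.tsum_le_tsum fun T => Nat.cast_le.2 ?_
        exact Finset.prod_le_prod' fun a _ =>
          Nat.factorial_le (lineCount_le_fiberCard (hedge T) a)
    _ ≤ ∑' f : Fin n → Fin n, ((∏ a, (fiberCard f a + 1)! : ℕ) : ℝ≥0∞) :=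
        ENNReal.tsum_comp_le_tsum_of_injective hinj
          fun f : Fin n → Fin n => ((∏ a, (fiberCard f a + 1)! : ℕ) : ℝ≥0∞)
    _ = ((2 * n).ascFactorial n : ℕ) := by
        rw [tsum_fintype, ← Nat.cast_sum, sum_prod_factorial]
    _ ≤ ((n ! * 8 ^ n : ℕ) : ℝ≥0∞) := by
        refine Nat.cast_le.2 ?_
        rw [Nat.ascFactorial_eq_factorial_mul_choose']
        refine Nat.mul_le_mul_left _ ((Nat.choose_le_two_pow _ _).trans ?_)
        rw [show 8 = 2 ^ 3 by norm_num, ← pow_mul]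
        exact Nat.pow_le_pow_right (by norm_num) (by omega)
    _ = _ := by push_cast; rfl

lemma tsum_chain_le {P : Type*} (K : P → P → ℝ≥0∞) {D S : ℝ≥0∞} (hD : ∑' p, ∑' p', K p p' ≤ D)
    (hS : ∀ p, ∑' p', K p p' ≤ S) (n : ℕ) (par : Fin (n + 2) → Fin (n + 2))
    (hpar : ∀ a, a ≠ 0 → par a < a) :
    ∑' k : Fin (n + 2) → P, ∏ a, (if a = 0 then 1 else K (k (par a)) (k a)) ≤ D * S ^ n := by
  induction n with
  | zero =>
    rw [← (finTwoArrowEquiv P).symm.tsum_eq, pow_zero, mul_one]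
    refine le_trans (le_of_eq ?_) hD
    rw [← ENNReal.tsum_prod]
    refine tsum_congr fun q => ?_
    have h1 : par 1 = 0 := by
      have := Fin.lt_def.1 (hpar 1 (by simp))
      exact Fin.ext (Nat.lt_one_iff.1 this)
    simp [Fin.prod_univ_two, h1]
  | succ n ih =>
    rw [← (Fin.snocEquiv fun _ : Fin (n + 3) => P).tsum_eq]
    have hlt : ∀ a : Fin (n + 2), a ≠ 0 → (par a.castSucc : ℕ) < a := fun a ha => by
      have := hpar a.castSucc (fun h => ha (Fin.ext (congrArg Fin.val h :)))
      exact this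
    set par' : Fin (n + 2) → Fin (n + 2) := fun a =>
      ⟨min (par a.castSucc) (n + 1), by omega⟩ with hpar'
    have hp' : ∀ a, a ≠ 0 → par a.castSucc = (par' a).castSucc := by
      intro a ha
      have h1 := hlt a ha
      have h2 := a.2
      ext
      simp only [hpar', Fin.val_castSucc]
      omega
    have hlast : ((par (Fin.last (n + 2)) : Fin (n + 3)) : ℕ) < n + 2 :=
      hpar (Fin.last (n + 2)) (by simp [Fin.ext_iff])
    set b : Fin (n + 2) := ⟨par (Fin.last (n + 2)), hlast⟩ with hb
    have hbl : par (Fin.last (n + 2)) = b.castSucc := by ext; rfl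
    have hterm : ∀ q : P × (Fin (n + 2) → P), ∏ a, (if a = 0 then 1 else
        K (Fin.snocEquiv (fun _ : Fin (n + 3) => P) q (par a))
          (Fin.snocEquiv (fun _ : Fin (n + 3) => P) q a)) =
        (∏ a, (if a = 0 then 1 else K (q.2 (par' a)) (q.2 a))) * K (q.2 b) q.1 := by
      intro q
      rw [Fin.prod_univ_castSucc, if_neg (by simp [Fin.ext_iff]), hbl]
      simp only [Fin.snocEquiv_apply, Fin.snoc_castSucc, Fin.snoc_last]
      congr 1
      refine Finset.prod_congr rfl fun a _ => ?_
      rcases eq_or_ne a 0 with rfl | ha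
      · simp
      · rw [if_neg (show a.castSucc ≠ 0 from fun h => ha (Fin.ext (congrArg Fin.val h :))), if_neg ha, hp' a ha, Fin.snoc_castSucc]
    rw [tsum_congr hterm, ENNReal.tsum_prod (f := fun (p : P) (k : Fin (n + 2) → P) =>
      (∏ a, (if a = 0 then 1 else K (k (par' a)) (k a))) * K (k b) p), ENNReal.tsum_comm]
    simp_rw [ENNReal.tsum_mul_left]
    refine (ENNReal.tsum_le_tsum fun k : Fin (n + 2) → P => mul_le_mul_right (hS (k b)) _).trans ?_
    rw [ENNReal.tsum_mul_right, pow_succ, ← mul_assoc]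
    refine mul_le_mul_left (ih par' fun a ha => ?_) S
    rw [Fin.lt_def]
    have := hlt a ha
    simp only [hpar']
    omega

/-- The sum over the momenta of the vertices of a tree. -/
theorem tsum_tree_le {P : Type*} (K : P → P → ℝ≥0∞) (hK : ∀ p p', K p p' = K p' p) {D S : ℝ≥0∞}
    (hD : ∑' p, ∑' p', K p p' ≤ D) (hS : ∀ p, ∑' p', K p p' ≤ S) {n : ℕ}
    {T : SimpleGraph (Fin (n + 2))} (hT : T.IsTree) :
    ∑' k : Fin (n + 2) → P, ∏ l ∈ treeEdges T,
      Sym2.lift ⟨fun a b => K (k a) (k b), fun _ _ => hK _ _⟩ l ≤ D * S ^ n := by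
  classical
  obtain ⟨par, rank, _, hr0, hrank, hedge, hinj⟩ := exists_parent hT 0
  set e := Tuple.sort rank with he
  have hmono : Monotone (rank ∘ e) := Tuple.monotone_sort rank
  have he0 : e 0 = 0 := by
    rw [← hr0]
    have := hmono (Fin.zero_le (e.symm 0))
    simp only [Function.comp, Equiv.apply_symm_apply, (hr0 0).2 rfl] at this
    omega
  rw [← (Equiv.arrowCongr e (Equiv.refl P)).tsum_eq]
  refine le_trans (le_of_eq (tsum_congr fun k => ?_))
    (tsum_chain_le K hD hS n (fun a => e.symm (par (e a))) fun a ha => ?_)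
  · rw [hedge, Finset.prod_image hinj, ← Finset.mul_prod_erase Finset.univ _ (Finset.mem_univ 0),
      if_pos rfl, one_mul]
    refine Finset.prod_bij (fun a _ => e.symm a) (fun a ha => ?_) (fun _ _ _ _ h => e.symm.injective h)
      (fun a ha => ⟨e a, ?_, by simp⟩) fun a ha => ?_
    · refine Finset.mem_erase.2 ⟨fun h => Finset.ne_of_mem_erase ha ?_, Finset.mem_univ _⟩
      rw [← he0, ← h, Equiv.apply_symm_apply]
    · refine Finset.mem_erase.2 ⟨fun h => Finset.ne_of_mem_erase ha ?_, Finset.mem_univ _⟩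
      rw [← he0] at h
      exact e.injective h
    · rw [if_neg fun h => Finset.ne_of_mem_erase ha (by rw [← he0, ← h, Equiv.apply_symm_apply])]
      simp [Equiv.arrowCongr, hK (k (e.symm a))]
  · have h1 : e a ≠ 0 := fun h => ha (e.injective (h.trans he0.symm))
    by_contra! h
    have h2 := hmono h
    have h3 := hrank _ h1
    simp only [Function.comp, Equiv.apply_symm_apply] at h2
    omega

end Trees

/-! ### Sums over momenta -/

section MomentumSums

/-- The decay of a propagator in a component of the momentum. -/
def decay (q : ℤ) : ℝ := (1 + (q : ℝ) ^ 2) ^ (-(1 / 3) : ℝ)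

lemma decay_pos (q : ℤ) : 0 < decay q := Real.rpow_pos_of_pos (by positivity) _

lemma decay_le_one (q : ℤ) : decay q ≤ 1 :=
  Real.rpow_le_one_of_one_le_of_nonpos (by nlinarith [sq_nonneg (q : ℝ)]) (by norm_num)

lemma decay_sq (q : ℤ) : decay q ^ 2 = (1 + (q : ℝ) ^ 2) ^ (-(2 / 3) : ℝ) := by
  rw [decay, ← Real.rpow_natCast, ← Real.rpow_mul (by positivity)]
  norm_num

lemma summable_decay_sq : Summable fun q : ℤ => decay q ^ 2 := by
  have h := Real.summable_abs_int_rpow (b := 4 / 3) (by norm_num)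
  have h2 : Summable fun q : ℤ => if q = 0 then (1 : ℝ) else 0 :=
    summable_of_ne_finset_zero (s := {0}) (by simp +contextual)
  refine (h.add h2).of_nonneg_of_le (fun q => sq_nonneg _) fun q => ?_
  rcases eq_or_ne q 0 with rfl | hq
  · have h3 := decay_le_one 0
    have h4 := decay_pos 0
    have h5 : (0 : ℝ) ≤ |((0 : ℤ) : ℝ)| ^ (-(4 / 3) : ℝ) := by positivity
    rw [if_pos rfl]
    nlinarith
  · rw [if_neg hq, add_zero, decay_sq]
    have hq' : 0 < |(q : ℝ)| := abs_pos.2 (by exact_mod_cast hq)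
    have h3 : |(q : ℝ)| ^ (-(4 / 3) : ℝ) = ((q : ℝ) ^ 2) ^ (-(2 / 3) : ℝ) := by
      rw [← sq_abs, ← Real.rpow_natCast, ← Real.rpow_mul hq'.le]
      norm_num
    rw [h3]
    exact Real.rpow_le_rpow_of_nonpos (by rw [← sq_abs]; positivity) (by linarith) (by norm_num)

variable {m : ℝ}

lemma propagator_le (hm : 0 < m) : ∃ M : ℝ, 0 < M ∧ ∀ (p : Momentum) (i : Fin 3),
    propagator m p ≤ M * (decay (p.1 i) * decay (p.1 (i + 1)) ^ 2) := by
  refine ⟨(min 1 (m ^ 2))⁻¹, by positivity, fun p i => ?_⟩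
  set q := p.1 i
  set x := p.1 (i + 1)
  have hsum : (q : ℝ) ^ 2 + (x : ℝ) ^ 2 ≤ ∑ i, ((p.1 i : ℤ) : ℝ) ^ 2 := by
    have := Finset.sum_le_univ_sum_of_nonneg (s := {i, i + 1})
      (f := fun i => ((p.1 i : ℤ) : ℝ) ^ 2) fun _ => sq_nonneg _
    rwa [Finset.sum_pair (by simp)] at this
  have hmin1 := min_le_left 1 (m ^ 2)
  have hmin2 := min_le_right 1 (m ^ 2)
  have hmin : 0 < min 1 (m ^ 2) := by positivity
  have hy : 0 < 1 + (q : ℝ) ^ 2 + (x : ℝ) ^ 2 := by positivity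
  have h1 : min 1 (m ^ 2) * (1 + (q : ℝ) ^ 2 + (x : ℝ) ^ 2) ≤ (∑ i, ((p.1 i : ℤ) : ℝ) ^ 2) + m ^ 2 := by
    have : 0 ≤ (q : ℝ) ^ 2 + (x : ℝ) ^ 2 := by positivity
    nlinarith
  have h2 : propagator m p ≤ (min 1 (m ^ 2))⁻¹ * (1 + (q : ℝ) ^ 2 + (x : ℝ) ^ 2)⁻¹ := by
    rw [propagator, ← mul_inv]
    exact inv_anti₀ (by positivity) h1
  refine h2.trans (mul_le_mul_of_nonneg_left ?_ (by positivity))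
  have h3 : (1 + (q : ℝ) ^ 2 + (x : ℝ) ^ 2)⁻¹ = (1 + (q : ℝ) ^ 2 + (x : ℝ) ^ 2) ^ (-(1 / 3) : ℝ) *
      (1 + (q : ℝ) ^ 2 + (x : ℝ) ^ 2) ^ (-(2 / 3) : ℝ) := by
    rw [← Real.rpow_add hy, ← Real.rpow_neg_one]
    norm_num
  rw [h3, decay_sq, decay]
  have h4 := sq_nonneg (q : ℝ)
  have h5 := sq_nonneg (x : ℝ)
  refine mul_le_mul (Real.rpow_le_rpow_of_nonpos (by positivity) (by linarith) (by norm_num))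
    (Real.rpow_le_rpow_of_nonpos (by positivity) (by linarith) (by norm_num))
    (Real.rpow_nonneg hy.le _) (Real.rpow_nonneg (by positivity) _)

/-- The weight of a line. -/
def lineKernel (m : ℝ) (p p' : Momentum) : ℝ := propagator m p * propagator m p' * overlap p p'

lemma lineKernel_comm (m : ℝ) (p p' : Momentum) : lineKernel m p p' = lineKernel m p' p := by
  rw [lineKernel, lineKernel, overlap_comm]
  ring

lemma lineKernel_nonneg (hm : 0 < m) (p p' : Momentum) : 0 ≤ lineKernel m p p' :=
  mul_nonneg (mul_nonneg (propagator_pos hm p).le (propagator_pos hm p').le) (overlap_nonneg p p')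

lemma propagator_le_inv (hm : 0 < m) (p : Momentum) : propagator m p ≤ (m ^ 2)⁻¹ := by
  refine inv_anti₀ (by positivity) ?_
  have : 0 ≤ ∑ i, ((p.1 i : ℤ) : ℝ) ^ 2 := Finset.sum_nonneg fun _ _ => sq_nonneg _
  linarith

lemma momentum_pair_injective (i : Fin 3) :
    Function.Injective fun p : Momentum => (p.1 i, p.1 (i + 1)) := by
  intro p p' h
  have h1 : p.1 i = p'.1 i := congrArg Prod.fst h
  have h2 : p.1 (i + 1) = p'.1 (i + 1) := congrArg Prod.snd h
  have hp := p.2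
  have hp' := p'.2
  rw [Fin.sum_univ_three] at hp hp'
  ext j
  fin_cases i <;> fin_cases j <;> simp at h1 h2 ⊢ <;> omega

/-- The sums over momenta that occur in the tree expansion. -/
lemma exists_lineKernel_bounds (hm : 0 < m) : ∃ D S : ℝ, 0 < D ∧ 0 < S ∧
    (∑' p, ∑' p', ENNReal.ofReal (lineKernel m p p')) ≤ ENNReal.ofReal D ∧
    ∀ p, ∑' p', ENNReal.ofReal (lineKernel m p p') ≤ ENNReal.ofReal S := by
  obtain ⟨M, hM, hprop⟩ := propagator_le hm
  set G : ℝ := ∑' q : ℤ, decay q ^ 2 with hG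
  have hG0 : 0 < G := summable_decay_sq.tsum_pos (fun q => sq_nonneg _) 0 (pow_pos (decay_pos 0) 2)
  have hGE : ∑' q : ℤ, ENNReal.ofReal (decay q ^ 2) = ENNReal.ofReal G :=
    (ENNReal.ofReal_tsum_of_nonneg (fun q => sq_nonneg _) summable_decay_sq).symm
  -- momenta with a given component
  have hfib : ∀ (i : Fin 3) (q : ℤ), ∑' p' : Momentum,
      ENNReal.ofReal (propagator m p' * if q = p'.1 i then 1 else 0) ≤
        ENNReal.ofReal (M * G * decay q) := by
    intro i q
    calc _ ≤ ∑' p' : Momentum, (fun y : ℤ × ℤ => if y.1 = q then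
          ENNReal.ofReal (M * decay q) * ENNReal.ofReal (decay y.2 ^ 2) else 0)
            (p'.1 i, p'.1 (i + 1)) := by
          refine ENNReal.tsum_le_tsum fun p' => ?_
          simp only
          rcases eq_or_ne q (p'.1 i) with h | h
          · rw [if_pos h, if_pos h.symm, mul_one, ← ENNReal.ofReal_mul (by
              have := decay_pos q
              positivity)]
            refine ENNReal.ofReal_le_ofReal ((hprop p' i).trans_eq ?_)
            rw [h]
            ring
          · rw [if_neg h, mul_zero, ENNReal.ofReal_zero]
            exact zero_le
      _ ≤ ∑' y : ℤ × ℤ, (if y.1 = q then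
          ENNReal.ofReal (M * decay q) * ENNReal.ofReal (decay y.2 ^ 2) else 0) :=
          ENNReal.tsum_comp_le_tsum_of_injective (momentum_pair_injective i) _
      _ = ENNReal.ofReal (M * decay q) * ENNReal.ofReal G := by
          rw [ENNReal.tsum_prod (f := fun a b => if a = q then
            ENNReal.ofReal (M * decay q) * ENNReal.ofReal (decay b ^ 2) else 0),
            tsum_eq_single q (fun a ha => by simp [ha])]
          simp only [if_true]
          rw [ENNReal.tsum_mul_left, hGE]
      _ = _ := by
          rw [← ENNReal.ofReal_mul (by
            have := decay_pos q
            positivity)]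
          congr 1
          ring
  have hrow : ∀ p : Momentum, ∑' p', ENNReal.ofReal (lineKernel m p p') ≤
      ∑ i, ENNReal.ofReal (propagator m p) * ENNReal.ofReal (M * G * decay (p.1 i)) := by
    intro p
    have h1 : ∀ p', ENNReal.ofReal (lineKernel m p p') = ∑ i : Fin 3, ENNReal.ofReal (propagator m p) *
        ENNReal.ofReal (propagator m p' * if p.1 i = p'.1 i then 1 else 0) := by
      intro p'
      have hp := (propagator_pos hm p).le
      have hp' := (propagator_pos hm p').le
      simp_rw [← ENNReal.ofReal_mul hp]
      rw [← ENNReal.ofReal_sum_of_nonneg fun i _ => mul_nonneg hp (mul_nonneg hp' (by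
        split_ifs <;> norm_num)), lineKernel, overlap, Finset.mul_sum]
      simp only [mul_assoc]
    simp_rw [h1]
    rw [Summable.tsum_finsetSum fun _ _ => ENNReal.summable]
    refine Finset.sum_le_sum fun i _ => ?_
    rw [ENNReal.tsum_mul_left]
    exact mul_le_mul_right (hfib i (p.1 i)) _
  refine ⟨3 * (M * G * (M * G * G)), 3 * ((m ^ 2)⁻¹ * (M * G)), by positivity, by positivity, ?_, ?_⟩
  · refine (ENNReal.tsum_le_tsum hrow).trans ?_
    rw [Summable.tsum_finsetSum fun _ _ => ENNReal.summable]
    have h2 : ∀ i : Fin 3, ∑' p : Momentum, ENNReal.ofReal (propagator m p) *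
        ENNReal.ofReal (M * G * decay (p.1 i)) ≤ ENNReal.ofReal (M * G * (M * G * G)) := by
      intro i
      calc _ ≤ ∑' p : Momentum, (fun y : ℤ × ℤ => ENNReal.ofReal (M * G * M) *
            (ENNReal.ofReal (decay y.1 ^ 2) * ENNReal.ofReal (decay y.2 ^ 2)))
              (p.1 i, p.1 (i + 1)) := by
            refine ENNReal.tsum_le_tsum fun p => ?_
            simp only
            have h5 := decay_pos (p.1 i)
            rw [← ENNReal.ofReal_mul (propagator_pos hm p).le, ← ENNReal.ofReal_mul (sq_nonneg _),
              ← ENNReal.ofReal_mul (by positivity)]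
            refine ENNReal.ofReal_le_ofReal ?_
            calc _ ≤ M * (decay (p.1 i) * decay (p.1 (i + 1)) ^ 2) * (M * G * decay (p.1 i)) :=
                  mul_le_mul_of_nonneg_right (hprop p i) (by positivity)
              _ = _ := by ring
        _ ≤ ∑' y : ℤ × ℤ, ENNReal.ofReal (M * G * M) *
            (ENNReal.ofReal (decay y.1 ^ 2) * ENNReal.ofReal (decay y.2 ^ 2)) :=
            ENNReal.tsum_comp_le_tsum_of_injective (momentum_pair_injective i) _
        _ = ENNReal.ofReal (M * G * M) * (ENNReal.ofReal G * ENNReal.ofReal G) := by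
            rw [ENNReal.tsum_mul_left, ENNReal.tsum_prod (f := fun a b =>
              ENNReal.ofReal (decay a ^ 2) * ENNReal.ofReal (decay b ^ 2))]
            simp_rw [ENNReal.tsum_mul_left, ENNReal.tsum_mul_right, hGE]
        _ = _ := by
            rw [← ENNReal.ofReal_mul hG0.le, ← ENNReal.ofReal_mul (by positivity)]
            congr 1
            ring
    refine (Finset.sum_le_sum fun i _ => h2 i).trans_eq ?_
    rw [Finset.sum_const, Finset.card_univ, Fintype.card_fin, ENNReal.ofReal_mul (p := 3) (by norm_num),
      nsmul_eq_mul]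
    norm_num
  · intro p
    refine (hrow p).trans ?_
    have h2 : ∀ i : Fin 3, ENNReal.ofReal (propagator m p) *
        ENNReal.ofReal (M * G * decay (p.1 i)) ≤ ENNReal.ofReal ((m ^ 2)⁻¹ * (M * G)) := by
      intro i
      rw [← ENNReal.ofReal_mul (propagator_pos hm p).le]
      refine ENNReal.ofReal_le_ofReal ?_
      have h3 := decay_le_one (p.1 i)
      have h4 := (decay_pos (p.1 i)).le
      exact mul_le_mul (propagator_le_inv hm p) (mul_le_of_le_one_right (by positivity) h3)
        (by positivity) (by positivity)
    refine (Finset.sum_le_sum fun i _ => h2 i).trans_eq ?_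
    rw [Finset.sum_const, Finset.card_univ, Fintype.card_fin, ENNReal.ofReal_mul (p := 3) (by norm_num),
      nsmul_eq_mul]
    norm_num

end MomentumSums

section Species

/-- The species of vertices: loop vertices with a momentum, and resolvents that join an outgoing
mode to an incoming one. -/
abbrev Species (N : ℕ) : Type := Momentum ⊕ (Fin N × Fin N)

/-- The momentum of a vertex. -/
def Species.mom {N : ℕ} (P : Fin N → Momentum) : Species N → Momentum :=
  Sum.elim id fun ij => P ij.1

/-- The weight of a species. -/
def Species.wt {N : ℕ} (η : ℝ) : Species N → ℝ := Sum.elim (fun _ => 1) fun _ => η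

lemma Species.wt_nonneg {N : ℕ} {η : ℝ} (hη : 0 ≤ η) (s : Species N) : 0 ≤ s.wt η := by
  rcases s with p | ij
  · exact zero_le_one
  · exact hη

lemma tsum_species_le {N : ℕ} (P : Fin N → Momentum) {η : ℝ} (hN : (N : ℝ) ^ 2 * η ≤ 1)
    (G : Momentum → ℝ≥0∞) :
    ∑' s : Species N, ENNReal.ofReal (s.wt η) * G (s.mom P) ≤ 2 * ∑' p, G p := by
  rw [Summable.tsum_sum ENNReal.summable ENNReal.summable, two_mul]
  refine add_le_add (le_of_eq (tsum_congr fun p => ?_)) ?_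
  · simp [Species.wt, Species.mom]
  · calc ∑' ij : Fin N × Fin N, ENNReal.ofReal η * G (P ij.1)
        ≤ ∑' _ij : Fin N × Fin N, ENNReal.ofReal η * ∑' p, G p :=
          ENNReal.tsum_le_tsum fun ij => mul_le_mul_right (ENNReal.le_tsum _) _
      _ = ENNReal.ofReal ((N : ℝ) ^ 2 * η) * ∑' p, G p := by
          rw [tsum_fintype, Finset.sum_const, Finset.card_univ, Fintype.card_prod, Fintype.card_fin,
            nsmul_eq_mul, ← mul_assoc, ENNReal.ofReal_mul (by positivity)]
          congr 2
          rw [← Nat.cast_pow, ENNReal.ofReal_natCast, pow_two]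
      _ ≤ 1 * ∑' p, G p := by
          refine mul_le_mul_left ?_ _
          rw [← ENNReal.ofReal_one]
          exact ENNReal.ofReal_le_ofReal hN
      _ = _ := one_mul _

lemma tsum_pi_species_le {N : ℕ} (P : Fin N → Momentum) {η : ℝ}
    (hN : (N : ℝ) ^ 2 * η ≤ 1) (n : ℕ) (G : (Fin n → Momentum) → ℝ≥0∞) :
    ∑' c : Fin n → Species N, (∏ a, ENNReal.ofReal ((c a).wt η)) * G (fun a => (c a).mom P) ≤
      2 ^ n * ∑' k, G k := by
  induction n with
  | zero =>
    rw [tsum_fintype, tsum_fintype]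
    simp [Subsingleton.elim (fun a : Fin 0 => _) (default : Fin 0 → Momentum)]
  | succ n ih =>
    rw [← (Fin.consEquiv fun _ : Fin (n + 1) => Species N).tsum_eq,
      ← (Fin.consEquiv fun _ : Fin (n + 1) => Momentum).tsum_eq]
    have h1 : ∀ q : Species N × (Fin n → Species N),
        (∏ a, ENNReal.ofReal ((Fin.consEquiv (fun _ : Fin (n + 1) => Species N) q a).wt η)) *
          G (fun a => (Fin.consEquiv (fun _ : Fin (n + 1) => Species N) q a).mom P) =
        ENNReal.ofReal (q.1.wt η) * ((∏ a, ENNReal.ofReal ((q.2 a).wt η)) *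
          G (Fin.cons (q.1.mom P) fun a => (q.2 a).mom P)) := by
      intro q
      rw [Fin.prod_univ_succ, mul_assoc]
      simp only [Fin.consEquiv_apply, Fin.cons_zero, Fin.cons_succ]
      congr 3
      funext a
      refine Fin.cases ?_ (fun b => ?_) a <;> simp
    rw [tsum_congr h1, ENNReal.tsum_prod (f := fun (s : Species N) (c : Fin n → Species N) =>
      ENNReal.ofReal (s.wt η) * ((∏ a, ENNReal.ofReal ((c a).wt η)) *
          G (Fin.cons (s.mom P) fun a => (c a).mom P)))]
    simp_rw [ENNReal.tsum_mul_left]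
    refine (ENNReal.tsum_le_tsum fun s : Species N => mul_le_mul_right
      (ih fun k => G (Fin.cons (s.mom P) k)) _).trans ?_
    refine (tsum_species_le P hN fun p => 2 ^ n * ∑' k, G (Fin.cons p k)).trans_eq ?_
    rw [ENNReal.tsum_mul_left, ← mul_assoc, pow_succ', ← ENNReal.tsum_prod
      (f := fun (p : Momentum) (k : Fin n → Momentum) => G (Fin.cons p k))]
    rfl

/-- The product of the line kernels. -/
def lineProd (m : ℝ) {n : ℕ} (T : SimpleGraph (Fin n)) (k : Fin n → Momentum) : ℝ :=
  ∏ l ∈ treeEdges T, Sym2.lift ⟨fun a b => lineKernel m (k a) (k b), fun _ _ => lineKernel_comm _ _ _⟩ l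

lemma lineProd_nonneg {m : ℝ} (hm : 0 < m) {n : ℕ} (T : SimpleGraph (Fin n)) (k : Fin n → Momentum) :
    0 ≤ lineProd m T k :=
  Finset.prod_nonneg fun l _ => by
    induction l with | _ a b => exact lineKernel_nonneg hm _ _

/-- The bound on the contribution of a decorated tree. -/
def termBound (m : ℝ) {N : ℕ} (P : Fin N → Momentum) (η ρ : ℝ) {n : ℕ} (T : SimpleGraph (Fin n))
    (c : Fin n → Species N) : ℝ :=
  ρ ^ (n - 1) / (n ! : ℝ) * (((∏ a, (c a).wt η) * ((∏ a, (lineCount (treeEdges T) a)! : ℕ) : ℝ)) *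
    lineProd m T fun a => (c a).mom P)

lemma termBound_nonneg {m : ℝ} (hm : 0 < m) {N : ℕ} (P : Fin N → Momentum) {η ρ : ℝ} (hη : 0 ≤ η)
    (hρ : 0 ≤ ρ) {n : ℕ} (T : SimpleGraph (Fin n)) (c : Fin n → Species N) :
    0 ≤ termBound m P η ρ T c := by
  have h1 := lineProd_nonneg hm T fun a => (c a).mom P
  have h2 : 0 ≤ ∏ a, (c a).wt η := Finset.prod_nonneg fun a _ => (c a).wt_nonneg hη
  unfold termBound
  positivity

/-- The sum of the contributions of the trees of a given order. -/
theorem tsum_termBound_le {m : ℝ} (hm : 0 < m) {D S : ℝ} (hD0 : 0 < D) (hS0 : 0 < S)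
    (hD : (∑' p, ∑' p', ENNReal.ofReal (lineKernel m p p')) ≤ ENNReal.ofReal D)
    (hS : ∀ p, ∑' p', ENNReal.ofReal (lineKernel m p p') ≤ ENNReal.ofReal S)
    {N : ℕ} (P : Fin N → Momentum) {η ρ : ℝ} (hη : 0 ≤ η) (hN : (N : ℝ) ^ 2 * η ≤ 1) (hρ : 0 ≤ ρ)
    (n : ℕ) :
    ∑' T : {T : SimpleGraph (Fin (n + 2)) // T.IsTree}, ∑' c : Fin (n + 2) → Species N,
      ENNReal.ofReal (termBound m P η ρ T.1 c) ≤
        ENNReal.ofReal (256 * ρ * D * (16 * (ρ * S)) ^ n) := by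
  have h1 : ∀ T : {T : SimpleGraph (Fin (n + 2)) // T.IsTree}, ∑' c : Fin (n + 2) → Species N,
      ENNReal.ofReal (termBound m P η ρ T.1 c) ≤
      ((∏ a, (lineCount (treeEdges T.1) a)! : ℕ) : ℝ≥0∞) *
        (ENNReal.ofReal (ρ ^ (n + 1) / ((n + 2)! : ℝ)) * (2 ^ (n + 2) *
        (ENNReal.ofReal D * ENNReal.ofReal S ^ n))) := by
    intro T
    have h2 : ∀ c : Fin (n + 2) → Species N, ENNReal.ofReal (termBound m P η ρ T.1 c) =
        ((∏ a, (lineCount (treeEdges T.1) a)! : ℕ) : ℝ≥0∞) *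
        (ENNReal.ofReal (ρ ^ (n + 1) / ((n + 2)! : ℝ)) * ((∏ a, ENNReal.ofReal ((c a).wt η)) *
          (fun k => ENNReal.ofReal (lineProd m T.1 k)) fun a => (c a).mom P)) := by
      intro c
      have h3 : ∀ a ∈ Finset.univ, 0 ≤ (c a).wt η := fun a _ => (c a).wt_nonneg hη
      simp only
      rw [← ENNReal.ofReal_prod_of_nonneg h3, ← ENNReal.ofReal_natCast,
        ← ENNReal.ofReal_mul (Finset.prod_nonneg h3), ← ENNReal.ofReal_mul (by positivity),
        ← ENNReal.ofReal_mul (by positivity), termBound]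
      congr 1
      rw [show n + 2 - 1 = n + 1 from rfl]
      ring
    simp_rw [h2]
    rw [ENNReal.tsum_mul_left, ENNReal.tsum_mul_left]
    refine mul_le_mul_right (mul_le_mul_right ?_ _) _
    refine (tsum_pi_species_le P hN (n + 2) fun k => ENNReal.ofReal (lineProd m T.1 k)).trans ?_
    refine mul_le_mul_right ?_ _
    refine le_trans (le_of_eq (tsum_congr fun k => ?_)) (tsum_tree_le (fun p p' =>
      ENNReal.ofReal (lineKernel m p p')) (fun p p' => by rw [lineKernel_comm]) hD hS T.2)
    rw [lineProd, ENNReal.ofReal_prod_of_nonneg]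
    · refine Finset.prod_congr rfl fun l _ => ?_
      induction l with | _ a b => rfl
    · intro l _
      induction l with | _ a b => exact lineKernel_nonneg hm _ _
  refine (ENNReal.tsum_le_tsum h1).trans ?_
  rw [ENNReal.tsum_mul_right]
  refine (mul_le_mul_left (tsum_trees_le (n + 2) (by omega)) _).trans (le_of_eq ?_)
  rw [← ENNReal.ofReal_natCast, ← ENNReal.ofReal_pow hS0.le, ← ENNReal.ofReal_mul hD0.le,
    show (8 : ℝ≥0∞) = ENNReal.ofReal 8 by simp, show (2 : ℝ≥0∞) = ENNReal.ofReal 2 by simp,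
    ← ENNReal.ofReal_pow (by norm_num), ← ENNReal.ofReal_pow (by norm_num),
    ← ENNReal.ofReal_mul (by positivity), ← ENNReal.ofReal_mul (by positivity),
    ← ENNReal.ofReal_mul (by positivity), ← ENNReal.ofReal_mul (by positivity)]
  congr 1
  have : ((n + 2)! : ℝ) ≠ 0 := by positivity
  rw [mul_pow, mul_pow, show (16 : ℝ) = 8 * 2 by norm_num, mul_pow]
  field_simp
  ring

end Species

/-! ### Values of trees -/

section TreeValues

variable {ι : Type}

/-- The expectation attached to a tree whose vertices carry species, `v s d` being the `d`-th
derivative of a vertex of species `s`. -/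
def treeVal (mom : ι → Momentum) (v : ι → ℕ → ℝ → ℂ) {n : ℕ} (F : Finset (Sym2 (Fin n)))
    (c : Fin n → ι) : ℂ :=
  (∏ l ∈ F, lineOverlap (fun a => mom (c a)) l : ℝ) * ∫ w, ∫ τ,
    ∏ a, v (c a) (lineCount F a) (Gam (mom (c a)) (fun iq => τ iq a))
      ∂replicaLaw (Matrix.of fun a b => linkMat F w a b) ∂edgeMeasure 0 F

instance isProbabilityMeasure_edgeMeasure {n : ℕ} (F : Finset (Sym2 (Fin n))) :
    IsProbabilityMeasure (edgeMeasure 0 F) := by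
  rw [edgeMeasure_zero]; infer_instance

lemma norm_integral_le_of_prob {Ω : Type*} [MeasurableSpace Ω] {μ : Measure Ω}
    [IsProbabilityMeasure μ] {f : Ω → ℂ} {b : ℝ} (h : ∀ x, ‖f x‖ ≤ b) : ‖∫ x, f x ∂μ‖ ≤ b :=
  (norm_integral_le_of_norm_le_const (ae_of_all _ h)).trans (by simp)

lemma norm_treeVal_le (mom : ι → Momentum) (v : ι → ℕ → ℝ → ℂ) {n : ℕ} (F : Finset (Sym2 (Fin n)))
    (c : Fin n → ι) {b : Fin n → ℝ} (hb : ∀ a s, ‖v (c a) (lineCount F a) s‖ ≤ b a) :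
    ‖treeVal mom v F c‖ ≤ (∏ l ∈ F, lineOverlap (fun a => mom (c a)) l) * ∏ a, b a := by
  rw [treeVal, norm_mul, Complex.norm_real,
    Real.norm_of_nonneg (Finset.prod_nonneg fun l _ => lineOverlap_nonneg _ l)]
  refine mul_le_mul_of_nonneg_left ?_ (Finset.prod_nonneg fun l _ => lineOverlap_nonneg _ l)
  refine norm_integral_le_of_prob fun w => norm_integral_le_of_prob fun τ => ?_
  rw [norm_prod]
  exact Finset.prod_le_prod (fun _ _ => norm_nonneg _) fun a _ => hb a _

lemma continuous_replicaGam {n : ℕ} (k : Momentum) (a : Fin n) :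
    Continuous fun τ : Fin 3 × ℤ → EuclideanSpace ℝ (Fin n) => Gam k (fun iq => τ iq a) := by
  refine (continuous_Gam k).comp ?_
  fun_prop

/-- The covariance matrices. -/
def Covariance (n : ℕ) : Type := {M : Fin n → Fin n → ℝ // (Matrix.of M).PosSemidef}

instance (n : ℕ) : TopologicalSpace (Covariance n) := instTopologicalSpaceSubtype

instance (n : ℕ) : MeasurableSpace (Covariance n) := Subtype.instMeasurableSpace

instance (n : ℕ) : FirstCountableTopology (Covariance n) :=
  inferInstanceAs (FirstCountableTopology {M : Fin n → Fin n → ℝ // (Matrix.of M).PosSemidef})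

instance (n : ℕ) : OpensMeasurableSpace (Covariance n) :=
  inferInstanceAs (OpensMeasurableSpace {M : Fin n → Fin n → ℝ // (Matrix.of M).PosSemidef})

lemma continuous_integral_covariance {n : ℕ} {f : (Fin 3 × ℤ → EuclideanSpace ℝ (Fin n)) → ℂ}
    (hf : Continuous f) {b : ℝ} (hb : ∀ τ, ‖f τ‖ ≤ b) :
    Continuous fun M : Covariance n => ∫ τ, f τ ∂replicaLaw (Matrix.of M.1) := by
  have hc : Continuous fun M : Covariance n => (Matrix.of M.1 : Matrix (Fin n) (Fin n) ℝ) :=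
    continuous_subtype_val
  exact continuous_integral_replicas _ hc (fun M => M.2) f hf hf.stronglyMeasurable b hb

/-- Expectations of bounded continuous functions of the replicated fields are measurable functions
of the covariance. -/
lemma measurable_integral_replicaLaw {n : ℕ} {Y : Type*} [MeasurableSpace Y]
    (X : Y → Fin n → Fin n → ℝ) (hX : ∀ a b, Measurable fun y => X y a b)
    (hp : ∀ y, (Matrix.of (X y)).PosSemidef)
    {f : (Fin 3 × ℤ → EuclideanSpace ℝ (Fin n)) → ℂ} (hf : Continuous f) {b : ℝ}
    (hb : ∀ τ, ‖f τ‖ ≤ b) : Measurable fun y => ∫ τ, f τ ∂replicaLaw (Matrix.of (X y)) := by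
  have h2 : Measurable fun y => (⟨X y, hp y⟩ : Covariance n) :=
    Measurable.subtype_mk (measurable_pi_iff.2 fun a => measurable_pi_iff.2 fun b => hX a b)
  have h3 := (continuous_integral_covariance hf hb).measurable.comp h2
  exact h3

lemma tendsto_treeVal {Y : Type*} {l : Filter Y} [l.IsCountablyGenerated] (mom : ι → Momentum)
    (v : Y → ι → ℕ → ℝ → ℂ) (v' : ι → ℕ → ℝ → ℂ) {n : ℕ} (F : Finset (Sym2 (Fin n)))
    (c : Fin n → ι) {b : Fin n → ℝ} (hb : ∀ y a s, ‖v y (c a) (lineCount F a) s‖ ≤ b a)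
    (hc : ∀ y a, Continuous (v y (c a) (lineCount F a)))
    (ht : ∀ a s, Tendsto (fun y => v y (c a) (lineCount F a) s) l (𝓝 (v' (c a) (lineCount F a) s))) :
    Tendsto (fun y => treeVal mom (v y) F c) l (𝓝 (treeVal mom v' F c)) := by
  have hcont : ∀ y, Continuous fun τ : Fin 3 × ℤ → EuclideanSpace ℝ (Fin n) =>
      ∏ a, v y (c a) (lineCount F a) (Gam (mom (c a)) (fun iq => τ iq a)) := fun y =>
    continuous_finsetProd _ fun a _ => (hc y a).comp (continuous_replicaGam _ _)
  have hbd : ∀ y (τ : Fin 3 × ℤ → EuclideanSpace ℝ (Fin n)),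
      ‖∏ a, v y (c a) (lineCount F a) (Gam (mom (c a)) (fun iq => τ iq a))‖ ≤ ∏ a, b a := fun y τ => by
    rw [norm_prod]
    exact Finset.prod_le_prod (fun _ _ => norm_nonneg _) fun a _ => hb y a _
  refine Tendsto.const_mul _ ?_
  refine tendsto_integral_filter_of_dominated_convergence (fun _ => ∏ a, b a)
    (Eventually.of_forall fun y => ?_) (Eventually.of_forall fun y => ae_of_all _ fun w => ?_)
    (integrable_const _) (ae_of_all _ fun w => ?_)
  · exact (measurable_integral_replicaLaw (fun w a b => linkMat F w a b)
      (fun a b => measurable_linkMat F a b) (posSemidef_linkMat F) (hcont y) (hbd y)).aestronglyMeasurable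
  · exact norm_integral_le_of_prob (hbd y)
  · refine tendsto_integral_filter_of_dominated_convergence (fun _ => ∏ a, b a)
      (Eventually.of_forall fun y => (hcont y).aestronglyMeasurable)
      (Eventually.of_forall fun y => ae_of_all _ (hbd y)) (integrable_const _)
      (ae_of_all _ fun τ => ?_)
    exact tendsto_finsetProd _ fun a _ => ht a _

lemma map_replicaLaw {n : ℕ} {X : Matrix (Fin n) (Fin n) ℝ} (hX : X.PosSemidef) {a : Fin n}
    (ha : X a a = 1) :
    (replicaLaw X).map (fun τ (iq : Fin 3 × ℤ) => τ iq a) = fieldMeasure := by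
  have h : Measurable fun y : EuclideanSpace ℝ (Fin n) => y a := by fun_prop
  have h1 := Measure.infinitePi_map_pi (fun _ : Fin 3 × ℤ => multivariateGaussian 0 X)
    (f := fun _ y => y a) fun _ => h
  refine h1.trans ?_
  rw [fieldMeasure]
  congr 1
  funext iq
  have h2 := (measurePreserving_eval_multivariateGaussian (μ := 0) hX (i := a)).map_eq
  rw [h2, ha]
  simp

/-- The field of a single replica is distributed as the field itself. -/
lemma integral_replicaLaw {n : ℕ} {X : Matrix (Fin n) (Fin n) ℝ} (hX : X.PosSemidef) {a : Fin n}
    (ha : X a a = 1) {f : Field → ℂ} (hf : StronglyMeasurable f) :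
    ∫ τ, f (fun iq => τ iq a) ∂replicaLaw X = ∫ τ, f τ ∂fieldMeasure := by
  have h : Measurable fun y : EuclideanSpace ℝ (Fin n) => y a := by fun_prop
  have h2 : Measurable fun (τ : Fin 3 × ℤ → EuclideanSpace ℝ (Fin n)) (iq : Fin 3 × ℤ) => τ iq a :=
    measurable_pi_iff.2 fun iq => h.comp (measurable_pi_apply iq)
  rw [← map_replicaLaw hX ha, integral_map h2.aemeasurable hf.aestronglyMeasurable]

end TreeValues

section Cumulants

variable {ι : Type} [Fintype ι]

namespace VertexData

/-- The exponential of the sum of the vertices as a sum over trees. -/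
theorem integral_exp_total_eq [Nonempty ι] (D : VertexData ι) {t : ℕ → ℂ}
    (ht : ∀ n, t n = ∑ F ∈ trees (Finset.univ : Finset (Fin (n + 2))), ∑ c : Fin (n + 2) → ι,
      treeVal D.mom D.vertex F c)
    (hs : Summable fun n : ℕ => ‖t n / ((n + 2)! : ℂ)‖ * 2 ^ (n + 2)) :
    ∫ τ, Complex.exp (D.total τ) ∂fieldMeasure =
      Complex.exp (∫ τ, D.total τ ∂fieldMeasure + ∑' n, t n / ((n + 2)! : ℂ)) := by
  letI : MeasurableSpace ι := ⊤
  haveI : DiscreteMeasurableSpace ι := ⟨fun _ => trivial⟩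
  have h1 : D.gas.cumulant 1 = ∫ τ, D.total τ ∂fieldMeasure := by
    have := D.gas.moment_succ (z := fun n => ∫ τ, D.total τ ^ n ∂fieldMeasure)
      (fun n A => D.moment_gas A) 0
    simpa using this.symm
  have h2 : ∀ n, D.gas.cumulant (n + 2) = t n := fun n => by
    rw [D.cumulant_eq_sum, ht]
    rfl
  have hsum : Summable fun n : ℕ => ‖D.gas.cumulant (n + 1) / ((n + 1)! : ℂ)‖ * 2 ^ (n + 1) := by
    rw [← summable_nat_add_iff 1]
    simpa only [h2] using hs
  have hsum' : Summable fun n : ℕ => D.gas.cumulant (n + 1) / ((n + 1)! : ℂ) := by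
    refine Summable.of_norm (hsum.of_nonneg_of_le (fun _ => norm_nonneg _) fun n => ?_)
    exact le_mul_of_one_le_right (norm_nonneg _) (one_le_pow₀ one_le_two)
  rw [D.integral_exp_total hsum, hsum'.tsum_eq_zero_add]
  simp only [h2, h1, zero_add, Nat.factorial_one, Nat.cast_one, div_one]

end VertexData

/-- Trees as edge sets and as graphs. -/
lemma sum_trees_eq {n : ℕ} (hn : 0 < n) [Fintype {T : SimpleGraph (Fin n) // T.IsTree}]
    (f : Finset (Sym2 (Fin n)) → ℂ) :
    ∑ F ∈ trees (Finset.univ : Finset (Fin n)), f F =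
      ∑ T : {T : SimpleGraph (Fin n) // T.IsTree}, f (treeEdges T.1) := by
  classical
  symm
  have hco : ∀ T : SimpleGraph (Fin n), ((treeEdges T : Finset (Sym2 (Fin n))) : Set (Sym2 (Fin n))) =
      T.edgeSet := fun T => by ext l; simp [mem_treeEdges]
  have hfe : ∀ T : SimpleGraph (Fin n),
      SimpleGraph.fromEdgeSet ((treeEdges T : Finset (Sym2 (Fin n))) : Set (Sym2 (Fin n))) = T :=
    fun T => by rw [hco, SimpleGraph.fromEdgeSet_edgeSet]
  refine Finset.sum_bij (fun T _ => treeEdges T.1) (fun T _ => ?_) (fun T _ T' _ h => ?_)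
    (fun F hF => ?_) fun T _ => rfl
  · rw [mem_trees, mem_forests, hfe]
    refine ⟨⟨fun l hl => ?_, T.2.2⟩, fun a _ b _ => T.2.1 a b⟩
    have := not_isDiag_of_mem_treeEdges T.1 l hl
    simp [pairs, this]
  · exact Subtype.ext (by rw [← hfe T.1, h, hfe])
  · obtain ⟨h1, h2⟩ := mem_trees.1 hF
    obtain ⟨h3, h4⟩ := mem_forests.1 h1
    have hne : Nonempty (Fin n) := ⟨⟨0, hn⟩⟩
    refine ⟨⟨SimpleGraph.fromEdgeSet (F : Set (Sym2 (Fin n))), ⟨⟨fun a b =>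
      h2 a (Finset.mem_univ _) b (Finset.mem_univ _)⟩, h4⟩⟩, Finset.mem_univ _, ?_⟩
    ext l
    rw [mem_treeEdges, SimpleGraph.edgeSet_fromEdgeSet]
    simp only [Set.mem_sdiff, Finset.mem_coe]
    exact ⟨fun h => h.1, fun h => ⟨h, fun hd => not_isDiag_of_mem_pairs l (h3 h) hd⟩⟩

end Cumulants

/-! ### The expansion with cutoffs -/

section SpeciesVertices

variable {m : ℝ} {lam : ℂ} {N : ℕ}

/-- The derivatives of the vertices of the theory with a cutoff `ε`; loop vertices that are not
differentiated are dropped. -/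
def specVertex (m : ℝ) (lam : ℂ) (P : Fin N → Momentum) (u : Fin N × Fin N → ℂ) (ε : ℝ) :
    Species N → ℕ → ℝ → ℂ :=
  Sum.elim (fun p d s => if d = 0 then 0 else loopVertex m lam ε p d s)
    fun ij d s => u ij * ((d ! : ℂ) * zeta lam ^ d * TGFT.resolvent m lam (P ij.1) s ^ (d + 1))

/-- The derivatives of the vertices. -/
def limVertex (m : ℝ) (lam : ℂ) (P : Fin N → Momentum) (u : Fin N × Fin N → ℂ) :
    Species N → ℕ → ℝ → ℂ :=
  Sum.elim (fun p d s => if d = 0 then 0 else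
    ((d - 1)! : ℂ) * zeta lam ^ d * TGFT.resolvent m lam p s ^ d)
    fun ij d s => u ij * ((d ! : ℂ) * zeta lam ^ d * TGFT.resolvent m lam (P ij.1) s ^ (d + 1))

variable (hr : 0 < cosHalf lam) (hm : 0 < m) (P : Fin N → Momentum) (u : Fin N × Fin N → ℂ)
include hr

lemma continuous_loopVertex (ε : ℝ) (p : Momentum) (d : ℕ) :
    Continuous (loopVertex m lam ε p (d + 1)) := by
  refine continuous_of_dominated
    (bound := fun α => |strength m lam p| ^ (d + 1) * (α ^ d * Real.exp (-(cosHalf lam * α))))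
    (fun s => Measurable.aestronglyMeasurable ?_) (fun s => ?_)
    ((integrableOn_pow_mul_exp_real hr d).const_mul _) (ae_of_all _ fun α => by fun_prop)
  · have := measurable_loopDens lam ε
    fun_prop
  · filter_upwards [ae_restrict_mem measurableSet_Ioi] with α hα
    have hα0 : 0 < α := hα
    rw [norm_mul, norm_mul, norm_pow, norm_exp_I_mul, norm_mul, Complex.norm_I, one_mul,
      Complex.norm_real, norm_mul, Real.norm_of_nonneg hα0.le, mul_one, Real.norm_eq_abs]
    refine (mul_le_mul_of_nonneg_right (norm_loopDens_le lam hα0) (by positivity)).trans_eq ?_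
    rw [mul_pow, pow_succ α]
    field_simp

lemma continuous_specVertex (ε : ℝ) (s : Species N) (d : ℕ) :
    Continuous (specVertex m lam P u ε s d) := by
  rcases s with p | ij
  · cases d with
    | zero => simpa [specVertex] using continuous_const
    | succ d => simpa [specVertex] using continuous_loopVertex hr ε p d
  · have := continuous_resolvent (m := m) hr (P ij.1)
    simp only [specVertex, Sum.elim_inr]
    fun_prop

lemma tendsto_specVertex (hm : 0 < m) (s : Species N) (d : ℕ) (x : ℝ) :
    Tendsto (fun ε => specVertex m lam P u ε s d x) (𝓝 0) (𝓝 (limVertex m lam P u s d x)) := by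
  rcases s with p | ij
  · cases d with
    | zero => simp [specVertex, limVertex]
    | succ d => simpa [specVertex, limVertex] using tendsto_loopVertex hr hm p d x
  · simp [specVertex, limVertex]

lemma norm_cilium_le (hm : 0 < m) (p : Momentum) (d : ℕ) (x : ℝ) :
    ‖(d ! : ℂ) * zeta lam ^ d * TGFT.resolvent m lam p x ^ (d + 1)‖ ≤
      propagator m p / cosHalf lam * ((d ! : ℝ) * (strength m lam p / cosHalf lam) ^ d) := by
  rw [norm_mul, norm_mul, norm_pow, norm_pow, Complex.norm_natCast, norm_zeta]
  have h1 := norm_resolvent_le hr hm p x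
  have h2 := cpl_nonneg lam
  calc _ ≤ (d ! : ℝ) * cpl lam ^ d * (propagator m p / cosHalf lam) ^ (d + 1) := by gcongr
    _ = _ := by
      rw [strength, mul_div_assoc, mul_pow, pow_succ]
      ring

/-- The bound on a vertex. -/
lemma norm_specVertex_le (hm : 0 < m) {η : ℝ}
    (hu : ∀ ij, ‖u ij‖ * (propagator m (P ij.1) / cosHalf lam) ≤ η) (ε : ℝ) (s : Species N) (d : ℕ)
    (x : ℝ) : ‖specVertex m lam P u ε s d x‖ ≤
      s.wt η * (d ! : ℝ) * (strength m lam (s.mom P) / cosHalf lam) ^ d := by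
  rcases s with p | ij
  · have hs := strength_nonneg (lam := lam) hm p
    cases d with
    | zero => simp [specVertex, Species.wt]
    | succ d =>
      simp only [specVertex, Sum.elim_inl, Species.wt, Species.mom, id, one_mul, Nat.succ_ne_zero,
        if_false]
      refine (norm_loopVertex_succ_le hr hm ε p d x).trans ?_
      refine mul_le_mul_of_nonneg_right ?_ (by positivity)
      exact Nat.cast_le.2 (Nat.factorial_le (Nat.le_succ d))
  · have hs := strength_nonneg (lam := lam) hm (P ij.1)
    simp only [specVertex, Sum.elim_inr, Species.wt, Species.mom]
    rw [norm_mul, mul_assoc η]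
    refine (mul_le_mul_of_nonneg_left (norm_cilium_le hr hm (P ij.1) d x) (norm_nonneg _)).trans ?_
    rw [← mul_assoc]
    exact mul_le_mul_of_nonneg_right (hu ij) (by positivity)

lemma norm_specVertex_zero_le (hm : 0 < m) {η : ℝ}
    (hu : ∀ ij, ‖u ij‖ * (propagator m (P ij.1) / cosHalf lam) ≤ η) (ε : ℝ) (s : Species N)
    (x : ℝ) : ‖specVertex m lam P u ε s 0 x‖ ≤ Sum.elim (fun _ => 0) (fun _ => η) s := by
  rcases s with p | ij
  · simp [specVertex]
  · have := norm_specVertex_le hr P u hm hu ε (.inr ij) 0 x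
    simpa [Species.wt] using this

omit hr in
lemma prod_strength_mul_overlap (T : SimpleGraph (Fin N)) (hT : T.IsTree) (k : Fin N → Momentum) :
    (∏ l ∈ treeEdges T, lineOverlap k l) *
      ∏ a, (strength m lam (k a) / cosHalf lam) ^ lineCount (treeEdges T) a =
      ((cpl lam / cosHalf lam) ^ 2) ^ (N - 1) * lineProd m T k := by
  have hc : (treeEdges T).card = N - 1 := by have := card_treeEdges hT; omega
  rw [← prod_edges _ (not_isDiag_of_mem_treeEdges T) fun a => strength m lam (k a) / cosHalf lam,
    ← Finset.prod_mul_distrib, lineProd, ← hc, ← Finset.prod_const, ← Finset.prod_mul_distrib]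
  refine Finset.prod_congr rfl fun l _ => ?_
  induction l with | _ a b => ?_
  simp only [lineOverlap_mk, Sym2.lift_mk, lineKernel, strength]
  ring

/-- The bound on the contribution of a tree. -/
lemma norm_treeVal_le_termBound (hm : 0 < m) {η : ℝ}
    (hu : ∀ ij, ‖u ij‖ * (propagator m (P ij.1) / cosHalf lam) ≤ η) (ε : ℝ) {n : ℕ}
    {T : SimpleGraph (Fin n)} (hT : T.IsTree) (c : Fin n → Species N) :
    ‖treeVal (Species.mom P) (specVertex m lam P u ε) (treeEdges T) c / (n ! : ℂ)‖ ≤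
      termBound m P η ((cpl lam / cosHalf lam) ^ 2) T c := by
  have h := norm_treeVal_le (Species.mom P) (specVertex m lam P u ε) (treeEdges T) c
    (fun a s => norm_specVertex_le hr P u hm hu ε (c a) (lineCount (treeEdges T) a) s)
  rw [norm_div, Complex.norm_natCast]
  refine (div_le_div_of_nonneg_right h (by positivity)).trans_eq ?_
  rw [Finset.prod_mul_distrib, Finset.prod_mul_distrib, mul_left_comm,
    prod_strength_mul_overlap T hT, termBound]
  push_cast
  ring

/-- The trees with species attached to their vertices. -/
abbrev Decorated (N : ℕ) : Type :=
  Σ n : ℕ, {T : SimpleGraph (Fin n) // T.IsTree} × (Fin n → Species N)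

/-- The bound on the contribution of a decorated tree. -/
def decBound (m ρ η : ℝ) (P : Fin N → Momentum) (j : Decorated N) : ℝ :=
  if j.1 < 2 then ∏ a, Sum.elim (fun _ => 0) (fun _ => η) (j.2.2 a)
    else termBound m P η ρ j.2.1.1 j.2.2

/-- The contribution of a decorated tree, given the vertices. -/
def decVal (P : Fin N → Momentum) (v : Species N → ℕ → ℝ → ℂ) (j : Decorated N) : ℂ :=
  treeVal (Species.mom P) v (treeEdges j.2.1.1) j.2.2 / (j.1 ! : ℂ)

omit hr in
lemma lineCount_of_lt_two {n : ℕ} (hn : n < 2) {T : SimpleGraph (Fin n)} (hT : T.IsTree) (a : Fin n) :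
    lineCount (treeEdges T) a = 0 := by
  have h := card_treeEdges hT
  have h2 : (treeEdges T).card = 0 := by omega
  rw [Finset.card_eq_zero.1 h2]
  rfl

lemma norm_decVal_le (hm : 0 < m) {η : ℝ}
    (hu : ∀ ij, ‖u ij‖ * (propagator m (P ij.1) / cosHalf lam) ≤ η) (ε : ℝ) (j : Decorated N) :
    ‖decVal P (specVertex m lam P u ε) j‖ ≤ decBound m ((cpl lam / cosHalf lam) ^ 2) η P j := by
  obtain ⟨n, T, c⟩ := j
  rw [decBound]
  split_ifs with h
  · have h0 := lineCount_of_lt_two h T.2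
    have h1 := norm_treeVal_le (Species.mom P) (specVertex m lam P u ε) (treeEdges T.1) c
      (b := fun a => Sum.elim (fun _ => 0) (fun _ => η) (c a)) fun a s => by
        rw [h0 a]
        exact norm_specVertex_zero_le hr P u hm hu ε (c a) s
    have h2 : treeEdges T.1 = ∅ := by
      have h3 := card_treeEdges T.2
      have h4 : n < 2 := h
      exact Finset.card_eq_zero.1 (by omega)
    rw [h2, Finset.prod_empty, one_mul] at h1
    rw [decVal, norm_div, Complex.norm_natCast]
    simp only [h2]
    refine (div_le_self (norm_nonneg _) ?_).trans h1
    exact_mod_cast Nat.one_le_iff_ne_zero.2 (Nat.factorial_ne_zero n)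
  · exact norm_treeVal_le_termBound hr P u hm hu ε T.2 c

lemma tendsto_decVal (hm : 0 < m) {Y : Type*} {l : Filter Y} [l.IsCountablyGenerated] {ε : Y → ℝ}
    (hε : Tendsto ε l (𝓝 0)) (j : Decorated N) :
    Tendsto (fun y => decVal P (specVertex m lam P u (ε y)) j) l
      (𝓝 (decVal P (limVertex m lam P u) j)) := by
  refine Tendsto.div_const ?_ _
  have hu : ∀ ij, ‖u ij‖ * (propagator m (P ij.1) / cosHalf lam) ≤
      ∑ ij, ‖u ij‖ * (propagator m (P ij.1) / cosHalf lam) := fun ij =>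
    Finset.single_le_sum (f := fun ij => ‖u ij‖ * (propagator m (P ij.1) / cosHalf lam))
      (fun ij _ => by have := propagator_pos hm (P ij.1); positivity) (Finset.mem_univ ij)
  exact tendsto_treeVal _ _ _ _ _
    (fun y a s => norm_specVertex_le hr P u hm hu (ε y) (j.2.2 a) _ s)
    (fun y a => continuous_specVertex hr P u (ε y) _ _)
    fun a s => (tendsto_specVertex hr P u hm _ _ s).comp hε

end SpeciesVertices

section DecoratedSum

variable {m : ℝ} {N : ℕ} (P : Fin N → Momentum)

lemma decBound_nonneg (hm : 0 < m) {η ρ : ℝ} (hη : 0 ≤ η) (hρ : 0 ≤ ρ) (j : Decorated N) :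
    0 ≤ decBound m ρ η P j := by
  rw [decBound]
  split_ifs
  · refine Finset.prod_nonneg fun a _ => ?_
    rcases j.2.2 a with p | ij
    · exact le_rfl
    · exact hη
  · exact termBound_nonneg hm P hη hρ _ _

/-- The conditions under which the tree expansion converges. -/
structure SmallCoupling (m ρ : ℝ) : Prop where
  pos : 0 < m
  nonneg : 0 ≤ ρ
  exists_bounds : ∃ D S : ℝ, 0 < D ∧ 0 < S ∧
    (∑' p, ∑' p', ENNReal.ofReal (lineKernel m p p')) ≤ ENNReal.ofReal D ∧
    (∀ p, ∑' p', ENNReal.ofReal (lineKernel m p p') ≤ ENNReal.ofReal S) ∧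
    ρ * S ≤ 1 / 64 ∧ 512 * ρ * D ≤ 1

variable {ρ η : ℝ}

/-- The bound on the sum of the trees of a given order. -/
lemma exists_order_bound (h : SmallCoupling m ρ) :
    ∃ A : ℝ, 0 ≤ A ∧ 2 * A ≤ 1 ∧ ∀ (N : ℕ) (P : Fin N → Momentum) (η : ℝ), 0 ≤ η →
      (N : ℝ) ^ 2 * η ≤ 1 → ∀ n : ℕ,
      ∑' q : {T : SimpleGraph (Fin (n + 2)) // T.IsTree} × (Fin (n + 2) → Species N),
        ENNReal.ofReal (termBound m P η ρ q.1.1 q.2) ≤ ENNReal.ofReal (A * (1 / 4) ^ n) := by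
  obtain ⟨D, S, hD0, hS0, hD, hS, hρS, hρD⟩ := h.exists_bounds
  have hρ := h.nonneg
  refine ⟨256 * ρ * D, by positivity, by linarith, fun N P η hη hN n => ?_⟩
  rw [ENNReal.tsum_prod (f := fun (T : {T : SimpleGraph (Fin (n + 2)) // T.IsTree})
    (c : Fin (n + 2) → Species N) => ENNReal.ofReal (termBound m P η ρ T.1 c))]
  refine (tsum_termBound_le h.pos hD0 hS0 hD hS P hη hN hρ n).trans (ENNReal.ofReal_le_ofReal ?_)
  have : 16 * (ρ * S) ≤ 1 / 4 := by linarith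
  gcongr

lemma tsum_decBound_order_one_le (hN : (N : ℝ) ^ 2 * η ≤ 1) :
    ∑' q : {T : SimpleGraph (Fin 1) // T.IsTree} × (Fin 1 → Species N),
      ENNReal.ofReal (decBound m ρ η P ⟨1, q⟩) ≤ 1 := by
  rw [ENNReal.tsum_prod (f := fun (T : {T : SimpleGraph (Fin 1) // T.IsTree})
    (c : Fin 1 → Species N) => ENNReal.ofReal (decBound m ρ η P ⟨1, T, c⟩))]
  have h1 : ∀ T : {T : SimpleGraph (Fin 1) // T.IsTree}, ∑' c : Fin 1 → Species N,
      ENNReal.ofReal (decBound m ρ η P ⟨1, T, c⟩) ≤ 1 := by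
    intro T
    rw [← (Equiv.funUnique (Fin 1) (Species N)).symm.tsum_eq,
      Summable.tsum_sum ENNReal.summable ENNReal.summable, tsum_fintype (β := Fin N × Fin N)]
    have e1 : ∀ p : Momentum, ENNReal.ofReal (decBound m ρ η P ⟨1, T,
        (Equiv.funUnique (Fin 1) (Species N)).symm (Sum.inl p)⟩) = 0 := fun p => by
      simp [decBound, Equiv.funUnique]
    have e2 : ∀ ij, ENNReal.ofReal (decBound m ρ η P ⟨1, T,
        (Equiv.funUnique (Fin 1) (Species N)).symm (Sum.inr ij)⟩) = ENNReal.ofReal η := fun ij => by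
      simp [decBound, Equiv.funUnique]
    simp_rw [e1, e2]
    rw [tsum_zero, zero_add, Finset.sum_const, Finset.card_univ, Fintype.card_prod,
      Fintype.card_fin, nsmul_eq_mul, ← ENNReal.ofReal_natCast, ← ENNReal.ofReal_mul (by positivity),
      ← ENNReal.ofReal_one]
    refine ENNReal.ofReal_le_ofReal (le_trans (le_of_eq ?_) hN)
    push_cast
    ring
  have h2 : Function.Injective fun _ : {T : SimpleGraph (Fin 1) // T.IsTree} => () :=
    fun T T' _ => Subsingleton.elim _ _
  exact (ENNReal.tsum_le_tsum h1).trans ((ENNReal.tsum_comp_le_tsum_of_injective h2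
    fun _ => 1).trans (by simp))

instance isEmpty_tree_zero : IsEmpty {T : SimpleGraph (Fin 0) // T.IsTree} :=
  ⟨fun T => (T.2.1.nonempty).elim fun a => a.elim0⟩

lemma tsum_decBound_le (h : SmallCoupling m ρ) (hη : 0 ≤ η) (hN : (N : ℝ) ^ 2 * η ≤ 1) :
    ∑' j : Decorated N, ENNReal.ofReal (decBound m ρ η P j) ≤ 2 := by
  obtain ⟨A, hA0, hA, hb⟩ := exists_order_bound h
  set f : ℕ → ℝ≥0∞ := fun n =>
    ∑' q : {T : SimpleGraph (Fin n) // T.IsTree} × (Fin n → Species N),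
      ENNReal.ofReal (decBound m ρ η P ⟨n, q⟩) with hf
  have h0 : f 0 = 0 := tsum_empty
  have h1 : f 1 ≤ 1 := tsum_decBound_order_one_le P hN
  have h2 : ∀ n, f (n + 2) ≤ ENNReal.ofReal (A * (1 / 4) ^ n) := fun n => by
    refine le_trans (le_of_eq (tsum_congr fun q => ?_)) (hb N P η hη hN n)
    rw [decBound, if_neg (by simp)]
  have h3 : ∑' n, f (n + 2) ≤ 1 := by
    refine (ENNReal.tsum_le_tsum h2).trans ?_
    have hg : HasSum (fun n : ℕ => A * (1 / 4 : ℝ) ^ n) (A * (1 - 1 / 4)⁻¹) :=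
      (hasSum_geometric_of_lt_one (by norm_num) (by norm_num)).mul_left A
    rw [← ENNReal.ofReal_tsum_of_nonneg (fun n => by positivity) hg.summable, hg.tsum_eq,
      ← ENNReal.ofReal_one]
    refine ENNReal.ofReal_le_ofReal ?_
    norm_num
    linarith
  have h4 : ∑' j : Decorated N, ENNReal.ofReal (decBound m ρ η P j) = ∑' n, f n :=
    ENNReal.tsum_sigma' _
  have h5 : ∑' n, f n = (f 0 + f 1) + ∑' n, f (n + 2) := by
    rw [← (ENNReal.summable (f := fun n => f (n + 2))).sum_add_tsum_nat_add' (f := f),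
      Finset.sum_range_succ, Finset.sum_range_one]
  rw [h4, h5, h0, zero_add]
  exact (add_le_add h1 h3).trans_eq one_add_one_eq_two

lemma summable_decBound (h : SmallCoupling m ρ) (hη : 0 ≤ η) (hN : (N : ℝ) ^ 2 * η ≤ 1) :
    Summable (decBound m ρ η P) := by
  have h1 := ENNReal.summable_toReal (ne_top_of_le_ne_top ENNReal.ofNat_ne_top
    (tsum_decBound_le P h hη hN))
  simpa only [ENNReal.toReal_ofReal (decBound_nonneg P h.pos hη h.nonneg _)] using h1

lemma tsum_decBound_real_le (h : SmallCoupling m ρ) (hη : 0 ≤ η) (hN : (N : ℝ) ^ 2 * η ≤ 1) :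
    ∑' j, decBound m ρ η P j ≤ 2 := by
  have h1 := tsum_decBound_le P h hη hN
  rw [← ENNReal.ofReal_tsum_of_nonneg (decBound_nonneg P h.pos hη h.nonneg)
    (summable_decBound P h hη hN)] at h1
  exact (ENNReal.ofReal_le_iff_le_toReal ENNReal.ofNat_ne_top).1 h1

end DecoratedSum

/-! ### The tree expansion of the theory with cutoffs -/

section Cutoff

variable {m : ℝ} {lam : ℂ} {N : ℕ} (P : Fin N → Momentum) (u : Fin N × Fin N → ℂ)

/-- The source term with coefficients `-u`. -/
def cilia (m : ℝ) (lam : ℂ) (P : Fin N → Momentum) (u : Fin N × Fin N → ℂ) (τ : Field) : ℂ :=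
  ∑ ij, u ij * TGFT.resolvent m lam (P ij.1) (Gam (P ij.1) τ)

/-- The exponent of the weight with cutoffs. -/
def cutExponent (m : ℝ) (lam : ℂ) (P : Fin N → Momentum) (u : Fin N × Fin N → ℂ)
    (A : Finset Momentum) (ε : ℝ) (τ : Field) : ℂ :=
  ∑ p ∈ A, loopFun m lam ε p (Gam p τ) + cilia m lam P u τ

/-- The species with cutoffs as species. -/
def cutEmb (N : ℕ) (A : Finset Momentum) : A ⊕ (Fin N × Fin N) → Species N :=
  Sum.map Subtype.val id

lemma cutEmb_injective (A : Finset Momentum) : Function.Injective (cutEmb N A) :=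
  Sum.map_injective.2 ⟨Subtype.val_injective, Function.injective_id⟩

/-- The vertices of the theory with cutoffs. -/
def cutData (hr : 0 < cosHalf lam) (hm : 0 < m) (P : Fin N → Momentum) (u : Fin N × Fin N → ℂ)
    (A : Finset Momentum) {ε : ℝ} (hε : 0 < ε) : VertexData (A ⊕ (Fin N × Fin N)) where
  mom i := (cutEmb N A i).mom P
  str i := strength m lam ((cutEmb N A i).mom P)
  str_nonneg _ := strength_nonneg hm _
  dens := Sum.elim (fun _ => loopDens lam ε) fun ij α => u ij * ciliumDens m lam (P ij.1) α
  measurable_dens := by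
    rintro (p | ij)
    · exact measurable_loopDens lam ε
    · exact (measurable_ciliumDens m lam (P ij.1)).const_mul (u ij)
  integrable := by
    rintro (p | ij) d
    · exact integrableOn_loopDens hr hε d
    · simp only [Sum.elim_inr, mul_assoc]
      exact (integrableOn_ciliumDens hr (P ij.1) d).const_mul (u ij)

variable (hr : 0 < cosHalf lam) (hm : 0 < m) (A : Finset Momentum) {ε : ℝ} (hε : 0 < ε)

lemma vertex_inr (ij : Fin N × Fin N) (d : ℕ) (s : ℝ) :
    (cutData hr hm P u A hε).vertex (.inr ij) d s = specVertex m lam P u ε (.inr ij) d s := by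
  simp only [specVertex, Sum.elim_inr]
  rw [← integral_ciliumDens hr, ← integral_const_mul]
  refine integral_congr_ae (ae_of_all _ fun α => ?_)
  simp only [cutData, cutEmb, Sum.map_inr, Sum.elim_inr, id, Species.mom]
  ring

lemma vertex_eq (i : A ⊕ (Fin N × Fin N)) {d : ℕ} (hd : d ≠ 0) (s : ℝ) :
    (cutData hr hm P u A hε).vertex i d s = specVertex m lam P u ε (cutEmb N A i) d s := by
  rcases i with p | ij
  · simp only [specVertex, cutEmb, Sum.map_inl, Sum.elim_inl, if_neg hd]
    rfl
  · exact vertex_inr P u hr hm A hε ij d s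

lemma total_cutData (τ : Field) : (cutData hr hm P u A hε).total τ =
    (A.card * ∫ α in Set.Ioi 0, loopDens lam ε α) + cutExponent m lam P u A ε τ := by
  rw [VertexData.total, Fintype.sum_sum_type, cutExponent, ← add_assoc]
  congr 1
  · have h : ∀ p : A, (cutData hr hm P u A hε).vertex (.inl p) 0
        (Gam ((cutData hr hm P u A hε).mom (.inl p)) τ) =
        (∫ α in Set.Ioi 0, loopDens lam ε α) + loopFun m lam ε p (Gam p τ) := fun p =>
      loopVertex_zero hr hm hε p.1 _
    simp_rw [h]
    rw [Finset.sum_add_distrib, Finset.sum_const, Finset.card_univ, Fintype.card_coe, nsmul_eq_mul,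
      Finset.sum_coe_sort A fun p => loopFun m lam ε p (Gam p τ)]
  · refine Finset.sum_congr rfl fun ij _ => ?_
    rw [vertex_inr]
    simp [specVertex, cutData, cutEmb, Species.mom]

include hr hm hε in
lemma integrable_cutExponent (hA : A.Nonempty) :
    Integrable (cutExponent m lam P u A ε) fieldMeasure := by
  haveI : Nonempty (A ⊕ (Fin N × Fin N)) := ⟨.inl ⟨hA.choose, hA.choose_spec⟩⟩
  letI : MeasurableSpace (A ⊕ (Fin N × Fin N)) := ⊤
  haveI : DiscreteMeasurableSpace (A ⊕ (Fin N × Fin N)) := ⟨fun _ => trivial⟩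
  have h := ((cutData hr hm P u A hε).integrable_total_pow 1).sub
    (integrable_const (A.card * ∫ α in Set.Ioi 0, loopDens lam ε α))
  refine h.congr (ae_of_all _ fun τ => ?_)
  simp only [Pi.sub_apply, pow_one, total_cutData]
  ring

open scoped Classical in
/-- The contribution of a decorated tree to the theory with cutoffs. -/
def cutTerm (m : ℝ) (lam : ℂ) (P : Fin N → Momentum) (u : Fin N × Fin N → ℂ) (A : Finset Momentum)
    (ε : ℝ) (j : Decorated N) : ℂ :=
  if 2 ≤ j.1 ∧ ∀ a, j.2.2 a ∈ Set.range (cutEmb N A) then decVal P (specVertex m lam P u ε) j else 0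

lemma lineCount_ne_zero {n : ℕ} {T : SimpleGraph (Fin (n + 2))} (hT : T.IsTree) (a : Fin (n + 2)) :
    lineCount (treeEdges T) a ≠ 0 := by
  obtain ⟨b, hb⟩ := hT.1.preconnected.exists_adj_of_nontrivial a
  refine Finset.card_ne_zero.2 ⟨s(a, b), ?_⟩
  rw [Finset.mem_filter, mem_treeEdges]
  exact ⟨hb, Sym2.mem_mk_left a b⟩

lemma treeVal_cutData {n : ℕ} {T : SimpleGraph (Fin (n + 2))} (hT : T.IsTree)
    (c : Fin (n + 2) → A ⊕ (Fin N × Fin N)) :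
    treeVal (cutData hr hm P u A hε).mom (cutData hr hm P u A hε).vertex (treeEdges T) c =
      treeVal (Species.mom P) (specVertex m lam P u ε) (treeEdges T) (cutEmb N A ∘ c) := by
  have h : ∀ (τ : Fin 3 × ℤ → EuclideanSpace ℝ (Fin (n + 2))) a,
      (cutData hr hm P u A hε).vertex (c a) (lineCount (treeEdges T) a)
        (Gam ((cutData hr hm P u A hε).mom (c a)) (fun iq => τ iq a)) =
      specVertex m lam P u ε ((cutEmb N A ∘ c) a) (lineCount (treeEdges T) a)
        (Gam (((cutEmb N A ∘ c) a).mom P) (fun iq => τ iq a)) := fun τ a =>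
    vertex_eq P u hr hm A hε (c a) (lineCount_ne_zero hT a) _
  simp only [treeVal, h]
  rfl

lemma tsum_cutTerm (n : ℕ) [Fintype {T : SimpleGraph (Fin (n + 2)) // T.IsTree}] :
    ∑' q, cutTerm m lam P u A ε ⟨n + 2, q⟩ =
      (∑ F ∈ trees (Finset.univ : Finset (Fin (n + 2))), ∑ c : Fin (n + 2) → A ⊕ (Fin N × Fin N),
        treeVal (cutData hr hm P u A hε).mom (cutData hr hm P u A hε).vertex F c) /
        ((n + 2)! : ℂ) := by
  rw [sum_trees_eq (by omega) fun F => ∑ c : Fin (n + 2) → A ⊕ (Fin N × Fin N),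
        treeVal (cutData hr hm P u A hε).mom (cutData hr hm P u A hε).vertex F c]
  have hinj : Function.Injective
      (Prod.map id (fun c : Fin (n + 2) → A ⊕ (Fin N × Fin N) => cutEmb N A ∘ c) :
      {T : SimpleGraph (Fin (n + 2)) // T.IsTree} × (Fin (n + 2) → A ⊕ (Fin N × Fin N)) →
      {T : SimpleGraph (Fin (n + 2)) // T.IsTree} × (Fin (n + 2) → Species N)) :=
    Function.injective_id.prodMap (cutEmb_injective A).comp_left
  rw [← hinj.tsum_eq, tsum_fintype, Fintype.sum_prod_type, Finset.sum_div]
  · refine Finset.sum_congr rfl fun T _ => ?_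
    rw [Finset.sum_div]
    refine Finset.sum_congr rfl fun c _ => ?_
    rw [treeVal_cutData P u hr hm A hε T.2 c, cutTerm, if_pos ⟨by simp, fun a => ⟨c a, rfl⟩⟩]
    rfl
  · rintro ⟨T, c⟩ hc
    have h : ∀ a, c a ∈ Set.range (cutEmb N A) := by
      by_contra h
      refine hc ?_
      change cutTerm m lam P u A ε ⟨n + 2, T, c⟩ = 0
      rw [cutTerm, if_neg fun h' => h h'.2]
    choose c' hc' using h
    exact ⟨(T, c'), Prod.ext rfl (funext hc')⟩

include hr in
lemma norm_cutTerm_le (hm : 0 < m) {η : ℝ} (hη : 0 ≤ η)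
    (hu : ∀ ij, ‖u ij‖ * (propagator m (P ij.1) / cosHalf lam) ≤ η) (ε : ℝ) (j : Decorated N) :
    ‖cutTerm m lam P u A ε j‖ ≤ decBound m ((cpl lam / cosHalf lam) ^ 2) η P j := by
  rw [cutTerm]
  split_ifs
  · exact norm_decVal_le hr P u hm hu ε j
  · rw [norm_zero]
    exact decBound_nonneg P hm hη (sq_nonneg _) j

include hr hm hε in
/-- The partition function with cutoffs as the exponential of a sum over trees. -/
theorem integral_exp_cutExponent (hA : A.Nonempty) {η : ℝ} (hη : 0 ≤ η)
    (hN : (N : ℝ) ^ 2 * η ≤ 1) (h : SmallCoupling m ((cpl lam / cosHalf lam) ^ 2))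
    (hu : ∀ ij, ‖u ij‖ * (propagator m (P ij.1) / cosHalf lam) ≤ η) :
    ∫ τ, Complex.exp (cutExponent m lam P u A ε τ) ∂fieldMeasure =
      Complex.exp (∫ τ, cutExponent m lam P u A ε τ ∂fieldMeasure +
        ∑' j, cutTerm m lam P u A ε j) := by
  classical
  haveI : Nonempty (A ⊕ (Fin N × Fin N)) := ⟨.inl ⟨hA.choose, hA.choose_spec⟩⟩
  letI : ∀ n, Fintype {T : SimpleGraph (Fin n) // T.IsTree} := fun n => Fintype.ofFinite _
  set D := cutData hr hm P u A hε with hD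
  set t : ℕ → ℂ := fun n => ∑ F ∈ trees (Finset.univ : Finset (Fin (n + 2))),
    ∑ c : Fin (n + 2) → A ⊕ (Fin N × Fin N), treeVal D.mom D.vertex F c with ht
  have hsd := summable_decBound P h hη hN
  have hs : Summable (cutTerm m lam P u A ε) :=
    Summable.of_norm_bounded hsd (norm_cutTerm_le P u hr A hm hη hu ε)
  have hfib : ∀ n, ∑' q, cutTerm m lam P u A ε ⟨n + 2, q⟩ = t n / ((n + 2)! : ℂ) := fun n =>
    tsum_cutTerm P u hr hm A hε n
  have hts : ∑' j, cutTerm m lam P u A ε j = ∑' n, t n / ((n + 2)! : ℂ) := by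
    have hsig := hs.sigma
    rw [hs.tsum_sigma, ← hsig.sum_add_tsum_nat_add 2, Finset.sum_range_succ, Finset.sum_range_one,
      tsum_congr hfib]
    have h0 : ∀ n < 2, ∑' q, cutTerm m lam P u A ε ⟨n, q⟩ = 0 := fun n hn => by
      refine (tsum_congr fun q => ?_).trans tsum_zero
      rw [cutTerm, if_neg fun h' => ?_]
      have := h'.1
      simp only at this
      omega
    rw [h0 0 (by norm_num), h0 1 (by norm_num), zero_add, zero_add]
  obtain ⟨B, hB0, -, hB⟩ := exists_order_bound h
  have hsum : Summable fun n : ℕ => ‖t n / ((n + 2)! : ℂ)‖ * 2 ^ (n + 2) := by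
    have hg : Summable fun n : ℕ => 4 * B * (1 / 2 : ℝ) ^ n :=
      (summable_geometric_of_lt_one (by norm_num) (by norm_num)).mul_left _
    refine hg.of_nonneg_of_le (fun n => by positivity) fun n => ?_
    have h1 : ‖t n / ((n + 2)! : ℂ)‖ ≤ B * (1 / 4) ^ n := by
      have h3 : Summable fun q => decBound m ((cpl lam / cosHalf lam) ^ 2) η P ⟨n + 2, q⟩ :=
        hsd.sigma_factor (n + 2)
      rw [← hfib n]
      refine (tsum_of_norm_bounded h3.hasSum fun q =>
        norm_cutTerm_le P u hr A hm hη hu ε ⟨n + 2, q⟩).trans ?_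
      have h4 := hB N P η hη hN n
      rw [← ENNReal.ofReal_le_ofReal_iff (by positivity),
        ENNReal.ofReal_tsum_of_nonneg (fun q => decBound_nonneg P hm hη (sq_nonneg _) _) h3]
      refine le_trans (le_of_eq (tsum_congr fun q => ?_)) h4
      rw [decBound, if_neg (by simp)]
    calc _ ≤ B * (1 / 4) ^ n * 2 ^ (n + 2) := by gcongr
      _ = 4 * B * ((1 / 4) ^ n * 2 ^ n) := by ring
      _ = _ := by rw [← mul_pow]; norm_num
  have hfin := D.integral_exp_total_eq (t := t) (fun n => rfl) hsum
  rw [← hts] at hfin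
  have htot : ∀ τ, D.total τ = _ := total_cutData P u hr hm A hε
  simp only [htot, Complex.exp_add] at hfin
  rw [integral_const_mul, integral_add (integrable_const _)
    (integrable_cutExponent P u hr hm A hε hA), integral_const, Complex.exp_add] at hfin
  rw [probReal_univ, one_smul, mul_assoc] at hfin
  rw [Complex.exp_add]
  exact mul_left_cancel₀ (Complex.exp_ne_zero _) hfin

end Cutoff

/-! ### Gaussian estimates -/

section FieldMoments

lemma measurePreserving_coord (x : Fin 3 × ℤ) :
    MeasurePreserving (fun τ : Field => τ x) fieldMeasure (gaussianReal 0 1) :=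
  measurePreserving_eval_infinitePi (fun _ : Fin 3 × ℤ => gaussianReal 0 1) x

lemma memLp_coord (x : Fin 3 × ℤ) {q : ℝ≥0∞} (hq : q ≠ ⊤) :
    MemLp (fun τ : Field => τ x) q fieldMeasure :=
  (memLp_id_gaussianReal' q hq).comp_measurePreserving (measurePreserving_coord x)

lemma memLp_Gam (p : Momentum) {q : ℝ≥0∞} (hq : q ≠ ⊤) : MemLp (Gam p) q fieldMeasure :=
  memLp_finsetSum (f := fun i (τ : Field) => τ (i, p.1 i)) Finset.univ fun _ _ => memLp_coord _ hq

lemma exists_eLpNorm_Gam_le {q : ℝ≥0∞} (h1 : 1 ≤ q) (hq : q ≠ ⊤) :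
    ∃ K : ℝ≥0∞, K ≠ ⊤ ∧ ∀ p, eLpNorm (Gam p) q fieldMeasure ≤ K := by
  refine ⟨∑ _ : Fin 3, eLpNorm id q (gaussianReal 0 1), ?_, fun p => ?_⟩
  · exact ENNReal.sum_ne_top.2 fun _ _ => (memLp_id_gaussianReal' q hq).eLpNorm_ne_top
  · have h2 : Gam p = ∑ i, fun τ : Field => τ (i, p.1 i) := by
      ext τ
      simp [Gam]
    rw [h2]
    refine (eLpNorm_sum_le (fun i _ => (memLp_coord _ hq).1) h1).trans (Finset.sum_le_sum
      fun i _ => le_of_eq ?_)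
    have h3 := eLpNorm_comp_measurePreserving (p := q) (memLp_id_gaussianReal' q hq).1
      (measurePreserving_coord (i, p.1 i))
    exact h3

lemma integral_coord (x : Fin 3 × ℤ) : ∫ τ, τ x ∂fieldMeasure = 0 := by
  have h := (measurePreserving_coord x).map_eq
  have h2 : ∫ y, y ∂gaussianReal 0 1 = 0 := integral_id_gaussianReal
  rwa [← h, integral_map (measurable_pi_apply x).aemeasurable (by fun_prop)] at h2

lemma integral_coord_mul (x y : Fin 3 × ℤ) :
    ∫ τ, τ x * τ y ∂fieldMeasure = if x = y then 1 else 0 := by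
  split_ifs with hxy
  · subst hxy
    have h3 : ∫ y, y ^ 2 ∂gaussianReal 0 1 = 1 := by
      have h := variance_fun_id_gaussianReal (μ := 0) (v := 1)
      rw [variance_of_integral_eq_zero (by fun_prop) integral_id_gaussianReal] at h
      simpa using h
    rw [← (measurePreserving_coord x).map_eq, integral_map (measurable_pi_apply x).aemeasurable (by fun_prop)] at h3
    simpa [pow_two] using h3
  · have h := (iIndepFun_infinitePi (P := fun _ : Fin 3 × ℤ => gaussianReal 0 1)
      (X := fun _ t => t) (fun _ => measurable_id)).indepFun hxy
    have h2 := h.integral_fun_mul_eq_mul_integral (measurable_pi_apply x).aestronglyMeasurable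
      (measurable_pi_apply y).aestronglyMeasurable
    refine h2.trans ?_
    have h3 := integral_coord x
    rw [fieldMeasure] at h3
    rw [h3, zero_mul]

lemma integral_Gam_mul (p p' : Momentum) :
    ∫ τ, Gam p τ * Gam p' τ ∂fieldMeasure = overlap p p' := by
  simp only [Gam, Finset.sum_mul_sum]
  have hi : ∀ x y, Integrable (fun τ : Field => τ x * τ y) fieldMeasure := fun x y =>
    (memLp_coord x (q := 2) ENNReal.ofNat_ne_top).integrable_mul
      (memLp_coord y (q := 2) ENNReal.ofNat_ne_top)
  rw [integral_finsetSum _ fun i _ => integrable_finsetSum _ fun j _ => hi _ _]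
  refine Finset.sum_congr rfl fun i _ => ?_
  rw [integral_finsetSum _ fun j _ => hi _ _, Finset.sum_eq_single i]
  · rw [integral_coord_mul]
    simp
  · intro j _ hj
    rw [integral_coord_mul, if_neg]
    simp [hj.symm]
  · simp

lemma integral_Gam (p : Momentum) : ∫ τ, Gam p τ ∂fieldMeasure = 0 := by
  simp only [Gam]
  rw [integral_finsetSum _ fun i _ => (memLp_coord _ ENNReal.one_ne_top).integrable le_rfl]
  simp [integral_coord]

variable {ι : Type*}

/-- The moment generating function of the intermediate fields. -/
lemma integral_rexp_fieldMeasure (S : Finset ι) (k : ι → Momentum) (x : ι → ℝ) :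
    ∫ τ, Real.exp (∑ a ∈ S, x a * Gam (k a) τ) ∂fieldMeasure =
      Real.exp ((∑ a ∈ S, ∑ b ∈ S, x a * x b * overlap (k a) (k b)) / 2) := by
  have h : ∀ τ : Field, ((Real.exp (∑ a ∈ S, x a * Gam (k a) τ) : ℝ) : ℂ) =
      ∏ iq ∈ fieldIndices S k,
        Complex.exp (((∑ a ∈ S, fieldCoeff (k a) (x a) iq : ℝ) : ℂ) * τ iq) := by
    intro τ
    rw [← Complex.exp_sum, Complex.ofReal_exp]
    congr 1
    simp only [← Complex.ofReal_mul]
    rw [← Complex.ofReal_sum]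
    congr 1
    simp only [Gam]
    rw [Finset.sum_congr rfl fun a ha => (sum_fieldIndices ha (x a) τ).symm, Finset.sum_comm]
    refine Finset.sum_congr rfl fun iq _ => ?_
    rw [← Finset.sum_mul]
  apply Complex.ofReal_injective
  rw [← integral_complex_ofReal]
  simp_rw [h]
  rw [fieldMeasure, integral_infinitePi_prod (fun _ => gaussianReal 0 1) _
    fun iq t => Complex.exp (((∑ a ∈ S, fieldCoeff (k a) (x a) iq : ℝ) : ℂ) * (t : ℂ))]
  · have h3 : ∀ z : ℂ, ∫ t, Complex.exp (z * (t : ℂ)) ∂gaussianReal 0 1 = Complex.exp (z ^ 2 / 2) := by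
      intro z
      have := complexMGF_id_gaussianReal (μ := 0) (v := 1) z
      simpa [complexMGF] using this
    simp only [h3]
    rw [← Complex.exp_sum, sum_overlap_one, Complex.ofReal_exp]
    congr 1
    push_cast
    rw [Finset.sum_div]
  · intro iq
    fun_prop

lemma integrable_rexp_fieldMeasure (S : Finset ι) (k : ι → Momentum) (x : ι → ℝ) :
    Integrable (fun τ => Real.exp (∑ a ∈ S, x a * Gam (k a) τ)) fieldMeasure := by
  refine Integrable.of_integral_ne_zero ?_
  rw [integral_rexp_fieldMeasure]
  exact (Real.exp_pos _).ne'

lemma integrable_exp_sq_gaussianReal :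
    Integrable (fun y : ℝ => Real.exp (y ^ 2 / 4)) (gaussianReal 0 1) := by
  rw [gaussianReal_of_var_ne_zero _ one_ne_zero, integrable_withDensity_iff_integrable_smul'
    (measurable_gaussianPDF _ _) (ae_of_all _ fun _ => gaussianPDF_lt_top)]
  refine ((integrable_exp_neg_mul_sq (b := 1 / 4) (by norm_num)).const_mul
    (√(2 * Real.pi * (1 : NNReal)))⁻¹).congr (ae_of_all _ fun y => ?_)
  simp only [toReal_gaussianPDF, gaussianPDFReal_def, smul_eq_mul]
  conv_rhs => rw [mul_assoc, ← Real.exp_add]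
  congr 2
  simp
  ring

/-- The exponential of a small quadratic form in the fields. -/
lemma exp_sum_le {S : Finset ι} {w y : ι → ℝ} (hw : ∀ a ∈ S, 0 ≤ w a) (hw1 : ∑ a ∈ S, w a ≤ 1) :
    Real.exp (∑ a ∈ S, w a * y a) ≤ 1 + ∑ a ∈ S, w a * Real.exp (y a) := by
  have h := convexOn_exp.map_add_sum_le (t := S) (w := w) (p := y) (v := 1 - ∑ a ∈ S, w a) (q := 0)
    hw (by ring) (fun _ _ => Set.mem_univ _) (by linarith) (Set.mem_univ _)
  simp only [smul_eq_mul, mul_zero, zero_add, Real.exp_zero, mul_one] at h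
  have := Finset.sum_nonneg hw
  linarith

end FieldMoments

/-! ### The sum of the logarithms -/

section Abstract

lemma summable_of_summable_inner {H ι : Type*} [NormedAddCommGroup H] [InnerProductSpace ℂ H]
    [CompleteSpace H] {v : ι → H} (h : Summable fun x : ι × ι => ‖inner ℂ (v x.1) (v x.2)‖) :
    Summable v := by
  classical
  rw [summable_iff_vanishing_norm] at h ⊢
  intro ε hε
  obtain ⟨s, hs⟩ := h (ε ^ 2) (by positivity)
  refine ⟨s.image Prod.fst, fun t ht => ?_⟩
  have hd : Disjoint (t ×ˢ t) s := by
    rw [Finset.disjoint_left] at ht ⊢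
    intro x hx hxs
    exact ht (Finset.mem_product.1 hx).1 (Finset.mem_image_of_mem _ hxs)
  have h1 := hs _ hd
  rw [Real.norm_of_nonneg (Finset.sum_nonneg fun _ _ => norm_nonneg _)] at h1
  have h2 : ‖∑ i ∈ t, v i‖ ^ 2 ≤ ∑ x ∈ t ×ˢ t, ‖inner ℂ (v x.1) (v x.2)‖ := by
    have h3 := inner_self_eq_norm_sq_to_K (𝕜 := ℂ) (∑ i ∈ t, v i)
    have h4 : ‖∑ i ∈ t, v i‖ ^ 2 = ‖inner ℂ (∑ i ∈ t, v i) (∑ i ∈ t, v i)‖ := by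
      rw [h3, norm_pow]
      simp
    rw [h4, sum_inner, Finset.sum_product]
    refine (norm_sum_le _ _).trans (Finset.sum_le_sum fun i _ => ?_)
    rw [inner_sum]
    exact norm_sum_le _ _
  exact lt_of_pow_lt_pow_left₀ 2 hε.le (h2.trans_lt h1)

lemma norm_exp_sub_exp_le (a b : ℂ) :
    ‖Complex.exp a - Complex.exp b‖ ≤ ‖a - b‖ * (‖Complex.exp a‖ + ‖Complex.exp b‖) := by
  have h : ∀ x ∈ segment ℝ a b, ‖Complex.exp x‖ ≤ ‖Complex.exp a‖ + ‖Complex.exp b‖ := by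
    rintro x ⟨s, t, hs, ht, hst, rfl⟩
    rw [Complex.norm_exp, Complex.norm_exp, Complex.norm_exp]
    have h1 : (s • a + t • b).re = s * a.re + t * b.re := by simp
    rw [h1]
    have h2 := convexOn_exp.2 (Set.mem_univ a.re) (Set.mem_univ b.re) hs ht hst
    simp only [smul_eq_mul] at h2
    have := Real.exp_pos a.re
    have := Real.exp_pos b.re
    nlinarith
  have h2 := (convex_segment (𝕜 := ℝ) a b).norm_image_sub_le_of_norm_hasDerivWithin_le
    (f := Complex.exp) (f' := Complex.exp) (fun x _ => (Complex.hasDerivAt_exp x).hasDerivWithinAt) h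
    (right_mem_segment ℝ a b) (left_mem_segment ℝ a b)
  rwa [mul_comm]

variable {Ω : Type*} [MeasurableSpace Ω] {μ : Measure Ω} [IsProbabilityMeasure μ]

/-- Exponentials of random variables that converge in `L²`. -/
lemma tendsto_integral_exp {a : ℕ → Ω → ℂ} {b : Ω → ℂ} (ha : ∀ n, AEStronglyMeasurable (a n) μ)
    (hb : AEStronglyMeasurable b μ) (hab : Tendsto (fun n => eLpNorm (a n - b) 2 μ) atTop (𝓝 0))
    {K : ℝ≥0∞} (hK : K ≠ ⊤) (hn : ∀ n, eLpNorm (fun τ => Complex.exp (a n τ)) 2 μ ≤ K) :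
    MemLp (fun τ => Complex.exp (b τ)) 2 μ ∧ Tendsto (fun n => ∫ τ, Complex.exp (a n τ) ∂μ) atTop
      (𝓝 (∫ τ, Complex.exp (b τ) ∂μ)) := by
  have hea : ∀ n, AEStronglyMeasurable (fun τ => Complex.exp (a n τ)) μ := fun n =>
    Complex.continuous_exp.comp_aestronglyMeasurable (ha n)
  have heb : AEStronglyMeasurable (fun τ => Complex.exp (b τ)) μ :=
    Complex.continuous_exp.comp_aestronglyMeasurable hb
  have hbK : eLpNorm (fun τ => Complex.exp (b τ)) 2 μ ≤ K := by
    obtain ⟨ns, -, hns⟩ := (tendstoInMeasure_of_tendsto_eLpNorm two_ne_zero ha hb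
      hab).exists_seq_tendsto_ae
    refine Lp.eLpNorm_le_of_ae_tendsto (u := atTop) (Eventually.of_forall fun i => hn (ns i))
      (fun i => hea (ns i)) ?_
    filter_upwards [hns] with τ hτ
    exact (Complex.continuous_exp.tendsto _).comp hτ
  have hmb : MemLp (fun τ => Complex.exp (b τ)) 2 μ := ⟨heb, hbK.trans_lt hK.lt_top⟩
  refine ⟨hmb, tendsto_integral_of_L1' _ heb (Eventually.of_forall fun n =>
    (MemLp.integrable one_le_two ⟨hea n, (hn n).trans_lt hK.lt_top⟩)) ?_⟩
  have hbd : ∀ n, eLpNorm ((fun τ => Complex.exp (a n τ)) - fun τ => Complex.exp (b τ)) 1 μ ≤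
      eLpNorm (a n - b) 2 μ * (2 * K) := by
    intro n
    set g : Ω → ℝ := fun τ => ‖Complex.exp (a n τ)‖ + ‖Complex.exp (b τ)‖ with hg
    have h1 : eLpNorm ((fun τ => Complex.exp (a n τ)) - fun τ => Complex.exp (b τ)) 1 μ ≤
        eLpNorm ((fun τ => ‖(a n - b) τ‖) • g) 1 μ := by
      refine eLpNorm_mono_real fun τ => ?_
      exact norm_exp_sub_exp_le _ _
    refine h1.trans ((eLpNorm_smul_le_mul_eLpNorm ((hea n).norm.add heb.norm)
      ((ha n).sub hb).norm (p := 2) (q := 2)).trans ?_)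
    rw [eLpNorm_norm, two_mul]
    refine mul_le_mul_right ((eLpNorm_add_le (hea n).norm heb.norm one_le_two).trans ?_) _
    rw [eLpNorm_norm, eLpNorm_norm]
    exact add_le_add (hn n) hbK
  refine tendsto_of_tendsto_of_tendsto_of_le_of_le tendsto_const_nhds ?_ (fun _ => zero_le) hbd
  have := ENNReal.Tendsto.mul_const (b := 2 * K) hab (Or.inr (ENNReal.mul_ne_top ENNReal.ofNat_ne_top hK))
  rwa [zero_mul] at this

lemma tendsto_integral_of_L2 {a : ℕ → Ω → ℂ} {b : Ω → ℂ} (ha : ∀ n, MemLp (a n) 2 μ)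
    (hb : AEStronglyMeasurable b μ) (hab : Tendsto (fun n => eLpNorm (a n - b) 2 μ) atTop (𝓝 0)) :
    Tendsto (fun n => ∫ τ, a n τ ∂μ) atTop (𝓝 (∫ τ, b τ ∂μ)) := by
  refine tendsto_integral_of_L1' _ hb (Eventually.of_forall fun n => (ha n).integrable one_le_two) ?_
  refine tendsto_of_tendsto_of_tendsto_of_le_of_le tendsto_const_nhds hab (fun _ => zero_le)
    fun n => eLpNorm_le_eLpNorm_of_exponent_le one_le_two ((ha n).1.sub hb)

end Abstract

section Bounds

variable {m ρ : ℝ}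

lemma SmallCoupling.exists_real_bounds (h : SmallCoupling m ρ) : ∃ D : ℝ, 0 < D ∧ 512 * ρ * D ≤ 1 ∧
    (Summable fun x : Momentum × Momentum => lineKernel m x.1 x.2) ∧
    ∀ A : Finset Momentum, ∑ p ∈ A, ∑ p' ∈ A, lineKernel m p p' ≤ D := by
  obtain ⟨D, S, hD0, -, hD, -, -, hρD⟩ := h.exists_bounds
  rw [← ENNReal.tsum_prod (f := fun p p' => ENNReal.ofReal (lineKernel m p p'))] at hD
  have h1 : Summable fun x : Momentum × Momentum => lineKernel m x.1 x.2 := by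
    have h2 := ENNReal.summable_toReal (ne_top_of_le_ne_top ENNReal.ofReal_ne_top hD)
    simpa only [ENNReal.toReal_ofReal (lineKernel_nonneg h.pos _ _)] using h2
  refine ⟨D, hD0, hρD, h1, fun A => ?_⟩
  rw [← ENNReal.ofReal_tsum_of_nonneg (fun x => lineKernel_nonneg h.pos _ _) h1,
    ENNReal.ofReal_le_ofReal_iff hD0.le] at hD
  rw [← Finset.sum_product']
  exact (h1.sum_le_tsum _ fun x _ => lineKernel_nonneg h.pos _ _).trans hD

lemma sum_propagator_sq_le (hm : 0 < m) (A : Finset Momentum) :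
    ∑ p ∈ A, 3 * propagator m p ^ 2 ≤ ∑ p ∈ A, ∑ p' ∈ A, lineKernel m p p' := by
  refine Finset.sum_le_sum fun p hp => ?_
  refine le_trans (le_of_eq ?_) (Finset.single_le_sum (f := fun p' => lineKernel m p p')
    (fun p' _ => lineKernel_nonneg hm p p') hp)
  simp only [lineKernel, overlap_self]
  ring

end Bounds

section LoopField

variable {m : ℝ} {lam : ℂ}

/-- A loop vertex as a random variable. -/
def loopField (m : ℝ) (lam : ℂ) (ε : ℝ) (p : Momentum) (τ : Field) : ℂ :=
  loopFun m lam ε p (Gam p τ)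

lemma measurable_loopField (ε : ℝ) (p : Momentum) : Measurable (loopField m lam ε p) := by
  have h1 : StronglyMeasurable fun x : Field × ℝ => loopDens lam ε x.2 *
      (Complex.exp (Complex.I * (x.2 * strength m lam p * Gam p x.1 : ℝ)) - 1) := by
    refine Measurable.stronglyMeasurable ?_
    have h2 : Measurable fun x : Field × ℝ => loopDens lam ε x.2 :=
      (measurable_loopDens lam ε).comp measurable_snd
    have h3 : Measurable fun x : Field × ℝ => Gam p x.1 := (measurable_Gam p).comp measurable_fst
    fun_prop
  exact (h1.integral_prod_right' (ν := volume.restrict (Set.Ioi 0))).measurable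

lemma memLp_Gam_sq (p : Momentum) : MemLp (fun τ => Gam p τ ^ 2) 2 fieldMeasure := by
  rw [memLp_two_iff_integrable_sq (((measurable_Gam p).pow_const 2).aestronglyMeasurable)]
  have h := (memLp_Gam p (q := 4) ENNReal.ofNat_ne_top).integrable_norm_pow (by norm_num)
  refine h.congr (ae_of_all _ fun τ => ?_)
  simp only [Real.norm_eq_abs]
  rw [← pow_mul, Even.pow_abs ⟨2, rfl⟩]

lemma exists_eLpNorm_Gam_sq_le :
    ∃ K : ℝ≥0∞, K ≠ ⊤ ∧ ∀ p, eLpNorm (fun τ => Gam p τ ^ 2) 2 fieldMeasure ≤ K := by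
  obtain ⟨K, hK, h⟩ := exists_eLpNorm_Gam_le (q := 2 * ENNReal.ofReal 2)
    (by simp)
    (by finiteness)
  refine ⟨K ^ (2 : ℝ), by finiteness, fun p => ?_⟩
  have h2 := eLpNorm_norm_rpow (p := 2) (q := 2) (μ := fieldMeasure) (Gam p) two_pos
  have h3 : (fun τ => ‖Gam p τ‖ ^ (2 : ℝ)) = fun τ => Gam p τ ^ 2 := by
    ext τ
    rw [Real.rpow_two, Real.norm_eq_abs, sq_abs]
  rw [← h3, h2]
  exact ENNReal.rpow_le_rpow (h p) (by norm_num)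

variable (hr : 0 < cosHalf lam) (hm : 0 < m)
include hr hm

/-- The part of a loop vertex of second order. -/
def loopRest (m : ℝ) (lam : ℂ) (ε : ℝ) (p : Momentum) (τ : Field) : ℂ :=
  loopField m lam ε p τ - loopLin lam ε * (strength m lam p * Gam p τ : ℝ)

lemma norm_loopRest_le (ε : ℝ) (p : Momentum) (τ : Field) : ‖loopRest m lam ε p τ‖ ≤
    2 * (cpl lam / cosHalf lam) ^ 2 * propagator m p ^ 2 * Gam p τ ^ 2 := by
  refine (norm_loopFun_sub_le hr hm ε p (Gam p τ)).trans_eq ?_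
  rw [strength]
  ring

lemma memLp_loopRest (ε : ℝ) (p : Momentum) : MemLp (loopRest m lam ε p) 2 fieldMeasure := by
  refine ((memLp_Gam_sq p).const_mul _).mono' ?_ (ae_of_all _ (norm_loopRest_le hr hm ε p))
  have h1 := measurable_loopField (m := m) (lam := lam) ε p
  have h2 := measurable_Gam p
  unfold loopRest
  fun_prop

lemma memLp_loopField (ε : ℝ) (p : Momentum) : MemLp (loopField m lam ε p) 2 fieldMeasure := by
  have h := (memLp_loopRest hr hm ε p).add
    (((memLp_Gam p ENNReal.ofNat_ne_top).const_mul (strength m lam p)).ofReal.const_mul (loopLin lam ε))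
  refine h.ae_eq (ae_of_all _ fun τ => ?_)
  simp [loopRest]

lemma norm_integral_loopField_le (ε : ℝ) (p : Momentum) :
    ‖∫ τ, loopField m lam ε p τ ∂fieldMeasure‖ ≤
      2 * (cpl lam / cosHalf lam) ^ 2 * (3 * propagator m p ^ 2) := by
  have h1 : ∫ τ, loopField m lam ε p τ ∂fieldMeasure = ∫ τ, loopRest m lam ε p τ ∂fieldMeasure := by
    have hi := ((memLp_Gam p (q := 1) ENNReal.one_ne_top).integrable le_rfl).const_mul (strength m lam p)
    have h3 := integral_sub ((memLp_loopField hr hm ε p).integrable one_le_two)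
      (hi.ofReal.const_mul (loopLin lam ε))
    have h4 : ∫ τ, loopLin lam ε * ((strength m lam p * Gam p τ : ℝ) : ℂ) ∂fieldMeasure = 0 := by
      rw [integral_const_mul, integral_complex_ofReal, integral_const_mul, integral_Gam]
      simp
    have h5 : ∫ τ, loopRest m lam ε p τ ∂fieldMeasure = _ := h3
    rw [h5]
    refine (sub_eq_self.2 ?_).symm
    exact h4
  rw [h1]
  have hg : Integrable (fun τ => 2 * (cpl lam / cosHalf lam) ^ 2 * propagator m p ^ 2 * Gam p τ ^ 2)
      fieldMeasure := ((memLp_Gam_sq p).integrable one_le_two).const_mul _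
  refine (norm_integral_le_of_norm_le hg (ae_of_all _ (norm_loopRest_le hr hm ε p))).trans_eq ?_
  rw [integral_const_mul]
  have := integral_Gam_mul p p
  rw [overlap_self] at this
  simp only [pow_two (Gam p _), this]
  ring

/-- The loop vertices are summable in `L²`. -/
lemma summable_loopField (h : SmallCoupling m ((cpl lam / cosHalf lam) ^ 2)) :
    Summable fun p => (memLp_loopField hr hm 0 p).toLp := by
  obtain ⟨D, hD0, hρD, hs, hD⟩ := h.exists_real_bounds
  obtain ⟨K, hK, hKp⟩ := exists_eLpNorm_Gam_sq_le
  have hsq : Summable fun p => propagator m p ^ 2 := by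
    refine summable_of_sum_le (c := D) (fun p => sq_nonneg _) fun A => ?_
    refine (Finset.sum_le_sum fun p _ => ?_).trans ((sum_propagator_sq_le hm A).trans (hD A))
    nlinarith [sq_nonneg (propagator m p)]
  have hG : ∀ p, MemLp (fun τ => ((Gam p τ : ℝ) : ℂ)) 2 fieldMeasure := fun p =>
    (memLp_Gam p ENNReal.ofNat_ne_top).ofReal
  have h1 : Summable fun p => (propagator m p : ℂ) • (hG p).toLp := by
    refine summable_of_summable_inner (hs.congr fun x => ?_)
    have h2 : inner ℂ ((hG x.1).toLp) ((hG x.2).toLp) = (overlap x.1 x.2 : ℂ) := by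
      rw [L2.inner_def, ← integral_Gam_mul, ← integral_complex_ofReal]
      refine integral_congr_ae ?_
      filter_upwards [(hG x.1).coeFn_toLp, (hG x.2).coeFn_toLp] with τ h1 h2
      rw [h1, h2]
      simp [mul_comm]
    rw [inner_smul_left, inner_smul_right, h2]
    have hn := lineKernel_nonneg hm x.1 x.2
    rw [lineKernel] at hn ⊢
    simp only [Complex.conj_ofReal, ← Complex.ofReal_mul, Complex.norm_real]
    rw [← mul_assoc, Real.norm_of_nonneg hn]
  have h2 : Summable fun p => (memLp_loopRest hr hm 0 p).toLp := by
    refine Summable.of_norm_bounded (hsq.mul_left (2 * (cpl lam / cosHalf lam) ^ 2 * K.toReal))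
      fun p => ?_
    rw [Lp.norm_toLp]
    refine ENNReal.toReal_le_of_le_ofReal (by positivity) ?_
    have h3 := eLpNorm_le_mul_eLpNorm_of_ae_le_mul (μ := fieldMeasure) (f := loopRest m lam 0 p)
      (g := fun τ => Gam p τ ^ 2) (c := 2 * (cpl lam / cosHalf lam) ^ 2 * propagator m p ^ 2)
      (ae_of_all _ fun τ => by
        rw [Real.norm_of_nonneg (sq_nonneg (Gam p τ))]
        exact norm_loopRest_le hr hm 0 p τ) 2
    refine h3.trans ((mul_le_mul_right (hKp p) _).trans_eq ?_)
    rw [← ENNReal.ofReal_toReal hK, ← ENNReal.ofReal_mul (by positivity),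
      ENNReal.toReal_ofReal ENNReal.toReal_nonneg]
    congr 1
    ring
  refine ((h1.const_smul (loopLin lam 0 * cpl lam)).add h2).congr fun p => ?_
  rw [← MemLp.toLp_const_smul, ← MemLp.toLp_const_smul, ← MemLp.toLp_add]
  refine MemLp.toLp_congr _ _ (ae_of_all _ fun τ => ?_)
  simp only [loopRest, strength, Pi.add_apply, Pi.smul_apply, smul_eq_mul]
  push_cast
  ring

lemma sum_log_eq (A : Finset Momentum) (τ : Field) :
    ∑ p ∈ A, Complex.log (denom m lam p (Gam p τ)) = -∑ p ∈ A, loopField m lam 0 p τ := by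
  rw [← Finset.sum_neg_distrib]
  refine Finset.sum_congr rfl fun p _ => ?_
  rw [loopField, loopFun_zero hr hm, neg_neg]

theorem exists_isTraceLog (h : SmallCoupling m ((cpl lam / cosHalf lam) ^ 2)) :
    ∃ W, IsTraceLog m lam W := by
  obtain ⟨F, hF⟩ := summable_loopField hr hm h
  refine ⟨-F, (Lp.memLp F).neg, ?_⟩
  rw [HasSum, Lp.tendsto_Lp_iff_tendsto_eLpNorm'] at hF
  refine hF.congr fun A => ?_
  rw [← eLpNorm_neg]
  refine eLpNorm_congr_ae ?_
  have h2 : ∀ᵐ τ ∂fieldMeasure, ∀ p, (memLp_loopField hr hm 0 p).toLp (loopField m lam 0 p) τ = loopField m lam 0 p τ :=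
    ae_all_iff.2 fun p => (memLp_loopField hr hm 0 p).coeFn_toLp
  filter_upwards [Lp.coeFn_fun_finsetSum A fun p => (memLp_loopField hr hm 0 p).toLp, h2] with τ h1 h2
  rw [sum_log_eq hr hm]
  simp only [Pi.neg_apply, Pi.sub_apply, h1, h2]
  ring

end LoopField

/-! ### Removal of the cutoffs -/

section ExpBound

variable {m : ℝ} {lam : ℂ}

lemma eLpNorm_two_le {Ω : Type*} [MeasurableSpace Ω] {μ : Measure Ω} {f : Ω → ℂ} {g : Ω → ℝ}
    (hg : Integrable g μ) (h : ∀ τ, ‖f τ‖ ^ 2 ≤ g τ) {B : ℝ} (hB : ∫ τ, g τ ∂μ ≤ B) :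
    eLpNorm f 2 μ ≤ ENNReal.ofReal B ^ (1 / 2 : ℝ) := by
  rw [eLpNorm_eq_lintegral_rpow_enorm_toReal two_ne_zero ENNReal.ofNat_ne_top]
  simp only [ENNReal.toReal_ofNat, ENNReal.rpow_two]
  refine ENNReal.rpow_le_rpow ?_ (by norm_num)
  refine le_trans ?_ (ENNReal.ofReal_le_ofReal hB)
  rw [ofReal_integral_eq_lintegral_ofReal hg (ae_of_all _ fun τ => (sq_nonneg _).trans (h τ))]
  refine lintegral_mono fun τ => ?_
  rw [← ofReal_norm, ← ENNReal.ofReal_pow (norm_nonneg _)]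
  exact ENNReal.ofReal_le_ofReal (h τ)

lemma Gam_sq_le (p : Momentum) (τ : Field) : Gam p τ ^ 2 ≤ 3 * ∑ i, τ (i, p.1 i) ^ 2 := by
  have h := sq_sum_le_card_mul_sum_sq (s := (Finset.univ : Finset (Fin 3)))
    (f := fun i => τ (i, p.1 i))
  simpa [Gam] using h

variable (hr : 0 < cosHalf lam) (hm : 0 < m)
include hr hm

lemma norm_exp_sum_loopField_sq_le {C : ℝ} (A : Finset Momentum) (ε : ℝ) {f : Field → ℂ}
    (hf : ∀ τ, ‖f τ‖ ≤ C)
    (hA : 96 * (cpl lam / cosHalf lam) ^ 2 * ∑ p ∈ A, 3 * propagator m p ^ 2 ≤ 1) (τ : Field) :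
    ‖Complex.exp (∑ p ∈ A, loopField m lam ε p τ + f τ)‖ ^ 2 ≤ Real.exp (2 * C) *
      (Real.exp (∑ p ∈ A, 4 * (loopLin lam ε).re * strength m lam p * Gam p τ) +
        (1 + ∑ x ∈ A ×ˢ (Finset.univ : Finset (Fin 3)),
          96 * (cpl lam / cosHalf lam) ^ 2 * propagator m x.1 ^ 2 *
            Real.exp (τ (x.2, x.1.1 x.2) ^ 2 / 4))) := by
  set ρ := (cpl lam / cosHalf lam) ^ 2 with hρ
  have h1 : ∀ p, (loopField m lam ε p τ).re ≤ (loopLin lam ε).re * strength m lam p * Gam p τ +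
      6 * ρ * propagator m p ^ 2 * ∑ i, τ (i, p.1 i) ^ 2 := by
    intro p
    have h2 := (Complex.re_le_norm _).trans (norm_loopRest_le hr hm ε p τ)
    rw [loopRest, Complex.sub_re, Complex.re_mul_ofReal] at h2
    have h3 : 2 * ρ * propagator m p ^ 2 * Gam p τ ^ 2 ≤
        2 * ρ * propagator m p ^ 2 * (3 * ∑ i, τ (i, p.1 i) ^ 2) :=
      mul_le_mul_of_nonneg_left (Gam_sq_le p τ) (by positivity)
    linarith
  set a := ∑ p ∈ A, 2 * (loopLin lam ε).re * strength m lam p * Gam p τ with ha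
  set b := ∑ x ∈ A ×ˢ (Finset.univ : Finset (Fin 3)),
    96 * ρ * propagator m x.1 ^ 2 * (τ (x.2, x.1.1 x.2) ^ 2 / 4) with hb
  have h4 : 2 * (∑ p ∈ A, loopField m lam ε p τ + f τ).re ≤ 2 * C + (a + b / 2) := by
    have h5 := (Complex.re_le_norm _).trans (hf τ)
    have h6 : 2 * ∑ p ∈ A, (loopField m lam ε p τ).re ≤ a + b / 2 := by
      rw [ha, hb, Finset.sum_product, Finset.sum_div, ← Finset.sum_add_distrib, Finset.mul_sum]
      refine Finset.sum_le_sum fun p _ => ?_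
      dsimp only
      rw [← Finset.mul_sum, ← Finset.sum_div]
      linarith [h1 p]
    rw [Complex.add_re, Complex.re_sum]
    linarith
  have h7 : Real.exp b ≤ 1 + ∑ x ∈ A ×ˢ (Finset.univ : Finset (Fin 3)),
      96 * ρ * propagator m x.1 ^ 2 * Real.exp (τ (x.2, x.1.1 x.2) ^ 2 / 4) := by
    refine exp_sum_le (fun x _ => by positivity) (le_trans (le_of_eq ?_) hA)
    rw [Finset.sum_product, Finset.mul_sum]
    refine Finset.sum_congr rfl fun p _ => ?_
    simp
    ring
  have h8 : Real.exp (a + b / 2) ≤ Real.exp (2 * a) + Real.exp b := by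
    have e1 : Real.exp (2 * a) = Real.exp a ^ 2 := by rw [← Real.exp_nat_mul]; norm_num
    have e2 : Real.exp b = Real.exp (b / 2) ^ 2 := by rw [← Real.exp_nat_mul]; congr 1; push_cast; ring
    rw [e1, e2, Real.exp_add]
    nlinarith [sq_nonneg (Real.exp a - Real.exp (b / 2)), sq_nonneg (Real.exp a),
      sq_nonneg (Real.exp (b / 2))]
  have h9 : 2 * a = ∑ p ∈ A, 4 * (loopLin lam ε).re * strength m lam p * Gam p τ := by
    rw [ha, Finset.mul_sum]
    exact Finset.sum_congr rfl fun p _ => by ring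
  rw [Complex.norm_exp, ← Real.exp_nat_mul, ← h9]
  calc _ ≤ Real.exp (2 * C + (a + b / 2)) := Real.exp_le_exp.2 (by exact_mod_cast h4)
    _ = Real.exp (2 * C) * Real.exp (a + b / 2) := Real.exp_add _ _
    _ ≤ _ := by
      refine mul_le_mul_of_nonneg_left (h8.trans ?_) (Real.exp_pos _).le
      exact add_le_add le_rfl h7

/-- Uniform `L²` bounds on the weights with cutoffs. -/
lemma exists_exp_bound (h : SmallCoupling m ((cpl lam / cosHalf lam) ^ 2)) (C : ℝ) :
    ∃ K : ℝ≥0∞, K ≠ ⊤ ∧ ∀ (A : Finset Momentum) (ε : ℝ) (f : Field → ℂ), (∀ τ, ‖f τ‖ ≤ C) →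
      eLpNorm (fun τ => Complex.exp (∑ p ∈ A, loopField m lam ε p τ + f τ)) 2 fieldMeasure ≤ K := by
  obtain ⟨D, hD0, hρD, -, hD⟩ := h.exists_real_bounds
  set ρ := (cpl lam / cosHalf lam) ^ 2 with hρ
  have hρ0 : 0 ≤ ρ := sq_nonneg _
  set K₀ := ∫ y, Real.exp (y ^ 2 / 4) ∂gaussianReal 0 1 with hK₀
  have hK0 : 0 ≤ K₀ := integral_nonneg fun _ => (Real.exp_pos _).le
  refine ⟨ENNReal.ofReal (Real.exp (2 * C) * (Real.exp 1 + (1 + K₀))) ^ (1 / 2 : ℝ), by finiteness,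
    fun A ε f hf => ?_⟩
  have hA2 := (sum_propagator_sq_le hm A).trans (hD A)
  have hA : 96 * ρ * ∑ p ∈ A, 3 * propagator m p ^ 2 ≤ 1 := by
    have : 96 * ρ * ∑ p ∈ A, 3 * propagator m p ^ 2 ≤ 96 * ρ * D := by gcongr
    nlinarith
  have hc : ∀ x : Fin 3 × ℤ, Integrable (fun τ : Field => Real.exp (τ x ^ 2 / 4)) fieldMeasure ∧
      ∫ τ, Real.exp (τ x ^ 2 / 4) ∂fieldMeasure = K₀ := by
    intro x
    have h1 := measurePreserving_coord x
    refine ⟨h1.integrable_comp_of_integrable integrable_exp_sq_gaussianReal, ?_⟩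
    rw [hK₀, ← h1.map_eq, integral_map h1.measurable.aemeasurable]
    rw [h1.map_eq]
    exact integrable_exp_sq_gaussianReal.1
  have hi1 := integrable_rexp_fieldMeasure A id
    fun p => 4 * (loopLin lam ε).re * strength m lam p
  have hi2 : Integrable (fun τ : Field => ∑ x ∈ A ×ˢ (Finset.univ : Finset (Fin 3)),
      96 * ρ * propagator m x.1 ^ 2 * Real.exp (τ (x.2, x.1.1 x.2) ^ 2 / 4)) fieldMeasure :=
    integrable_finsetSum _ fun x _ => (hc _).1.const_mul _
  refine eLpNorm_two_le ((hi1.add ((integrable_const 1).add hi2)).const_mul (Real.exp (2 * C)))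
    (fun τ => norm_exp_sum_loopField_sq_le hr hm A ε hf hA τ) ?_
  rw [integral_const_mul, integral_add' hi1 ((integrable_const 1).add hi2),
    integral_add' (integrable_const 1) hi2, integral_finsetSum _ fun x _ => (hc _).1.const_mul _,
    integral_rexp_fieldMeasure]
  refine mul_le_mul_of_nonneg_left (add_le_add (Real.exp_le_exp.2 ?_) (add_le_add (by simp) ?_))
    (Real.exp_pos _).le
  · have h2 : ∀ p p', 4 * (loopLin lam ε).re * strength m lam p *
        (4 * (loopLin lam ε).re * strength m lam p') * overlap (id p) (id p') =
        16 * ((loopLin lam ε).re ^ 2 * cpl lam ^ 2) * lineKernel m p p' := fun p p' => by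
      simp only [strength, lineKernel, id]
      ring
    simp_rw [h2, ← Finset.mul_sum]
    have h3 : (loopLin lam ε).re ^ 2 * cpl lam ^ 2 ≤ ρ := by
      have h4 : |(loopLin lam ε).re| ≤ 1 / cosHalf lam :=
        (Complex.abs_re_le_norm _).trans (norm_loopLin_le hr ε)
      have h5 := pow_le_pow_left₀ (abs_nonneg _) h4 2
      rw [sq_abs] at h5
      calc _ ≤ (1 / cosHalf lam) ^ 2 * cpl lam ^ 2 := by gcongr
        _ = _ := by rw [hρ]; ring
    have h6 : 0 ≤ ∑ p ∈ A, ∑ p' ∈ A, lineKernel m p p' :=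
      Finset.sum_nonneg fun p _ => Finset.sum_nonneg fun p' _ => lineKernel_nonneg hm p p'
    have h7 := mul_le_mul h3 (hD A) h6 hρ0
    linarith
  · simp only [integral_const_mul, (hc _).2]
    rw [← Finset.sum_mul]
    refine mul_le_of_le_one_left hK0 (le_trans (le_of_eq ?_) hA)
    rw [Finset.sum_product, Finset.mul_sum]
    refine Finset.sum_congr rfl fun p _ => ?_
    simp
    ring

end ExpBound

section Limit

variable {m : ℝ} {lam : ℂ} {N : ℕ} (P : Fin N → Momentum) (u : Fin N × Fin N → ℂ)
variable (hr : 0 < cosHalf lam) (hm : 0 < m)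

/-- Finite sets of momenta and cutoffs along which the expansion is studied. -/
lemma exists_cutoffs : ∃ (A : ℕ → Finset Momentum) (ε : ℕ → ℝ), Tendsto A atTop atTop ∧
    (∀ n, (A n).Nonempty) ∧ (∀ n, 0 < ε n) ∧ (∀ n, ε n ≤ 1 / ((n : ℝ) + 1)) ∧
    ∀ n, (A n).card * ε n ≤ 1 / ((n : ℝ) + 1) := by
  classical
  obtain ⟨A, hA⟩ := (atTop : Filter (Finset Momentum)).exists_seq_tendsto
  refine ⟨fun n => insert ⟨0, by simp⟩ (A n),
    fun n => 1 / (((n : ℝ) + 1) * ((insert ⟨0, by simp⟩ (A n) : Finset Momentum).card + 1)),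
    tendsto_atTop_mono (fun n => Finset.subset_insert _ _) hA, fun n => Finset.insert_nonempty _ _,
    fun n => by positivity, fun n => ?_, fun n => ?_⟩
  · refine one_div_le_one_div_of_le (by positivity) (le_mul_of_one_le_right (by positivity) ?_)
    linarith [Nat.cast_nonneg (α := ℝ) (insert ⟨0, by simp⟩ (A n) : Finset Momentum).card]
  · set c : ℝ := ((insert ⟨0, by simp⟩ (A n) : Finset Momentum).card : ℝ)
    have hc : 0 ≤ c := Nat.cast_nonneg _
    rw [mul_one_div, div_le_div_iff₀ (by positivity) (by positivity)]
    nlinarith [Nat.cast_nonneg (α := ℝ) n]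

include hr

lemma continuous_cilia : Continuous (cilia m lam P u) := by
  have h := fun p => continuous_resolvent (m := m) hr p
  have h2 := fun p => continuous_Gam p
  unfold cilia
  fun_prop

include hm

lemma norm_cilia_le (τ : Field) : ‖cilia m lam P u τ‖ ≤
    ∑ ij, ‖u ij‖ * (propagator m (P ij.1) / cosHalf lam) := by
  refine (norm_sum_le _ _).trans (Finset.sum_le_sum fun ij _ => ?_)
  rw [norm_mul]
  exact mul_le_mul_of_nonneg_left (norm_resolvent_le hr hm _ _) (norm_nonneg _)

lemma memLp_cilia : MemLp (cilia m lam P u) 2 fieldMeasure :=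
  MemLp.of_bound (continuous_cilia P u hr).measurable.aestronglyMeasurable _
    (ae_of_all _ (norm_cilia_le P u hr hm))

lemma memLp_cutExponent (A : Finset Momentum) (ε : ℝ) :
    MemLp (cutExponent m lam P u A ε) 2 fieldMeasure :=
  (memLp_finsetSum (f := fun p => loopField m lam ε p) A fun p _ =>
    memLp_loopField hr hm ε p).add (memLp_cilia P u hr hm)

lemma tendsto_cutExponent {W : Field → ℂ} (hW : IsTraceLog m lam W) {A : ℕ → Finset Momentum}
    {ε : ℕ → ℝ} (hA : Tendsto A atTop atTop) (hε : ∀ n, 0 < ε n)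
    (hAε : ∀ n, (A n).card * ε n ≤ 1 / ((n : ℝ) + 1)) :
    Tendsto (fun n => eLpNorm (cutExponent m lam P u (A n) (ε n) -
      fun τ => -W τ + cilia m lam P u τ) 2 fieldMeasure) atTop (𝓝 0) := by
  obtain ⟨K, hK, hKp⟩ := exists_eLpNorm_Gam_le (q := 2) one_le_two ENNReal.ofNat_ne_top
  have h1 : ∀ n, eLpNorm (∑ p ∈ A n, (loopField m lam (ε n) p - loopField m lam 0 p)) 2
      fieldMeasure ≤ ENNReal.ofReal (1 / ((n : ℝ) + 1)) * (ENNReal.ofReal (cpl lam * (m ^ 2)⁻¹) * K) := by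
    intro n
    refine (eLpNorm_sum_le (fun p _ => ((memLp_loopField hr hm _ p).sub
      (memLp_loopField hr hm 0 p)).1) one_le_two).trans ?_
    refine (Finset.sum_le_card_nsmul _ _ (ENNReal.ofReal (ε n * (cpl lam * (m ^ 2)⁻¹)) * K)
      fun p _ => ?_).trans ?_
    · refine (eLpNorm_le_mul_eLpNorm_of_ae_le_mul (g := Gam p) (c := ε n * (cpl lam * (m ^ 2)⁻¹))
        (ae_of_all _ fun τ => ?_) 2).trans (mul_le_mul_right (hKp p) _)
      refine (norm_loopFun_sub_zero_le hr hm (hε n).le p (Gam p τ)).trans ?_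
      rw [← mul_assoc, Real.norm_eq_abs, strength]
      have := propagator_le_inv hm p
      have := cpl_nonneg lam
      have := (hε n).le
      gcongr
    · rw [nsmul_eq_mul, ENNReal.ofReal_mul (hε n).le, mul_assoc, ← mul_assoc (((A n).card : ℝ≥0∞)),
        ← ENNReal.ofReal_natCast, ← ENNReal.ofReal_mul (Nat.cast_nonneg _)]
      exact mul_le_mul_left (ENNReal.ofReal_le_ofReal (hAε n)) _
  have h2 : Tendsto (fun n : ℕ => ENNReal.ofReal (1 / ((n : ℝ) + 1)) *
      (ENNReal.ofReal (cpl lam * (m ^ 2)⁻¹) * K)) atTop (𝓝 0) := by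
    have h3 := ENNReal.Tendsto.mul_const (b := ENNReal.ofReal (cpl lam * (m ^ 2)⁻¹) * K)
      (ENNReal.tendsto_ofReal tendsto_one_div_add_atTop_nhds_zero_nat)
      (Or.inr (by finiteness))
    simpa using h3
  have h4 := h2.add (hW.2.comp hA)
  rw [add_zero] at h4
  refine tendsto_of_tendsto_of_tendsto_of_le_of_le tendsto_const_nhds h4 (fun _ => zero_le)
    fun n => ?_
  have h5 : (cutExponent m lam P u (A n) (ε n) - fun τ => -W τ + cilia m lam P u τ) =
      (∑ p ∈ A n, (loopField m lam (ε n) p - loopField m lam 0 p)) -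
        fun τ => (∑ p ∈ A n, Complex.log (denom m lam p (Gam p τ))) - W τ := by
    ext τ
    simp only [Pi.sub_apply, Finset.sum_apply, sum_log_eq hr hm, Finset.sum_sub_distrib, cutExponent,
      loopField]
    ring
  rw [h5]
  refine (eLpNorm_sub_le (memLp_finsetSum' _ fun p _ => (memLp_loopField hr hm _ p).sub
    (memLp_loopField hr hm 0 p)).1 ?_ one_le_two).trans (add_le_add (h1 n) le_rfl)
  simp only [sum_log_eq hr hm]
  exact ((memLp_finsetSum (f := fun p => loopField m lam 0 p) (A n) fun p _ =>
    memLp_loopField hr hm 0 p).neg.sub hW.1).1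

/-- Bounds on the contributions of the decorated trees. -/
lemma norm_decVal_limVertex_le {η : ℝ}
    (hu : ∀ ij, ‖u ij‖ * (propagator m (P ij.1) / cosHalf lam) ≤ η) (j : Decorated N) :
    ‖decVal P (limVertex m lam P u) j‖ ≤ decBound m ((cpl lam / cosHalf lam) ^ 2) η P j :=
  le_of_tendsto (tendsto_decVal hr P u hm tendsto_id j).norm
    (Eventually.of_forall fun ε => norm_decVal_le hr P u hm hu ε j)

/-- The integral over the fields as the exponential of a sum over trees. -/
theorem integral_exp_eq (h : SmallCoupling m ((cpl lam / cosHalf lam) ^ 2)) {W : Field → ℂ}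
    (hW : IsTraceLog m lam W) {η : ℝ} (hη : 0 ≤ η) (hN : (N : ℝ) ^ 2 * η ≤ 1)
    (hu : ∀ ij, ‖u ij‖ * (propagator m (P ij.1) / cosHalf lam) ≤ η) :
    MemLp (fun τ => Complex.exp (-W τ + cilia m lam P u τ)) 2 fieldMeasure ∧
    ∫ τ, Complex.exp (-W τ + cilia m lam P u τ) ∂fieldMeasure =
      Complex.exp (∫ τ, -W τ ∂fieldMeasure + ∫ τ, cilia m lam P u τ ∂fieldMeasure +
        ∑' j : Decorated N, if 2 ≤ j.1 then decVal P (limVertex m lam P u) j else 0) := by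
  classical
  obtain ⟨A, ε, hA, hAne, hε, hε1, hAε⟩ := exists_cutoffs
  obtain ⟨K, hK, hKb⟩ := exists_exp_bound hr hm h
    (∑ ij, ‖u ij‖ * (propagator m (P ij.1) / cosHalf lam))
  have hε0 : Tendsto ε atTop (𝓝 0) := tendsto_of_tendsto_of_tendsto_of_le_of_le tendsto_const_nhds
    tendsto_one_div_add_atTop_nhds_zero_nat (fun n => (hε n).le) hε1
  have hlim := tendsto_cutExponent P u hr hm hW hA hε hAε
  have hbm : AEStronglyMeasurable (fun τ => -W τ + cilia m lam P u τ) fieldMeasure :=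
    hW.1.1.neg.add (memLp_cilia P u hr hm).1
  obtain ⟨h1, h2⟩ := tendsto_integral_exp (fun n => (memLp_cutExponent P u hr hm (A n) (ε n)).1)
    hbm hlim hK fun n => hKb (A n) (ε n) _ (norm_cilia_le P u hr hm)
  refine ⟨h1, tendsto_nhds_unique h2 ?_⟩
  simp_rw [integral_exp_cutExponent P u hr hm (A _) (hε _) (hAne _) hη hN h hu]
  have h3 := tendsto_integral_of_L2 (fun n => memLp_cutExponent P u hr hm (A n) (ε n)) hbm hlim
  have h4 : ∫ τ, -W τ + cilia m lam P u τ ∂fieldMeasure =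
      ∫ τ, -W τ ∂fieldMeasure + ∫ τ, cilia m lam P u τ ∂fieldMeasure :=
    integral_add (hW.1.neg.integrable one_le_two) ((memLp_cilia P u hr hm).integrable one_le_two)
  rw [h4] at h3
  refine (Complex.continuous_exp.tendsto _).comp (h3.add ?_)
  refine tendsto_tsum_of_dominated_convergence (summable_decBound P h hη hN) (fun j => ?_)
    (Eventually.of_forall fun n j => norm_cutTerm_le P u hr (A n) hm hη hu (ε n) j)
  split_ifs with hj
  · refine (tendsto_decVal hr P u hm hε0 j).congr' ?_
    set B : Finset Momentum := Finset.univ.biUnion fun a => (j.2.2 a).elim (fun p => {p}) fun _ => ∅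
    filter_upwards [hA.eventually_ge_atTop B] with n hn
    have hc : ∀ a, j.2.2 a ∈ Set.range (cutEmb N (A n)) := by
      intro a
      rcases hc : j.2.2 a with p | ij
      · refine ⟨.inl ⟨p, hn ?_⟩, rfl⟩
        exact Finset.mem_biUnion.2 ⟨a, Finset.mem_univ _, by simp [hc]⟩
      · exact ⟨.inr ij, rfl⟩
    rw [cutTerm, if_pos ⟨hj, hc⟩]
  · simp only [cutTerm, hj, false_and, if_false]
    exact tendsto_const_nhds

end Limit

/-! ### The logarithm of the partition function -/

section Partition

variable {m : ℝ} {lam : ℂ} {N : ℕ} (P : Fin N → Momentum) (u : Fin N × Fin N → ℂ)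

/-- The sum over all decorated trees. -/
def decSum (m : ℝ) (lam : ℂ) (P : Fin N → Momentum) (u : Fin N × Fin N → ℂ) : ℂ :=
  ∑' j, decVal P (limVertex m lam P u) j

/-- The decorated tree with a single vertex, which is a cilium. -/
def singleCilium (ij : Fin N × Fin N) : Decorated N :=
  ⟨1, ⟨⊥, SimpleGraph.IsTree.of_subsingleton⟩, fun _ => .inr ij⟩

variable (hr : 0 < cosHalf lam) (hm : 0 < m)

include hr in
lemma decVal_singleCilium (ij : Fin N × Fin N) : decVal P (limVertex m lam P u) (singleCilium ij) =
    u ij * ∫ τ, TGFT.resolvent m lam (P ij.1) (Gam (P ij.1) τ) ∂fieldMeasure := by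
  have h1 : treeEdges (⊥ : SimpleGraph (Fin 1)) = ∅ := by
    ext l
    simp [mem_treeEdges]
  have h2 : ∀ w, ∫ τ, TGFT.resolvent m lam (P ij.1) (Gam (P ij.1) fun iq => τ iq (0 : Fin 1))
      ∂replicaLaw (Matrix.of fun a b => linkMat (∅ : Finset (Sym2 (Fin 1))) w a b) =
      ∫ τ, TGFT.resolvent m lam (P ij.1) (Gam (P ij.1) τ) ∂fieldMeasure := fun w =>
    integral_replicaLaw (posSemidef_linkMat ∅ w) (linkMat_self _ _ _)
      (f := fun τ => TGFT.resolvent m lam (P ij.1) (Gam (P ij.1) τ))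
      ((continuous_resolvent hr _).comp (continuous_Gam _)).stronglyMeasurable
  have h3 : ∀ v : Species N → ℕ → ℝ → ℂ, treeVal (Species.mom P) v (∅ : Finset (Sym2 (Fin 1)))
      (fun _ => .inr ij) = ∫ w, ∫ τ, v (.inr ij) 0 (Gam (P ij.1) fun iq => τ iq (0 : Fin 1))
        ∂replicaLaw (Matrix.of fun a b => linkMat (∅ : Finset (Sym2 (Fin 1))) w a b)
        ∂edgeMeasure 0 (∅ : Finset (Sym2 (Fin 1))) := fun v => by
    simp [treeVal, lineCount, Species.mom]
  rw [decVal]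
  simp only [singleCilium, h1, h3]
  simp only [limVertex, Sum.elim_inr, Nat.factorial_zero, Nat.cast_one, pow_zero, one_mul, zero_add,
    pow_one, integral_const_mul, h2]
  simp

include hr hm

lemma tsum_order_one (hs : Summable (decVal P (limVertex m lam P u))) :
    ∫ τ, cilia m lam P u τ ∂fieldMeasure +
      (∑' j : Decorated N, if 2 ≤ j.1 then decVal P (limVertex m lam P u) j else 0) =
      decSum m lam P u := by
  have hinj : Function.Injective (singleCilium (N := N)) := fun ij ij' h => by
    have h2 := eq_of_heq (Sigma.mk.inj h).2
    exact Sum.inr_injective (congrFun (Prod.mk.inj h2).2 0)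
  have h1 : ∫ τ, cilia m lam P u τ ∂fieldMeasure =
      ∑' j : Decorated N, if 2 ≤ j.1 then 0 else decVal P (limVertex m lam P u) j := by
    rw [← hinj.tsum_eq, tsum_fintype]
    · simp only [cilia]
      rw [integral_finsetSum]
      · refine Finset.sum_congr rfl fun ij _ => ?_
        rw [integral_const_mul, if_neg (by simp [singleCilium]), decVal_singleCilium P u hr]
      · intro ij _
        refine Integrable.const_mul (Integrable.of_bound (C := propagator m (P ij.1) / cosHalf lam)
          ((continuous_resolvent hr _).comp (continuous_Gam _)).measurable.aestronglyMeasurable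
          (ae_of_all _ fun τ => norm_resolvent_le hr hm _ _)) _
    · rintro ⟨n, T, c⟩ hj
      rw [Function.mem_support] at hj
      have hn : n < 2 := by
        by_contra hn
        exact hj (if_pos (not_lt.1 hn))
      have hn0 : n ≠ 0 := by
        rintro rfl
        exact isEmpty_tree_zero.false T
      obtain rfl : n = 1 := by omega
      rcases hc : c 0 with p | ij
      · refine absurd ?_ hj
        rw [if_neg (by simp), decVal, treeVal]
        have h0 := lineCount_of_lt_two one_lt_two T.2 0
        simp [h0, hc, limVertex]
      · refine ⟨ij, ?_⟩
        have hT : (⟨⊥, SimpleGraph.IsTree.of_subsingleton⟩ :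
          {T : SimpleGraph (Fin 1) // T.IsTree}) = T := Subsingleton.elim _ _
        have hc2 : c = fun _ => .inr ij := funext fun a => by rw [Subsingleton.elim a 0, hc]
        rw [singleCilium, hT, hc2]
  have h2 : ∀ q : ℕ → Prop, ∀ [DecidablePred q],
      Summable fun j : Decorated N => if q j.1 then decVal P (limVertex m lam P u) j else 0 := by
    intro q _
    refine hs.norm.of_norm_bounded fun j => ?_
    split_ifs
    · exact le_rfl
    · simp
  have h3 : Summable fun j : Decorated N =>
      if 2 ≤ j.1 then 0 else decVal P (limVertex m lam P u) j := by
    refine (h2 fun n => ¬ 2 ≤ n).congr fun j => ?_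
    by_cases hj : 2 ≤ j.1 <;> simp [hj]
  rw [h1, decSum, ← h3.tsum_add (h2 fun n => 2 ≤ n)]
  refine tsum_congr fun j => ?_
  split_ifs <;> simp

lemma norm_integral_log_le (h : SmallCoupling m ((cpl lam / cosHalf lam) ^ 2)) {W : Field → ℂ}
    (hW : IsTraceLog m lam W) : ‖∫ τ, -W τ ∂fieldMeasure‖ ≤ 1 := by
  obtain ⟨D, hD0, hρD, -, hD⟩ := h.exists_real_bounds
  obtain ⟨A, ε, hA, -, hε, -, hAε⟩ := exists_cutoffs
  have h1 := tendsto_cutExponent (N := 0) (fun i => i.elim0) 0 hr hm hW hA hε hAε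
  have h2 := tendsto_integral_of_L2 (fun n => memLp_cutExponent _ _ hr hm (A n) (ε n))
    (hW.1.1.neg.add (memLp_cilia (N := 0) (fun i => i.elim0) 0 hr hm).1) h1
  have hc : ∀ τ, cilia m lam (N := 0) (fun i => i.elim0) 0 τ = 0 := fun τ => by simp [cilia]
  simp only [hc, add_zero, cutExponent, Pi.add_apply, Pi.neg_apply] at h2
  refine le_of_tendsto h2.norm (Eventually.of_forall fun n => ?_)
  have h3 := integral_finsetSum (μ := fieldMeasure) (f := fun p => loopField m lam (ε n) p) (A n)
    fun p _ => (memLp_loopField hr hm (ε n) p).integrable one_le_two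
  have h4 : ‖∫ τ, ∑ p ∈ A n, loopField m lam (ε n) p τ ∂fieldMeasure‖ ≤ 1 := by
    rw [h3]
    refine (norm_sum_le_of_le _ fun p _ => norm_integral_loopField_le hr hm (ε n) p).trans ?_
    rw [← Finset.mul_sum]
    have h5 := (sum_propagator_sq_le hm (A n)).trans (hD (A n))
    have h6 := h.nonneg
    calc _ ≤ 2 * (cpl lam / cosHalf lam) ^ 2 * D := by gcongr
      _ ≤ 1 := by nlinarith
  exact h4

/-- The partition function with a polynomial source as the exponential of a sum over trees. -/
theorem log_integral_exp_eq (h : SmallCoupling m ((cpl lam / cosHalf lam) ^ 2)) {W : Field → ℂ}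
    (hW : IsTraceLog m lam W) {η : ℝ} (hη : 0 ≤ η) (hN : (N : ℝ) ^ 2 * η ≤ 1)
    (hu : ∀ ij, ‖u ij‖ * (propagator m (P ij.1) / cosHalf lam) ≤ η) :
    ∫ τ, Complex.exp (-W τ + cilia m lam P u τ) ∂fieldMeasure ∈ Complex.slitPlane ∧
    Complex.log (∫ τ, Complex.exp (-W τ + cilia m lam P u τ) ∂fieldMeasure) =
      ∫ τ, -W τ ∂fieldMeasure + decSum m lam P u := by
  have hb := norm_decVal_limVertex_le P u hr hm hu
  have hsd := summable_decBound P h hη hN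
  have h1 := (integral_exp_eq P u hr hm h hW hη hN hu).2
  rw [add_assoc, tsum_order_one P u hr hm (hsd.of_norm_bounded hb)] at h1
  have h2 : ‖decSum m lam P u‖ ≤ 2 :=
    (tsum_of_norm_bounded hsd.hasSum hb).trans (tsum_decBound_real_le P h hη hN)
  have h3 : |(∫ τ, -W τ ∂fieldMeasure + decSum m lam P u).im| ≤ 3 :=
    (Complex.abs_im_le_norm _).trans ((norm_add_le _ _).trans
      (by linarith [norm_integral_log_le hr hm h hW]))
  rw [abs_le] at h3
  have hpi := Real.pi_gt_three
  refine ⟨?_, ?_⟩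
  · rw [h1, Complex.mem_slitPlane_iff_arg]
    refine ⟨?_, Complex.exp_ne_zero _⟩
    have h4 := Complex.log_exp (x := ∫ τ, -W τ ∂fieldMeasure + decSum m lam P u)
      (by linarith) (by linarith)
    rw [← Complex.log_im, h4]
    exact ne_of_lt (by linarith)
  · rw [h1, Complex.log_exp (by linarith) (by linarith)]

end Partition

section Source

variable {m : ℝ} {lam : ℂ} {N : ℕ}

/-- The coefficients of the source term for the sources `∑ x_j δ_{p̄_j}`, `∑ y_i δ_{p_i}`. -/
def sourceCoeff (p pbar : Fin N → Momentum) (x y : Fin N → ℂ) (ij : Fin N × Fin N) : ℂ :=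
  (if p ij.1 = pbar ij.2 then -1 else 0) * (x ij.2 * y ij.1)

lemma sourceTerm_modeSource (p pbar : Fin N → Momentum) (x y : Fin N → ℂ) (τ : Field) :
    -sourceTerm m lam (modeSource p pbar (x, y)) τ = cilia m lam p (sourceCoeff p pbar x y) τ := by
  simp only [sourceTerm, modeSource]
  rw [← Finsupp.sum_finsetSum_index (by simp) (by intros; ring), cilia, Fintype.sum_prod_type_right,
    ← Finset.sum_neg_distrib]
  refine Finset.sum_congr rfl fun j _ => ?_
  rw [Finsupp.sum_single_index (by simp), Finsupp.finsetSum_apply, Finset.sum_mul, Finset.sum_mul,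
    ← Finset.sum_neg_distrib]
  refine Finset.sum_congr rfl fun i _ => ?_
  rw [Finsupp.single_apply, sourceCoeff]
  split_ifs with h
  · rw [h]
    ring
  · simp

variable (hr : 0 < cosHalf lam) (hm : 0 < m)
include hr hm

lemma integrable_weight (h : SmallCoupling m ((cpl lam / cosHalf lam) ^ 2)) {W : Field → ℂ}
    (hW : IsTraceLog m lam W) (S : Source) : Integrable (weight m lam W S) fieldMeasure := by
  have h1 := (integral_exp_eq (N := 0) (fun i => i.elim0) 0 hr hm h hW le_rfl (by simp)
    (fun ij => ij.1.elim0)).1.integrable one_le_two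
  have hc : ∀ τ, cilia m lam (N := 0) (fun i => i.elim0) 0 τ = 0 := fun τ => by simp [cilia]
  simp only [hc, add_zero] at h1
  have h2 : Continuous (sourceTerm m lam S) := by
    have h3 := fun p => continuous_resolvent (m := m) hr p
    have h4 := fun p => continuous_Gam p
    unfold sourceTerm Finsupp.sum
    fun_prop
  obtain ⟨C, hC⟩ : ∃ C, ∀ τ, ‖sourceTerm m lam S τ‖ ≤ C := by
    refine ⟨∑ p ∈ S.1.support, ‖S.2 p‖ * (propagator m p / cosHalf lam) * ‖S.1 p‖, fun τ => ?_⟩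
    refine norm_sum_le_of_le _ fun p _ => ?_
    rw [norm_mul, norm_mul]
    gcongr
    exact norm_resolvent_le hr hm p _
  refine (h1.mul_bdd (c := Real.exp C) (g := fun τ => Complex.exp (-sourceTerm m lam S τ))
    (Complex.continuous_exp.comp h2.neg).measurable.aestronglyMeasurable
    (ae_of_all _ fun τ => ?_)).congr (ae_of_all _ fun τ => ?_)
  · refine (Complex.norm_exp_le_exp_norm _).trans (Real.exp_le_exp.2 ?_)
    rw [norm_neg]
    exact hC τ
  · simp only [weight]
    rw [← Complex.exp_add, sub_eq_add_neg]

end Source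

/-! ### Derivatives with respect to the sources -/

section PowerSeries

variable {J K : Type*}

lemma hasDerivAt_tsum_mul_pow {A : J → ℂ} {k : J → ℕ} {δ : ℝ} (hδ : 0 < δ)
    (hs : Summable fun j => ‖A j‖ * δ ^ k j) :
    HasDerivAt (fun t : ℂ => ∑' j, A j * t ^ k j) (∑' j, if k j = 1 then A j else 0) 0 := by
  have h0 : (0 : ℂ) ∈ Metric.ball (0 : ℂ) (δ / 2) := Metric.mem_ball_self (by positivity)
  have h := hasDerivAt_tsum_of_isPreconnected (g := fun j t => A j * t ^ k j)
    (g' := fun j t => A j * (k j * t ^ (k j - 1))) (hs.mul_right δ⁻¹) Metric.isOpen_ball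
    (convex_ball (0 : ℂ) (δ / 2)).isPreconnected
    (fun j t _ => (hasDerivAt_pow (k j) t).const_mul (A j)) (fun j t ht => ?_) h0 ?_ h0
  · refine h.congr_deriv (tsum_congr fun j => ?_)
    rcases hk : k j with _ | _ | n
    · simp
    · simp
    · simp
  · rw [mem_ball_zero_iff] at ht
    rw [norm_mul, mul_assoc]
    refine mul_le_mul_of_nonneg_left ?_ (norm_nonneg _)
    rcases hk : k j with _ | n
    · simp only [Nat.cast_zero, zero_mul, norm_zero]
      positivity
    · rw [norm_mul, norm_pow, Complex.norm_natCast, pow_succ, mul_assoc, mul_inv_cancel₀ hδ.ne',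
        mul_one, Nat.add_sub_cancel]
      have h1 : ((n + 1 : ℕ) : ℝ) ≤ 2 ^ n := by
        exact_mod_cast Nat.succ_le_of_lt (Nat.lt_two_pow_self (n := n))
      calc _ ≤ (2 : ℝ) ^ n * (δ / 2) ^ n := by gcongr
        _ = δ ^ n := by rw [← mul_pow]; congr 1; ring
  · refine Summable.of_norm (hs.of_nonneg_of_le (fun _ => norm_nonneg _) fun j => ?_)
    rw [norm_mul, norm_pow, norm_zero]
    gcongr

variable [Fintype K] [DecidableEq K]

/-- The partial derivative with respect to a coordinate. -/
def coordDeriv (k : K) (G : (K → ℂ) → ℂ) (z : K → ℂ) : ℂ := deriv (fun t => G (z + Pi.single k t)) 0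

/-- Iterated derivatives of a power series, in directions in which it is evaluated at zero. -/
lemma foldr_coordDeriv {G : (K → ℂ) → ℂ} {c : ℂ} {b : J → ℂ} {e : J → K → ℕ} {δ : ℝ} (hδ : 0 < δ)
    (hs : Summable fun j => ‖b j‖ * ∏ k, δ ^ e j k)
    (hG : ∀ z, (∀ k, ‖z k‖ < δ) → G z = c + ∑' j, b j * ∏ k, z k ^ e j k) (l : List K)
    (hl : l.Nodup) : ∀ z : K → ℂ, (∀ k, ‖z k‖ < δ) → (∀ k ∈ l, z k = 0) →
      l.foldr coordDeriv G z = (if l = [] then c else 0) + ∑' j,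
        if ∀ k ∈ l, e j k = 1 then b j * ∏ k, (if k ∈ l then 1 else z k ^ e j k) else 0 := by
  induction l with
  | nil => intro z hz _; simpa using hG z hz
  | cons k l ih =>
    intro z hz hzl
    have hkl := (List.nodup_cons.1 hl).1
    set A : J → ℂ := fun j => if ∀ i ∈ l, e j i = 1 then
      b j * ∏ i, (if i ∈ k :: l then 1 else z i ^ e j i) else 0 with hA
    have h1 : ∀ t : ℂ, ‖t‖ < δ → l.foldr coordDeriv G (z + Pi.single k t) =
        (if l = [] then c else 0) + ∑' j, A j * t ^ e j k := by
      intro t ht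
      rw [ih (List.nodup_cons.1 hl).2]
      · congr 1
        refine tsum_congr fun j => ?_
        simp only [hA]
        split_ifs with h
        · rw [mul_assoc]
          congr 1
          have h2 : t ^ e j k = ∏ i, if i = k then t ^ e j i else 1 := by
            rw [Finset.prod_ite_eq' Finset.univ k]
            simp
          rw [h2, ← Finset.prod_mul_distrib]
          refine Finset.prod_congr rfl fun i _ => ?_
          by_cases hik : i = k
          · subst hik
            simp [hkl, hzl i]
          · simp [hik]
        · rw [zero_mul]
      · intro i
        by_cases hik : i = k
        · subst hik
          simpa [hzl i] using ht
        · simpa [hik] using hz i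
      · intro i hi
        have hik : i ≠ k := fun h => hkl (h ▸ hi)
        simp [hik, hzl i (List.mem_cons_of_mem _ hi)]
    have hsA : Summable fun j => ‖A j‖ * δ ^ e j k := by
      set M := max 1 δ⁻¹ with hM
      have hM1 : 1 ≤ M := le_max_left _ _
      refine (hs.mul_left (M ^ Fintype.card K)).of_nonneg_of_le (fun _ => by positivity) fun j => ?_
      simp only [hA]
      split_ifs with h
      · rw [norm_mul, norm_prod, mul_left_comm (M ^ _), mul_assoc]
        refine mul_le_mul_of_nonneg_left ?_ (norm_nonneg _)
        have h2 : δ ^ e j k = ∏ i, if i = k then δ ^ e j i else 1 := by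
          rw [Finset.prod_ite_eq' Finset.univ k]
          simp
        rw [h2, ← Finset.prod_mul_distrib, ← Finset.card_univ, ← Finset.prod_const,
          ← Finset.prod_mul_distrib]
        refine Finset.prod_le_prod (fun i _ => by positivity) fun i _ => ?_
        by_cases hik : i = k
        · subst hik
          simpa using le_mul_of_one_le_left (by positivity) hM1
        · by_cases hil : i ∈ l
          · simp only [List.mem_cons, hil, or_true, if_true, norm_one, hik, if_false, mul_one,
              h i hil, pow_one]
            calc (1 : ℝ) = δ⁻¹ * δ := (inv_mul_cancel₀ hδ.ne').symm
              _ ≤ M * δ := by gcongr; exact le_max_right _ _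
          · simp only [List.mem_cons, hil, hik, or_self, if_false, mul_one, norm_pow]
            calc ‖z i‖ ^ e j i ≤ δ ^ e j i := by gcongr; exact (hz i).le
              _ ≤ M * δ ^ e j i := le_mul_of_one_le_left (by positivity) hM1
      · rw [norm_zero, zero_mul]
        positivity
    have h3 := ((hasDerivAt_tsum_mul_pow hδ hsA).const_add (if l = [] then c else 0)).congr_of_eventuallyEq
      (f₁ := fun t => l.foldr coordDeriv G (z + Pi.single k t)) (by
        filter_upwards [Metric.ball_mem_nhds (0 : ℂ) hδ] with t ht
        exact h1 t (mem_ball_zero_iff.1 ht))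
    rw [List.foldr_cons, coordDeriv, h3.deriv, if_neg (List.cons_ne_nil _ _), zero_add]
    refine tsum_congr fun j => ?_
    simp only [hA, List.forall_mem_cons, ite_and]

end PowerSeries

section Monomials

variable {m : ℝ} {lam : ℂ} {N : ℕ} (P : Fin N → Momentum) (u : Fin N × Fin N → ℂ)

/-- The exponent of a source variable in the contribution of a species; `inl` stands for the
sources `J` and `inr` for the sources `J̄`. -/
def speciesExp : Species N → Fin N ⊕ Fin N → ℕ :=
  Sum.elim (fun _ _ => 0) fun ij =>
    Sum.elim (fun j => if j = ij.2 then 1 else 0) fun i => if i = ij.1 then 1 else 0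

/-- The exponent of a source variable in the contribution of a decorated tree. -/
def decExp (j : Decorated N) (k : Fin N ⊕ Fin N) : ℕ := ∑ a, speciesExp (j.2.2 a) k

/-- The coefficient of the contribution of a decorated tree. -/
def decCoeff (m : ℝ) (lam : ℂ) (p pbar : Fin N → Momentum) (j : Decorated N) : ℂ :=
  (∏ a, Sum.elim (fun _ => 1) (fun ij : Fin N × Fin N => if p ij.1 = pbar ij.2 then -1 else 0)
    (j.2.2 a)) * decVal p (limVertex m lam p 1) j

lemma decVal_limVertex (j : Decorated N) : decVal P (limVertex m lam P u) j =
    (∏ a, Sum.elim (fun _ => 1) u (j.2.2 a)) * decVal P (limVertex m lam P 1) j := by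
  have h : ∀ s d x, limVertex m lam P u s d x = Sum.elim (fun _ => 1) u s * limVertex m lam P 1 s d x := by
    rintro (p | ij) d x <;> simp [limVertex]
  simp only [decVal, treeVal]
  simp_rw [fun a d x => h (j.2.2 a) d x, Finset.prod_mul_distrib, integral_const_mul]
  ring

lemma decVal_sourceCoeff (p pbar : Fin N → Momentum) (z : Fin N ⊕ Fin N → ℂ) (j : Decorated N) :
    decVal p (limVertex m lam p (sourceCoeff p pbar (z ∘ Sum.inl) (z ∘ Sum.inr))) j =
      decCoeff m lam p pbar j * ∏ k, z k ^ decExp j k := by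
  rw [decVal_limVertex, decCoeff, mul_right_comm]
  congr 1
  simp only [decExp, ← Finset.prod_pow_eq_pow_sum]
  rw [Finset.prod_comm, ← Finset.prod_mul_distrib]
  refine Finset.prod_congr rfl fun a _ => ?_
  rcases j.2.2 a with q | ij
  · simp [speciesExp]
  · simp [speciesExp, sourceCoeff, Fintype.prod_sum_type]

variable (hr : 0 < cosHalf lam) (hm : 0 < m)
include hm

/-- A polydisc of sources on which the expansion converges. -/
lemma exists_radius (hr : 0 < cosHalf lam) (p pbar : Fin N → Momentum) :
    ∃ η δ : ℝ, 0 < δ ∧ 0 ≤ η ∧ (N : ℝ) ^ 2 * η ≤ 1 ∧ ∀ x y : Fin N → ℂ, (∀ i, ‖x i‖ ≤ δ) →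
      (∀ i, ‖y i‖ ≤ δ) → ∀ ij, ‖sourceCoeff p pbar x y ij‖ *
        (propagator m (p ij.1) / cosHalf lam) ≤ η := by
  set B := (m ^ 2)⁻¹ / cosHalf lam with hB
  have hB0 : 0 < B := by positivity
  have hN : (0 : ℝ) < (N : ℝ) ^ 2 + 1 := by positivity
  refine ⟨1 / ((N : ℝ) ^ 2 + 1), min 1 (1 / (((N : ℝ) ^ 2 + 1) * B)), by positivity, by positivity,
    ?_, fun x y hx hy ij => ?_⟩
  · rw [mul_one_div, div_le_one hN]
    linarith
  · set δ := min 1 (1 / (((N : ℝ) ^ 2 + 1) * B))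
    have hδ : 0 < δ := by positivity
    have h1 : ‖sourceCoeff p pbar x y ij‖ ≤ δ := by
      rw [sourceCoeff, norm_mul, norm_mul]
      have h2 : ‖(if p ij.1 = pbar ij.2 then -1 else 0 : ℂ)‖ ≤ 1 := by split_ifs <;> simp
      calc _ ≤ 1 * (δ * 1) := by
            refine mul_le_mul h2 (mul_le_mul (hx _) ((hy _).trans (min_le_left _ _))
              (norm_nonneg _) hδ.le) (by positivity) zero_le_one
        _ = δ := by ring
    have h3 : propagator m (p ij.1) / cosHalf lam ≤ B :=
      div_le_div_of_nonneg_right (propagator_le_inv hm _) hr.le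
    have h4 : 0 ≤ propagator m (p ij.1) / cosHalf lam := by
      have := propagator_pos hm (p ij.1)
      positivity
    calc _ ≤ 1 / (((N : ℝ) ^ 2 + 1) * B) * B :=
          mul_le_mul (h1.trans (min_le_right _ _)) h3 h4 (by positivity)
      _ = _ := by field_simp

include hr

/-- The partition function with given sources. -/
lemma partitionFn_modeSource {W : Field → ℂ} (p pbar : Fin N → Momentum) (x y : Fin N → ℂ) :
    partitionFn m lam W (modeSource p pbar (x, y)) =
      ∫ τ, Complex.exp (-W τ + cilia m lam p (sourceCoeff p pbar x y) τ) ∂fieldMeasure := by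
  simp only [partitionFn, weight, sub_eq_add_neg, sourceTerm_modeSource]

lemma foldr_derivJ (F : Source → ℂ) (p pbar : Fin N → Momentum) (L : List (Fin N))
    (z : Fin N ⊕ Fin N → ℂ) :
    L.foldr (fun i G => derivJ (pbar i) (derivJbar (p i) G)) F
      (modeSource p pbar (z ∘ Sum.inl, z ∘ Sum.inr)) =
    (L.flatMap fun i => [Sum.inl i, Sum.inr i]).foldr coordDeriv
      (fun z => F (modeSource p pbar (z ∘ Sum.inl, z ∘ Sum.inr))) z := by
  induction L generalizing z with
  | nil => rfl
  | cons i L ih =>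
    have h1 : ∀ (z : Fin N ⊕ Fin N → ℂ) (t : ℂ),
        ((modeSource p pbar (z ∘ Sum.inl, z ∘ Sum.inr)).1 + Finsupp.single (pbar i) t,
          (modeSource p pbar (z ∘ Sum.inl, z ∘ Sum.inr)).2) =
        modeSource p pbar ((z + Pi.single (Sum.inl i) t) ∘ Sum.inl,
          (z + Pi.single (Sum.inl i) t) ∘ Sum.inr) := fun z t => by
      have : ∀ j, Finsupp.single (pbar j) (Pi.single (M := fun _ => ℂ) (Sum.inl i : Fin N ⊕ Fin N) t
          (Sum.inl j)) = if j = i then Finsupp.single (pbar i) t else 0 := fun j => by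
        by_cases hj : j = i
        · subst hj; simp
        · simp [hj]
      simp [modeSource, Finset.sum_add_distrib, Finsupp.single_add, this]
    have h2 : ∀ (z : Fin N ⊕ Fin N → ℂ) (t : ℂ),
        ((modeSource p pbar (z ∘ Sum.inl, z ∘ Sum.inr)).1,
          (modeSource p pbar (z ∘ Sum.inl, z ∘ Sum.inr)).2 + Finsupp.single (p i) t) =
        modeSource p pbar ((z + Pi.single (Sum.inr i) t) ∘ Sum.inl,
          (z + Pi.single (Sum.inr i) t) ∘ Sum.inr) := fun z t => by
      have : ∀ j, Finsupp.single (p j) (Pi.single (M := fun _ => ℂ) (Sum.inr i : Fin N ⊕ Fin N) t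
          (Sum.inr j)) = if j = i then Finsupp.single (p i) t else 0 := fun j => by
        by_cases hj : j = i
        · subst hj; simp
        · simp [hj]
      simp [modeSource, Finset.sum_add_distrib, Finsupp.single_add, this]
    simp only [List.foldr_cons, List.flatMap_cons, List.cons_append, List.nil_append]
    simp only [derivJ, derivJbar, coordDeriv]
    congr 1
    funext t
    congr 1
    funext s
    rw [← ih, ← h2, ← h1]

/-- The Schwinger functions as sums of the coefficients of multilinear contributions. -/
theorem hasSum_schwinger (hN : 1 ≤ N) (h : SmallCoupling m ((cpl lam / cosHalf lam) ^ 2))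
    {W : Field → ℂ} (hW : IsTraceLog m lam W) (p pbar : Fin N → Momentum) :
    HasSum (fun j => if ∀ k, decExp j k = 1 then decCoeff m lam p pbar j else 0)
      (schwinger m lam W p pbar) := by
  obtain ⟨η, δ, hδ, hη, hNη, hu⟩ := exists_radius hm hr p pbar
  have hs : Summable fun j => ‖decCoeff m lam p pbar j‖ * ∏ k, δ ^ decExp j k := by
    have h1 := norm_decVal_limVertex_le p _ hr hm (hu (fun _ => δ) (fun _ => δ)
      (fun _ => by simp [abs_of_pos hδ]) fun _ => by simp [abs_of_pos hδ])
    refine (summable_decBound p h hη hNη).of_nonneg_of_le (fun j => by positivity) fun j => ?_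
    refine le_trans (le_of_eq ?_) (h1 j)
    have h2 := decVal_sourceCoeff (m := m) (lam := lam) p pbar (fun _ => (δ : ℂ)) j
    simp only [Function.comp_def] at h2
    rw [h2, norm_mul, norm_prod]
    simp [abs_of_pos hδ]
  have hG : ∀ z : Fin N ⊕ Fin N → ℂ, (∀ k, ‖z k‖ < δ) →
      Complex.log (partitionFn m lam W (modeSource p pbar (z ∘ Sum.inl, z ∘ Sum.inr))) =
      ∫ τ, -W τ ∂fieldMeasure + ∑' j, decCoeff m lam p pbar j * ∏ k, z k ^ decExp j k := by
    intro z hz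
    rw [partitionFn_modeSource hr hm, (log_integral_exp_eq p _ hr hm h hW hη hNη
      (hu (z ∘ Sum.inl) (z ∘ Sum.inr) (fun i => (hz _).le) fun i => (hz _).le)).2, decSum]
    simp only [decVal_sourceCoeff]
  set L : List (Fin N ⊕ Fin N) := (List.finRange N).flatMap fun i => [Sum.inl i, Sum.inr i] with hL
  have hmem : ∀ k, k ∈ L := by
    rintro (i | i) <;> simp [hL]
  have hnd : L.Nodup := by
    rw [hL, List.nodup_flatMap]
    refine ⟨fun i _ => by simp, (List.nodup_finRange N).imp fun {a b} hab => ?_⟩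
    simp [Function.onFun, hab.symm]
  have h3 := foldr_coordDeriv hδ hs hG L hnd 0 (fun _ => by simpa using hδ) (by simp)
  have h4 : schwinger m lam W p pbar = L.foldr coordDeriv (fun z : Fin N ⊕ Fin N → ℂ =>
      Complex.log (partitionFn m lam W (modeSource p pbar (z ∘ Sum.inl, z ∘ Sum.inr)))) 0 := by
    rw [hL, ← foldr_derivJ hr hm fun S => Complex.log (partitionFn m lam W S)]
    simp [schwinger, modeSource]
    rfl
  have h5 : L ≠ [] := List.ne_nil_of_mem (hmem (Sum.inl ⟨0, hN⟩))
  rw [← h4, if_neg h5, zero_add] at h3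
  simp only [hmem, forall_true_left, if_true, Finset.prod_const_one, mul_one] at h3
  rw [h3]
  refine Summable.hasSum ?_
  refine Summable.of_norm ((hs.mul_right (δ⁻¹ ^ (N + N))).of_nonneg_of_le (fun _ => norm_nonneg _)
    fun j => ?_)
  split_ifs with hj
  · simp only [hj, pow_one, Finset.prod_const, Finset.card_univ, Fintype.card_sum, Fintype.card_fin]
    rw [mul_assoc, ← mul_pow, mul_inv_cancel₀ hδ.ne', one_pow, mul_one]
  · rw [norm_zero]
    positivity

end Monomials

/-! ### Analyticity in the sources -/

section Analytic

open scoped BoundedContinuousFunction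

variable {m : ℝ} {lam : ℂ} {N : ℕ}

/-- Integration against an integrable function as a functional on bounded continuous functions. -/
def integralAgainst {g : Field → ℂ} (hg : Integrable g fieldMeasure) : (Field →ᵇ ℂ) →L[ℂ] ℂ :=
  have hi : ∀ f : Field →ᵇ ℂ, Integrable (fun τ => g τ * f τ) fieldMeasure := fun f =>
    hg.mul_bdd (c := ‖f‖) f.continuous.measurable.aestronglyMeasurable (ae_of_all _ f.norm_coe_le_norm)
  LinearMap.mkContinuous
    { toFun := fun f => ∫ τ, g τ * f τ ∂fieldMeasure
      map_add' := fun f f' => by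
        rw [← integral_add (hi f) (hi f')]
        simp [mul_add]
      map_smul' := fun c f => by
        rw [RingHom.id_apply, smul_eq_mul, ← integral_const_mul]
        refine integral_congr_ae (ae_of_all _ fun τ => ?_)
        simp
        ring }
    (∫ τ, ‖g τ‖ ∂fieldMeasure) fun f => by
      rw [← integral_mul_const]
      refine norm_integral_le_of_norm_le (hg.norm.mul_const _) (ae_of_all _ fun τ => ?_)
      rw [norm_mul]
      exact mul_le_mul_of_nonneg_left (f.norm_coe_le_norm τ) (norm_nonneg _)

lemma exp_boundedContinuous_apply (f : Field →ᵇ ℂ) (τ : Field) :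
    NormedSpace.exp f τ = Complex.exp (f τ) := by
  let ev : (Field →ᵇ ℂ) →+* ℂ :=
    { toFun := fun f => f τ
      map_one' := rfl
      map_mul' := fun _ _ => rfl
      map_zero' := rfl
      map_add' := fun _ _ => rfl }
  have h := NormedSpace.map_exp (f := ev) (continuous_eval_const τ) f
  rw [Complex.exp_eq_exp_ℂ]
  exact h

variable (hr : 0 < cosHalf lam) (hm : 0 < m)
include hr hm

lemma analyticAt_partitionFn (h : SmallCoupling m ((cpl lam / cosHalf lam) ^ 2)) {W : Field → ℂ}
    (hW : IsTraceLog m lam W) (p pbar : Fin N → Momentum) :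
    AnalyticAt ℂ (fun ab => partitionFn m lam W (modeSource p pbar ab)) 0 := by
  have h0 := integrable_weight hr hm h hW 0
  have hg : Integrable (fun τ => Complex.exp (-W τ)) fieldMeasure :=
    h0.congr (ae_of_all _ fun τ => by simp [weight, sourceTerm])
  let R : Momentum → (Field →ᵇ ℂ) := fun q => BoundedContinuousFunction.ofNormedAddCommGroup
    (fun τ => TGFT.resolvent m lam q (Gam q τ)) ((continuous_resolvent hr q).comp (continuous_Gam q))
    (propagator m q / cosHalf lam) fun τ => norm_resolvent_le hr hm q _
  have h1 : (fun ab => partitionFn m lam W (modeSource p pbar ab)) = fun ab =>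
      integralAgainst hg (NormedSpace.exp (∑ ij : Fin N × Fin N,
        sourceCoeff p pbar ab.1 ab.2 ij • R (p ij.1))) := by
    funext ab
    rw [partitionFn_modeSource hr hm]
    change _ = ∫ τ, Complex.exp (-W τ) * _ ∂fieldMeasure
    refine integral_congr_ae (ae_of_all _ fun τ => ?_)
    simp only
    rw [exp_boundedContinuous_apply, ← Complex.exp_add]
    congr 2
    simp [cilia, R]
  rw [h1]
  refine (ContinuousLinearMap.analyticAt _ _).comp (AnalyticAt.comp (NormedSpace.exp_analytic _) ?_)
  refine Finset.analyticAt_fun_sum _ fun ij _ => AnalyticAt.fun_smul ?_ analyticAt_const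
  have hx : AnalyticAt ℂ (fun ab : (Fin N → ℂ) × (Fin N → ℂ) => ab.1 ij.2) 0 :=
    ((ContinuousLinearMap.proj (R := ℂ) ij.2).comp
      (ContinuousLinearMap.fst ℂ (Fin N → ℂ) (Fin N → ℂ))).analyticAt 0
  have hy : AnalyticAt ℂ (fun ab : (Fin N → ℂ) × (Fin N → ℂ) => ab.2 ij.1) 0 :=
    ((ContinuousLinearMap.proj (R := ℂ) ij.1).comp
      (ContinuousLinearMap.snd ℂ (Fin N → ℂ) (Fin N → ℂ))).analyticAt 0
  exact analyticAt_const.mul (hx.mul hy)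

omit hr hm in
lemma modeSource_zero (p pbar : Fin N → Momentum) : modeSource p pbar 0 = 0 := by
  simp [modeSource]

lemma partitionFn_zero (h : SmallCoupling m ((cpl lam / cosHalf lam) ^ 2)) {W : Field → ℂ}
    (hW : IsTraceLog m lam W) : partitionFn m lam W 0 ∈ Complex.slitPlane ∧
    Complex.log (partitionFn m lam W 0) = ∫ τ, -W τ ∂fieldMeasure +
      decSum m lam (N := 0) (fun i => i.elim0) 0 := by
  have h1 := log_integral_exp_eq (N := 0) (fun i => i.elim0) 0 hr hm h hW le_rfl (by simp)
    (fun ij => ij.1.elim0)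
  have h2 : partitionFn m lam W 0 = ∫ τ, Complex.exp (-W τ +
      cilia m lam (N := 0) (fun i => i.elim0) 0 τ) ∂fieldMeasure := by
    simp [partitionFn, weight, sourceTerm, cilia]
  rwa [h2]

theorem analyticAt_log_partitionFn (h : SmallCoupling m ((cpl lam / cosHalf lam) ^ 2))
    {W : Field → ℂ} (hW : IsTraceLog m lam W) (p pbar : Fin N → Momentum) :
    AnalyticAt ℂ (fun ab => Complex.log (partitionFn m lam W (modeSource p pbar ab))) 0 := by
  refine (analyticAt_partitionFn hr hm h hW p pbar).clog ?_
  rw [modeSource_zero]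
  exact (partitionFn_zero hr hm h hW).1

end Analytic

/-! ### Ciliated trees and decorated trees -/

section Interpolation

variable {N : ℕ} (x : CiliatedTree N)

/-- The weights of the edges of the tree given by real numbers for all pairs of vertices. -/
def clipWeights (w : Sym2 (Fin x.order) → ℝ) : x.Weights := fun l =>
  Set.projIcc 0 1 zero_le_one (w l)

lemma map_projIcc : ((volume : Measure ℝ).restrict (Set.Ioc 0 1)).map (Set.projIcc 0 1 zero_le_one) =
    (volume : Measure unitInterval) := by
  have h1 : (volume : Measure unitInterval).map Subtype.val =
      (volume : Measure ℝ).restrict (Set.Icc 0 1) :=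
    map_comap_subtype_coe measurableSet_Icc volume
  rw [Measure.restrict_congr_set Ioc_ae_eq_Icc, ← h1, Measure.map_map (by fun_prop) measurable_subtype_coe]
  have h2 : (Set.projIcc (0 : ℝ) 1 zero_le_one) ∘ Subtype.val = id := by
    ext a
    simp
  rw [h2, Measure.map_id]

lemma measurePreserving_clipWeights :
    MeasurePreserving (clipWeights x) (edgeMeasure 0 (treeEdges x.tree)) x.weightsMeasure := by
  classical
  have h1 : MeasurePreserving (fun (w : Sym2 (Fin x.order) → ℝ) (l : x.tree.edgeSet) => w l)
      (Measure.pi fun _ => (volume : Measure ℝ).restrict (Set.Ioc 0 1))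
      (Measure.pi fun _ => (volume : Measure ℝ).restrict (Set.Ioc 0 1)) := by
    refine ⟨by fun_prop, ?_⟩
    have h := Measure.map_infinitePi_infinitePi_of_inj
      (P := fun _ : Sym2 (Fin x.order) => (volume : Measure ℝ).restrict (Set.Ioc 0 1))
      (f := fun l : x.tree.edgeSet => (l : Sym2 (Fin x.order))) Subtype.val_injective
    rwa [Measure.infinitePi_eq_pi, Measure.infinitePi_eq_pi] at h
  have h2 : MeasurePreserving (fun (w : x.tree.edgeSet → ℝ) (l : x.tree.edgeSet) =>
      Set.projIcc (0 : ℝ) 1 zero_le_one (w l))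
      (Measure.pi fun _ => (volume : Measure ℝ).restrict (Set.Ioc 0 1))
      (Measure.pi fun _ => (volume : Measure unitInterval)) :=
    measurePreserving_pi _ _ fun _ => ⟨by fun_prop, map_projIcc⟩
  rw [edgeMeasure_zero]
  have h3 := h2.comp h1
  unfold CiliatedTree.weightsMeasure
  convert h3
  rfl

lemma reachable_level_iff {n : ℕ} {T : SimpleGraph (Fin n)} (hT : T.IsTree) {a b : Fin n}
    {p : T.Walk a b} (hp : p.IsPath) (w : Sym2 (Fin n) → ℝ) (t : ℝ) :
    (SimpleGraph.fromEdgeSet (level (treeEdges T) w t)).Reachable a b ↔ ∀ l ∈ p.edges, t ≤ w l := by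
  classical
  have hle : SimpleGraph.fromEdgeSet (level (treeEdges T) w t) ≤ T := by
    refine (SimpleGraph.fromEdgeSet_mono fun l hl => ?_).trans_eq (SimpleGraph.fromEdgeSet_edgeSet T)
    exact mem_treeEdges.1 hl.1
  constructor
  · rintro ⟨q⟩ l hl
    have h1 : (q.toPath : (SimpleGraph.fromEdgeSet _).Walk a b).mapLe hle = p :=
      (hT.existsUnique_path a b).unique (q.toPath.2.mapLe hle) hp
    rw [← h1, SimpleGraph.Walk.edges_mapLe_eq_edges] at hl
    have h2 := SimpleGraph.Walk.edges_subset_edgeSet _ hl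
    rw [SimpleGraph.edgeSet_fromEdgeSet] at h2
    exact h2.1.2
  · intro h
    refine ⟨p.transfer _ fun l hl => ?_⟩
    have h3 := p.edges_subset_edgeSet hl
    rw [SimpleGraph.edgeSet_fromEdgeSet]
    exact ⟨⟨mem_treeEdges.2 h3, h l hl⟩, T.not_isDiag_of_mem_edgeSet h3⟩

lemma interpolation_clipWeights (w : Sym2 (Fin x.order) → ℝ) :
    x.interpolation (clipWeights x w) = Matrix.of fun a b => linkMat (treeEdges x.tree) w a b := by
  classical
  ext a b
  simp only [CiliatedTree.interpolation, Matrix.of_apply, linkMat]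
  set M : unitInterval := Finset.inf _ (clipWeights x w) with hM
  have h1 : ∀ t ∈ Set.Ioc (0 : ℝ) 1, linkInd (treeEdges x.tree) w s(a, b) t =
      Set.indicator {t | t ≤ (M : ℝ)} (fun _ => (1 : ℝ)) t := by
    intro t ht
    have hp : (x.path a b).IsPath := (x.2.1.2.existsUnique_path a b).choose_spec.1
    rw [linkInd, Set.indicator_apply]
    refine if_congr ?_ rfl rfl
    rw [linked_mk, reachable_level_iff x.2.1.2 hp]
    have h2 : t ≤ (M : ℝ) ↔ (⟨t, ht.1.le, ht.2⟩ : unitInterval) ≤ M := Iff.rfl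
    rw [Set.mem_ofPred_eq, h2, hM, Finset.le_inf_iff]
    have h3 : ∀ l, t ≤ w l ↔
        (⟨t, ht.1.le, ht.2⟩ : unitInterval) ≤ Set.projIcc 0 1 zero_le_one (w l) := by
      intro l
      rw [← Subtype.coe_le_coe, Set.coe_projIcc]
      simp [ht.1.not_ge, ht.2]
    constructor
    · intro h l hl
      exact (h3 l).1 (h l (Finset.mem_filter.1 hl).2)
    · intro h l hl
      exact (h3 l).2 (h ⟨l, (x.path a b).edges_subset_edgeSet hl⟩
        (Finset.mem_filter.2 ⟨Finset.mem_univ _, hl⟩))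
  rw [intervalIntegral.integral_congr_ae (g := Set.indicator {t | t ≤ (M : ℝ)} fun _ => (1 : ℝ))
    (ae_of_all _ fun t ht => h1 t (by rwa [Set.uIoc_of_le zero_le_one] at ht)),
    intervalIntegral.integral_indicator M.2]
  simp

/-- Numbers for all pairs of vertices that extend the weights of a tree. -/
def extendWeights (w : x.Weights) : Sym2 (Fin x.order) → ℝ := by
  classical
  exact fun l => if h : l ∈ x.tree.edgeSet then (w ⟨l, h⟩ : ℝ) else 1

lemma clipWeights_extendWeights (w : x.Weights) : clipWeights x (extendWeights x w) = w := by
  funext l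
  simp [clipWeights, extendWeights, l.2]

lemma measurable_extendWeights : Measurable (extendWeights x) := by
  refine measurable_pi_iff.2 fun l => ?_
  by_cases h : l ∈ x.tree.edgeSet
  · simp only [extendWeights, h, dif_pos]
    fun_prop
  · simp only [extendWeights, h, dif_neg, not_false_eq_true]
    fun_prop

lemma interpolation_eq (w : x.Weights) : x.interpolation w =
    Matrix.of fun a b => linkMat (treeEdges x.tree) (extendWeights x w) a b := by
  rw [← interpolation_clipWeights, clipWeights_extendWeights]

lemma measurable_integral_replicaMeasure {f : x.Replicas → ℂ} (hf : Continuous f) {b : ℝ}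
    (hb : ∀ τ, ‖f τ‖ ≤ b) : Measurable fun w => ∫ τ, f τ ∂x.replicaMeasure w := by
  have h := measurable_integral_replicaLaw
    (X := fun (w : x.Weights) a b => linkMat (treeEdges x.tree) (extendWeights x w) a b)
    (fun a b => (measurable_linkMat (treeEdges x.tree) a b).comp (measurable_extendWeights x))
    (fun w => posSemidef_linkMat _ _) hf hb
  have h2 : ∀ w, x.replicaMeasure w = replicaLaw
      (Matrix.of fun a b => linkMat (treeEdges x.tree) (extendWeights x w) a b) := fun w => by
    rw [CiliatedTree.replicaMeasure, interpolation_eq]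
  simp only [h2]
  exact h

instance (w : x.Weights) : IsProbabilityMeasure (x.replicaMeasure w) := by
  unfold CiliatedTree.replicaMeasure
  infer_instance

instance : IsProbabilityMeasure x.weightsMeasure := by
  unfold CiliatedTree.weightsMeasure
  infer_instance

lemma integral_replicaMeasure_eq (f : x.Replicas → ℂ) {b : ℝ} (hf : Continuous f)
    (hb : ∀ τ, ‖f τ‖ ≤ b) :
    ∫ w, ∫ τ, f τ ∂x.replicaMeasure w ∂x.weightsMeasure = ∫ w, ∫ τ, f τ ∂replicaLaw
      (Matrix.of fun a b => linkMat (treeEdges x.tree) w a b) ∂edgeMeasure 0 (treeEdges x.tree) := by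
  rw [← (measurePreserving_clipWeights x).map_eq, integral_map
    (measurePreserving_clipWeights x).measurable.aemeasurable
    (measurable_integral_replicaMeasure x hf hb).aestronglyMeasurable]
  simp only [CiliatedTree.replicaMeasure, interpolation_clipWeights]

open scoped Classical in
lemma degree_eq_lineCount (a : Fin x.order) : x.tree.degree a = lineCount (treeEdges x.tree) a := by
  rw [← SimpleGraph.card_incidenceFinset_eq_degree, SimpleGraph.incidenceFinset_eq_filter, lineCount,
    treeEdges]

lemma sum_lineCount : ∑ a, lineCount (treeEdges x.tree) a = 2 * (x.order - 1) := by
  classical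
  have h := x.tree.sum_degrees_eq_twice_card_edges
  have h2 : x.tree.edgeFinset.card + 1 = x.1 := x.2.1.2.card_edgeFinset.trans (Fintype.card_fin _)
  have h3 : x.order - 1 = x.tree.edgeFinset.card := by
    change x.1 - 1 = _
    omega
  rw [h3, ← h]
  exact Finset.sum_congr rfl fun a _ => (by rw [← degree_eq_lineCount])

lemma lineFactor_eq (k : Fin x.order → Momentum) :
    x.lineFactor k = ((∏ l ∈ treeEdges x.tree, lineOverlap k l : ℝ) : ℂ) := by
  classical
  rw [CiliatedTree.lineFactor, Complex.ofReal_prod]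
  refine Finset.prod_bij (fun ab _ => s(ab.1, ab.2)) (fun ab hab => ?_) (fun ab hab ab' hab' h => ?_)
    (fun l hl => ?_) fun ab _ => ?_
  · exact mem_treeEdges.2 (Finset.mem_filter.1 hab).2.2
  · have h1 := (Finset.mem_filter.1 hab).2.1
    have h2 := (Finset.mem_filter.1 hab').2.1
    rw [Sym2.eq_iff] at h
    rcases h with ⟨h3, h4⟩ | ⟨h3, h4⟩
    · exact Prod.ext h3 h4
    · rw [h3, h4] at h1
      exact absurd h1 h2.asymm
  · induction l with | _ a b => ?_
    have h1 : x.tree.Adj a b := mem_treeEdges.1 hl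
    rcases lt_or_gt_of_ne h1.ne with h2 | h2
    · exact ⟨(a, b), Finset.mem_filter.2 ⟨Finset.mem_univ _, h2, h1⟩, rfl⟩
    · exact ⟨(b, a), Finset.mem_filter.2 ⟨Finset.mem_univ _, h2, h1.symm⟩, Sym2.eq_swap⟩
  · simp [overlap]

end Interpolation

section Decoration

variable {N : ℕ} (x : CiliatedTree N) (π : Equiv.Perm (Fin N))

open scoped Classical in
/-- The decorated tree given by a ciliated tree, a pairing of the external momenta and an assignment
of momenta. -/
def decorate (k : Fin x.order → Momentum) : Decorated N :=
  ⟨x.1, x.2.1, fun a =>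
    if h : a ∈ Set.range x.cilium then .inr (h.choose, π h.choose) else .inl (k a)⟩

lemma decorate_cilium (k : Fin x.order → Momentum) (i : Fin N) :
    (decorate x π k).2.2 (x.cilium i) = .inr (i, π i) := by
  have h : x.cilium i ∈ Set.range x.cilium := ⟨i, rfl⟩
  have h2 : h.choose = i := x.cilium.injective h.choose_spec
  simp only [decorate]
  rw [dif_pos h, h2]

lemma decorate_of_notMem (k : Fin x.order → Momentum) {a : Fin x.order}
    (ha : a ∉ Set.range x.cilium) : (decorate x π k).2.2 a = .inl (k a) := by
  simp only [decorate]
  rw [dif_neg ha]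

lemma mom_decorate {p : Fin N → Momentum} (k : x.Momenta p) (a : Fin x.order) :
    ((decorate x π k.1).2.2 a).mom p = k.1 a := by
  by_cases h : a ∈ Set.range x.cilium
  · obtain ⟨i, rfl⟩ := h
    rw [decorate_cilium, Species.mom, Sum.elim_inr, k.2 i]
  · rw [decorate_of_notMem x π _ h, Species.mom, Sum.elim_inl, id]

@[to_additive]
lemma prod_eq_prod_embedding {M : Type*} [CommMonoid M] {n : ℕ} (c : Fin N ↪ Fin n) (F : Fin n → M)
    (hF : ∀ a ∉ Set.range c, F a = 1) : ∏ a, F a = ∏ i, F (c i) := by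
  rw [← Finset.prod_map Finset.univ c F]
  refine (Finset.prod_subset (Finset.subset_univ _) fun a _ ha => hF a fun h => ha ?_).symm
  obtain ⟨i, rfl⟩ := h
  exact Finset.mem_map_of_mem c (Finset.mem_univ i)

lemma prod_decorate {M : Type*} [CommMonoid M] (k : Fin x.order → Momentum) (f : Fin N × Fin N → M) :
    ∏ a, Sum.elim (fun _ => 1) f ((decorate x π k).2.2 a) = ∏ i, f (i, π i) := by
  refine (prod_eq_prod_embedding x.cilium _ fun a ha => ?_).trans (Finset.prod_congr rfl fun i _ => ?_)
  · rw [decorate_of_notMem x π k ha, Sum.elim_inl]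
  · rw [decorate_cilium, Sum.elim_inr]

lemma decExp_decorate (k : Fin x.order → Momentum) (s : Fin N ⊕ Fin N) :
    decExp (decorate x π k) s = 1 := by
  rw [decExp]
  refine (sum_eq_sum_embedding x.cilium _ fun a ha => ?_).trans ?_
  · rw [decorate_of_notMem x π k ha]
    rfl
  · simp only [decorate_cilium, speciesExp, Sum.elim_inr]
    rcases s with j | i
    · rw [← Equiv.sum_comp π.symm]
      simp
    · simp

/-- The decorated trees with an assignment of momenta. -/
def decorateSigma (p : Fin N → Momentum)
    (q : Σ x : CiliatedTree N, Equiv.Perm (Fin N) × x.Momenta p) : Decorated N :=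
  decorate q.1 q.2.1 q.2.2.1

lemma decorateSigma_injective (p : Fin N → Momentum) : Function.Injective (decorateSigma p) := by
  rintro ⟨⟨n, T, c⟩, π, k⟩ ⟨⟨n', T', c'⟩, π', k'⟩ h
  have hn : n = n' := congrArg Sigma.fst h
  subst hn
  have h1 := eq_of_heq (Sigma.mk.inj h).2
  obtain ⟨hT, hc⟩ := Prod.mk.inj h1
  simp only at hT
  subst hT
  have hcil : ∀ i, c i = c' i ∧ π i = π' i := by
    intro i
    have h2 := congrFun hc (c i)
    have h3 : _ = Sum.inr (i, π i) := decorate_cilium ⟨n, T, c⟩ π k.1 i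
    have h4 : (decorate ⟨n, T, c'⟩ π' k'.1).2.2 (c i) = Sum.inr (i, π i) := h2.symm.trans h3
    by_cases hr : c i ∈ Set.range c'
    · obtain ⟨i', hi'⟩ := hr
      have h5 : (decorate ⟨n, T, c'⟩ π' k'.1).2.2 (c' i') = _ := decorate_cilium ⟨n, T, c'⟩ π' k'.1 i'
      rw [hi', h4] at h5
      have h6 := Sum.inr_injective h5
      have h7 : i = i' := congrArg Prod.fst h6
      subst h7
      exact ⟨hi'.symm, congrArg Prod.snd h6⟩
    · have h5 := decorate_of_notMem ⟨n, T, c'⟩ π' k'.1 (a := c i) hr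
      rw [h4] at h5
      exact absurd h5 (by simp)
  obtain rfl : c = c' := DFunLike.ext _ _ fun i => (hcil i).1
  obtain rfl : π = π' := Equiv.ext fun i => (hcil i).2
  have hk : k = k' := by
    refine Subtype.ext (funext fun a => ?_)
    rw [← mom_decorate ⟨n, T, c⟩ π k a, ← mom_decorate ⟨n, T, c⟩ π k' a]
    exact congrArg _ (congrFun hc a)
  rw [hk]

lemma mem_range_decorateSigma (p : Fin N → Momentum) {j : Decorated N} (hj : ∀ s, decExp j s = 1) :
    j ∈ Set.range (decorateSigma p) := by
  classical
  obtain ⟨n, T, c⟩ := j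
  have huniq : ∀ s a a', speciesExp (c a) s = 1 → speciesExp (c a') s = 1 → a = a' := by
    intro s a a' ha ha'
    by_contra hne
    have h1 : ∑ b ∈ {a, a'}, speciesExp (c b) s ≤ ∑ b, speciesExp (c b) s :=
      Finset.sum_le_sum_of_subset (Finset.subset_univ _)
    rw [Finset.sum_pair hne, ha, ha'] at h1
    have h2 : ∑ b, speciesExp (c b) s = 1 := hj s
    omega
  have hex : ∀ i, ∃ a j, c a = Sum.inr (i, j) := by
    intro i
    have h1 : ∑ b, speciesExp (c b) (Sum.inr i) = 1 := hj (Sum.inr i)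
    obtain ⟨a, -, ha⟩ := Finset.exists_ne_zero_of_sum_ne_zero (by rw [h1]; exact one_ne_zero)
    rcases hc : c a with q | ⟨i', j⟩
    · rw [hc] at ha
      exact absurd rfl ha
    · rw [hc] at ha
      simp only [speciesExp, Sum.elim_inr, ne_eq, ite_eq_right_iff, one_ne_zero, imp_false,
        not_not] at ha
      exact ⟨a, j, by rw [hc, ha]⟩
  choose cil perm hcp using hex
  have h1 : ∀ i, speciesExp (c (cil i)) (Sum.inl (perm i)) = 1 := fun i => by
    rw [hcp]; simp [speciesExp]
  have hcil : Function.Injective cil := fun i i' h => by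
    have h2 := hcp i
    rw [h, hcp i'] at h2
    exact (congrArg Prod.fst (Sum.inr_injective h2)).symm
  have hperm : Function.Injective perm := fun i i' h =>
    hcil (huniq (Sum.inl (perm i)) _ _ (h1 i) (by rw [h]; exact h1 i'))
  refine ⟨⟨⟨n, T, ⟨cil, hcil⟩⟩, Equiv.ofBijective perm (Finite.injective_iff_bijective.1 hperm),
    ⟨fun a => (c a).mom p, fun i => ?_⟩⟩, ?_⟩
  · change (c (cil i)).mom p = p i
    rw [hcp]
    rfl
  · refine Sigma.ext rfl (heq_of_eq (Prod.ext rfl (funext fun a => ?_)))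
    by_cases ha : a ∈ Set.range cil
    · obtain ⟨i, rfl⟩ := ha
      exact (decorate_cilium ⟨n, T, ⟨cil, hcil⟩⟩ _ _ i).trans (hcp i).symm
    · refine (decorate_of_notMem ⟨n, T, ⟨cil, hcil⟩⟩ _ _ ha).trans ?_
      rcases hc : c a with q | ⟨i, j⟩
      · simp [hc, Species.mom]
      · refine absurd ⟨i, huniq (Sum.inr i) _ _ ?_ ?_⟩ ha
        · rw [hcp]; simp [speciesExp]
        · rw [hc]; simp [speciesExp]

end Decoration

section Amplitudes

variable {m : ℝ} {lam : ℂ} {N : ℕ} (x : CiliatedTree N) {p : Fin N → Momentum}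

/-- The trees without a loop vertex to which no line is attached. -/
def NoTadpole (x : CiliatedTree N) : Prop := 2 ≤ x.order ∨ 1 ≤ N

lemma NoTadpole.lineCount_ne_zero {x : CiliatedTree N} (hx : NoTadpole x) {a : Fin x.order}
    (ha : a ∉ Set.range x.cilium) : lineCount (treeEdges x.tree) a ≠ 0 := by
  obtain ⟨n, T, c⟩ := x
  by_cases hn : 2 ≤ n
  · obtain ⟨n, rfl⟩ := Nat.exists_eq_add_of_le' hn
    exact LVE.lineCount_ne_zero T.2 a
  · refine absurd ?_ ha
    have hN : 1 ≤ N := hx.resolve_left hn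
    have h1 : n ≤ 1 := by omega
    have := Fin.subsingleton_iff_le_one.2 h1
    exact ⟨⟨0, hN⟩, Subsingleton.elim (α := Fin n) _ _⟩

open scoped Classical in
lemma vertexFactor_eq (hx : NoTadpole x) (π : Equiv.Perm (Fin N)) (k : x.Momenta p) (τ : x.Replicas)
    (a : Fin x.order) :
    limVertex m lam p 1 ((decorate x π k.1).2.2 a) (lineCount (treeEdges x.tree) a)
      (Gam (((decorate x π k.1).2.2 a).mom p) fun iq => τ iq a) =
    zeta lam ^ lineCount (treeEdges x.tree) a * x.vertexFactor m lam k.1 τ a := by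
  rw [mom_decorate, CiliatedTree.vertexFactor, degree_eq_lineCount]
  by_cases h : a ∈ Set.range x.cilium
  · rw [if_pos h]
    obtain ⟨i, rfl⟩ := h
    rw [decorate_cilium, limVertex, Sum.elim_inr, k.2 i]
    have h3 : x.replica τ (x.cilium i) = fun iq => τ iq (x.cilium i) := rfl
    simp only [Pi.one_apply, one_mul, h3]
    ring
  · rw [if_neg h, decorate_of_notMem x π _ h, limVertex, Sum.elim_inl,
      if_neg (hx.lineCount_ne_zero h)]
    have h3 : x.replica τ a = fun iq => τ iq a := rfl
    rw [h3]
    simp only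
    ring

variable (hr : 0 < cosHalf lam)

include hr in
lemma continuous_integrand (k : x.Momenta p) : Continuous fun τ => x.integrand m lam p τ k := by
  unfold CiliatedTree.integrand
  refine Continuous.mul (continuous_finsetProd _ fun a _ => ?_) continuous_const
  have h := (continuous_resolvent (m := m) hr (k.1 a)).comp (continuous_replicaGam (k.1 a) a)
  simp only [Function.comp_def] at h
  unfold CiliatedTree.vertexFactor CiliatedTree.replica
  split_ifs
  · exact continuous_const.mul (h.pow _)
  · exact continuous_const.mul (h.pow _)

lemma prod_overlap_mul (t : ℝ) {n : ℕ} {T : SimpleGraph (Fin n)} (hT : T.IsTree)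
    (k : Fin n → Momentum) : (∏ l ∈ treeEdges T, lineOverlap k l) *
      ∏ a, (t * propagator m (k a)) ^ lineCount (treeEdges T) a = (t ^ 2) ^ (n - 1) * lineProd m T k := by
  have hc : (treeEdges T).card = n - 1 := by have := card_treeEdges hT; omega
  rw [← prod_edges _ (not_isDiag_of_mem_treeEdges T) fun a => t * propagator m (k a),
    ← Finset.prod_mul_distrib, lineProd, ← hc, ← Finset.prod_const, ← Finset.prod_mul_distrib]
  refine Finset.prod_congr rfl fun l _ => ?_
  induction l with | _ a b => ?_
  simp only [lineOverlap_mk, Sym2.lift_mk, lineKernel]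
  ring

/-- The constant in the bounds on the integrands. -/
def ciliaConst (m : ℝ) (lam : ℂ) (η : ℝ) (p : Fin N → Momentum) : ℝ :=
  ∏ i, propagator m (p i) / (cosHalf lam * η)

include hr in
lemma norm_integrand_le (hm : 0 < m) {η ρ : ℝ} (hη : 0 < η) (hρ : 0 < ρ) (τ : x.Replicas)
    (k : x.Momenta p) : ‖x.integrand m lam p τ k‖ ≤
      (x.order ! : ℝ) * ciliaConst m lam η p * ((cosHalf lam ^ 2 * ρ)⁻¹) ^ (x.order - 1) *
        termBound m p η ρ x.tree (decorate x 1 k.1).2.2 := by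
  classical
  obtain ⟨c, hc⟩ : ∃ c : Fin x.order → Species N, c = (decorate x 1 k.1).2.2 := ⟨_, rfl⟩
  rw [← hc]
  have hmom : ∀ a, (c a).mom p = k.1 a := fun a => by rw [hc]; exact mom_decorate x 1 k a
  have h1 : ∀ a, ‖x.vertexFactor m lam k.1 τ a‖ ≤
      (Sum.elim (fun _ => 1) (fun ij : Fin N × Fin N => propagator m (p ij.1) / (cosHalf lam * η)) (c a) *
        ((c a).wt η * ((lineCount (treeEdges x.tree) a)! : ℝ))) *
        ((cosHalf lam)⁻¹ * propagator m (k.1 a)) ^ lineCount (treeEdges x.tree) a := by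
    intro a
    have hR := norm_resolvent_le hr hm (k.1 a) (Gam (k.1 a) (x.replica τ a))
    have hp0 := propagator_pos hm (k.1 a)
    rw [div_eq_inv_mul] at hR
    rw [CiliatedTree.vertexFactor, degree_eq_lineCount]
    by_cases h : a ∈ Set.range x.cilium
    · rw [if_pos h]
      obtain ⟨i, rfl⟩ := h
      rw [hc, decorate_cilium, norm_mul, norm_pow, Complex.norm_natCast]
      simp only [Sum.elim_inr, Species.wt]
      rw [pow_succ]
      have e1 : propagator m (p i) / (cosHalf lam * η) * (η *
          ((lineCount (treeEdges x.tree) (x.cilium i))! : ℝ)) =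
          ((lineCount (treeEdges x.tree) (x.cilium i))! : ℝ) *
            ((cosHalf lam)⁻¹ * propagator m (k.1 (x.cilium i))) := by
        rw [k.2 i]
        field_simp
      rw [e1, mul_comm (_ ^ _) (‖_‖), ← mul_assoc]
      gcongr
    · rw [if_neg h, hc, decorate_of_notMem x 1 _ h, norm_mul, norm_pow, Complex.norm_natCast]
      simp only [Sum.elim_inl, Species.wt, one_mul]
      have e2 : (((lineCount (treeEdges x.tree) a - 1)! : ℕ) : ℝ) ≤
          ((lineCount (treeEdges x.tree) a)! : ℝ) :=
        Nat.cast_le.2 (Nat.factorial_le (Nat.sub_le _ _))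
      gcongr
  have h2 : 0 ≤ ∏ l ∈ treeEdges x.tree, lineOverlap k.1 l :=
    Finset.prod_nonneg fun l _ => lineOverlap_nonneg _ l
  rw [CiliatedTree.integrand, norm_mul, norm_prod, lineFactor_eq, Complex.norm_real,
    Real.norm_of_nonneg h2]
  refine (mul_le_mul_of_nonneg_right (Finset.prod_le_prod (fun _ _ => norm_nonneg _)
    fun a _ => h1 a) h2).trans_eq ?_
  have hprod : ∏ a, Sum.elim (fun _ => 1)
      (fun ij : Fin N × Fin N => propagator m (p ij.1) / (cosHalf lam * η)) (c a) =
      ∏ i, propagator m (p i) / (cosHalf lam * η) := by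
    rw [hc]
    exact prod_decorate x 1 k.1 _
  rw [Finset.prod_mul_distrib, mul_assoc, mul_comm (∏ a, _ ^ _), prod_overlap_mul _ x.2.1.2,
    Finset.prod_mul_distrib, hprod, Finset.prod_mul_distrib, termBound, funext hmom,
    ciliaConst, mul_inv, mul_pow, inv_pow, inv_pow]
  have h3 : (x.order ! : ℝ) ≠ 0 := Nat.cast_ne_zero.2 (Nat.factorial_ne_zero _)
  push_cast
  field_simp
  have h4 : (1 / ρ) ^ (x.order - 1) * ρ ^ (x.order - 1) = 1 := by
    rw [← mul_pow, one_div_mul_cancel hρ.ne', one_pow]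
  rw [mul_assoc _ ((1 / ρ) ^ _), h4, mul_one]

lemma termBound_eq_decBound (hx : NoTadpole x) {η ρ : ℝ} (k : Fin x.order → Momentum) :
    termBound m p η ρ x.tree (decorate x 1 k).2.2 = decBound m ρ η p (decorate x 1 k) := by
  rw [decBound]
  split_ifs with h
  · have h1 : x.order < 2 := h
    have h0 := lineCount_of_lt_two h1 x.2.1.2
    have h2 : treeEdges x.tree = ∅ := by
      have h3 := card_treeEdges x.2.1.2
      exact Finset.card_eq_zero.1 (by change (treeEdges x.tree).card + 1 = x.order at h3; omega)
    have h3 : x.order - 1 = 0 := by omega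
    have h4 : x.order ! = 1 := Nat.factorial_eq_one.2 (by omega)
    have h5 : ∏ a, (lineCount (treeEdges x.tree) a)! = 1 :=
      Finset.prod_eq_one fun a _ => by rw [h0 a]; rfl
    have h6 : ∀ k, lineProd m x.tree k = 1 := fun k => by rw [lineProd, h2, Finset.prod_empty]
    unfold termBound
    rw [h3, h4, h5, h6, pow_zero, Nat.cast_one, div_one, one_mul, mul_one, mul_one]
    refine Finset.prod_congr rfl fun (a : Fin x.order) _ => ?_
    by_cases ha : a ∈ Set.range x.cilium
    · obtain ⟨i, rfl⟩ := ha
      simp [decorate_cilium, Species.wt]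
    · exact absurd (h0 a) (hx.lineCount_ne_zero ha)
  · rfl

end Amplitudes

section Families

variable {N : ℕ} (x : CiliatedTree N) {κ : Type} {F : κ → x.Replicas → ℂ} {B : κ → ℝ}

lemma integrable_replicaMeasure {f : x.Replicas → ℂ} (hf : Continuous f) {b : ℝ}
    (hb : ∀ τ, ‖f τ‖ ≤ b) (w : x.Weights) : Integrable f (x.replicaMeasure w) :=
  .of_bound hf.aestronglyMeasurable b (ae_of_all _ hb)

lemma integrable_integral_replicaMeasure {f : x.Replicas → ℂ} (hf : Continuous f) {b : ℝ}
    (hb : ∀ τ, ‖f τ‖ ≤ b) :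
    Integrable (fun w => ∫ τ, f τ ∂x.replicaMeasure w) x.weightsMeasure :=
  .of_bound (measurable_integral_replicaMeasure x hf hb).aestronglyMeasurable b
    (ae_of_all _ fun _ => norm_integral_le_of_prob hb)

variable (hF : ∀ k, Continuous (F k)) (hb : ∀ k τ, ‖F k τ‖ ≤ B k) (hB : Summable B)
include hb hB

lemma norm_tsum_le_tsum_bound (τ : x.Replicas) : ‖∑' k, F k τ‖ ≤ ∑' k, B k :=
  tsum_of_norm_bounded hB.hasSum fun k => hb k τ

include hF

lemma hasSum_integral_replicaMeasure [Countable κ] :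
    HasSum (fun k => ∫ w, ∫ τ, F k τ ∂x.replicaMeasure w ∂x.weightsMeasure)
      (∫ w, ∫ τ, ∑' k, F k τ ∂x.replicaMeasure w ∂x.weightsMeasure) := by
  have h1 : ∀ w, HasSum (fun k => ∫ τ, F k τ ∂x.replicaMeasure w)
      (∫ τ, ∑' k, F k τ ∂x.replicaMeasure w) := fun w =>
    hasSum_integral_of_summable_integral_norm
      (fun k => integrable_replicaMeasure x (hF k) (hb k) w) <|
      hB.of_nonneg_of_le (fun k => integral_nonneg fun _ => norm_nonneg _) fun k => by
        have h := integral_mono_of_nonneg (μ := x.replicaMeasure w)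
          (ae_of_all _ fun τ => norm_nonneg (F k τ)) (integrable_const (B k)) (ae_of_all _ (hb k))
        simpa using h
  have h2 := hasSum_integral_of_summable_integral_norm
    (fun k => integrable_integral_replicaMeasure x (hF k) (hb k)) <|
      hB.of_nonneg_of_le (fun k => integral_nonneg fun _ => norm_nonneg _) fun k => by
        have h := integral_mono_of_nonneg (μ := x.weightsMeasure)
          (ae_of_all _ fun w => norm_nonneg (∫ τ, F k τ ∂x.replicaMeasure w)) (integrable_const (B k))
          (ae_of_all _ fun w => norm_integral_le_of_prob (hb k))
        simpa using h
  simpa only [(h1 _).tsum_eq] using h2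

end Families

section Amplitudes

variable {m : ℝ} {lam : ℂ} {N : ℕ} (x : CiliatedTree N) {p : Fin N → Momentum}
  (hr : 0 < cosHalf lam) (hm : 0 < m)
include hr hm

lemma decVal_decorate (hx : NoTadpole x) (π : Equiv.Perm (Fin N)) (k : x.Momenta p) :
    decVal p (limVertex m lam p 1) (decorate x π k.1) =
      (-2 * lam) ^ (x.order - 1) / (x.order ! : ℂ) *
        ∫ w, ∫ τ, x.integrand m lam p τ k ∂x.replicaMeasure w ∂x.weightsMeasure := by
  obtain ⟨c, hc⟩ : ∃ c : Fin x.order → Species N, c = (decorate x π k.1).2.2 := ⟨_, rfl⟩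
  have h1 : ∀ τ : x.Replicas, ((∏ l ∈ treeEdges x.tree, lineOverlap k.1 l : ℝ) : ℂ) *
      ∏ a : Fin x.order, limVertex m lam p 1 (c a) (lineCount (treeEdges x.tree) a)
        (Gam ((c a).mom p) fun iq => τ iq a) =
      (-2 * lam) ^ (x.order - 1) * x.integrand m lam p τ k := by
    intro τ
    rw [hc, Finset.prod_congr rfl fun a _ => vertexFactor_eq x hx π k τ a, Finset.prod_mul_distrib,
      Finset.prod_pow_eq_pow_sum, sum_lineCount, pow_mul, zeta_sq, CiliatedTree.integrand, lineFactor_eq]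
    ring
  have h2 : (fun a => (c a).mom p) = k.1 := funext fun a => by rw [hc]; exact mom_decorate x π k a
  have h3 : treeVal (Species.mom p) (limVertex m lam p 1) (treeEdges x.tree) c =
      (-2 * lam) ^ (x.order - 1) *
        ∫ w, ∫ τ, x.integrand m lam p τ k ∂x.replicaMeasure w ∂x.weightsMeasure := by
    rw [integral_replicaMeasure_eq x _ (continuous_integrand x hr k)
      (norm_integrand_le x hr hm one_pos one_pos · k), treeVal, ← integral_const_mul,
      ← integral_const_mul]
    simp_rw [← integral_const_mul, ← h1, h2]
  rw [div_mul_eq_mul_div, ← h3, hc]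
  rfl

variable {η ρ : ℝ} (hη : 0 < η) (hρ : 0 < ρ) (hN : (N : ℝ) ^ 2 * η ≤ 1) (h : SmallCoupling m ρ)

/-- The bound on the integrand. -/
def integrandBound (m : ℝ) (lam : ℂ) (p : Fin N → Momentum) (η ρ : ℝ) (x : CiliatedTree N)
    (k : x.Momenta p) : ℝ :=
  (x.order ! : ℝ) * ciliaConst m lam η p * ((cosHalf lam ^ 2 * ρ)⁻¹) ^ (x.order - 1) *
    decBound m ρ η p (decorate x 1 k.1)

include hη hρ

lemma norm_integrand_le_integrandBound (hx : NoTadpole x) (k : x.Momenta p) (τ : x.Replicas) :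
    ‖x.integrand m lam p τ k‖ ≤ integrandBound m lam p η ρ x k :=
  (norm_integrand_le x hr hm hη hρ τ k).trans_eq (by rw [integrandBound, termBound_eq_decBound x hx])

omit hr hm hρ in
include hN h in
lemma summable_decBound_decorate (p : Fin N → Momentum) :
    Summable fun q : Σ x : CiliatedTree N, x.Momenta p => decBound m ρ η p (decorate q.1 1 q.2.1) := by
  have hi : Function.Injective fun q : Σ x : CiliatedTree N, x.Momenta p =>
      (⟨q.1, 1, q.2⟩ : Σ x : CiliatedTree N, Equiv.Perm (Fin N) × x.Momenta p) := by
    rintro ⟨x, k⟩ ⟨x', k'⟩ h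
    obtain rfl : x = x' := congrArg Sigma.fst h
    have h2 := eq_of_heq (Sigma.mk.inj h).2
    exact congrArg (Sigma.mk x) (Prod.mk.inj h2).2
  exact (summable_decBound p h hη.le hN).comp_injective ((decorateSigma_injective p).comp hi)

include hN h

omit hr hm hρ in
lemma summable_integrandBound : Summable (integrandBound m lam p η ρ x) :=
  ((summable_decBound_decorate hη hN h p).sigma_factor x).mul_left _

lemma wellDefined (hx : NoTadpole x) : x.WellDefined m lam p := by
  have hF := fun k : x.Momenta p => continuous_integrand x hr (m := m) k
  have hb := norm_integrand_le_integrandBound x hr hm hη hρ (p := p) hx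
  have hB := summable_integrandBound x hη hN h (lam := lam) (p := p)
  have hc : Continuous fun τ => ∑' k : x.Momenta p, x.integrand m lam p τ k :=
    continuous_tsum hF hB hb
  have hF' : ∀ k : x.Momenta p, Continuous fun τ => (‖x.integrand m lam p τ k‖ : ℂ) := fun k =>
    Complex.continuous_ofReal.comp (hF k).norm
  have hb' : ∀ (k : x.Momenta p) τ, ‖(‖x.integrand m lam p τ k‖ : ℂ)‖ ≤
      integrandBound m lam p η ρ x k := fun k τ => by
    rw [Complex.norm_real, norm_norm]
    exact hb k τ
  have hc' := continuous_tsum hF' hB hb'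
  refine ⟨fun τ => hB.of_nonneg_of_le (fun _ => norm_nonneg _) fun k => hb k τ, fun w =>
    integrable_replicaMeasure x hc (norm_tsum_le_tsum_bound x hb hB) w, fun w => ?_,
    integrable_integral_replicaMeasure x hc (norm_tsum_le_tsum_bound x hb hB), ?_⟩
  · have h1 := (integrable_replicaMeasure x hc' (norm_tsum_le_tsum_bound x hb' hB) w).re
    refine h1.congr (ae_of_all _ fun τ => ?_)
    simp only [← Complex.ofReal_tsum]
    rfl
  · have h1 := (integrable_integral_replicaMeasure x hc' (norm_tsum_le_tsum_bound x hb' hB)).re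
    refine h1.congr (ae_of_all _ fun w => ?_)
    simp only [← Complex.ofReal_tsum, integral_complex_ofReal]
    rfl

lemma hasSum_amplitude (hx : NoTadpole x) :
    HasSum (fun k : x.Momenta p => (-1) ^ N * decVal p (limVertex m lam p 1) (decorate x 1 k.1))
      (x.amplitude m lam p) := by
  have h1 := hasSum_integral_replicaMeasure x (fun k : x.Momenta p => continuous_integrand x hr (m := m) k)
    (norm_integrand_le_integrandBound x hr hm hη hρ (p := p) hx)
    (summable_integrandBound x hη hN h (lam := lam) (p := p))
  simp_rw [decVal_decorate x hr hm hx, ← mul_assoc]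
  exact h1.mul_left _

lemma absAmplitude_le (hx : NoTadpole x) (hl : 2 * ‖lam‖ ≤ cosHalf lam ^ 2 * ρ) :
    x.absAmplitude m lam p ≤ ciliaConst m lam η p *
      ∑' k : x.Momenta p, decBound m ρ η p (decorate x 1 k.1) := by
  have hb := norm_integrand_le_integrandBound x hr hm hη hρ (p := p) hx
  have hB := summable_integrandBound x hη hN h (lam := lam) (p := p)
  have hpos : 0 < cosHalf lam ^ 2 * ρ := by positivity
  have h0 : 0 ≤ ∑' k : x.Momenta p, decBound m ρ η p (decorate x 1 k.1) :=
    tsum_nonneg fun k => decBound_nonneg p hm hη.le hρ.le _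
  have hC : 0 ≤ ciliaConst m lam η p := Finset.prod_nonneg fun i _ => by
    have := propagator_pos hm (p i)
    positivity
  have h1 : ∀ τ : x.Replicas, ∑' k : x.Momenta p, ‖x.integrand m lam p τ k‖ ≤
      ∑' k, integrandBound m lam p η ρ x k := fun τ =>
    (hB.of_nonneg_of_le (fun _ => norm_nonneg _) fun k => hb k τ).tsum_le_tsum (hb · τ) hB
  have hw := wellDefined x hr hm hη hρ hN h (p := p) hx
  have h2 : ∫ w, ∫ τ, ∑' k : x.Momenta p, ‖x.integrand m lam p τ k‖ ∂x.replicaMeasure w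
      ∂x.weightsMeasure ≤ ∑' k, integrandBound m lam p η ρ x k := by
    refine (integral_mono (g := fun _ => ∑' k, integrandBound m lam p η ρ x k) hw.2.2.2.2
      (integrable_const _) fun w => ?_).trans_eq (by simp)
    exact (integral_mono (hw.2.2.1 w) (integrable_const _) h1).trans_eq (by simp)
  refine (mul_le_mul_of_nonneg_left h2 (by positivity)).trans ?_
  unfold integrandBound
  rw [tsum_mul_left]
  have h3 : (2 * ‖lam‖) ^ (x.order - 1) * ((cosHalf lam ^ 2 * ρ)⁻¹) ^ (x.order - 1) ≤ 1 := by
    rw [← mul_pow, ← div_eq_mul_inv]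
    exact pow_le_one₀ (by positivity) ((div_le_one hpos).2 hl)
  have h4 : (x.order ! : ℝ) ≠ 0 := Nat.cast_ne_zero.2 (Nat.factorial_ne_zero _)
  calc _ = ((2 * ‖lam‖) ^ (x.order - 1) * ((cosHalf lam ^ 2 * ρ)⁻¹) ^ (x.order - 1)) *
        (ciliaConst m lam η p * ∑' k : x.Momenta p, decBound m ρ η p (decorate x 1 k.1)) := by
        rw [div_mul_eq_mul_div, div_eq_iff h4]
        ring
    _ ≤ _ := mul_le_of_le_one_left (mul_nonneg hC h0) h3

/-- Absolute convergence of the loop vertex expansion. -/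
theorem lveConvergesAbsolutely (hl : 2 * ‖lam‖ ≤ cosHalf lam ^ 2 * ρ) {A : Set (CiliatedTree N)}
    (hA : ∀ x ∈ A, NoTadpole x) (p : Fin N → Momentum) : LVEConvergesAbsolutely m lam p A := by
  refine ⟨fun x hx => wellDefined x hr hm hη hρ hN h (hA x hx), ?_⟩
  have h1 := ((summable_decBound_decorate hη hN h p).sigma.mul_left (ciliaConst m lam η p)).subtype A
  refine h1.of_nonneg_of_le (fun x => ?_) fun x =>
    absAmplitude_le x.1 hr hm hη hρ hN h (hA x x.2) hl
  exact mul_nonneg (by positivity) (integral_nonneg fun w => integral_nonneg fun τ =>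
    tsum_nonneg fun k => norm_nonneg _)

end Amplitudes

lemma hasSum_mul_complex {ι κ : Type*} {f : ι → ℂ} {g : κ → ℂ} {s t : ℂ} (hf : HasSum f s)
    (hg : HasSum g t) : HasSum (fun q : ι × κ => f q.1 * g q.2) (s * t) :=
  hf.mul hg (summable_mul_of_summable_norm hf.summable.norm hg.summable.norm)

section Expansions

variable {m : ℝ} {lam : ℂ} (hr : 0 < cosHalf lam) (hm : 0 < m) {ρ : ℝ} (hρ : 0 < ρ)
  (h : SmallCoupling m ρ) (h0 : SmallCoupling m ((cpl lam / cosHalf lam) ^ 2)) {W : Field → ℂ}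
  (hW : IsTraceLog m lam W)
include hr hm hρ h h0 hW

/-- The loop vertex expansion of the free energy. -/
theorem hasSum_freeEnergy : HasSum (fun x : {x : CiliatedTree 0 // 2 ≤ x.order} =>
      x.1.amplitude m lam (fun i : Fin 0 => i.elim0))
    (Complex.log (partitionFn m lam W 0) - ∫ τ, -W τ ∂fieldMeasure) := by
  set p : Fin 0 → Momentum := fun i => i.elim0 with hp
  have hu : (0 : Fin 0 × Fin 0 → ℂ) = 1 := Subsingleton.elim _ _
  rw [(partitionFn_zero hr hm h0 hW).2, add_sub_cancel_left, decSum, hu]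
  have hN : ((0 : ℕ) : ℝ) ^ 2 * 1 ≤ 1 := by norm_num
  have hle := norm_decVal_limVertex_le p 1 hr hm (η := 1) fun ij => ij.1.elim0
  have h1 : HasSum (fun j => decVal p (limVertex m lam p 1) j) _ :=
    (Summable.of_norm_bounded (summable_decBound p h0 zero_le_one hN) hle).hasSum
  set g : (Σ x : {x : CiliatedTree 0 // 2 ≤ x.order}, x.1.Momenta p) → Decorated 0 :=
    fun q => decorate q.1.1 1 q.2.1
  have hg : Function.Injective g := by
    have hi : Function.Injective fun q : Σ x : {x : CiliatedTree 0 // 2 ≤ x.order}, x.1.Momenta p =>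
        (⟨q.1.1, 1, q.2⟩ : Σ x : CiliatedTree 0, Equiv.Perm (Fin 0) × x.Momenta p) := by
      rintro ⟨⟨x, hx⟩, k⟩ ⟨⟨x', hx'⟩, k'⟩ h
      obtain rfl : x = x' := congrArg Sigma.fst h
      have h2 := eq_of_heq (Sigma.mk.inj h).2
      exact congrArg (Sigma.mk (⟨x, hx⟩ : {x : CiliatedTree 0 // 2 ≤ x.order})) (Prod.mk.inj h2).2
    exact (decorateSigma_injective p).comp hi
  rw [← hg.hasSum_iff] at h1
  · refine h1.sigma fun x => ?_
    have h2 := hasSum_amplitude x.1 hr hm one_pos hρ hN h (p := p) (.inl x.2)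
    simp only [pow_zero, one_mul] at h2
    exact h2
  · intro j hj
    by_cases hj2 : 2 ≤ j.1
    · obtain ⟨⟨x, π, k⟩, hq⟩ := mem_range_decorateSigma p (j := j) fun s =>
        s.elim (fun i => i.elim0) fun i => i.elim0
      obtain rfl : π = 1 := Subsingleton.elim _ _
      have hx : x.order = j.1 := congrArg Sigma.fst hq
      exact absurd ⟨⟨⟨x, by omega⟩, k⟩, hq⟩ hj
    · have h3 : j.1 ≠ 0 := by
        obtain ⟨n, T, c⟩ := j
        rintro rfl
        exact isEmpty_tree_zero.false T
      have h4 := hle j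
      rw [decBound, if_pos (by omega), Finset.prod_eq_zero (Finset.mem_univ ⟨0, by omega⟩)] at h4
      · exact norm_le_zero_iff.1 h4
      · rcases j.2.2 ⟨0, by omega⟩ with q | ⟨i, -⟩
        · rfl
        · exact i.elim0

omit hρ h h0 hW in
lemma decCoeff_decorate {N : ℕ} (hN : 1 ≤ N) (p pbar : Fin N → Momentum) (x : CiliatedTree N)
    (π : Equiv.Perm (Fin N)) (k : x.Momenta p) :
    decCoeff m lam p pbar (decorate x π k.1) = (∏ i, if p i = pbar (π i) then (1 : ℂ) else 0) *
      ((-1) ^ N * decVal p (limVertex m lam p 1) (decorate x 1 k.1)) := by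
  have hx : NoTadpole x := .inr hN
  have h5 : ∏ i, (if p i = pbar (π i) then (-1 : ℂ) else 0) =
      (∏ i, if p i = pbar (π i) then (1 : ℂ) else 0) * (-1) ^ N := by
    calc _ = ∏ i, (if p i = pbar (π i) then (1 : ℂ) else 0) * (-1) :=
          Finset.prod_congr rfl fun i _ => by split_ifs <;> simp
      _ = _ := by rw [Finset.prod_mul_distrib, Finset.prod_const, Finset.card_univ, Fintype.card_fin]
  have h6 := prod_decorate x π k.1 fun ij => if p ij.1 = pbar ij.2 then (-1 : ℂ) else 0
  rw [decCoeff, decVal_decorate x hr hm hx, decVal_decorate x hr hm hx, ← mul_assoc _ ((-1) ^ N), ← h5,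
    ← h6]

omit h0 hW in
lemma hasSum_pairing_mul {N : ℕ} (hN : 1 ≤ N) (p pbar : Fin N → Momentum) (x : CiliatedTree N) :
    HasSum (fun q : Equiv.Perm (Fin N) × x.Momenta p =>
      (∏ i, if p i = pbar (q.1 i) then (1 : ℂ) else 0) *
        ((-1) ^ N * decVal p (limVertex m lam p 1) (decorate x 1 q.2.1)))
      (pairing p pbar * x.amplitude m lam p) := by
  have hη : 0 < ((N : ℝ) ^ 2 + 1)⁻¹ := by positivity
  have hNη : (N : ℝ) ^ 2 * ((N : ℝ) ^ 2 + 1)⁻¹ ≤ 1 := by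
    rw [← div_eq_mul_inv, div_le_one (by positivity)]
    linarith
  have h2 := hasSum_amplitude x hr hm hη hρ hNη h (p := p) (.inr hN)
  have h3 : HasSum (fun π : Equiv.Perm (Fin N) => ∏ i, if p i = pbar (π i) then (1 : ℂ) else 0)
      (pairing p pbar) := hasSum_fintype _
  convert hasSum_mul_complex h3 h2

/-- The loop vertex expansion of the connected Schwinger functions. -/
theorem hasSum_schwinger_amplitude {N : ℕ} (hN : 1 ≤ N) (p pbar : Fin N → Momentum) :
    HasSum (fun x : CiliatedTree N => pairing p pbar * x.amplitude m lam p)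
      (schwinger m lam W p pbar) := by
  obtain ⟨f, h1, hf1, hf0⟩ : ∃ f : Decorated N → ℂ, HasSum f (schwinger m lam W p pbar) ∧
      (∀ j, (∀ s, decExp j s = 1) → f j = decCoeff m lam p pbar j) ∧
      ∀ j, (¬ ∀ s, decExp j s = 1) → f j = 0 :=
    ⟨_, hasSum_schwinger hr hm hN h0 hW p pbar, fun j hj => if_pos hj, fun j hj => if_neg hj⟩
  rw [← (decorateSigma_injective p).hasSum_iff
    fun j hj => hf0 j fun hj' => hj (mem_range_decorateSigma p hj')] at h1
  have h4 : ∀ q : Σ x : CiliatedTree N, Equiv.Perm (Fin N) × x.Momenta p,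
      (f ∘ decorateSigma p) q = (∏ i, if p i = pbar (q.2.1 i) then (1 : ℂ) else 0) *
        ((-1) ^ N * decVal p (limVertex m lam p 1) (decorate q.1 1 q.2.2.1)) := fun q =>
    (hf1 _ (decExp_decorate q.1 q.2.1 q.2.2.1)).trans
      (decCoeff_decorate hr hm hN p pbar q.1 q.2.1 q.2.2)
  rw [funext h4] at h1
  exact h1.sigma (hasSum_pairing_mul hr hm hρ h hN p pbar)

end Expansions

end LVE

end

namespace LVE

open TGFT

lemma cosHalf_pos {κ : ℝ} {lam : ℂ} (h : lam ∈ cardioid κ) : 0 < cosHalf lam := by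
  have h1 : ‖lam‖ < cosHalf lam ^ 2 / κ := h
  have h2 : cosHalf lam ≠ 0 := by
    intro h3
    rw [h3] at h1
    norm_num at h1
    exact absurd h1 (norm_nonneg lam).not_gt
  refine lt_of_le_of_ne (Real.cos_nonneg_of_neg_pi_div_two_le_of_le ?_ ?_) h2.symm
  · have := Complex.neg_pi_lt_arg lam
    linarith
  · have := Complex.arg_le_pi lam
    linarith

/-- The constant which fixes the size of the cardioid. -/
lemma exists_smallCoupling {m : ℝ} (hm : 0 < m) :
    ∃ ρ, 0 < ρ ∧ ∀ ρ', 0 ≤ ρ' → ρ' ≤ ρ → SmallCoupling m ρ' := by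
  obtain ⟨D, S, hD, hS, h1, h2⟩ := exists_lineKernel_bounds hm
  refine ⟨min (1 / (64 * S)) (1 / (512 * D)), by positivity, fun ρ' h0 h => ⟨hm, h0, D, S, hD, hS, h1, h2, ?_, ?_⟩⟩
  · have := (le_div_iff₀ (by positivity)).1 (h.trans (min_le_left _ _))
    linarith
  · have := (le_div_iff₀ (by positivity)).1 (h.trans (min_le_right _ _))
    linarith

end LVE

theorem mainTheorem3 (m : ℝ) (hm : 0 < m) :
    ∃ κ : ℝ, 0 < κ ∧ ∀ lam ∈ TGFT.cardioid κ,
      -- bounds on the resolvent and its derivatives with respect to the intermediate field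
      (∀ (p : TGFT.Momentum) (d : ℕ) (s : ℝ),
        ‖iteratedDeriv d (TGFT.resolvent m lam p) s‖ ≤
          (d ! : ℝ) * Real.sqrt (2 * ‖lam‖) ^ d * TGFT.propagator m p ^ (d + 1) *
            (1 / Real.cos (lam.arg / 2)) ^ (d + 1)) ∧
      -- the sum of the logarithms exists
      (∃ W : TGFT.Field → ℂ, TGFT.IsTraceLog m lam W) ∧
      ∀ W : TGFT.Field → ℂ, TGFT.IsTraceLog m lam W →
        -- the partition function is well defined, and so is its logarithm near zero sources
        (∀ S : TGFT.Source, Integrable (TGFT.weight m lam W S) TGFT.fieldMeasure) ∧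
        TGFT.partitionFn m lam W 0 ∈ Complex.slitPlane ∧
        -- the tree expansion of the free energy, without its one-vertex term
        TGFT.LVEConvergesAbsolutely m lam (fun i : Fin 0 => i.elim0) {x | 2 ≤ x.order} ∧
        HasSum (fun x : {x : TGFT.CiliatedTree 0 // 2 ≤ x.order} =>
            x.1.amplitude m lam (fun i : Fin 0 => i.elim0))
          (Complex.log (TGFT.partitionFn m lam W 0) - ∫ τ, -W τ ∂TGFT.fieldMeasure) ∧
        -- the expansion of the connected Schwinger functions
        ∀ (N : ℕ), 1 ≤ N → ∀ (p pbar : Fin N → TGFT.Momentum),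
          AnalyticAt ℂ (fun ab => Complex.log (TGFT.partitionFn m lam W
            (TGFT.modeSource p pbar ab))) 0 ∧
          TGFT.LVEConvergesAbsolutely m lam p Set.univ ∧
          HasSum (fun x : TGFT.CiliatedTree N =>
              TGFT.pairing p pbar * x.amplitude m lam p)
            (TGFT.schwinger m lam W p pbar) := by

  obtain ⟨ρ, hρ, hsmall⟩ := LVE.exists_smallCoupling hm
  refine ⟨2 / ρ, by positivity, fun lam hlam => ?_⟩
  have hr := LVE.cosHalf_pos hlam
  have hl : 2 * ‖lam‖ ≤ LVE.cosHalf lam ^ 2 * ρ := by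
    have h1 : ‖lam‖ < LVE.cosHalf lam ^ 2 / (2 / ρ) := hlam
    rw [div_div_eq_mul_div] at h1
    linarith
  have h := hsmall ρ hρ.le le_rfl
  have h0 : LVE.SmallCoupling m ((LVE.cpl lam / LVE.cosHalf lam) ^ 2) := by
    refine hsmall _ (sq_nonneg _) ?_
    rw [div_pow, LVE.cpl_sq, div_le_iff₀ (by positivity)]
    linarith
  refine ⟨LVE.norm_iteratedDeriv_resolvent_le hr hm, LVE.exists_isTraceLog hr hm h0, fun W hW =>
    ⟨LVE.integrable_weight hr hm h0 hW, (LVE.partitionFn_zero hr hm h0 hW).1,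
      LVE.lveConvergesAbsolutely hr hm one_pos hρ (by norm_num) h hl (fun _ hx => .inl hx) _,
      LVE.hasSum_freeEnergy hr hm hρ h h0 hW, fun N hN p pbar =>
      ⟨LVE.analyticAt_log_partitionFn hr hm h0 hW p pbar, ?_,
        LVE.hasSum_schwinger_amplitude hr hm hρ h h0 hW hN p pbar⟩⟩⟩
  have hη : 0 < ((N : ℝ) ^ 2 + 1)⁻¹ := by positivity
  have hNη : (N : ℝ) ^ 2 * ((N : ℝ) ^ 2 + 1)⁻¹ ≤ 1 := by
    rw [← div_eq_mul_inv, div_le_one (by positivity)]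
    linarith
  exact LVE.lveConvergesAbsolutely hr hm hη hρ hNη h hl (fun _ _ => .inr hN) p
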